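/- **Setting.** Let $X$ be a compact (Hausdorff) complex manifold. For an open set $U\subseteq X$ let $$\mathcal A(U)=\varinjlim_{V\supseteq\overline U}\bigl(\mathcal A^{0,\bullet}(V),\bar\partial\bigr)$$ be the dg-algebra of germs along the closure $\overline U$ of smooth $(0,\bullet)$-forms (the limit is over the open $V\subseteq X$ containing $\overline U$), and let $\mathcal A^0(U)$ be its degree-zero part. In particular $\mathcal A(X)=(\mathcal A^{0,\bullet}(X),\bar\partial)$. *Cohesive modules.* The dg-category $\mathcal P_{\mathcal A(U)}$ has as objects the pairs $(E^\bullet,\mathbb E)$, where $E^\bullet$ is a bounded $\mathbb Z$-graded, finitely generated projective right $\mathcal A^0(U)$-module and $\mathbb E$ is a $\mathbb C$-linear endomorphism of degree $1$ of $E^\bullet\otimes_{\mathcal A^0(U)}\mathcal A(U)$ with $\mathbb E(x\omega)=\mathbb E(x)\omega+(-1)^{|x|}x\,\bar\partial\omega$ and $\mathbb E\circ\mathbb E=0$. The morphisms of degree $k$ from $(E_1,\mathbb E_1)$ to $(E_2,\mathbb E_2)$ are the right $\mathcal A(U)$-linear maps $\phi:E_1\otimes\mathcal A(U)\to E_2\otimes\mathcal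 A(U)$ of degree $k$, with differential $d\phi=\mathbb E_2\circ\phi-(-1)^{|\phi|}\phi\circ\mathbb E_1$. For $U'\subseteq U$, restriction $\mathcal P_{\mathcal A(U)}\to\mathcal P_{\mathcal A(U')}$ is base change along $\mathcal A(U)\to\mathcal A(U')$. *Twisted complexes.* Let $\{U_i\}$ be a locally finite open cover of $X$ and write $U_{i_0\dots i_p}=U_{i_0}\cap\dots\cap U_{i_p}$. For families $E=(E_i)$, $F=(F_i)$ with $E_i,F_i\in\mathcal P_{\mathcal A(U_i)}$, let $C^p(\mathrm{Mor}^q(E,F))$ be the set of families $u=(u_{i_0\dots i_p})$ of morphisms $u_{i_0\dots i_p}:E_{i_p}\to F_{i_0}$ of degree $q$ over $U_{i_0\dots i_p}$; such $u$ has total degree $p+q$. For $u\in C^p(\mathrm{Mor}^q(F,G))$ and $v\in C^r(\mathrm{Mor}^s(E,F))$ put $$(u\cdot v)_{i_0\dots i_{p+r}}=(-1)^{qr}\,u_{i_0\dots i_p}\circ v_{i_p\dots i_{p+r}},\qquad (\delta u)_{i_0\dots i_{p+1}}=\sum_{k=1}^{p}(-1)^k u_{i_0\dots\widehat{i_k}\dots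 i_{p+1}}|_{U_{i_0\dots i_{p+1}}}.$$ A twisted complex consists of objects $E_i=(E_i^\bullet,\mathbb E_i)\in\mathcal P_{\mathcal A(U_i)}$ and $a=\sum_{k\ge0}a^{k,1-k}$, where $a^{0,1}_i=\mathbb E_i$ and $a^{k,1-k}\in C^k(\mathrm{Mor}^{1-k}(E,E))$ for $k\ge1$, such that $\delta a+a\cdot a=0$ and every $a^{1,0}_{ii}$ is invertible up to homotopy. The dg-category $\mathrm{Tw}(X,\mathcal P_{\mathcal A},U_i)$ has the twisted complexes as objects; the morphisms of degree $n$ from $(E,a)$ to $(F,b)$ are the $\phi=\sum_p\phi^{p,n-p}$ with $\phi^{p,n-p}\in C^p(\mathrm{Mor}^{n-p}(E,F))$, composition is the product above, and $$d\phi=\delta\phi+b\cdot\phi-(-1)^{|\phi|}\phi\cdot a .$$ *The twisting functor.* $\mathcal T:\mathcal P_{\mathcal A(X)}\to\mathrm{Tw}(X,\mathcal P_{\mathcal A},U_i)$ sends $(Q,\mathbb Q)$ to the twisted complex with $E_i=Q|_{U_i}$, $a^{0,1}_i=\mathbb Q|_{U_i}$, $a^{1,0}_{ij}=\mathrm{id}_{Q|_{U_{ij}}}$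 and $a^{k,1-k}=0$ for $k\ge2$, and sends a morphism $\phi$ to the cochain with $(\phi|_{U_i})_i$ in Čech degree $0$ and zero in all other Čech degrees. **Theorem.** Let $X$ be a compact complex manifold and $\{U_i\}$ a locally finite open cover of $X$. Then $\mathcal T:\mathcal P_{\mathcal A(X)}\to\mathrm{Tw}(X,\mathcal P_{\mathcal A},U_i)$ is a quasi-equivalence of dg-categories: for all $Q,R\in\mathcal P_{\mathcal A(X)}$ the map of complexes $\mathcal P_{\mathcal A(X)}^\bullet(Q,R)\to\mathrm{Tw}^\bullet(\mathcal T(Q),\mathcal T(R))$ induces isomorphisms on cohomology in all degrees, and every twisted complex is homotopy equivalent to $\mathcal T(Q)$ for some $Q\in\mathcal P_{\mathcal A(X)}$. -/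

import Mathlib

open TensorProduct
open scoped RightActions ContDiff Manifold
universe u v w
set_option linter.unusedSectionVars false
set_option linter.unusedVariables false
set_option linter.unusedSimpArgs false
set_option linter.checkUnivs false

/-! ### Differential graded categories -/

/-- A dg-category over `ℂ`.  The differential and the composition take a proof of the equation
between the degrees as an argument, so that no transport between degrees is needed.
`comp` is written in the order of composition of maps: `comp h g f` is `g ∘ f`. -/
structure DGCat : Type (max (u + 1) (v + 1)) where
  Obj : Type u
  Hom : Obj → Obj → ℤ → Type v
  [addCommGroup : ∀ X Y n, AddCommGroup (Hom X Y n)]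
  [module : ∀ X Y n, Module ℂ (Hom X Y n)]
  d : ∀ {X Y : Obj} {n m : ℤ}, n + 1 = m → (Hom X Y n →ₗ[ℂ] Hom X Y m)
  id : ∀ X : Obj, Hom X X 0
  comp : ∀ {X Y Z : Obj} {m n k : ℤ}, m + n = k →
    (Hom Y Z m →ₗ[ℂ] Hom X Y n →ₗ[ℂ] Hom X Z k)
  id_comp : ∀ {X Y : Obj} {n : ℤ} (h : 0 + n = n) (f : Hom X Y n), comp h (id Y) f = f
  comp_id : ∀ {X Y : Obj} {n : ℤ} (h : n + 0 = n) (f : Hom X Y n), comp h f (id X) = f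
  assoc : ∀ {W X Y Z : Obj} {l m n lm mn k : ℤ} (hlm : l + m = lm) (hmn : m + n = mn)
    (h₁ : lm + n = k) (h₂ : l + mn = k) (f : Hom Y Z l) (g : Hom X Y m) (e : Hom W X n),
    comp h₁ (comp hlm f g) e = comp h₂ f (comp hmn g e)
  d_d : ∀ {X Y : Obj} {l m n : ℤ} (h₁ : l + 1 = m) (h₂ : m + 1 = n) (f : Hom X Y l),
    d h₂ (d h₁ f) = 0
  d_id : ∀ (X : Obj) {m : ℤ} (h : 0 + 1 = m), d h (id X) = 0
  d_comp : ∀ {X Y Z : Obj} {m n k m' n' k' : ℤ} (h : m + n = k) (hm : m + 1 = m')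
    (hn : n + 1 = n') (hk : k + 1 = k') (h₁ : m' + n = k') (h₂ : m + n' = k')
    (g : Hom Y Z m) (f : Hom X Y n),
    d hk (comp h g f) = comp h₁ (d hm g) f + m.negOnePow • comp h₂ g (d hn f)

namespace DGCat

attribute [instance] DGCat.addCommGroup DGCat.module

/-- Two closed morphisms of degree zero are homotopic if they differ by a coboundary. -/
def Homotopic (C : DGCat) {X Y : C.Obj} (f g : C.Hom X Y 0) : Prop :=
  ∃ h : C.Hom X Y (-1), f - g = C.d (by norm_num) h

/-- A closed degree zero morphism that is invertible up to homotopy. -/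
def IsHomotopyEquiv (C : DGCat) {X Y : C.Obj} (f : C.Hom X Y 0) : Prop :=
  C.d (zero_add 1) f = 0 ∧ ∃ g : C.Hom Y X 0, C.d (zero_add 1) g = 0 ∧
    C.Homotopic (C.comp (zero_add 0) g f) (C.id X) ∧
    C.Homotopic (C.comp (zero_add 0) f g) (C.id Y)

/-- A dg-functor. -/
structure Functor (C D : DGCat) where
  obj : C.Obj → D.Obj
  map : ∀ {X Y : C.Obj} {n : ℤ}, C.Hom X Y n →ₗ[ℂ] D.Hom (obj X) (obj Y) n
  map_id : ∀ X : C.Obj, map (C.id X) = D.id (obj X)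
  map_comp : ∀ {X Y Z : C.Obj} {m n k : ℤ} (h : m + n = k) (g : C.Hom Y Z m) (f : C.Hom X Y n),
    map (C.comp h g f) = D.comp h (map g) (map f)
  map_d : ∀ {X Y : C.Obj} {n m : ℤ} (h : n + 1 = m) (f : C.Hom X Y n),
    map (C.d h f) = D.d h (map f)

/-- A dg-functor is a quasi-equivalence if it induces bijections on the cohomology of the
morphism complexes (surjectivity and injectivity are spelled out on cocycles) and if every object
of the target is homotopy equivalent to an object in the image. -/
structure Functor.IsQuasiEquivalence {C D : DGCat} (F : Functor C D) : Prop where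
  surjective : ∀ {X Y : C.Obj} {l m n : ℤ} (hl : l + 1 = m) (hm : m + 1 = n)
    (g : D.Hom (F.obj X) (F.obj Y) m), D.d hm g = 0 →
    ∃ f : C.Hom X Y m, C.d hm f = 0 ∧ ∃ h : D.Hom (F.obj X) (F.obj Y) l, g - F.map f = D.d hl h
  injective : ∀ {X Y : C.Obj} {l m n : ℤ} (hl : l + 1 = m) (hm : m + 1 = n)
    (f : C.Hom X Y m), C.d hm f = 0 →
    (∃ h : D.Hom (F.obj X) (F.obj Y) l, F.map f = D.d hl h) → ∃ e : C.Hom X Y l, f = C.d hl e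
  essSurj : ∀ Y : D.Obj, ∃ (X : C.Obj) (f : D.Hom (F.obj X) Y 0), D.IsHomotopyEquiv f

/-- Twisting of a dg-category by Maurer–Cartan elements: the objects are indexed by a type `O`,
each `o : O` having an underlying object `obj o` and a solution `a o` of `d a + a ∘ a = 0`.
Morphisms and composition are unchanged, the differential becomes
`φ ↦ d φ + b ∘ φ - (-1)^|φ| φ ∘ a`. -/
def twist (C : DGCat) {O : Type*} (obj : O → C.Obj) (a : ∀ o, C.Hom (obj o) (obj o) 1)
    (mc : ∀ o, C.d one_add_one_eq_two (a o) + C.comp one_add_one_eq_two (a o) (a o) = 0) :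
    DGCat where
  Obj := O
  Hom x y n := C.Hom (obj x) (obj y) n
  d {x y n m} h := C.d h + C.comp (by omega) (a y) -
    n.negOnePow • (C.comp h).flip (a x)
  id x := C.id (obj x)
  comp h := C.comp h
  id_comp h f := C.id_comp h f
  comp_id h f := C.comp_id h f
  assoc := C.assoc
  d_d {x y l m n} h₁ h₂ f := by
    subst h₁
    have e1 := C.d_comp (m := 1) (n := l) (k := l + 1) (by omega) one_add_one_eq_two rfl h₂
      (by omega) (by omega) (a y) f
    have e2 := C.d_comp (m := l) (n := 1) (k := l + 1) rfl rfl one_add_one_eq_two h₂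
      (by omega) (by omega) f (a x)
    have e3 := C.assoc (W := obj x) (l := 1) (m := 1) (n := l) (k := n) one_add_one_eq_two
      (mn := l + 1) (by omega) (by omega) (by omega) (a y) (a y) f
    have e4 := C.assoc (W := obj x) (l := l) (m := 1) (n := 1) (k := n) (lm := l + 1) rfl
      one_add_one_eq_two (by omega) (by omega) f (a x) (a x)
    have e5 := C.assoc (W := obj x) (l := 1) (m := l) (n := 1) (k := n) (lm := l + 1)
      (mn := l + 1) (by omega) rfl (by omega) (by omega) (a y) f (a x)
    have m1 := eq_neg_of_add_eq_zero_left (mc y)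
    have m2 := eq_neg_of_add_eq_zero_left (mc x)
    simp only [LinearMap.add_apply, LinearMap.sub_apply, LinearMap.smul_apply,
      LinearMap.flip_apply, map_add, map_sub, Units.smul_def, map_zsmul, e1, e2, C.d_d, m1, m2,
      map_neg, LinearMap.neg_apply, e3, e4, e5, Int.negOnePow_succ, Units.val_neg, neg_smul,
      Int.negOnePow_one]
    simp only [smul_sub, smul_add, smul_smul, smul_neg, Int.units_coe_mul_self, Units.val_one, one_smul]
    abel
  d_id x m h := by
    subst h
    simp [C.d_id, C.comp_id, C.id_comp]
  d_comp {x y z m n k m' n' k'} h hm hn hk h₁ h₂ g f := by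
    subst h hm hn hk
    have e1 := C.d_comp rfl rfl rfl rfl h₁ h₂ g f
    have e2 := C.assoc (l := 1) (m := m) (n := n) (lm := m + 1) (mn := m + n) (by omega)
      rfl h₁ (by omega) (a z) g f
    have e3 := C.assoc (l := m) (m := 1) (n := n) (lm := m + 1) (mn := n + 1) rfl (by omega)
      h₁ h₂ g (a y) f
    have e4 := C.assoc (l := m) (m := n) (n := 1) (lm := m + n) (mn := n + 1) rfl rfl
      rfl h₂ g f (a x)
    simp only [LinearMap.add_apply, LinearMap.sub_apply, LinearMap.smul_apply,
      LinearMap.flip_apply, map_add, map_sub, Units.smul_def, map_zsmul, e1, e2, e3, e4,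
      smul_add, smul_sub, smul_smul, Int.negOnePow_add, Units.val_mul]
    abel

end DGCat

/-! ### Differential graded algebras and right dg-modules -/

/-- A non-negatively graded dg-algebra over `ℂ` whose degree zero part is commutative and central.
`Z` is the degree zero part, given as a commutative ring that `algebraMap Z A` identifies with
`gr 0`. -/
structure DGAlg : Type (u + 1) where
  A : Type u
  Z : Type u
  [ring : Ring A]
  [algebra : Algebra ℂ A]
  [commRing : CommRing Z]
  [zeroAlgebra : Algebra Z A]
  gr : ℕ → Submodule ℂ A
  one_mem : (1 : A) ∈ gr 0
  mul_mem : ∀ {i j : ℕ} {a b : A}, a ∈ gr i → b ∈ gr j → a * b ∈ gr (i + j)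
  internal : DirectSum.IsInternal gr
  zero_injective : Function.Injective (algebraMap Z A)
  mem_gr_zero : ∀ a : A, a ∈ gr 0 ↔ ∃ z : Z, algebraMap Z A z = a
  d : A →ₗ[ℂ] A
  d_mem : ∀ {i : ℕ} {a : A}, a ∈ gr i → d a ∈ gr (i + 1)
  d_mul : ∀ {i : ℕ} {a : A} (b : A), a ∈ gr i → d (a * b) = d a * b + (-1 : ℤ) ^ i • (a * d b)
  d_d : ∀ a : A, d (d a) = 0

namespace DGAlg

attribute [instance] DGAlg.ring DGAlg.algebra DGAlg.commRing DGAlg.zeroAlgebra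

/-- A morphism of dg-algebras; `zero` is its restriction to the degree zero parts. -/
structure Hom (A B : DGAlg.{u}) where
  toFun : A.A →ₐ[ℂ] B.A
  zero : A.Z →+* B.Z
  algebraMap_zero : ∀ z, algebraMap B.Z B.A (zero z) = toFun (algebraMap A.Z A.A z)
  map_mem : ∀ {i : ℕ} {a : A.A}, a ∈ A.gr i → toFun a ∈ B.gr i
  map_d : ∀ a, toFun (A.d a) = B.d (toFun a)

/-- The identity morphism. -/
def Hom.id (A : DGAlg.{u}) : Hom A A where
  toFun := AlgHom.id ℂ A.A
  zero := RingHom.id A.Z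
  algebraMap_zero _ := rfl
  map_mem h := h
  map_d _ := rfl

variable {A B C : DGAlg.{u}}

/-- The algebra `B`, seen as a module over the degree zero part of `A` through `f : A → B`. -/
def Pull (_f : Hom A B) : Type u := B.A

instance (f : Hom A B) : AddCommGroup (Pull f) := inferInstanceAs (AddCommGroup B.A)
instance (f : Hom A B) : Module ℂ (Pull f) := inferInstanceAs (Module ℂ B.A)
instance (f : Hom A B) : Module (B.A)ᵐᵒᵖ (Pull f) := inferInstanceAs (Module (B.A)ᵐᵒᵖ B.A)
instance (f : Hom A B) : Module A.Z (Pull f) :=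
  Module.compHom B.A ((algebraMap B.Z B.A).comp f.zero)

instance (f : Hom A B) : SMulCommClass A.Z (B.A)ᵐᵒᵖ (Pull f) where
  smul_comm z b m := (mul_assoc (algebraMap B.Z B.A (f.zero z)) (show B.A from m) b.unop).symm

instance (f : Hom A B) : SMulCommClass A.Z ℂ (Pull f) where
  smul_comm z c m := mul_smul_comm c (algebraMap B.Z B.A (f.zero z)) (show B.A from m)

instance (f : Hom A B) : IsScalarTower ℂ (B.A)ᵐᵒᵖ (Pull f) where
  smul_assoc c b m := mul_smul_comm c (show B.A from m) b.unop

/-- The degree zero part of `B`, seen as an algebra over the degree zero part of `A`. -/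
def PullZero (_f : Hom A B) : Type u := B.Z

instance (f : Hom A B) : CommRing (PullZero f) := inferInstanceAs (CommRing B.Z)
instance (f : Hom A B) : Algebra A.Z (PullZero f) := f.zero.toAlgebra

end DGAlg

open DGAlg

/-- The right `B`-module `E ⊗_{A⁰} B` for a module `E` over the degree zero part of `A` and a
morphism `f : A → B`.  As `A⁰` is commutative and central, the two factors may be written in either
order: the element `e ⊗ b` is `b ⊗ₜ e` here, and `(b ⊗ₜ e) <• b' = (b * b') ⊗ₜ e`. -/
abbrev ScalarExt {A B : DGAlg.{u}} (f : Hom A B) (E : Type u) [AddCommGroup E] [Module A.Z E] : Type u :=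
  Pull f ⊗[A.Z] E

namespace ScalarExt

variable {A B C D : DGAlg.{u}} (f : Hom A B) {E : Type u} [AddCommGroup E] [Module A.Z E]

/-- The pure tensor `e ⊗ b`. -/
def mk (b : B.A) (e : E) : ScalarExt f E := (show Pull f from b) ⊗ₜ[A.Z] e

theorem mk_add (b : B.A) (e e' : E) : mk f b (e + e') = mk f b e + mk f b e' :=
  TensorProduct.tmul_add _ _ _

theorem add_mk (b b' : B.A) (e : E) : mk f (b + b') e = mk f b e + mk f b' e :=
  TensorProduct.add_tmul _ _ _

@[simp] theorem mk_zero (b : B.A) : mk f b (0 : E) = 0 := TensorProduct.tmul_zero _ _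

@[simp] theorem zero_mk (e : E) : mk f 0 e = 0 := TensorProduct.zero_tmul _ _

theorem mk_smul (b : B.A) (z : A.Z) (e : E) :
    mk f b (z • e) = mk f (algebraMap B.Z B.A (f.zero z) * b) e := by
  unfold mk
  rw [TensorProduct.tmul_smul, TensorProduct.smul_tmul']
  rfl

theorem mk_zsmul (b : B.A) (n : ℤ) (e : E) : mk f b (n • e) = n • mk f b e :=
  map_zsmul (AddMonoidHom.mk' (mk f b) (mk_add f b)) n e

theorem zsmul_mk (b : B.A) (n : ℤ) (e : E) : mk f (n • b) e = n • mk f b e :=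
  map_zsmul (AddMonoidHom.mk' (fun b => mk f b e) (fun b b' => add_mk f b b' e)) n b

theorem csmul_mk (c : ℂ) (b : B.A) (e : E) : c • mk f b e = mk f (c • b) e :=
  TensorProduct.smul_tmul' _ _ _

theorem mk_mul (b b' : B.A) (e : E) : mk f b e <• b' = mk f (b * b') e :=
  TensorProduct.smul_tmul' _ _ _

theorem mk_eq (b : B.A) (e : E) : mk f b e = mk f 1 e <• b := by rw [mk_mul, one_mul]

@[elab_as_elim]
theorem induction {P : ScalarExt f E → Prop} (x : ScalarExt f E) (h0 : P 0) (hm : ∀ b e, P (mk f b e))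
    (ha : ∀ x y, P x → P y → P (x + y)) : P x :=
  TensorProduct.induction_on x h0 hm ha

/-- The degree `k` part of `E ⊗ B`, for a grading of `E`. -/
def gr (𝓔 : ℤ → Submodule A.Z E) (k : ℤ) : Submodule ℂ (ScalarExt f E) :=
  Submodule.span ℂ {x | ∃ (j : ℕ) (n : ℤ) (b : B.A) (e : E),
    b ∈ B.gr j ∧ e ∈ 𝓔 n ∧ (j : ℤ) + n = k ∧ x = mk f b e}

theorem mk_mem (𝓔 : ℤ → Submodule A.Z E) {j : ℕ} {n k : ℤ} {b : B.A} {e : E} (hb : b ∈ B.gr j)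
    (he : e ∈ 𝓔 n) (h : (j : ℤ) + n = k) : mk f b e ∈ gr f 𝓔 k :=
  Submodule.subset_span ⟨j, n, b, e, hb, he, h, rfl⟩

@[elab_as_elim]
theorem hom_induction {𝓔 : ℤ → Submodule A.Z E} (h𝓔 : DirectSum.IsInternal 𝓔)
    {P : ScalarExt f E → Prop} (x : ScalarExt f E) (h0 : P 0)
    (hm : ∀ (j : ℕ) (n : ℤ) (b : B.A) (e : E), b ∈ B.gr j → e ∈ 𝓔 n → P (mk f b e))
    (ha : ∀ x y, P x → P y → P (x + y)) : P x := by
  refine induction f x h0 (fun b e => ?_) ha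
  have hb : b ∈ ⨆ j, B.gr j := by rw [B.internal.submodule_iSup_eq_top]; trivial
  have he : e ∈ ⨆ n, 𝓔 n := by rw [h𝓔.submodule_iSup_eq_top]; trivial
  refine Submodule.iSup_induction B.gr (motive := fun b => P (mk f b e)) hb (fun j b hb => ?_)
    (by simpa using h0) (fun x y hx hy => by rw [add_mk]; exact ha _ _ hx hy)
  refine Submodule.iSup_induction 𝓔 (motive := fun e => P (mk f b e)) he (fun n e he => ?_)
    (by simpa using h0) (fun x y hx hy => by rw [mk_add]; exact ha _ _ hx hy)
  exact hm j n b e hb he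

theorem gr_induction {𝓔 : ℤ → Submodule A.Z E} {k : ℤ}
    {P : ScalarExt f E → Prop} {x : ScalarExt f E} (hx : x ∈ gr f 𝓔 k) (h0 : P 0)
    (hm : ∀ (j : ℕ) (n : ℤ) (b : B.A) (e : E), b ∈ B.gr j → e ∈ 𝓔 n → (j : ℤ) + n = k →
      P (mk f b e))
    (ha : ∀ x y, P x → P y → P (x + y)) : P x := by
  refine Submodule.span_induction (p := fun x _ => ∀ c : ℂ, P (c • x)) ?_ ?_ ?_ ?_ hx 1 |>
    fun h => by simpa using h
  · rintro x ⟨j, n, b, e, hb, he, h, rfl⟩ c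
    rw [csmul_mk]
    exact hm j n _ e ((B.gr j).smul_mem c hb) he h
  · intro c; simpa using h0
  · intro x y _ _ hx hy c
    rw [smul_add]
    exact ha _ _ (hx c) (hy c)
  · intro a x _ hx c
    rw [smul_smul]
    exact hx _

theorem smul_mem {𝓔 : ℤ → Submodule A.Z E} {k l : ℤ} {j : ℕ} {x : ScalarExt f E} {b : B.A}
    (hx : x ∈ gr f 𝓔 k) (hb : b ∈ B.gr j) (h : k + j = l) : x <• b ∈ gr f 𝓔 l := by
  refine gr_induction f (P := fun x => x <• b ∈ gr f 𝓔 l) hx (by simp) ?_ ?_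
  · intro i n b' e hb' he hk
    rw [mk_mul]
    exact mk_mem f 𝓔 (B.mul_mem hb' hb) he (by push_cast; omega)
  · intro x y hx hy
    rw [smul_add]
    exact add_mem hx hy

/-- The right `B`-linear map `E ⊗ B → N`, `e ⊗ b ↦ ψ(e) b`, induced by an `A⁰`-linear map `ψ`. -/
def lift {N : Type u} [AddCommGroup N] [Module (B.A)ᵐᵒᵖ N] (ψ : E →+ N)
    (hψ : ∀ (z : A.Z) (e : E), ψ (z • e) = ψ e <• algebraMap B.Z B.A (f.zero z)) :
    ScalarExt f E →ₗ[(B.A)ᵐᵒᵖ] N where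
  toFun := TensorProduct.liftAddHom (R := A.Z) (M := Pull f) (N := E)
    (AddMonoidHom.mk' (fun b : Pull f => AddMonoidHom.mk' (fun e => ψ e <• (show B.A from b))
      (fun e e' => by rw [map_add, smul_add]))
      (fun b b' => by
        ext e
        exact add_smul (MulOpposite.op (show B.A from b)) (MulOpposite.op (show B.A from b'))
          (ψ e)))
    (fun z b e => by
      change ψ e <• (algebraMap B.Z B.A (f.zero z) * (show B.A from b)) =
        ψ (z • e) <• (show B.A from b)
      rw [hψ, MulOpposite.op_mul, mul_smul])
  map_add' x y := map_add _ x y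
  map_smul' c x := by
    refine induction f x ?_ ?_ ?_
    · simp
    · intro b e
      change _ = c • (ψ e <• b)
      rw [show c • mk f b e = mk f (b * c.unop) e from mk_mul f b c.unop e]
      change ψ e <• (b * c.unop) = _
      rw [MulOpposite.op_mul, mul_smul, MulOpposite.op_unop]
    · intro x y hx hy
      rw [smul_add, map_add, map_add, smul_add, hx, hy]

theorem lift_mk {N : Type u} [AddCommGroup N] [Module (B.A)ᵐᵒᵖ N] (ψ : E →+ N)
    (hψ : ∀ (z : A.Z) (e : E), ψ (z • e) = ψ e <• algebraMap B.Z B.A (f.zero z)) (b : B.A) (e : E) :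
    lift f ψ hψ (mk f b e) = ψ e <• b := rfl

theorem hom_ext {N : Type u} [AddCommGroup N] [Module (B.A)ᵐᵒᵖ N] {φ φ' : ScalarExt f E →ₗ[(B.A)ᵐᵒᵖ] N}
    (h : ∀ e, φ (mk f 1 e) = φ' (mk f 1 e)) : φ = φ' := by
  ext x
  refine induction f x (by simp) (fun b e => ?_) (fun x y hx hy => by rw [map_add, map_add, hx, hy])
  rw [mk_eq, map_smul, map_smul, h]

/-- The map `E ⊗_{A⁰} B → E ⊗_{A⁰} C`, `e ⊗ b ↦ e ⊗ h(b)`. -/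
def push {f : Hom A B} {k : Hom A C} (h : Hom B C) (hk : ∀ a, h.toFun (f.toFun a) = k.toFun a) :
    ScalarExt f E →+ ScalarExt k E :=
  TensorProduct.liftAddHom (R := A.Z) (M := Pull f) (N := E)
    (AddMonoidHom.mk' (fun b : Pull f => AddMonoidHom.mk' (fun e => mk k (h.toFun b) e)
      (fun e e' => mk_add k _ e e'))
      (fun b b' => by
        ext e
        change mk k (h.toFun ((show B.A from b) + (show B.A from b'))) e = _
        rw [map_add, add_mk]
        rfl))
    (fun z b e => by
      change mk k (h.toFun (algebraMap B.Z B.A (f.zero z) * (show B.A from b))) e =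
        mk k (h.toFun b) (z • e)
      rw [mk_smul, map_mul, f.algebraMap_zero, k.algebraMap_zero, hk])

section push
variable {f} {k : Hom A C} (h : Hom B C) (hk : ∀ a, h.toFun (f.toFun a) = k.toFun a)

theorem push_mk (b : B.A) (e : E) : push h hk (mk f b e) = mk k (h.toFun b) e := rfl

theorem push_smul (x : ScalarExt f E) (b : B.A) : push h hk (x <• b) = push h hk x <• h.toFun b := by
  refine induction f x (by simp) (fun b' e => ?_)
    (fun x y hx hy => by rw [smul_add, map_add, map_add, smul_add, hx, hy])
  rw [mk_mul, push_mk, push_mk, mk_mul, map_mul]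

theorem push_csmul (x : ScalarExt f E) (c : ℂ) : push h hk (c • x) = c • push h hk x := by
  refine induction f x (by simp) (fun b' e => ?_)
    (fun x y hx hy => by rw [smul_add, map_add, map_add, smul_add, hx, hy])
  rw [csmul_mk, push_mk, push_mk, csmul_mk, map_smul]

theorem push_mem {𝓔 : ℤ → Submodule A.Z E} {n : ℤ} {x : ScalarExt f E} (hx : x ∈ gr f 𝓔 n) :
    push h hk x ∈ gr k 𝓔 n := by
  refine gr_induction f (P := fun x => push h hk x ∈ gr k 𝓔 n) hx (by simp) ?_ ?_
  · intro j m b e hb he hn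
    exact mk_mem k 𝓔 (h.map_mem hb) he hn
  · intro x y hx hy
    rw [map_add]
    exact add_mem hx hy

theorem push_push {l : Hom A D} (h' : Hom C D) (hl : ∀ a, h'.toFun (k.toFun a) = l.toFun a)
    (h'' : Hom B D) (hh : ∀ b, h'.toFun (h.toFun b) = h''.toFun b)
    (hl' : ∀ a, h''.toFun (f.toFun a) = l.toFun a) (x : ScalarExt f E) :
    push h' hl (push h hk x) = push h'' hl' x := by
  refine induction f x (by simp) (fun b' e => ?_)
    (fun x y hx hy => by rw [map_add, map_add, map_add, hx, hy])
  rw [push_mk, push_mk, push_mk, hh]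

theorem push_id (h : Hom B B) (hk : ∀ a, h.toFun (f.toFun a) = f.toFun a)
    (hh : ∀ b, h.toFun b = b) (x : ScalarExt f E) : push h hk x = x := by
  refine induction f x (by simp) (fun b' e => ?_)
    (fun x y hx hy => by rw [map_add, hx, hy])
  rw [push_mk, hh]

end push

end ScalarExt

/-- A right dg-module over `B`: a right `B`-module spanned by the pieces of a grading, with a
differential that satisfies the Leibniz rule `∇(x b) = ∇(x) b + (-1)^|x| x db`. -/
structure DGMod (B : DGAlg.{u}) : Type (u + 1) where
  M : Type u
  [addCommGroup : AddCommGroup M]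
  [moduleC : Module ℂ M]
  [module : Module (B.A)ᵐᵒᵖ M]
  [tower : IsScalarTower ℂ (B.A)ᵐᵒᵖ M]
  gr : ℤ → Submodule ℂ M
  iSup_gr : ⨆ k, gr k = ⊤
  conn : M →ₗ[ℂ] M
  conn_mem : ∀ {k : ℤ} {x : M}, x ∈ gr k → conn x ∈ gr (k + 1)
  leibniz : ∀ {k : ℤ} {x : M} (b : B.A), x ∈ gr k →
    conn (x <• b) = conn x <• b + k.negOnePow • (x <• B.d b)
  conn_conn : ∀ x : M, conn (conn x) = 0

namespace DGMod

attribute [instance] DGMod.addCommGroup DGMod.moduleC DGMod.module DGMod.tower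

variable {B : DGAlg.{u}}

/-- The right `B`-linear maps of degree `n`. -/
def Hom (M N : DGMod B) (n : ℤ) : Submodule ℂ (M.M →ₗ[(B.A)ᵐᵒᵖ] N.M) where
  carrier := {φ | ∀ (k : ℤ) (x : M.M), x ∈ M.gr k → φ x ∈ N.gr (k + n)}
  add_mem' h₁ h₂ k x hx := add_mem (h₁ k x hx) (h₂ k x hx)
  zero_mem' _ _ _ := zero_mem _
  smul_mem' c _ h k x hx := (N.gr _).smul_mem c (h k x hx)

variable {L M N : DGMod B}

@[elab_as_elim]
theorem hom_induction {P : M.M → Prop} (x : M.M) (hm : ∀ k x, x ∈ M.gr k → P x)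
    (ha : ∀ x y, P x → P y → P (x + y)) : P x := by
  have hx : x ∈ ⨆ k, M.gr k := by rw [M.iSup_gr]; trivial
  exact Submodule.iSup_induction M.gr (motive := P) hx hm (hm 0 0 (zero_mem _)) ha

/-- The differential `φ ↦ ∇ ∘ φ - (-1)^|φ| φ ∘ ∇` on morphisms, as a map. -/
def dFun {n : ℤ} (φ : Hom M N n) : M.M →ₗ[(B.A)ᵐᵒᵖ] N.M where
  toFun x := N.conn (φ.1 x) - n.negOnePow • φ.1 (M.conn x)
  map_add' x y := by simp only [map_add, smul_add]; abel
  map_smul' b x := by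
    refine hom_induction (P := fun x => N.conn (φ.1 (b • x)) - n.negOnePow • φ.1 (M.conn (b • x)) =
      b • (N.conn (φ.1 x) - n.negOnePow • φ.1 (M.conn x))) x ?_ ?_
    · intro k x hx
      have h1 := M.leibniz b.unop hx
      have h2 := N.leibniz b.unop (φ.2 k x hx)
      rw [MulOpposite.op_unop] at h1 h2
      rw [map_smul, h1, h2, map_add]
      simp only [Units.smul_def, map_zsmul, map_smul, smul_add, smul_sub, smul_smul,
        Int.negOnePow_add, Units.val_mul]
      rw [smul_comm b, mul_comm (k.negOnePow : ℤ)]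
      abel
    · intro x y hx hy
      simp only [smul_add, map_add, smul_sub] at hx hy ⊢
      rw [add_sub_add_comm, hx, hy]
      abel

theorem dFun_apply {n : ℤ} (φ : Hom M N n) (x : M.M) :
    dFun φ x = N.conn (φ.1 x) - n.negOnePow • φ.1 (M.conn x) := rfl

/-- The differential on morphisms. -/
def d {n m : ℤ} (h : n + 1 = m) : Hom M N n →ₗ[ℂ] Hom M N m where
  toFun φ := ⟨dFun φ, fun k x hx => by
    have h1 := N.conn_mem (φ.2 k x hx)
    have h2 := φ.2 _ _ (M.conn_mem hx)
    rw [show k + n + 1 = k + m by omega] at h1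
    rw [show k + 1 + n = k + m by omega] at h2
    rw [dFun_apply, Units.smul_def]
    exact sub_mem h1 (zsmul_mem h2 _)⟩
  map_add' φ ψ := by
    ext x
    simp only [dFun_apply, Submodule.coe_add, LinearMap.add_apply, map_add, smul_add]
    abel
  map_smul' c φ := by
    ext x
    simp only [dFun_apply, Submodule.coe_smul, LinearMap.smul_apply, map_smul, RingHom.id_apply,
      smul_sub, Units.smul_def]
    rw [smul_comm c]

theorem d_apply {n m : ℤ} (h : n + 1 = m) (φ : Hom M N n) (x : M.M) :
    (d h φ).1 x = N.conn (φ.1 x) - n.negOnePow • φ.1 (M.conn x) := rfl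

/-- Composition of morphisms. -/
def comp {m n k : ℤ} (h : m + n = k) : Hom M N m →ₗ[ℂ] Hom L M n →ₗ[ℂ] Hom L N k :=
  LinearMap.mk₂ ℂ (fun g f => ⟨g.1 ∘ₗ f.1, fun i x hx => by
      rw [← h, add_comm m, ← add_assoc]
      exact g.2 _ _ (f.2 _ _ hx)⟩)
    (fun _ _ _ => rfl) (fun _ _ _ => rfl)
    (fun g f f' => by ext x; exact map_add g.1 (f.1 x) (f'.1 x))
    (fun c g f => by ext x; exact g.1.map_smul_of_tower c (f.1 x))

theorem comp_apply {m n k : ℤ} (h : m + n = k) (g : Hom M N m) (f : Hom L M n) (x : L.M) :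
    (comp h g f).1 x = g.1 (f.1 x) := rfl

/-- The identity. -/
def idHom (M : DGMod B) : Hom M M 0 := ⟨LinearMap.id, fun k x hx => by simpa using hx⟩

theorem d_d {l m n : ℤ} (h₁ : l + 1 = m) (h₂ : m + 1 = n) (f : Hom M N l) :
    d h₂ (d h₁ f) = 0 := by
  ext x
  subst h₁
  simp only [d_apply, map_sub, Units.smul_def, map_zsmul, conn_conn, smul_zero, map_zero,
    Int.negOnePow_succ, Units.val_neg, neg_smul]
  simp

theorem d_comp {m n k m' n' k' : ℤ} (h : m + n = k) (hm : m + 1 = m')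
    (hn : n + 1 = n') (hk : k + 1 = k') (h₁ : m' + n = k') (h₂ : m + n' = k')
    (g : Hom M N m) (f : Hom L M n) :
    d hk (comp h g f) = comp h₁ (d hm g) f + m.negOnePow • comp h₂ g (d hn f) := by
  ext x
  subst h
  change N.conn (g.1 (f.1 x)) - (m + n).negOnePow • g.1 (f.1 (L.conn x)) =
    (N.conn (g.1 (f.1 x)) - m.negOnePow • g.1 (M.conn (f.1 x))) +
    m.negOnePow • g.1 (M.conn (f.1 x) - n.negOnePow • f.1 (L.conn x))
  simp only [Units.smul_def, map_sub, map_zsmul, smul_sub, smul_smul, Int.negOnePow_add,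
    Units.val_mul]
  abel

theorem d_id {m : ℤ} (h : 0 + 1 = m) : d h (idHom M) = 0 := by
  ext x
  simp [d_apply, idHom]

end DGMod

/-- The dg-category with objects indexed by `O`, each with an underlying right dg-module. -/
def DGMod.dgCat {B : DGAlg.{u}} {O : Type v} (M : O → DGMod B) : DGCat.{v, u} where
  Obj := O
  Hom X Y n := DGMod.Hom (M X) (M Y) n
  d h := DGMod.d h
  id X := DGMod.idHom (M X)
  comp h := DGMod.comp h
  id_comp _ _ := rfl
  comp_id _ _ := rfl
  assoc _ _ _ _ _ _ _ := rfl
  d_d := DGMod.d_d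
  d_id _ _ h := DGMod.d_id h
  d_comp := DGMod.d_comp

/-! ### Cohesive modules -/

/-- A cohesive module over `A`: a `ℤ`-graded finitely generated projective module `E` over the
degree zero part of `A` (being finitely generated, it is concentrated in finitely many degrees)
with a flat `ℤ`-connection on `E ⊗_{A⁰} A`. -/
structure CohesiveModule (A : DGAlg.{u}) : Type (u + 1) where
  E : Type u
  [addCommGroup : AddCommGroup E]
  [module : Module A.Z E]
  gr : ℤ → Submodule A.Z E
  internal : DirectSum.IsInternal gr
  finite : Module.Finite A.Z E
  projective : Module.Projective A.Z E
  conn : ScalarExt (Hom.id A) E →ₗ[ℂ] ScalarExt (Hom.id A) E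
  conn_mem : ∀ {k : ℤ} {x : ScalarExt (Hom.id A) E}, x ∈ ScalarExt.gr (Hom.id A) gr k →
    conn x ∈ ScalarExt.gr (Hom.id A) gr (k + 1)
  leibniz : ∀ {k : ℤ} {x : ScalarExt (Hom.id A) E} (a : A.A),
    x ∈ ScalarExt.gr (Hom.id A) gr k → conn (x <• a) = conn x <• a + k.negOnePow • (x <• A.d a)
  conn_conn : ∀ x, conn (conn x) = 0

namespace CohesiveModule

attribute [instance] CohesiveModule.addCommGroup CohesiveModule.module

variable {A B C D : DGAlg.{u}} (E : CohesiveModule A)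

theorem iSup_gr (f : Hom A B) : ⨆ k, ScalarExt.gr f E.gr k = ⊤ := by
  rw [eq_top_iff]
  rintro x -
  refine ScalarExt.hom_induction f E.internal x (zero_mem _) ?_ (fun x y hx hy => add_mem hx hy)
  intro j n b e hb he
  exact Submodule.mem_iSup_of_mem ((j : ℤ) + n) (ScalarExt.mk_mem f _ hb he rfl)

/-- The right dg-module `E ⊗_{A⁰} A` of a cohesive module. -/
def toDGMod : DGMod A where
  M := ScalarExt (Hom.id A) E.E
  gr := ScalarExt.gr (Hom.id A) E.gr
  iSup_gr := E.iSup_gr _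
  conn := E.conn
  conn_mem := E.conn_mem
  leibniz := E.leibniz
  conn_conn := E.conn_conn

/-- The sign operator `e ↦ (-1)^|e| e`. -/
noncomputable def sign : E.E →ₗ[A.Z] E.E :=
  (DirectSum.toModule A.Z ℤ E.E fun n => (n.negOnePow : ℤ) • (E.gr n).subtype) ∘ₗ
    (LinearEquiv.ofBijective (DirectSum.coeLinearMap E.gr) E.internal).symm.toLinearMap

theorem sign_apply {n : ℤ} {e : E.E} (he : e ∈ E.gr n) : E.sign e = (n.negOnePow : ℤ) • e := by
  have : (LinearEquiv.ofBijective (DirectSum.coeLinearMap E.gr) E.internal).symm e =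
      DirectSum.lof A.Z ℤ (fun n => E.gr n) n ⟨e, he⟩ := by
    rw [LinearEquiv.symm_apply_eq]
    exact (DirectSum.coeLinearMap_lof E.gr n ⟨e, he⟩).symm
  simp [sign, this]

@[elab_as_elim]
theorem gr_induction {P : E.E → Prop} (e : E.E) (hm : ∀ n e, e ∈ E.gr n → P e)
    (ha : ∀ x y, P x → P y → P (x + y)) : P e := by
  have hx : e ∈ ⨆ k, E.gr k := by rw [E.internal.submodule_iSup_eq_top]; trivial
  exact Submodule.iSup_induction E.gr (motive := P) hx hm (hm 0 0 (zero_mem _)) ha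

/-- The restriction of the connection to `E`. -/
def conn₁ (e : E.E) : ScalarExt (Hom.id A) E.E := E.conn (ScalarExt.mk _ 1 e)

theorem conn_mk (a : A.A) (e : E.E) : E.conn (ScalarExt.mk _ a e) =
    E.conn₁ e <• a + ScalarExt.mk _ (A.d a) (E.sign e) := by
  refine E.gr_induction e ?_ ?_
  · intro n e he
    rw [ScalarExt.mk_eq, E.leibniz a (ScalarExt.mk_mem _ _ A.one_mem he (zero_add n)),
      E.sign_apply he, ScalarExt.mk_zsmul, ScalarExt.mk_mul, one_mul]
    rfl
  · intro x y hx hy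
    simp only [conn₁, ScalarExt.mk_add, map_add, smul_add] at hx hy ⊢
    rw [hx, hy]
    abel

theorem conn₁_add (e e' : E.E) : E.conn₁ (e + e') = E.conn₁ e + E.conn₁ e' := by
  rw [conn₁, ScalarExt.mk_add, map_add]; rfl

theorem conn₁_mem {n : ℤ} {e : E.E} (he : e ∈ E.gr n) :
    E.conn₁ e ∈ ScalarExt.gr (Hom.id A) E.gr (n + 1) :=
  E.conn_mem (ScalarExt.mk_mem _ _ A.one_mem he (zero_add n))

theorem conn₁_smul (z : A.Z) (e : E.E) : E.conn₁ (z • e) =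
    E.conn₁ e <• algebraMap A.Z A.A z + ScalarExt.mk _ (A.d (algebraMap A.Z A.A z)) (E.sign e) := by
  rw [← E.conn_mk, conn₁, ScalarExt.mk_smul, mul_one]
  rfl

theorem d_one : A.d 1 = 0 := by
  have := A.d_mul (a := 1) 1 A.one_mem
  simpa using this

theorem id_push (f : Hom A B) (a : A.A) : f.toFun ((Hom.id A).toFun a) = f.toFun a := rfl

/-- The map `E → E ⊗_{A⁰} B` induced by the connection of `E`. -/
def connTo (f : Hom A B) (e : E.E) : ScalarExt f E.E := ScalarExt.push f (id_push f) (E.conn₁ e)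

/-- The connection `e ⊗ b ↦ ∇(e) b + (-1)^|e| e ⊗ db` on `E ⊗_{A⁰} B`. -/
noncomputable def connExt (f : Hom A B) : ScalarExt f E.E →ₗ[ℂ] ScalarExt f E.E :=
  let φ : ScalarExt f E.E →+ ScalarExt f E.E :=
    TensorProduct.liftAddHom (R := A.Z) (M := Pull f) (N := E.E)
      (AddMonoidHom.mk' (fun b : Pull f => AddMonoidHom.mk'
          (fun e => E.connTo f e <• (show B.A from b) +
            ScalarExt.mk f (B.d (show B.A from b)) (E.sign e))
          (fun e e' => by
            simp only [connTo, conn₁_add, map_add, smul_add, ScalarExt.mk_add]; abel))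
        (fun b b' => by
          ext e
          change E.connTo f e <• ((show B.A from b) + (show B.A from b')) +
            ScalarExt.mk f (B.d ((show B.A from b) + (show B.A from b'))) (E.sign e) = 
            E.connTo f e <• (show B.A from b) + ScalarExt.mk f (B.d (show B.A from b)) (E.sign e) + 
            (E.connTo f e <• (show B.A from b') +
              ScalarExt.mk f (B.d (show B.A from b')) (E.sign e))
          rw [map_add, ScalarExt.add_mk, MulOpposite.op_add, add_smul]
          abel))
      (fun z b e => by
        change E.connTo f e <• (algebraMap B.Z B.A (f.zero z) * (show B.A from b)) +
          ScalarExt.mk f (B.d (algebraMap B.Z B.A (f.zero z) * (show B.A from b))) (E.sign e) =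
          E.connTo f (z • e) <• (show B.A from b) +
            ScalarExt.mk f (B.d (show B.A from b)) (E.sign (z • e))
        rw [connTo, connTo, conn₁_smul, map_add, ScalarExt.push_smul, ScalarExt.push_mk, map_smul,
          ScalarExt.mk_smul, f.map_d, ← f.algebraMap_zero,
          B.d_mul (i := 0) _ ((B.mem_gr_zero _).2 ⟨_, rfl⟩), smul_add, ScalarExt.mk_mul,
          ScalarExt.add_mk, MulOpposite.op_mul, mul_smul]
        simp only [pow_zero, one_smul]
        abel)
  have hφ : ∀ b e, φ (ScalarExt.mk f b e) = E.connTo f e <• b + ScalarExt.mk f (B.d b) (E.sign e) :=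
    fun _ _ => rfl
  { φ with
    map_smul' := fun c x => by
      change φ (c • x) = c • φ x
      refine ScalarExt.induction f x (by simp) (fun b e => ?_) (fun x y hx hy => ?_)
      · rw [ScalarExt.csmul_mk, hφ, hφ, map_smul, smul_add, ScalarExt.csmul_mk,
          MulOpposite.op_smul, smul_assoc]
      · rw [smul_add, map_add, map_add, smul_add, hx, hy] }

theorem connExt_mk (f : Hom A B) (b : B.A) (e : E.E) :
    E.connExt f (ScalarExt.mk f b e) =
      E.connTo f e <• b + ScalarExt.mk f (B.d b) (E.sign e) := rfl

theorem sign_mem {n : ℤ} {e : E.E} (he : e ∈ E.gr n) : E.sign e ∈ E.gr n := by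
  rw [E.sign_apply he]; exact zsmul_mem he _

theorem connExt_mem (f : Hom A B) {k : ℤ} {x : ScalarExt f E.E} (hx : x ∈ ScalarExt.gr f E.gr k) :
    E.connExt f x ∈ ScalarExt.gr f E.gr (k + 1) := by
  refine ScalarExt.gr_induction f (P := fun x => E.connExt f x ∈ ScalarExt.gr f E.gr (k + 1))
    hx (by simp) ?_ (fun x y hx hy => by rw [map_add]; exact add_mem hx hy)
  intro j n b e hb he h
  rw [connExt_mk]
  refine add_mem (ScalarExt.smul_mem f (ScalarExt.push_mem _ _ (E.conn₁_mem he)) hb (by omega)) ?_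
  exact ScalarExt.mk_mem f _ (B.d_mem hb) (E.sign_mem he) (by push_cast; omega)

theorem negOnePow_natCast (j : ℕ) : ((j : ℤ).negOnePow : ℤ) = (-1) ^ j := by
  induction j with
  | zero => simp
  | succ j ih => push_cast; rw [Int.negOnePow_succ, Units.val_neg, ih, pow_succ]; ring

theorem connExt_leibniz (f : Hom A B) {k : ℤ} {x : ScalarExt f E.E} (b : B.A)
    (hx : x ∈ ScalarExt.gr f E.gr k) :
    E.connExt f (x <• b) = E.connExt f x <• b + k.negOnePow • (x <• B.d b) := by
  refine ScalarExt.gr_induction f (P := fun x =>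
    E.connExt f (x <• b) = E.connExt f x <• b + k.negOnePow • (x <• B.d b))
    hx (by simp) ?_ (fun x y hx hy => by
      simp only [smul_add, map_add] at hx hy ⊢
      rw [hx, hy]; abel)
  intro j n b' e hb he h
  rw [ScalarExt.mk_mul, connExt_mk, connExt_mk, B.d_mul b hb, ScalarExt.mk_mul, smul_add,
    ScalarExt.mk_mul, ScalarExt.add_mk, E.sign_apply he, ← h, MulOpposite.op_mul, mul_smul]
  simp only [ScalarExt.mk_zsmul, ScalarExt.zsmul_mk, Units.smul_def, Int.negOnePow_add,
    Units.val_mul, smul_smul, negOnePow_natCast]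
  rw [mul_comm ((-1) ^ j)]
  abel

theorem connExt_push {f : Hom A B} {k : Hom A C} (h : Hom B C)
    (hk : ∀ a, h.toFun (f.toFun a) = k.toFun a) (x : ScalarExt f E.E) :
    E.connExt k (ScalarExt.push h hk x) = ScalarExt.push h hk (E.connExt f x) := by
  refine ScalarExt.induction f x (by simp) (fun b e => ?_) (fun x y hx hy => by
    simp only [map_add]; rw [hx, hy])
  rw [ScalarExt.push_mk, connExt_mk, connExt_mk, map_add, ScalarExt.push_smul, ScalarExt.push_mk,
    h.map_d, connTo, connTo, ScalarExt.push_push f (id_push f) h hk k hk (id_push k)]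

theorem connExt_push_id (f : Hom A B) (x : ScalarExt (Hom.id A) E.E) :
    E.connExt f (ScalarExt.push f (id_push f) x) = ScalarExt.push f (id_push f) (E.conn x) := by
  refine ScalarExt.induction _ x (by simp) (fun b e => ?_) (fun x y hx hy => by
    simp only [map_add]; rw [hx, hy])
  rw [ScalarExt.push_mk, connExt_mk, conn_mk, map_add, ScalarExt.push_smul, ScalarExt.push_mk,
    f.map_d, connTo]

theorem connExt_conn₁ (f : Hom A B) (e : E.E) : E.connExt f (E.connTo f e) = 0 := by
  rw [connTo, connExt_push_id, conn₁, E.conn_conn, map_zero]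

theorem connExt_connExt (f : Hom A B) (x : ScalarExt f E.E) :
    E.connExt f (E.connExt f x) = 0 := by
  refine ScalarExt.hom_induction f E.internal x (by simp) ?_ (fun x y hx hy => by
    simp only [map_add]; rw [hx, hy, add_zero])
  intro j n b e hb he
  have hmem : E.connTo f e ∈ ScalarExt.gr f E.gr (n + 1) :=
    ScalarExt.push_mem _ _ (E.conn₁_mem he)
  rw [connExt_mk, map_add, E.connExt_leibniz f b hmem, connExt_conn₁, connExt_mk, B.d_d,
    E.sign_apply he, ScalarExt.zero_mk, smul_zero, add_zero, zero_add]
  have : E.connTo f ((n.negOnePow : ℤ) • e) = (n.negOnePow : ℤ) • E.connTo f e :=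
    map_zsmul (AddMonoidHom.mk' (E.connTo f) (fun x y => by
      simp only [connTo, conn₁_add, map_add])) _ _
  rw [this, Int.negOnePow_succ, Units.smul_def, Units.val_neg, neg_smul, smul_comm]
  simp

/-- The right dg-module `E ⊗_{A⁰} B` over `B`, for a morphism `f : A → B`.  It is the dg-module
`(E ⊗_{A⁰} B⁰) ⊗_{B⁰} B` of the pullback of `E` along `f`. -/
noncomputable def extend (f : Hom A B) : DGMod B where
  M := ScalarExt f E.E
  gr := ScalarExt.gr f E.gr
  iSup_gr := E.iSup_gr f
  conn := E.connExt f
  conn_mem := E.connExt_mem f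
  leibniz := E.connExt_leibniz f
  conn_conn := E.connExt_connExt f

end CohesiveModule

/-- The dg-category of cohesive modules over `A`. -/
def cohesiveCat (A : DGAlg.{u}) : DGCat.{u + 1, u} :=
  DGMod.dgCat fun E : CohesiveModule A => E.toDGMod

namespace ScalarExt

variable {A A' A'' B C D : DGAlg.{u}} {E F G : Type u} [AddCommGroup E] [Module A.Z E]
  [AddCommGroup F] [Module A'.Z F] [AddCommGroup G] [Module A''.Z G]
  {f : Hom A B} {g : Hom A' B} {k : Hom A'' B} {f' : Hom A C} {g' : Hom A' C} {k' : Hom A'' C}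
  (h : Hom B C)
  (hf : ∀ a, h.toFun (f.toFun a) = f'.toFun a) (hg : ∀ a, h.toFun (g.toFun a) = g'.toFun a)
  (hk : ∀ a, h.toFun (k.toFun a) = k'.toFun a)

/-- Base change along `h : B → C` of a right `B`-linear map `φ : E ⊗ B → F ⊗ B`. -/
def restr (φ : ScalarExt f E →ₗ[(B.A)ᵐᵒᵖ] ScalarExt g F) :
    ScalarExt f' E →ₗ[(C.A)ᵐᵒᵖ] ScalarExt g' F :=
  lift f' (AddMonoidHom.mk' (fun e => push h hg (φ (mk f 1 e)))
      (fun e e' => by rw [mk_add, map_add, map_add]))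
    (fun z e => by
      change push h hg (φ (mk f 1 (z • e))) = push h hg (φ (mk f 1 e)) <• _
      rw [mk_smul, mul_one, mk_eq, map_smul, push_smul, f.algebraMap_zero, f'.algebraMap_zero, hf])

theorem restr_mk (φ : ScalarExt f E →ₗ[(B.A)ᵐᵒᵖ] ScalarExt g F) (c : C.A) (e : E) :
    restr h hf hg φ (mk f' c e) = push h hg (φ (mk f 1 e)) <• c := rfl

theorem restr_push (φ : ScalarExt f E →ₗ[(B.A)ᵐᵒᵖ] ScalarExt g F) (x : ScalarExt f E) :
    restr h hf hg φ (push h hf x) = push h hg (φ x) := by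
  refine induction f x (by simp) (fun b e => ?_) (fun x y hx hy => by
    simp only [map_add]; rw [hx, hy])
  rw [push_mk, restr_mk, mk_eq f b e, map_smul, push_smul]

theorem mk_one_eq_push (e : E) : mk f' 1 e = push h hf (mk f 1 e) := by
  rw [push_mk, map_one]

theorem restr_add (φ ψ : ScalarExt f E →ₗ[(B.A)ᵐᵒᵖ] ScalarExt g F) :
    restr h hf hg (φ + ψ) = restr h hf hg φ + restr h hf hg ψ :=
  hom_ext _ fun e => by
    simp only [mk_one_eq_push h hf, LinearMap.add_apply, restr_push, map_add]

theorem restr_csmul (c : ℂ) (φ : ScalarExt f E →ₗ[(B.A)ᵐᵒᵖ] ScalarExt g F) :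
    restr h hf hg (c • φ) = c • restr h hf hg φ :=
  hom_ext _ fun e => by
    simp only [mk_one_eq_push h hf, LinearMap.smul_apply, restr_push, push_csmul]

theorem restr_id : restr h hf hf (LinearMap.id : ScalarExt f E →ₗ[(B.A)ᵐᵒᵖ] _) = LinearMap.id :=
  hom_ext _ fun e => by
    simp only [mk_one_eq_push h hf, LinearMap.id_apply, restr_push]

theorem restr_comp (ψ : ScalarExt g F →ₗ[(B.A)ᵐᵒᵖ] ScalarExt k G)
    (φ : ScalarExt f E →ₗ[(B.A)ᵐᵒᵖ] ScalarExt g F) :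
    restr h hf hk (ψ ∘ₗ φ) = restr h hg hk ψ ∘ₗ restr h hf hg φ :=
  hom_ext _ fun e => by
    simp only [mk_one_eq_push h hf, LinearMap.comp_apply, restr_push]

theorem restr_restr {f'' : Hom A D} {g'' : Hom A' D} (h' : Hom C D) (h'' : Hom B D)
    (hh : ∀ b, h'.toFun (h.toFun b) = h''.toFun b)
    (hf' : ∀ a, h'.toFun (f'.toFun a) = f''.toFun a) (hg' : ∀ a, h'.toFun (g'.toFun a) = g''.toFun a)
    (hf'' : ∀ a, h''.toFun (f.toFun a) = f''.toFun a)
    (hg'' : ∀ a, h''.toFun (g.toFun a) = g''.toFun a)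
    (φ : ScalarExt f E →ₗ[(B.A)ᵐᵒᵖ] ScalarExt g F) :
    restr h' hf' hg' (restr h hf hg φ) = restr h'' hf'' hg'' φ :=
  hom_ext _ fun e => by
    conv_lhs => rw [mk_one_eq_push h' hf', mk_one_eq_push h hf]
    rw [mk_one_eq_push h'' hf'', restr_push, restr_push, restr_push,
      push_push h hg h' hg' h'' hh hg'']

theorem restr_mem {𝓔 : ℤ → Submodule A.Z E} {𝓕 : ℤ → Submodule A'.Z F} {n : ℤ}
    {φ : ScalarExt f E →ₗ[(B.A)ᵐᵒᵖ] ScalarExt g F}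
    (hφ : ∀ (k : ℤ) (x : ScalarExt f E), x ∈ gr f 𝓔 k → φ x ∈ gr g 𝓕 (k + n))
    (k : ℤ) (x : ScalarExt f' E) (hx : x ∈ gr f' 𝓔 k) : restr h hf hg φ x ∈ gr g' 𝓕 (k + n) := by
  refine gr_induction f' (P := fun x => restr h hf hg φ x ∈ gr g' 𝓕 (k + n)) hx (by simp) ?_
    (fun x y hx hy => by rw [map_add]; exact add_mem hx hy)
  intro j m b e hb he hjm
  rw [restr_mk]
  exact smul_mem g' (push_mem h hg (hφ m _ (mk_mem f 𝓔 B.one_mem he (zero_add m)))) hb (by omega)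

end ScalarExt

namespace CohesiveModule

variable {A A' A'' B C D : DGAlg.{u}} (E : CohesiveModule A) {E' : CohesiveModule A}
  {F : CohesiveModule A'} {G : CohesiveModule A''}

section restr
variable {E}
  {f : Hom A B} {g : Hom A' B} {k : Hom A'' B} {f' : Hom A C} {g' : Hom A' C} {k' : Hom A'' C}
  (h : Hom B C)
  (hf : ∀ a, h.toFun (f.toFun a) = f'.toFun a) (hg : ∀ a, h.toFun (g.toFun a) = g'.toFun a)
  (hk : ∀ a, h.toFun (k.toFun a) = k'.toFun a)

/-- Restriction of morphisms along `h : B → C`. -/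
noncomputable def restr {n : ℤ} :
    DGMod.Hom (E.extend f) (F.extend g) n →ₗ[ℂ] DGMod.Hom (E.extend f') (F.extend g') n where
  toFun φ := ⟨ScalarExt.restr h hf hg φ.1, ScalarExt.restr_mem h hf hg φ.2⟩
  map_add' φ ψ := Subtype.ext (ScalarExt.restr_add h hf hg φ.1 ψ.1)
  map_smul' c φ := Subtype.ext (ScalarExt.restr_csmul h hf hg c φ.1)

theorem restr_coe {n : ℤ} (φ : DGMod.Hom (E.extend f) (F.extend g) n) :
    (restr h hf hg φ).1 = ScalarExt.restr h hf hg φ.1 := rfl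

theorem restr_d_aux {cE : ScalarExt f E.E →ₗ[ℂ] ScalarExt f E.E}
    {cF : ScalarExt g F.E →ₗ[ℂ] ScalarExt g F.E}
    (h₁ : ∀ x, E.connExt f' (ScalarExt.push h hf x) = ScalarExt.push h hf (cE x))
    (h₂ : ∀ x, F.connExt g' (ScalarExt.push h hg x) = ScalarExt.push h hg (cF x)) (s : ℤˣ)
    (φ : ScalarExt f E.E →ₗ[(B.A)ᵐᵒᵖ] ScalarExt g F.E) (e : E.E) :
    ScalarExt.push h hg (cF (φ (ScalarExt.mk f 1 e)) - s • φ (cE (ScalarExt.mk f 1 e))) <• (1 : C.A) =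
      F.connExt g' (ScalarExt.restr h hf hg φ (ScalarExt.mk f' 1 e)) -
      s • ScalarExt.restr h hf hg φ (E.connExt f' (ScalarExt.mk f' 1 e)) := by
  rw [ScalarExt.mk_one_eq_push h hf, ScalarExt.restr_push, h₁, h₂, ScalarExt.restr_push, map_sub,
    Units.smul_def, Units.smul_def, map_zsmul, MulOpposite.op_one, one_smul]

theorem restr_d {n m : ℤ} (hnm : n + 1 = m) (φ : DGMod.Hom (E.extend f) (F.extend g) n) :
    restr h hf hg (DGMod.d hnm φ) = DGMod.d hnm (restr h hf hg φ) := by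
  refine Subtype.ext (ScalarExt.hom_ext _ fun e => ?_)
  exact restr_d_aux h hf hg (E.connExt_push h hf) (F.connExt_push h hg) n.negOnePow φ.1 e

theorem restr_comp {m n l : ℤ} (hmn : m + n = l) (ψ : DGMod.Hom (F.extend g) (G.extend k) m)
    (φ : DGMod.Hom (E.extend f) (F.extend g) n) :
    restr h hf hk (DGMod.comp hmn ψ φ) = DGMod.comp hmn (restr h hg hk ψ) (restr h hf hg φ) :=
  Subtype.ext (ScalarExt.restr_comp h hf hg hk ψ.1 φ.1)

theorem restr_idHom : restr h hf hf (DGMod.idHom (E.extend f)) = DGMod.idHom (E.extend f') :=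
  Subtype.ext (ScalarExt.restr_id h hf)

theorem restr_restr {f'' : Hom A D} {g'' : Hom A' D} (h' : Hom C D) (h'' : Hom B D)
    (hh : ∀ b, h'.toFun (h.toFun b) = h''.toFun b)
    (hf' : ∀ a, h'.toFun (f'.toFun a) = f''.toFun a) (hg' : ∀ a, h'.toFun (g'.toFun a) = g''.toFun a)
    (hf'' : ∀ a, h''.toFun (f.toFun a) = f''.toFun a)
    (hg'' : ∀ a, h''.toFun (g.toFun a) = g''.toFun a) {n : ℤ}
    (φ : DGMod.Hom (E.extend f) (F.extend g) n) :
    restr h' hf' hg' (restr h hf hg φ) = restr h'' hf'' hg'' φ :=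
  Subtype.ext (ScalarExt.restr_restr h hf hg h' h'' hh hf' hg' hf'' hg'' φ.1)

end restr

/-- The restriction of a morphism of cohesive modules over `A` along `f : A → B`. -/
noncomputable def extendHom (f : Hom A B) {n : ℤ} :
    DGMod.Hom E.toDGMod E'.toDGMod n →ₗ[ℂ] DGMod.Hom (E.extend f) (E'.extend f) n where
  toFun φ := ⟨ScalarExt.restr (f := Hom.id A) (g := Hom.id A) f (id_push f) (id_push f) φ.1,
    ScalarExt.restr_mem (f := Hom.id A) (g := Hom.id A) f (id_push f) (id_push f) φ.2⟩
  map_add' φ ψ := Subtype.ext (ScalarExt.restr_add f (id_push f) (id_push f) φ.1 ψ.1)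
  map_smul' c φ := Subtype.ext (ScalarExt.restr_csmul f (id_push f) (id_push f) c φ.1)

theorem extendHom_coe (f : Hom A B) {n : ℤ} (φ : DGMod.Hom E.toDGMod E'.toDGMod n) :
    (extendHom E f φ).1 =
      ScalarExt.restr (f := Hom.id A) (g := Hom.id A) f (id_push f) (id_push f) φ.1 := rfl

theorem extendHom_d (f : Hom A B) {n m : ℤ} (hnm : n + 1 = m)
    (φ : DGMod.Hom E.toDGMod E'.toDGMod n) :
    extendHom E f (DGMod.d hnm φ) = DGMod.d hnm (extendHom E f φ) := by
  refine Subtype.ext (ScalarExt.hom_ext _ fun e => ?_)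
  exact restr_d_aux f (id_push f) (id_push f) (E.connExt_push_id f) (E'.connExt_push_id f)
    n.negOnePow φ.1 e

theorem extendHom_comp (f : Hom A B) {E'' : CohesiveModule A} {m n l : ℤ} (hmn : m + n = l)
    (ψ : DGMod.Hom E'.toDGMod E''.toDGMod m) (φ : DGMod.Hom E.toDGMod E'.toDGMod n) :
    extendHom E f (DGMod.comp hmn ψ φ) = DGMod.comp hmn (extendHom E' f ψ) (extendHom E f φ) :=
  Subtype.ext (ScalarExt.restr_comp f (id_push f) (id_push f) (id_push f) ψ.1 φ.1)

theorem extendHom_id (f : Hom A B) :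
    extendHom E f (DGMod.idHom E.toDGMod) = DGMod.idHom (E.extend f) :=
  Subtype.ext (ScalarExt.restr_id f (id_push f))

theorem restr_extendHom {f : Hom A B} {k : Hom A C} (h : Hom B C)
    (hk : ∀ a, h.toFun (f.toFun a) = k.toFun a) {n : ℤ}
    (φ : DGMod.Hom E.toDGMod E'.toDGMod n) :
    restr h hk hk (extendHom E f φ) = extendHom E k φ :=
  Subtype.ext (ScalarExt.restr_restr f (id_push f) (id_push f) h k hk hk hk
    (id_push k) (id_push k) φ.1)

/-! ### Pullback of cohesive modules -/

/-- The graded module `E ⊗_{A⁰} B⁰`. -/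
def PullModule (f : Hom A B) : Type u := PullZero f ⊗[A.Z] E.E

noncomputable instance (f : Hom A B) : AddCommGroup (E.PullModule f) :=
  inferInstanceAs (AddCommGroup (PullZero f ⊗[A.Z] E.E))

noncomputable instance (f : Hom A B) : Module B.Z (E.PullModule f) :=
  inferInstanceAs (Module (PullZero f) (PullZero f ⊗[A.Z] E.E))

/-- The pure tensor `e ⊗ s` in `E ⊗_{A⁰} B⁰`. -/
def pullMk (f : Hom A B) (s : B.Z) (e : E.E) : E.PullModule f :=
  (show PullZero f from s) ⊗ₜ[A.Z] e

/-- The grading of `E ⊗_{A⁰} B⁰`. -/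
noncomputable def pullGr (f : Hom A B) (n : ℤ) : Submodule B.Z (E.PullModule f) :=
  (E.gr n).baseChange (PullZero f)

theorem pullGr_internal (f : Hom A B) : DirectSum.IsInternal (E.pullGr f) :=
  DirectSum.IsInternal.baseChange (S := PullZero f) E.gr E.internal

section pull
variable {f : Hom A B} (h : Hom B C) {k : Hom A C} (hk : ∀ a, h.toFun (f.toFun a) = k.toFun a)

theorem smul_pullMk (s t : B.Z) (e : E.E) : s • E.pullMk f t e = E.pullMk f (s * t) e :=
  TensorProduct.smul_tmul' (R := A.Z) (show PullZero f from s) (show PullZero f from t) e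

theorem pullMk_smul (s : B.Z) (z : A.Z) (e : E.E) :
    E.pullMk f s (z • e) = E.pullMk f (f.zero z * s) e := by
  unfold pullMk
  rw [TensorProduct.tmul_smul, TensorProduct.smul_tmul']
  rfl

theorem pullMk_add (s : B.Z) (e e' : E.E) :
    E.pullMk f s (e + e') = E.pullMk f s e + E.pullMk f s e' := TensorProduct.tmul_add _ _ _

@[elab_as_elim]
theorem pull_induction {P : E.PullModule f → Prop} (x : E.PullModule f) (h0 : P 0)
    (hm : ∀ s e, P (E.pullMk f s e)) (ha : ∀ x y, P x → P y → P (x + y)) : P x :=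
  TensorProduct.induction_on (R := A.Z) (M := PullZero f) (N := E.E) x h0 hm ha

theorem algebraMap_comp (hk : ∀ a, h.toFun (f.toFun a) = k.toFun a) (z : A.Z) :
    algebraMap C.Z C.A (h.zero (f.zero z)) = algebraMap C.Z C.A (k.zero z) := by
  rw [h.algebraMap_zero, f.algebraMap_zero, k.algebraMap_zero, hk]

/-- The map `E ⊗_{A⁰} B⁰ → E ⊗_{A⁰} C`. -/
noncomputable def pullToExt : E.PullModule f →+ ScalarExt k E.E :=
  TensorProduct.liftAddHom (R := A.Z) (M := PullZero f) (N := E.E)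
    (AddMonoidHom.mk' (fun s : PullZero f => AddMonoidHom.mk'
        (fun e => ScalarExt.mk k (algebraMap C.Z C.A (h.zero s)) e)
        (fun e e' => ScalarExt.mk_add k _ e e'))
      (fun s s' => by
        ext e
        change ScalarExt.mk k (algebraMap C.Z C.A (h.zero ((show B.Z from s) +
          (show B.Z from s')))) e = _
        rw [map_add, map_add, ScalarExt.add_mk]
        rfl))
    (fun z s e => by
      change ScalarExt.mk k (algebraMap C.Z C.A (h.zero (f.zero z * (show B.Z from s)))) e =
        ScalarExt.mk k (algebraMap C.Z C.A (h.zero s)) (z • e)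
      rw [ScalarExt.mk_smul, map_mul, map_mul, algebraMap_comp h hk])

theorem pullToExt_mk (s : B.Z) (e : E.E) : E.pullToExt h hk (E.pullMk f s e) =
    ScalarExt.mk k (algebraMap C.Z C.A (h.zero s)) e := rfl

theorem pullToExt_smul (z : B.Z) (x : E.PullModule f) :
    E.pullToExt h hk (z • x) = E.pullToExt h hk x <• algebraMap C.Z C.A (h.zero z) := by
  refine E.pull_induction x (by simp) (fun s e => ?_)
    (fun x y hx hy => by rw [smul_add, map_add, map_add, smul_add, hx, hy])
  rw [smul_pullMk, pullToExt_mk, pullToExt_mk, ScalarExt.mk_mul, mul_comm z, map_mul, map_mul]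

/-- The canonical map `(E ⊗_{A⁰} B⁰) ⊗_{B⁰} C → E ⊗_{A⁰} C`. -/
noncomputable def assocTo : ScalarExt h (E.PullModule f) →ₗ[(C.A)ᵐᵒᵖ] ScalarExt k E.E :=
  ScalarExt.lift h (E.pullToExt h hk) (E.pullToExt_smul h hk)

/-- The canonical map `E ⊗_{A⁰} C → (E ⊗_{A⁰} B⁰) ⊗_{B⁰} C`. -/
noncomputable def assocInv : ScalarExt k E.E →ₗ[(C.A)ᵐᵒᵖ] ScalarExt h (E.PullModule f) :=
  ScalarExt.lift k (AddMonoidHom.mk' (fun e => ScalarExt.mk h 1 (E.pullMk f 1 e))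
      (fun e e' => by rw [pullMk_add, ScalarExt.mk_add]))
    (fun z e => by
      change ScalarExt.mk h 1 (E.pullMk f 1 (z • e)) = ScalarExt.mk h 1 (E.pullMk f 1 e) <• _
      rw [pullMk_smul, ← smul_pullMk, ScalarExt.mk_smul, ScalarExt.mk_mul, mul_one, one_mul,
        algebraMap_comp h hk])

theorem assocTo_mk (c : C.A) (x : E.PullModule f) : E.assocTo h hk (ScalarExt.mk h c x) =
    E.pullToExt h hk x <• c := rfl

theorem assocInv_mk (c : C.A) (e : E.E) : E.assocInv h hk (ScalarExt.mk k c e) =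
    ScalarExt.mk h c (E.pullMk f 1 e) := by
  rw [ScalarExt.mk_eq h c]
  rfl

theorem assocTo_assocInv (x : ScalarExt k E.E) : E.assocTo h hk (E.assocInv h hk x) = x := by
  refine ScalarExt.induction k x (by simp) (fun c e => ?_) (fun x y hx hy => by
    rw [map_add, map_add, hx, hy])
  rw [assocInv_mk, assocTo_mk, pullToExt_mk, map_one, map_one, ScalarExt.mk_mul, one_mul]

theorem assocInv_assocTo (x : ScalarExt h (E.PullModule f)) :
    E.assocInv h hk (E.assocTo h hk x) = x := by
  refine ScalarExt.induction h x (by simp) (fun c x => ?_) (fun x y hx hy => by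
    rw [map_add, map_add, hx, hy])
  refine E.pull_induction x (by simp) (fun s e => ?_) (fun x y hx hy => by
    rw [ScalarExt.mk_add, map_add, map_add, hx, hy])
  rw [assocTo_mk, pullToExt_mk, ScalarExt.mk_mul, assocInv_mk, ← ScalarExt.mk_smul, smul_pullMk,
    mul_one]

theorem pullMk_mem {n : ℤ} {e : E.E} (he : e ∈ E.gr n) : E.pullMk f 1 e ∈ E.pullGr f n :=
  Submodule.tmul_mem_baseChange_of_mem (1 : PullZero f) he

theorem pullToExt_mem {n : ℤ} {x : E.PullModule f} (hx : x ∈ E.pullGr f n) :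
    E.pullToExt h hk x ∈ ScalarExt.gr k E.gr n := by
  unfold pullGr at hx
  rw [Submodule.baseChange_eq_span] at hx
  refine Submodule.span_induction (R := PullZero f) (M := PullZero f ⊗[A.Z] E.E)
    (p := fun x _ => E.pullToExt h hk x ∈ ScalarExt.gr k E.gr n) ?_ ?_ ?_ ?_ hx
  · rintro _ ⟨e, he, rfl⟩
    change ScalarExt.mk k (algebraMap C.Z C.A (h.zero 1)) e ∈ _
    rw [map_one, map_one]
    exact ScalarExt.mk_mem k _ C.one_mem he (zero_add n)
  · exact (map_zero (E.pullToExt h hk)).symm ▸ zero_mem _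
  · intro x y _ _ hx hy
    exact (map_add (E.pullToExt h hk) x y).symm ▸ add_mem hx hy
  · intro s x _ hx
    refine (E.pullToExt_smul h hk s x).symm ▸ ?_
    exact ScalarExt.smul_mem k hx ((C.mem_gr_zero _).2 ⟨_, rfl⟩) (by simp)

theorem assocTo_mem {n : ℤ} {x : ScalarExt h (E.PullModule f)}
    (hx : x ∈ ScalarExt.gr h (E.pullGr f) n) : E.assocTo h hk x ∈ ScalarExt.gr k E.gr n := by
  refine ScalarExt.gr_induction h (P := fun x => E.assocTo h hk x ∈ ScalarExt.gr k E.gr n) hx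
    (by simp) ?_ (fun x y hx hy => by rw [map_add]; exact add_mem hx hy)
  intro j m c x hc hx hjm
  exact ScalarExt.smul_mem k (E.pullToExt_mem h hk hx) hc (by omega)

theorem assocInv_mem {n : ℤ} {x : ScalarExt k E.E}
    (hx : x ∈ ScalarExt.gr k E.gr n) : E.assocInv h hk x ∈ ScalarExt.gr h (E.pullGr f) n := by
  refine ScalarExt.gr_induction k (P := fun x => E.assocInv h hk x ∈ ScalarExt.gr h (E.pullGr f) n)
    hx (by simp) ?_ (fun x y hx hy => by rw [map_add]; exact add_mem hx hy)
  intro j m c e hc he hjm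
  rw [assocInv_mk]
  exact ScalarExt.mk_mem h _ hc (E.pullMk_mem he) hjm

end pull

theorem id_comp (f : Hom A B) (a : A.A) : (Hom.id B).toFun (f.toFun a) = f.toFun a := rfl

/-- The pullback of a cohesive module along a morphism of dg-algebras: the graded module
`E ⊗_{A⁰} B⁰` with the connection of `E ⊗_{A⁰} B`, carried over by the canonical isomorphism
`(E ⊗_{A⁰} B⁰) ⊗_{B⁰} B = E ⊗_{A⁰} B`. -/
noncomputable def pullback (f : Hom A B) : CohesiveModule B where
  E := E.PullModule f
  gr := E.pullGr f
  internal := E.pullGr_internal f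
  finite := by
    have := E.finite
    exact Module.Finite.base_change A.Z (PullZero f) E.E
  projective := by
    have := E.projective
    exact Module.Projective.tensorProduct (R := PullZero f) (R₀ := A.Z) (M := PullZero f) (N := E.E)
  conn := (LinearMap.restrictScalars ℂ (E.assocInv (Hom.id B) (id_comp f))) ∘ₗ E.connExt f ∘ₗ
    (LinearMap.restrictScalars ℂ (E.assocTo (Hom.id B) (id_comp f)))
  conn_mem hx := E.assocInv_mem _ (id_comp f) (E.connExt_mem f (E.assocTo_mem _ (id_comp f) hx))
  leibniz {k x} b hx := by
    simp only [LinearMap.comp_apply, LinearMap.restrictScalars_apply]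
    rw [map_smul, E.connExt_leibniz f b (E.assocTo_mem _ (id_comp f) hx), map_add, map_smul, Units.smul_def,
      map_zsmul, map_smul, assocInv_assocTo]
    rfl
  conn_conn x := by
    simp only [LinearMap.comp_apply, LinearMap.restrictScalars_apply]
    rw [assocTo_assocInv, connExt_connExt, map_zero]

end CohesiveModule

namespace CohesiveModule

variable {A B C : DGAlg.{u}} (E : CohesiveModule A)
variable {f : Hom A B} (h : Hom B C) {k : Hom A C} (hk : ∀ a, h.toFun (f.toFun a) = k.toFun a)

theorem assocTo_push (x : ScalarExt (Hom.id B) (E.PullModule f)) :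
    E.assocTo h hk (ScalarExt.push h (id_push h) x) =
      ScalarExt.push h hk (E.assocTo (Hom.id B) (id_comp f) x) := by
  refine ScalarExt.induction _ x (by simp) (fun c x => ?_) (fun x y hx hy => by
    simp only [map_add]; rw [hx, hy])
  rw [ScalarExt.push_mk, assocTo_mk, assocTo_mk, ScalarExt.push_smul]
  congr 1
  refine E.pull_induction x (by simp) (fun s e => ?_) (fun x y hx hy => by
    simp only [map_add]; rw [hx, hy])
  rw [pullToExt_mk, pullToExt_mk, ScalarExt.push_mk, h.algebraMap_zero]
  rfl

/-- The connection of the pullback, typed on `(E ⊗_{A⁰} B⁰) ⊗_{B⁰} C`. -/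
noncomputable def pullConn : ScalarExt h (E.PullModule f) →ₗ[ℂ] ScalarExt h (E.PullModule f) :=
  (E.pullback f).connExt h

theorem pullConn_mk {n : ℤ} (c : C.A) {x : E.PullModule f} (hx : x ∈ E.pullGr f n) :
    E.pullConn h (ScalarExt.mk h c x) =
      ScalarExt.push h (id_push h) (E.assocInv (Hom.id B) (id_comp f)
        (E.connExt f (E.assocTo (Hom.id B) (id_comp f) (ScalarExt.mk _ 1 x)))) <• c +
      (n.negOnePow : ℤ) • ScalarExt.mk h (C.d c) x := by
  rw [← ScalarExt.mk_zsmul, ← show (E.pullback f).sign x = (n.negOnePow : ℤ) • x from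
    (E.pullback f).sign_apply hx]
  rfl

theorem assocTo_conn (x : ScalarExt h (E.PullModule f)) :
    E.assocTo h hk (E.pullConn h x) = E.connExt k (E.assocTo h hk x) := by
  refine ScalarExt.hom_induction h (E.pullGr_internal f) x (by simp) ?_ (fun x y hx hy => by
    simp only [map_add]; rw [hx, hy])
  intro j n c x hc hx
  have h3 := E.connExt_leibniz k c (E.assocTo_mem h hk
    (ScalarExt.mk_mem h (E.pullGr f) C.one_mem hx (zero_add n)))
  rw [pullConn_mk E h c hx, map_add, map_smul, assocTo_push, assocTo_assocInv, ← connExt_push,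
    ← assocTo_push, ScalarExt.push_mk, map_one, map_zsmul, ScalarExt.mk_eq h c x,
    LinearMap.map_smul (E.assocTo h hk) (MulOpposite.op c), h3,
    ScalarExt.mk_eq h (C.d c) x, LinearMap.map_smul (E.assocTo h hk) (MulOpposite.op (C.d c)),
    Units.smul_def]

/-- The canonical isomorphism `(E ⊗_{A⁰} B⁰) ⊗_{B⁰} C → E ⊗_{A⁰} C` of dg-modules. -/
noncomputable def assocHom : DGMod.Hom ((E.pullback f).extend h) (E.extend k) 0 :=
  ⟨E.assocTo h hk, fun n x hx => by
    rw [add_zero]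
    exact E.assocTo_mem h hk hx⟩

/-- The inverse of `assocHom`. -/
noncomputable def assocHomInv : DGMod.Hom (E.extend k) ((E.pullback f).extend h) 0 :=
  ⟨E.assocInv h hk, fun n x hx => by
    rw [add_zero]
    exact E.assocInv_mem h hk hx⟩

theorem comp_assocHomInv :
    DGMod.comp (add_zero 0) (E.assocHom h hk) (E.assocHomInv h hk) = DGMod.idHom _ :=
  Subtype.ext (LinearMap.ext fun x => E.assocTo_assocInv h hk x)

theorem comp_assocHom :
    DGMod.comp (add_zero 0) (E.assocHomInv h hk) (E.assocHom h hk) = DGMod.idHom _ :=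
  Subtype.ext (LinearMap.ext fun x => E.assocInv_assocTo h hk x)

theorem d_assocHom {m : ℤ} (hm : 0 + 1 = m) : DGMod.d hm (E.assocHom h hk) = 0 := by
  refine Subtype.ext (LinearMap.ext fun x => ?_)
  rw [DGMod.d_apply, Int.negOnePow_zero, one_smul]
  exact sub_eq_zero.2 (E.assocTo_conn h hk x).symm

theorem d_assocHomInv {m : ℤ} (hm : 0 + 1 = m) : DGMod.d hm (E.assocHomInv h hk) = 0 := by
  refine Subtype.ext (LinearMap.ext fun x => ?_)
  rw [DGMod.d_apply, Int.negOnePow_zero, one_smul]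
  refine sub_eq_zero.2 ?_
  have key : ∀ x : ScalarExt k E.E,
      E.pullConn h (E.assocInv h hk x) = E.assocInv h hk (E.connExt k x) := fun x => by
    have := E.assocTo_conn h hk (E.assocInv h hk x)
    rw [assocTo_assocInv] at this
    rw [← this, assocInv_assocTo]
  exact key x

variable {D : DGAlg.{u}} (h' : Hom C D) {l : Hom A D} {h'' : Hom B D}

theorem restr_assocHom (hh : ∀ b, h'.toFun (h.toFun b) = h''.toFun b)
    (hl : ∀ a, h'.toFun (k.toFun a) = l.toFun a) (hl' : ∀ a, h''.toFun (f.toFun a) = l.toFun a) :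
    restr h' hh hl (E.assocHom h hk) = E.assocHom h'' hl' := by
  refine Subtype.ext (ScalarExt.hom_ext _ fun x => ?_)
  change ScalarExt.push h' hl (E.pullToExt h hk x <• (1 : C.A)) <• (1 : D.A) =
    E.pullToExt h'' hl' x <• (1 : D.A)
  simp only [MulOpposite.op_one, one_smul]
  refine E.pull_induction x (by simp) (fun s e => ?_) (fun x y hx hy => by
    simp only [map_add]; rw [hx, hy])
  rw [pullToExt_mk, pullToExt_mk, ScalarExt.push_mk, h.algebraMap_zero, h''.algebraMap_zero, hh]

theorem restr_assocHomInv (hh : ∀ b, h'.toFun (h.toFun b) = h''.toFun b)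
    (hl : ∀ a, h'.toFun (k.toFun a) = l.toFun a) (hl' : ∀ a, h''.toFun (f.toFun a) = l.toFun a) :
    restr h' hl hh (E.assocHomInv h hk) = E.assocHomInv h'' hl' := by
  refine Subtype.ext (ScalarExt.hom_ext _ fun e => ?_)
  change ScalarExt.push h' hh (E.assocInv h hk (ScalarExt.mk k 1 e)) <• (1 : D.A) =
    E.assocInv h'' hl' (ScalarExt.mk l 1 e)
  rw [assocInv_mk, assocInv_mk, ScalarExt.push_mk, map_one, MulOpposite.op_one, one_smul]

end CohesiveModule

/-! ### Čech cochains with values in morphisms of cohesive modules -/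

/-- A presheaf of dg-algebras on a topological space. -/
structure DGAlgPresheaf (X : Type v) [TopologicalSpace X] where
  obj : TopologicalSpace.Opens X → DGAlg.{u}
  res : ∀ {U V : TopologicalSpace.Opens X}, U ≤ V → Hom (obj V) (obj U)
  res_id : ∀ (U : TopologicalSpace.Opens X) (h : U ≤ U) (a : (obj U).A), (res h).toFun a = a
  res_res : ∀ {U V W : TopologicalSpace.Opens X} (h : U ≤ V) (h' : V ≤ W) (h'' : U ≤ W)
    (a : (obj W).A), (res h).toFun ((res h').toFun a) = (res h'').toFun a

/-- The `p`-simplices `i₀ … i_p` with first vertex `i₀ = a` and last vertex `i_p = b`. -/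
abbrev Simplex (ι : Type w) (p : ℕ) (a b : ι) : Type w :=
  {I : Fin (p + 1) → ι // I 0 = a ∧ I (Fin.last p) = b}

namespace Simplex

variable {ι : Type w} {m : ℕ} {a b : ι}

/-- The front face `i₀ … i_p` of `i₀ … i_{p+r}`. -/
def front (s : Simplex ι m a b) (p r : ℕ) (h : p + r = m) : Simplex ι p a (s.1 ⟨p, by omega⟩) :=
  ⟨fun k => s.1 ⟨k, by omega⟩, s.2.1, rfl⟩

/-- The back face `i_p … i_{p+r}` of `i₀ … i_{p+r}`. -/
def back (s : Simplex ι m a b) (p r : ℕ) (h : p + r = m) : Simplex ι r (s.1 ⟨p, by omega⟩) b :=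
  ⟨fun k => s.1 ⟨p + k, by omega⟩, rfl, (congrArg s.1 (Fin.ext h)).trans s.2.2⟩

/-- The interior face `i₀ … î_{k+1} … i_{p+1}`, where `0 < k + 1 < p + 1`. -/
def face {p : ℕ} (s : Simplex ι (p + 1) a b) (k : Fin p) : Simplex ι p a b :=
  ⟨fun j => s.1 (k.castSucc.succ.succAbove j),
    (congrArg s.1 (Fin.succAbove_ne_zero_zero (Fin.succ_ne_zero _))).trans s.2.1,
    (congrArg s.1 (Fin.succAbove_ne_last_last (by
      simp [Fin.ext_iff]; omega))).trans s.2.2⟩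

theorem face_apply {p : ℕ} (s : Simplex ι (p + 1) a b) (k : Fin p) (j : Fin (p + 1)) :
    (s.face k).1 j = if h : (j : ℕ) ≤ k then s.1 ⟨j, by omega⟩ else s.1 ⟨j + 1, by omega⟩ := by
  change s.1 (k.castSucc.succ.succAbove j) = _
  unfold Fin.succAbove
  split_ifs with h1 h2 h2
  · rfl
  · simp [Fin.lt_def] at h1; omega
  · simp [Fin.lt_def] at h1; omega
  · rfl

end Simplex

section Cech

variable {X : Type v} [TopologicalSpace X] (𝒜 : DGAlgPresheaf.{u} X) {ι : Type w}
  (U : ι → TopologicalSpace.Opens X)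

/-- The intersection `U_{i₀ … i_p}`. -/
def supp {p : ℕ} {a b : ι} (s : Simplex ι p a b) : TopologicalSpace.Opens X := ⨅ k, U (s.1 k)

variable {U} in
theorem supp_le_first {p : ℕ} {a b : ι} (s : Simplex ι p a b) : supp U s ≤ U a :=
  (iInf_le _ 0).trans (le_of_eq (congrArg U s.2.1))

variable {U} in
theorem supp_le_last {p : ℕ} {a b : ι} (s : Simplex ι p a b) : supp U s ≤ U b :=
  (iInf_le _ (Fin.last p)).trans (le_of_eq (congrArg U s.2.2))

variable {U} in
theorem supp_le_front {m : ℕ} {a b : ι} (s : Simplex ι m a b) (p r : ℕ) (h : p + r = m) :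
    supp U s ≤ supp U (s.front p r h) := le_iInf fun _ => iInf_le _ _

variable {U} in
theorem supp_le_back {m : ℕ} {a b : ι} (s : Simplex ι m a b) (p r : ℕ) (h : p + r = m) :
    supp U s ≤ supp U (s.back p r h) := le_iInf fun _ => iInf_le _ _

variable {U} in
theorem supp_le_face {p : ℕ} {a b : ι} (s : Simplex ι (p + 1) a b) (k : Fin p) :
    supp U s ≤ supp U (s.face k) := le_iInf fun _ => iInf_le _ _

/-- A family of cohesive modules on the members of the cover. -/
abbrev CohesiveFamily := ∀ i, CohesiveModule (𝒜.obj (U i))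

variable {𝒜 U}

/-- The morphisms of degree `n` from `E_i` to `F_j` on an open subset `V` of `U_i ∩ U_j`. -/
def LHom (E F : CohesiveFamily 𝒜 U) (V : TopologicalSpace.Opens X) {i j : ι} (hi : V ≤ U i)
    (hj : V ≤ U j) (n : ℤ) : Type u :=
  DGMod.Hom ((E i).extend (𝒜.res hi)) ((F j).extend (𝒜.res hj)) n

/-- The identity of `E_i = E_j`, for equal indices `i = j`. -/
noncomputable def LHom.eqId (E : CohesiveFamily 𝒜 U) {V : TopologicalSpace.Opens X} {i j : ι}
    (hi : V ≤ U i) (hj : V ≤ U j) (h : i = j) : LHom E E V hi hj 0 := by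
  subst h
  exact DGMod.idHom ((E i).extend (𝒜.res hi))

namespace LHom

variable {E F G H : CohesiveFamily 𝒜 U} {V V' V'' : TopologicalSpace.Opens X} {i j k l : ι}
  {hi : V ≤ U i} {hj : V ≤ U j} {hk : V ≤ U k} {hl : V ≤ U l}

noncomputable instance (n : ℤ) : AddCommGroup (LHom E F V hi hj n) :=
  inferInstanceAs (AddCommGroup (DGMod.Hom ((E i).extend (𝒜.res hi)) ((F j).extend (𝒜.res hj)) n))

noncomputable instance (n : ℤ) : Module ℂ (LHom E F V hi hj n) :=
  inferInstanceAs (Module ℂ (DGMod.Hom ((E i).extend (𝒜.res hi)) ((F j).extend (𝒜.res hj)) n))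

/-- The differential. -/
noncomputable def d {n m : ℤ} (h : n + 1 = m) : LHom E F V hi hj n →ₗ[ℂ] LHom E F V hi hj m :=
  DGMod.d h

/-- The composition. -/
noncomputable def comp {m n k' : ℤ} (h : m + n = k') :
    LHom F G V hj hk m →ₗ[ℂ] LHom E F V hi hj n →ₗ[ℂ] LHom E G V hi hk k' :=
  DGMod.comp h

/-- Restriction to a smaller open set. -/
noncomputable def rs (hV : V' ≤ V) {n : ℤ} :
    LHom E F V hi hj n →ₗ[ℂ] LHom E F V' (hV.trans hi) (hV.trans hj) n :=
  CohesiveModule.restr (𝒜.res hV) (𝒜.res_res hV hi (hV.trans hi))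
    (𝒜.res_res hV hj (hV.trans hj))

/-- Transport along an equality of degrees. -/
noncomputable def cast {n m : ℤ} (h : n = m) : LHom E F V hi hj n →ₗ[ℂ] LHom E F V hi hj m := by
  subst h
  exact LinearMap.id

theorem cast_rfl {n : ℤ} (x : LHom E F V hi hj n) : cast rfl x = x := rfl

theorem cast_cast {n m q : ℤ} (h : n = m) (h' : m = q) (x : LHom E F V hi hj n) :
    cast h' (cast h x) = cast (h.trans h') x := by subst h h'; rfl

theorem cast_inj {n m : ℤ} (h : n = m) {x y : LHom E F V hi hj n} :
    cast h x = cast h y ↔ x = y := by subst h; rfl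

theorem d_cast {n n' m : ℤ} (e : n = n') (h : n' + 1 = m) (x : LHom E F V hi hj n) :
    d h (cast e x) = d (by omega) x := by subst e; rfl

theorem cast_d {n m m' : ℤ} (e : m = m') (h : n + 1 = m) (x : LHom E F V hi hj n) :
    cast e (d h x) = d (by omega) x := by subst e; rfl

theorem cast_comp {m n q q' : ℤ} (e : q = q') (h : m + n = q) (x : LHom F G V hj hk m)
    (y : LHom E F V hi hj n) : cast e (comp h x y) = comp (by omega) x y := by subst e; rfl

theorem comp_cast_left {m m' n q : ℤ} (e : m = m') (h : m' + n = q) (x : LHom F G V hj hk m)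
    (y : LHom E F V hi hj n) : comp h (cast e x) y = comp (by omega) x y := by subst e; rfl

theorem comp_cast_right {m n n' q : ℤ} (e : n = n') (h : m + n' = q) (x : LHom F G V hj hk m)
    (y : LHom E F V hi hj n) : comp h x (cast e y) = comp (by omega) x y := by subst e; rfl

theorem rs_cast (hV : V' ≤ V) {n n' : ℤ} (e : n = n') (x : LHom E F V hi hj n) :
    rs hV (cast e x) = cast e (rs hV x) := by subst e; rfl

theorem rs_rs (hV : V' ≤ V) (hV' : V'' ≤ V') {n : ℤ} (x : LHom E F V hi hj n) :
    rs hV' (rs hV x) = rs (hV'.trans hV) x :=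
  CohesiveModule.restr_restr (𝒜.res hV) (𝒜.res_res hV hi (hV.trans hi))
    (𝒜.res_res hV hj (hV.trans hj)) (𝒜.res hV') (𝒜.res (hV'.trans hV))
    (𝒜.res_res hV' hV (hV'.trans hV)) _ _ _ _ x

theorem rs_d (hV : V' ≤ V) {n m : ℤ} (h : n + 1 = m) (x : LHom E F V hi hj n) :
    rs hV (d h x) = d h (rs hV x) :=
  CohesiveModule.restr_d _ _ _ h x

theorem rs_comp (hV : V' ≤ V) {m n q : ℤ} (h : m + n = q) (x : LHom F G V hj hk m)
    (y : LHom E F V hi hj n) : rs hV (comp h x y) = comp h (rs hV x) (rs hV y) :=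
  CohesiveModule.restr_comp _ _ _ _ h x y

theorem rs_eqId (hV : V' ≤ V) (h : i = j) :
    rs hV (eqId E hi hj h) = eqId E (hV.trans hi) (hV.trans hj) h := by
  subst h
  exact CohesiveModule.restr_idHom _ _

theorem rs_self (hV : V ≤ V) {n : ℤ} (x : LHom E F V hi hj n) : rs hV x = x := by
  refine Subtype.ext (ScalarExt.hom_ext _ fun e => ?_)
  have key : ∀ φ : ScalarExt (𝒜.res hi) (E i).E →ₗ[((𝒜.obj V).A)ᵐᵒᵖ]
      ScalarExt (𝒜.res hj) (F j).E,
      ScalarExt.restr (𝒜.res hV) (𝒜.res_res hV hi (hV.trans hi))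
        (𝒜.res_res hV hj (hV.trans hj)) φ (ScalarExt.mk (𝒜.res hi) 1 e) =
      φ (ScalarExt.mk (𝒜.res hi) 1 e) := fun φ => by
    rw [ScalarExt.restr_mk, MulOpposite.op_one, one_smul]
    exact ScalarExt.push_id _ _ (𝒜.res_id V hV) _
  exact key x.1

theorem comp_assoc {a b c ab bc q : ℤ} (hab : a + b = ab) (hbc : b + c = bc) (h₁ : ab + c = q)
    (h₂ : a + bc = q) (x : LHom G H V hk hl a) (y : LHom F G V hj hk b) (z : LHom E F V hi hj c) :
    comp h₁ (comp hab x y) z = comp h₂ x (comp hbc y z) := rfl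

theorem d_d {a b c : ℤ} (h₁ : a + 1 = b) (h₂ : b + 1 = c) (x : LHom E F V hi hj a) :
    d h₂ (d h₁ x) = 0 := DGMod.d_d h₁ h₂ x

theorem d_comp {m n k' m' n' k'' : ℤ} (h : m + n = k') (hm : m + 1 = m')
    (hn : n + 1 = n') (hk' : k' + 1 = k'') (h₁ : m' + n = k'') (h₂ : m + n' = k'')
    (x : LHom F G V hj hk m) (y : LHom E F V hi hj n) :
    d hk' (comp h x y) = comp h₁ (d hm x) y + m.negOnePow • comp h₂ x (d hn y) :=
  DGMod.d_comp h hm hn hk' h₁ h₂ x y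

theorem d_eqId (h : i = j) {m : ℤ} (hm : 0 + 1 = m) : d hm (eqId E hi hj h) = 0 := by
  subst h
  exact DGMod.d_id hm

theorem eqId_comp {n q : ℤ} (h : 0 + n = q) (x : LHom E F V hi hj n) :
    comp h (eqId F hj hj rfl) x = cast (by omega) x := by
  obtain rfl : n = q := by omega
  rfl

theorem comp_eqId {n q : ℤ} (h : n + 0 = q) (x : LHom E F V hi hj n) :
    comp h x (eqId E hi hi rfl) = cast (by omega) x := by
  obtain rfl : n = q := by omega
  rfl

end LHom

end Cech

section sums

open Finset

variable {M : Type u} [AddCommGroup M]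

theorem sum_antidiag (m : ℕ) (F : ∀ p r : ℕ, p + r = m → M) :
    ∑ x : antidiagonal m, F x.1.1 x.1.2 (mem_antidiagonal.1 x.2) =
      ∑ x ∈ antidiagonal m, if h : x.1 + x.2 = m then F x.1 x.2 h else 0 := by
  rw [← Finset.sum_coe_sort (antidiagonal m)
    (fun x : ℕ × ℕ => if h : x.1 + x.2 = m then F x.1 x.2 h else (0 : M))]
  refine sum_congr rfl fun x _ => ?_
  rw [dif_pos (mem_antidiagonal.1 x.2)]

theorem sum_antidiag_succ (m : ℕ) (F : ∀ p r : ℕ, p + r = m + 1 → M) :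
    ∑ x : antidiagonal (m + 1), F x.1.1 x.1.2 (mem_antidiagonal.1 x.2) =
      F 0 (m + 1) (by omega) + ∑ x : antidiagonal m, F (x.1.1 + 1) x.1.2 (by
        have := mem_antidiagonal.1 x.2; omega) := by
  rw [sum_antidiag, Finset.Nat.sum_antidiagonal_succ, dif_pos (by omega),
    sum_antidiag m (fun p r h => F (p + 1) r (by omega))]
  congr 1
  refine sum_congr rfl fun x hx => ?_
  have := mem_antidiagonal.1 hx
  rw [dif_pos this, dif_pos (by dsimp; omega)]

theorem sum_antidiag_succ' (m : ℕ) (F : ∀ p r : ℕ, p + r = m + 1 → M) :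
    ∑ x : antidiagonal (m + 1), F x.1.1 x.1.2 (mem_antidiagonal.1 x.2) =
      F (m + 1) 0 (by omega) + ∑ x : antidiagonal m, F x.1.1 (x.1.2 + 1) (by
        have := mem_antidiagonal.1 x.2; omega) := by
  rw [sum_antidiag, Finset.Nat.sum_antidiagonal_succ', dif_pos (by omega),
    sum_antidiag m (fun p r h => F p (r + 1) (by omega))]
  congr 1
  refine sum_congr rfl fun x hx => ?_
  have := mem_antidiagonal.1 hx
  rw [dif_pos this, dif_pos (by dsimp; omega)]

theorem sum_antidiag_assoc (m : ℕ) (F : ∀ i j r : ℕ, i + j + r = m → M) :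
    ∑ x : antidiagonal m, ∑ y : antidiagonal x.1.1, F y.1.1 y.1.2 x.1.2 (by
        have := mem_antidiagonal.1 x.2; have := mem_antidiagonal.1 y.2; omega) =
      ∑ x : antidiagonal m, ∑ y : antidiagonal x.1.2, F x.1.1 y.1.1 y.1.2 (by
        have := mem_antidiagonal.1 x.2; have := mem_antidiagonal.1 y.2; omega) := by
  rw [← Fintype.sum_sigma', ← Fintype.sum_sigma']
  refine sum_bij'
    (fun x _ => ⟨⟨(x.2.1.1, x.2.1.2 + x.1.1.2), ?_⟩, ⟨(x.2.1.2, x.1.1.2), ?_⟩⟩)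
    (fun x _ => ⟨⟨(x.1.1.1 + x.2.1.1, x.2.1.2), ?_⟩, ⟨(x.1.1.1, x.2.1.1), ?_⟩⟩)
    (fun _ _ => mem_univ _) (fun _ _ => mem_univ _) ?_ ?_ (fun _ _ => rfl)
  · have := mem_antidiagonal.1 x.1.2; have := mem_antidiagonal.1 x.2.2
    rw [HasAntidiagonal.mem_antidiagonal]; dsimp; omega
  · rw [HasAntidiagonal.mem_antidiagonal]
  · have := mem_antidiagonal.1 x.1.2; have := mem_antidiagonal.1 x.2.2
    rw [HasAntidiagonal.mem_antidiagonal]; dsimp; omega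
  · rw [HasAntidiagonal.mem_antidiagonal]
  · rintro ⟨⟨⟨p, r⟩, h⟩, ⟨⟨i, j⟩, h'⟩⟩ _
    have e : i + j = p := by simpa using h'
    subst e
    rfl
  · rintro ⟨⟨⟨p, r⟩, h⟩, ⟨⟨i, j⟩, h'⟩⟩ _
    have e : i + j = r := by simpa using h'
    subst e
    rfl

theorem sum_fin_split (m : ℕ) (F : ∀ p r : ℕ, p + r = m → Fin m → M) :
    ∑ k : Fin m, ∑ x : antidiagonal m, F x.1.1 x.1.2 (mem_antidiagonal.1 x.2) k =
      (∑ x : antidiagonal m, ∑ k : Fin x.1.1, F x.1.1 x.1.2 (mem_antidiagonal.1 x.2) ⟨k, by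
        have := mem_antidiagonal.1 x.2; omega⟩) +
      ∑ x : antidiagonal m, ∑ k : Fin x.1.2, F x.1.1 x.1.2 (mem_antidiagonal.1 x.2) ⟨x.1.1 + k, by
        have := mem_antidiagonal.1 x.2; omega⟩ := by
  rw [sum_comm, ← sum_add_distrib]
  refine sum_congr rfl ?_
  rintro ⟨⟨p, r⟩, h⟩ _
  obtain rfl : p + r = m := mem_antidiagonal.1 h
  exact Fin.sum_univ_add _

theorem sum_fin_cancel (p : ℕ) (F : Fin (p + 1) → Fin p → M)
    (hF : ∀ (k : Fin (p + 1)) (l : Fin p) (h : (k : ℕ) ≤ l),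
      F k l + F l.succ ⟨k, by omega⟩ = 0) :
    ∑ k, ∑ l, F k l = 0 := by
  rw [← Fintype.sum_prod_type' (f := F)]
  have key : ∀ (k : Fin (p + 1)) (l : Fin p) (h : (l : ℕ) < k),
      F ⟨l, by omega⟩ ⟨k - 1, by omega⟩ + F k l = 0 := by
    intro k l h
    have := hF ⟨l, by omega⟩ ⟨k - 1, by omega⟩ (by dsimp; omega)
    convert this using 3
    ext; simp; omega
  refine sum_involution (fun x _ => if h : (x.1 : ℕ) ≤ x.2 then (x.2.succ, ⟨x.1, by omega⟩)
    else (⟨x.2, by omega⟩, ⟨x.1 - 1, by omega⟩)) ?_ ?_ (fun _ _ => mem_univ _) ?_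
  · rintro ⟨k, l⟩ _
    dsimp only
    split_ifs with h
    · exact hF k l h
    · rw [add_comm]; exact key k l (by omega)
  · rintro ⟨k, l⟩ _ _ h
    dsimp only at h
    split_ifs at h with h'
    · simp only [Prod.mk.injEq, Fin.ext_iff, Fin.val_succ] at h
      omega
    · simp only [Prod.mk.injEq, Fin.ext_iff] at h
      omega
  · rintro ⟨k, l⟩ _
    dsimp only
    by_cases h : (k : ℕ) ≤ l
    · simp only [h, dif_pos]
      rw [dif_neg (by simp; omega)]
      simp
    · simp only [h, dif_neg, not_false_eq_true]
      rw [dif_pos (by omega)]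
      simp only [Prod.mk.injEq, Fin.ext_iff, Fin.val_succ, and_true]
      omega

end sums

section Cech

open Finset

variable {X : Type v} [TopologicalSpace X] {𝒜 : DGAlgPresheaf.{u} X} {ι : Type w}
  {U : ι → TopologicalSpace.Opens X}

/-- The Čech cochains of total degree `n` with values in the morphisms from the family `E` to the
family `F`: the component `u^{p,n-p}_{i₀ … i_p}` is a morphism of degree `n - p` from `E_{i_p}` to
`F_{i₀}` on `U_{i₀ … i_p}`. -/
def CechHom (E F : CohesiveFamily 𝒜 U) (n : ℤ) : Type (max u w) :=
  ∀ (p : ℕ) (a b : ι) (s : Simplex ι p a b),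
    LHom E F (supp U s) (supp_le_last s) (supp_le_first s) (n - p)

namespace CechHom

variable {E F G H : CohesiveFamily 𝒜 U}

noncomputable instance (n : ℤ) : AddCommGroup (CechHom E F n) :=
  inferInstanceAs (AddCommGroup (∀ (p : ℕ) (a b : ι) (s : Simplex ι p a b),
    LHom E F (supp U s) (supp_le_last s) (supp_le_first s) (n - p)))

noncomputable instance (n : ℤ) : Module ℂ (CechHom E F n) :=
  inferInstanceAs (Module ℂ (∀ (p : ℕ) (a b : ι) (s : Simplex ι p a b),
    LHom E F (supp U s) (supp_le_last s) (supp_le_first s) (n - p)))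

theorem ext {n : ℤ} {u v : CechHom E F n}
    (h : ∀ (p : ℕ) (a b : ι) (s : Simplex ι p a b), u p a b s = v p a b s) : u = v :=
  funext fun p => funext fun a => funext fun b => funext fun s => h p a b s

theorem add_apply {n : ℤ} (u v : CechHom E F n) (p : ℕ) (a b : ι) (s : Simplex ι p a b) :
    (u + v) p a b s = u p a b s + v p a b s := rfl

theorem smul_apply {n : ℤ} (c : ℂ) (u : CechHom E F n) (p : ℕ) (a b : ι) (s : Simplex ι p a b) :
    (c • u) p a b s = c • u p a b s := rfl

theorem zsmul_apply {n : ℤ} (c : ℤ) (u : CechHom E F n) (p : ℕ) (a b : ι) (s : Simplex ι p a b) :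
    (c • u) p a b s = c • u p a b s := rfl

theorem zero_apply {n : ℤ} (p : ℕ) (a b : ι) (s : Simplex ι p a b) :
    (0 : CechHom E F n) p a b s = 0 := rfl

/-- The composition of `u` on the simplex `s₁` with `v` on the simplex `s₂`, restricted to `V`. -/
noncomputable def cup {n₁ n₂ : ℤ} (u : CechHom F G n₁) (v : CechHom E F n₂) {p r : ℕ} {a b c : ι}
    (s₁ : Simplex ι p a c) (s₂ : Simplex ι r c b) {V : TopologicalSpace.Opens X}
    (h₁ : V ≤ supp U s₁) (h₂ : V ≤ supp U s₂) {k : ℤ} (hk : n₁ - p + (n₂ - r) = k) :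
    LHom E G V (h₂.trans (supp_le_last s₂)) (h₁.trans (supp_le_first s₁)) k :=
  LHom.comp hk (LHom.rs h₁ (u p a c s₁)) (LHom.rs h₂ (v r c b s₂))

theorem rs_congr {n : ℤ} (u : CechHom E F n) {p : ℕ} {a b : ι} {s s' : Simplex ι p a b}
    (h : s.1 = s'.1) {V : TopologicalSpace.Opens X} (hV : V ≤ supp U s) (hV' : V ≤ supp U s') :
    LHom.rs hV (u p a b s) = LHom.rs hV' (u p a b s') := by
  obtain rfl : s = s' := Subtype.ext h
  rfl

theorem cup_congr {n₁ n₂ : ℤ} (u : CechHom F G n₁) (v : CechHom E F n₂) {p r : ℕ} {a b c c' : ι}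
    {s₁ : Simplex ι p a c} {s₂ : Simplex ι r c b} {s₁' : Simplex ι p a c'} {s₂' : Simplex ι r c' b}
    (hc : c = c') (e₁ : s₁.1 = s₁'.1) (e₂ : s₂.1 = s₂'.1)
    {V : TopologicalSpace.Opens X} (h₁ : V ≤ supp U s₁) (h₂ : V ≤ supp U s₂)
    (h₁' : V ≤ supp U s₁') (h₂' : V ≤ supp U s₂') {k : ℤ} (hk : n₁ - p + (n₂ - r) = k) :
    cup u v s₁ s₂ h₁ h₂ hk = cup u v s₁' s₂' h₁' h₂' hk := by
  subst hc
  obtain rfl : s₁ = s₁' := Subtype.ext e₁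
  obtain rfl : s₂ = s₂' := Subtype.ext e₂
  rfl

theorem cup_cast {n₁ n₂ : ℤ} (u : CechHom F G n₁) (v : CechHom E F n₂) {p r : ℕ} {a b c : ι}
    (s₁ : Simplex ι p a c) (s₂ : Simplex ι r c b) {V : TopologicalSpace.Opens X}
    (h₁ : V ≤ supp U s₁) (h₂ : V ≤ supp U s₂) {k k' : ℤ} (hk : n₁ - p + (n₂ - r) = k)
    (e : k = k') : LHom.cast e (cup u v s₁ s₂ h₁ h₂ hk) = cup u v s₁ s₂ h₁ h₂ (hk.trans e) := by
  subst e; rfl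

theorem cup_rs {n₁ n₂ : ℤ} (u : CechHom F G n₁) (v : CechHom E F n₂) {p r : ℕ} {a b c : ι}
    (s₁ : Simplex ι p a c) (s₂ : Simplex ι r c b) {V V' : TopologicalSpace.Opens X}
    (h₁ : V ≤ supp U s₁) (h₂ : V ≤ supp U s₂) {k : ℤ} (hk : n₁ - p + (n₂ - r) = k)
    (hV : V' ≤ V) : LHom.rs hV (cup u v s₁ s₂ h₁ h₂ hk) =
      cup u v s₁ s₂ (hV.trans h₁) (hV.trans h₂) hk := by
  unfold cup
  rw [LHom.rs_comp, LHom.rs_rs, LHom.rs_rs]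

theorem deg_add {n₁ n₂ n : ℤ} (h : n₁ + n₂ = n) {m : ℕ} (x : antidiagonal m) :
    n₁ - x.1.1 + (n₂ - x.1.2) = n - m := by
  have := mem_antidiagonal.1 x.2
  omega

/-- The product of cochains,
`(u · v)_{i₀ … i_m} = ∑_{p + r = m} (-1)^{q r} u_{i₀ … i_p} ∘ v_{i_p … i_m}`,
where `q = n₁ - p` is the degree of the morphism `u_{i₀ … i_p}`. -/
noncomputable def mul {n₁ n₂ n : ℤ} (h : n₁ + n₂ = n) (u : CechHom F G n₁) (v : CechHom E F n₂) :
    CechHom E G n := fun m _ _ s =>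
  ∑ x : antidiagonal m, ((n₁ - x.1.1) * x.1.2).negOnePow •
    cup u v (s.front x.1.1 x.1.2 (mem_antidiagonal.1 x.2))
      (s.back x.1.1 x.1.2 (mem_antidiagonal.1 x.2)) (supp_le_front s _ _ _) (supp_le_back s _ _ _)
      (deg_add h x)

theorem mul_apply {n₁ n₂ n : ℤ} (h : n₁ + n₂ = n) (u : CechHom F G n₁) (v : CechHom E F n₂)
    (m : ℕ) (a b : ι) (s : Simplex ι m a b) : mul h u v m a b s =
  ∑ x : antidiagonal m, ((n₁ - x.1.1) * x.1.2).negOnePow •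
    cup u v (s.front x.1.1 x.1.2 (mem_antidiagonal.1 x.2))
      (s.back x.1.1 x.1.2 (mem_antidiagonal.1 x.2)) (supp_le_front s _ _ _) (supp_le_back s _ _ _)
      (deg_add h x) := rfl

/-- The product of cochains as a bilinear map. -/
noncomputable def comp {n₁ n₂ n : ℤ} (h : n₁ + n₂ = n) :
    CechHom F G n₁ →ₗ[ℂ] CechHom E F n₂ →ₗ[ℂ] CechHom E G n :=
  LinearMap.mk₂ ℂ (mul h)
    (fun u u' v => ext fun m a b s => by
      simp only [mul_apply, add_apply, cup, map_add, LinearMap.add_apply, smul_add,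
        sum_add_distrib])
    (fun c u v => ext fun m a b s => by
      simp only [mul_apply, smul_apply, cup, map_smul, LinearMap.smul_apply, smul_sum]
      exact sum_congr rfl fun x _ => smul_comm _ _ _)
    (fun u v v' => ext fun m a b s => by
      simp only [mul_apply, add_apply, cup, map_add, LinearMap.add_apply, smul_add,
        sum_add_distrib])
    (fun c u v => ext fun m a b s => by
      simp only [mul_apply, smul_apply, cup, map_smul, LinearMap.smul_apply, smul_sum]
      exact sum_congr rfl fun x _ => smul_comm _ _ _)

theorem comp_apply {n₁ n₂ n : ℤ} (h : n₁ + n₂ = n) (u : CechHom F G n₁) (v : CechHom E F n₂) :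
    comp h u v = mul h u v := rfl

/-- The Čech differential
`(δu)_{i₀ … i_{p+1}} = ∑_{k=1}^{p} (-1)^k u_{i₀ … î_k … i_{p+1}}`. -/
noncomputable def delta {n m : ℤ} (h : n + 1 = m) (u : CechHom E F n) : CechHom E F m
  | 0, _, _, _ => 0
  | p + 1, a, b, s => ∑ k : Fin p, ((k : ℤ) + 1).negOnePow •
      LHom.cast (by push_cast; omega) (LHom.rs (supp_le_face s k) (u p a b (s.face k)))

/-- The differential of the morphisms, with the sign `(-1)^p`. -/
noncomputable def dInt {n m : ℤ} (h : n + 1 = m) (u : CechHom E F n) : CechHom E F m :=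
  fun p a b s => (p : ℤ).negOnePow • LHom.d (by omega) (u p a b s)

/-- The total differential. -/
noncomputable def d {n m : ℤ} (h : n + 1 = m) : CechHom E F n →ₗ[ℂ] CechHom E F m where
  toFun u := dInt h u + delta h u
  map_add' u v := ext fun p a b s => by
    cases p with
    | zero => simp [add_apply, dInt, delta]
    | succ p =>
      simp only [add_apply, dInt, delta, map_add, smul_add, sum_add_distrib]
      abel
  map_smul' c u := ext fun p a b s => by
    cases p with
    | zero =>
      simp only [add_apply, smul_apply, dInt, delta, map_smul, RingHom.id_apply, smul_add]
      rw [smul_comm, smul_zero]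
    | succ p =>
      simp only [add_apply, smul_apply, dInt, delta, map_smul, RingHom.id_apply, smul_add, smul_sum]
      rw [smul_comm]
      refine congrArg₂ _ rfl (sum_congr rfl fun x _ => smul_comm _ _ _)

theorem d_apply {n m : ℤ} (h : n + 1 = m) (u : CechHom E F n) : d h u = dInt h u + delta h u := rfl

/-- The identity cochain. -/
noncomputable def id (E : CohesiveFamily 𝒜 U) : CechHom E E 0
  | 0, _, _, s => LHom.cast (by simp) (LHom.eqId E (supp_le_last s) (supp_le_first s)
      (s.2.2.symm.trans s.2.1))
  | _ + 1, _, _, _ => 0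

end CechHom

end Cech

section Cech

open Finset

variable {X : Type v} [TopologicalSpace X] {𝒜 : DGAlgPresheaf.{u} X} {ι : Type w}
  {U : ι → TopologicalSpace.Opens X}

namespace CechHom

variable {E F G H : CohesiveFamily 𝒜 U}

theorem comp_left_deg {V : TopologicalSpace.Opens X} {i₁ i₂ i₃ i₄ : ι} {h₁ : V ≤ U i₁}
    {h₂ : V ≤ U i₂} {h₃ : V ≤ U i₃} {h₄ : V ≤ U i₄} {a b c ab q : ℤ} (hab : a + b = ab)
    (hq : ab + c = q) (x : LHom G H V h₃ h₄ a) (y : LHom F G V h₂ h₃ b) (z : LHom E F V h₁ h₂ c) :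
    LHom.comp hq (LHom.comp hab x y) z =
      LHom.comp (hab ▸ hq : a + b + c = q) (LHom.comp rfl x y) z := by
  subst hab; rfl

theorem comp_right_deg {V : TopologicalSpace.Opens X} {i₁ i₂ i₃ i₄ : ι} {h₁ : V ≤ U i₁}
    {h₂ : V ≤ U i₂} {h₃ : V ≤ U i₃} {h₄ : V ≤ U i₄} {a b c bc q : ℤ} (hbc : b + c = bc)
    (hq : a + bc = q) (x : LHom G H V h₃ h₄ a) (y : LHom F G V h₂ h₃ b) (z : LHom E F V h₁ h₂ c) :
    LHom.comp hq x (LHom.comp hbc y z) =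
      LHom.comp (by omega : a + b + c = q) (LHom.comp rfl x y) z := by
  subst hbc hq; rfl

theorem assoc {l m n lm mn k : ℤ} (hlm : l + m = lm) (hmn : m + n = mn)
    (h₁ : lm + n = k) (h₂ : l + mn = k) (f : CechHom G H l) (g : CechHom F G m)
    (e : CechHom E F n) : comp h₁ (comp hlm f g) e = comp h₂ f (comp hmn g e) := by
  refine ext fun q a b s => ?_
  let T : ∀ i j r : ℕ, i + j + r = q →
      LHom E H (supp U s) (supp_le_last s) (supp_le_first s) (k - q) := fun i j r hq =>
    ((l + m - (i + j)) * r + (l - i) * j).negOnePow •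
    LHom.comp (m := l - i + (m - j)) (n := n - r) (by omega)
      (LHom.comp rfl (LHom.rs (supp_le_front s i (j + r) (by omega)) (f _ _ _ (s.front i (j + r) (by omega))))
        (LHom.rs ((supp_le_front s (i + j) r hq).trans (supp_le_back _ i j rfl))
          (g _ _ _ ((s.front (i + j) r hq).back i j rfl))))
      (LHom.rs (supp_le_back s (i + j) r hq) (e _ _ _ (s.back (i + j) r hq)))
  refine Eq.trans ?_ ((sum_antidiag_assoc q T).trans ?_)
  · rw [comp_apply, mul_apply]
    refine sum_congr rfl ?_
    rintro ⟨⟨p, r⟩, hx⟩ -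
    simp only [cup, comp_apply, mul_apply, map_sum, LinearMap.sum_apply, smul_sum]
    refine sum_congr rfl ?_
    rintro ⟨⟨i, j⟩, hy⟩ -
    have e : i + j = p := by simpa using hy
    subst e
    simp only [Units.smul_def, map_zsmul, LinearMap.smul_apply, LHom.rs_comp, LHom.rs_rs, T,
      smul_smul, ← Units.val_mul, ← Int.negOnePow_add]
    refine congrArg₂ _ (congrArg (fun z : ℤ => (z.negOnePow : ℤ)) ?_) (comp_left_deg _ _ _ _ _)
    subst hlm
    push_cast
    ring
  · rw [comp_apply, mul_apply]
    refine sum_congr rfl ?_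
    rintro ⟨⟨i, q'⟩, hx⟩ -
    simp only [cup, comp_apply, mul_apply, map_sum, smul_sum]
    refine sum_congr rfl ?_
    rintro ⟨⟨j, r⟩, hy⟩ -
    have e : j + r = q' := by simpa using hy
    subst e
    simp only [Units.smul_def, map_zsmul, LHom.rs_comp, LHom.rs_rs, T,
      smul_smul, ← Units.val_mul, ← Int.negOnePow_add]
    rw [comp_right_deg]
    refine congrArg₂ _ ?_ (congrArg _ (rs_congr e ?_ _ _))
    swap
    · exact funext fun k => congrArg s.1 (Fin.ext (add_assoc i j k))
    refine congrArg (fun z : ℤ => (z.negOnePow : ℤ)) ?_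
    push_cast
    ring

end CechHom

end Cech

section Cech

open Finset

variable {X : Type v} [TopologicalSpace X] {𝒜 : DGAlgPresheaf.{u} X} {ι : Type w}
  {U : ι → TopologicalSpace.Opens X}

namespace CechHom

variable {E F G H : CohesiveFamily 𝒜 U}

theorem id_zero (p : ℕ) (hp : p ≠ 0) (a b : ι) (s : Simplex ι p a b) : id E p a b s = 0 := by
  cases p with
  | zero => exact absurd rfl hp
  | succ p => rfl

theorem cup_id_left {n : ℤ} (v : CechHom E F n) {p r : ℕ} (hp : p = 0) {a b c : ι} (hc : c = a)
    (s₁ : Simplex ι p a c) (s₂ : Simplex ι r c b) (s : Simplex ι r a b) (hs : s₂.1 = s.1)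
    {V : TopologicalSpace.Opens X} (h₁ : V ≤ supp U s₁) (h₂ : V ≤ supp U s₂) (h : V ≤ supp U s)
    {k : ℤ} (hk : 0 - (p : ℤ) + (n - r) = k) :
    cup (id F) v s₁ s₂ h₁ h₂ hk = LHom.cast (by omega) (LHom.rs h (v r a b s)) := by
  subst hp hc
  obtain rfl : s₂ = s := Subtype.ext hs
  change LHom.comp hk (LHom.rs h₁ (LHom.cast _ (LHom.eqId F _ _ _))) _ = _
  rw [LHom.rs_cast, LHom.comp_cast_left, LHom.rs_eqId, LHom.eqId_comp]

theorem cup_id_right {n : ℤ} (u : CechHom E F n) {p r : ℕ} (hr : r = 0) {a b c : ι} (hc : c = b)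
    (s₁ : Simplex ι p a c) (s₂ : Simplex ι r c b) (s : Simplex ι p a b) (hs : s₁.1 = s.1)
    {V : TopologicalSpace.Opens X} (h₁ : V ≤ supp U s₁) (h₂ : V ≤ supp U s₂) (h : V ≤ supp U s)
    {k : ℤ} (hk : n - p + (0 - (r : ℤ)) = k) :
    cup u (id E) s₁ s₂ h₁ h₂ hk = LHom.cast (by omega) (LHom.rs h (u p a b s)) := by
  subst hr hc
  obtain rfl : s₁ = s := Subtype.ext hs
  change LHom.comp hk _ (LHom.rs h₂ (LHom.cast _ (LHom.eqId E _ _ _))) = _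
  rw [LHom.rs_cast, LHom.comp_cast_right, LHom.rs_eqId, LHom.comp_eqId]

theorem id_comp {n : ℤ} (h : 0 + n = n) (f : CechHom E F n) : comp h (id F) f = f := by
  refine ext fun m a b s => ?_
  rw [comp_apply, mul_apply, sum_eq_single ⟨(0, m), by simp⟩]
  · refine (congrArg _ (cup_id_left (p := 0) (r := m) f rfl s.2.1 (s.front 0 m (zero_add m))
      (s.back 0 m (zero_add m)) s ?_ _ _ le_rfl _)).trans ?_
    swap
    · simp only [LHom.rs_self, LHom.cast_rfl]
      simp
    · exact funext fun k => congrArg s.1 (Fin.ext (zero_add k.1))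
  · rintro ⟨⟨p, r⟩, hx⟩ - hne
    have hp : p ≠ 0 := by
      rintro rfl
      refine hne (Subtype.ext (Prod.ext rfl ?_))
      simpa using hx
    simp only [cup, id_zero p hp, map_zero, LinearMap.zero_apply, smul_zero]
  · exact fun h => absurd (mem_univ _) h

theorem comp_id {n : ℤ} (h : n + 0 = n) (f : CechHom E F n) : comp h f (id E) = f := by
  refine ext fun m a b s => ?_
  rw [comp_apply, mul_apply, sum_eq_single ⟨(m, 0), by simp⟩]
  · rw [cup_id_right f rfl s.2.2 _ _ s _ _ _ le_rfl]
    · simp only [LHom.rs_self, LHom.cast_rfl]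
      simp
    · rfl
  · rintro ⟨⟨p, r⟩, hx⟩ - hne
    have hp : r ≠ 0 := by
      rintro rfl
      refine hne (Subtype.ext (Prod.ext ?_ rfl))
      simpa using hx
    simp only [cup, id_zero r hp, map_zero, smul_zero]
  · exact fun h => absurd (mem_univ _) h

theorem d_id {m : ℤ} (h : 0 + 1 = m) : d h (id E) = 0 := by
  refine ext fun p a b s => ?_
  rw [d_apply, add_apply, zero_apply]
  match p, s with
  | 0, s =>
    simp only [dInt, delta, id, LHom.d_cast, LHom.d_eqId, smul_zero, add_zero]
  | 1, s =>
    simp only [dInt, delta, id, map_zero, smul_zero, zero_add]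
    rfl
  | p + 2, s =>
    simp only [dInt, delta, id, map_zero, smul_zero, zero_add, sum_const_zero]

theorem dInt_dInt {l m n : ℤ} (h₁ : l + 1 = m) (h₂ : m + 1 = n) (f : CechHom E F l) :
    dInt h₂ (dInt h₁ f) = 0 := by
  refine ext fun p a b s => ?_
  simp only [dInt, Units.smul_def, map_zsmul, LHom.d_d, smul_zero]
  rfl

theorem delta_zero {l m : ℤ} (h₁ : l + 1 = m) (f : CechHom E F l) (a b : ι)
    (s : Simplex ι 0 a b) : delta h₁ f 0 a b s = 0 := rfl

theorem delta_succ {l m : ℤ} (h₁ : l + 1 = m) (f : CechHom E F l) (p : ℕ) (a b : ι)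
    (s : Simplex ι (p + 1) a b) : delta h₁ f (p + 1) a b s = ∑ k : Fin p, ((k : ℤ) + 1).negOnePow •
      LHom.cast (by push_cast; omega) (LHom.rs (supp_le_face s k) (f p a b (s.face k))) := rfl

theorem delta_dInt {l m n : ℤ} (h₁ : l + 1 = m) (h₂ : m + 1 = n) (f : CechHom E F l) :
    delta h₂ (dInt h₁ f) + dInt h₂ (delta h₁ f) = 0 := by
  refine ext fun p a b s => ?_
  rw [add_apply, zero_apply]
  cases p with
  | zero => simp only [dInt, delta_zero, map_zero, smul_zero, add_zero]
  | succ p =>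
    simp only [dInt, delta_succ, map_sum, Units.smul_def, map_zsmul, smul_sum, ← sum_add_distrib]
    refine sum_eq_zero fun k _ => ?_
    rw [LHom.rs_d, LHom.cast_d, LHom.d_cast]
    simp only [smul_smul, Nat.cast_succ, Int.negOnePow_succ, Units.val_neg, ← add_smul]
    convert zero_smul ℤ _
    ring

theorem face_face {p : ℕ} {a b : ι} (s : Simplex ι (p + 2) a b) (k : Fin (p + 1)) (l : Fin p)
    (h : (k : ℕ) ≤ l) :
    ((s.face k).face l).1 = ((s.face l.succ).face ⟨k, by omega⟩).1 := by
  funext j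
  simp only [Simplex.face_apply, Fin.val_succ]
  split_ifs <;> first | rfl | omega

theorem delta_delta {l m n : ℤ} (h₁ : l + 1 = m) (h₂ : m + 1 = n) (f : CechHom E F l) :
    delta h₂ (delta h₁ f) = 0 := by
  refine ext fun p a b s => ?_
  rw [zero_apply]
  match p, s with
  | 0, s => rfl
  | 1, s => rfl
  | p + 2, s =>
    simp only [delta_succ, map_sum, Units.smul_def, map_zsmul, smul_sum, LHom.rs_cast,
      LHom.cast_cast, LHom.rs_rs, smul_smul]
    refine sum_fin_cancel p _ fun k l h => ?_
    dsimp only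
    rw [rs_congr f (face_face s k l h) _
      ((supp_le_face s l.succ).trans (supp_le_face (s.face l.succ) ⟨k, by omega⟩)), ← add_smul]
    convert zero_smul ℤ _
    simp only [Fin.val_succ, Nat.cast_succ, Int.negOnePow_succ, Units.val_neg]
    ring

theorem d_d {l m n : ℤ} (h₁ : l + 1 = m) (h₂ : m + 1 = n) (f : CechHom E F l) :
    d h₂ (d h₁ f) = 0 := by
  have e1 := delta_dInt h₁ h₂ f
  have e2 := delta_delta h₁ h₂ f
  have e3 := dInt_dInt h₁ h₂ f
  have e4 : ∀ u v : CechHom E F m, dInt h₂ (u + v) = dInt h₂ u + dInt h₂ v := fun u v =>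
    ext fun p a b s => by simp only [add_apply, dInt, map_add, smul_add]
  have e5 : delta h₂ (dInt h₁ f + delta h₁ f) =
      delta h₂ (dInt h₁ f) + delta h₂ (delta h₁ f) := ext fun p a b s => by
    cases p with
    | zero => simp only [add_apply, delta_zero, add_zero]
    | succ p => simp only [add_apply, delta_succ, map_add, smul_add, sum_add_distrib]
  rw [d_apply, d_apply, e4, e5, e2, e3, zero_add, add_zero, add_comm, e1]

end CechHom

end Cech

section Cech

open Finset

variable {X : Type v} [TopologicalSpace X] {𝒜 : DGAlgPresheaf.{u} X} {ι : Type w}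
  {U : ι → TopologicalSpace.Opens X}

namespace CechHom

variable {E F G H : CohesiveFamily 𝒜 U}

theorem dInt_apply {n m : ℤ} (h : n + 1 = m) (u : CechHom E F n) (p : ℕ) (a b : ι)
    (s : Simplex ι p a b) :
    dInt h u p a b s = (p : ℤ).negOnePow • LHom.d (by omega) (u p a b s) := rfl

theorem dInt_mul {m n k m' n' k' : ℤ} (h : m + n = k) (hm : m + 1 = m')
    (hn : n + 1 = n') (hk : k + 1 = k') (h₁ : m' + n = k') (h₂ : m + n' = k')
    (g : CechHom F G m) (f : CechHom E F n) :
    dInt hk (mul h g f) = mul h₁ (dInt hm g) f + (m.negOnePow : ℤ) • mul h₂ g (dInt hn f) := by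
  refine ext fun q a b s => ?_
  rw [add_apply, zsmul_apply, mul_apply, mul_apply]
  simp only [dInt_apply, mul_apply, map_sum, smul_sum, ← sum_add_distrib]
  refine sum_congr rfl ?_
  rintro ⟨⟨p, r⟩, hx⟩ -
  have e : p + r = q := by simpa using hx
  subst e hm
  simp only [cup, dInt_apply, Units.smul_def, map_zsmul, LinearMap.smul_apply]
  rw [LHom.d_comp (m' := m + 1 - p) (n' := n' - r) _ (by omega) (by omega) _ (by omega) (by omega),
    LHom.rs_d, LHom.rs_d]
  simp only [Units.smul_def, smul_add, smul_smul, ← Units.val_mul, ← Int.negOnePow_add]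
  congr 2
  · refine congrArg (fun z : ℤ => (z.negOnePow : ℤ)) ?_
    push_cast
    ring
  · refine congrArg (fun z : ℤ => (z.negOnePow : ℤ)) ?_
    push_cast
    ring

theorem face_front_lt {q p r : ℕ} (h : p + r = q) {a b : ι} (s : Simplex ι (q + 1) a b)
    (k : Fin p) : ((s.face ⟨k, by omega⟩).front p r h).1 =
      ((s.front (p + 1) r (by omega)).face k).1 := by
  funext j
  change (s.face ⟨k, _⟩).1 ⟨j, _⟩ = _
  rw [Simplex.face_apply, Simplex.face_apply]
  rfl

theorem face_back_lt {q p r : ℕ} (h : p + r = q) {a b : ι} (s : Simplex ι (q + 1) a b)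
    (k : Fin p) : ((s.face ⟨k, by omega⟩).back p r h).1 = (s.back (p + 1) r (by omega)).1 := by
  funext j
  change (s.face ⟨k, _⟩).1 ⟨p + j, _⟩ = _
  rw [Simplex.face_apply, dif_neg (by dsimp; omega)]
  refine congrArg s.1 (Fin.ext ?_)
  dsimp
  omega

theorem face_front_ge {q p r : ℕ} (h : p + r = q) {a b : ι} (s : Simplex ι (q + 1) a b)
    (k : Fin r) : ((s.face ⟨p + k, by omega⟩).front p r h).1 =
      (s.front p (r + 1) (by omega)).1 := by
  funext j
  change (s.face ⟨p + k, _⟩).1 ⟨j, _⟩ = _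
  rw [Simplex.face_apply, dif_pos (by dsimp; omega)]
  rfl

theorem face_back_ge {q p r : ℕ} (h : p + r = q) {a b : ι} (s : Simplex ι (q + 1) a b)
    (k : Fin r) : ((s.face ⟨p + k, by omega⟩).back p r h).1 =
      ((s.back p (r + 1) (by omega)).face k).1 := by
  funext j
  change (s.face ⟨p + k, _⟩).1 ⟨p + j, _⟩ = _
  rw [Simplex.face_apply, Simplex.face_apply]
  dsimp only
  by_cases h : (j : ℕ) ≤ k
  · rw [dif_pos (by omega), dif_pos h]; rfl
  · rw [dif_neg (by omega), dif_neg h]; rfl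

theorem delta_mul {m n k m' n' k' : ℤ} (h : m + n = k) (hm : m + 1 = m')
    (hn : n + 1 = n') (hk : k + 1 = k') (h₁ : m' + n = k') (h₂ : m + n' = k')
    (g : CechHom F G m) (f : CechHom E F n) :
    delta hk (mul h g f) = mul h₁ (delta hm g) f + (m.negOnePow : ℤ) • mul h₂ g (delta hn f) := by
  refine ext fun q a b s => ?_
  rw [add_apply, zsmul_apply, mul_apply, mul_apply]
  cases q with
  | zero =>
    rw [delta_zero, sum_eq_zero, sum_eq_zero, smul_zero, add_zero]
    · rintro ⟨⟨p, r⟩, hx⟩ -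
      obtain rfl : r = 0 := by have : p + r = 0 := by simpa using hx
                               omega
      simp only [cup, delta_zero, map_zero, smul_zero]
    · rintro ⟨⟨p, r⟩, hx⟩ -
      obtain rfl : p = 0 := by have : p + r = 0 := by simpa using hx
                               omega
      simp only [cup, delta_zero, map_zero, LinearMap.zero_apply, smul_zero]
  | succ q =>
    have hd : ∀ {p r : ℕ}, p + r = q → m - p + (n - r) = k' - (q + 1 : ℕ) := by
      intro p r hq
      push_cast
      omega
    rw [delta_succ]
    simp only [mul_apply, map_sum, smul_sum, Units.smul_def, map_zsmul, cup_rs, cup_cast]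
    refine (sum_fin_split (M := LHom E G (supp U s) (supp_le_last s) (supp_le_first s) (k' - (q + 1 : ℕ)))
      q (fun p r hq k => ((((k : ℤ) + 1).negOnePow : ℤˣ) : ℤ) •
      (((m - p) * r).negOnePow : ℤ) •
        (cup g f ((s.face k).front p r hq) ((s.face k).back p r hq)
          ((supp_le_face s k).trans (supp_le_front _ _ _ _))
          ((supp_le_face s k).trans (supp_le_back _ _ _ _)) (hd hq)))).trans ?_
    refine congrArg₂ _ ?_ ?_
    · refine Eq.trans ?_ (sum_antidiag_succ
        (M := LHom E G (supp U s) (supp_le_last s) (supp_le_first s) (k' - (q + 1 : ℕ))) q (fun p r hq => (((m' - p) * r).negOnePow : ℤ) •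
        cup (delta hm g) f (s.front p r hq) (s.back p r hq) (supp_le_front _ _ _ _)
          (supp_le_back _ _ _ _) (by omega))).symm
      simp only [cup, delta_zero, map_zero, LinearMap.zero_apply, smul_zero, zero_add]
      refine sum_congr rfl ?_
      rintro ⟨⟨p, r⟩, hx⟩ -
      simp only [delta_succ, map_sum, LinearMap.sum_apply, smul_sum]
      refine sum_congr rfl fun x _ => ?_
      have e : p + r = q := by simpa using hx
      simp only [Units.smul_def, map_zsmul, LinearMap.smul_apply, LHom.rs_cast, LHom.rs_rs,
        LHom.comp_cast_left, smul_smul]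
      refine congrArg₂ _ ?_ (cup_congr g f ?_ (face_front_lt e s x) (face_back_lt e s x) _ _
        ((supp_le_front s (p + 1) r (by omega)).trans (supp_le_face _ x))
        (supp_le_back s (p + 1) r (by omega)) (hd e))
      · simp only [← Units.val_mul, ← Int.negOnePow_add]
        subst hm
        refine congrArg (fun z : ℤ => (z.negOnePow : ℤ)) ?_
        push_cast
        ring
      · rw [Simplex.face_apply, dif_neg (by dsimp; omega)]
    · rw [← smul_sum]
      refine Eq.trans ?_ (congrArg _ (sum_antidiag_succ'
        (M := LHom E G (supp U s) (supp_le_last s) (supp_le_first s) (k' - (q + 1 : ℕ))) q (fun p r hq => (((m - p) * r).negOnePow : ℤ) •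
        cup g (delta hn f) (s.front p r hq) (s.back p r hq) (supp_le_front _ _ _ _)
          (supp_le_back _ _ _ _) (by omega))).symm)
      simp only [cup, delta_zero, map_zero, smul_zero, zero_add, smul_sum]
      refine sum_congr rfl ?_
      rintro ⟨⟨p, r⟩, hx⟩ -
      simp only [delta_succ, map_sum, smul_sum]
      refine sum_congr rfl fun x _ => ?_
      have e : p + r = q := by simpa using hx
      simp only [Units.smul_def, map_zsmul, LHom.rs_cast, LHom.rs_rs,
        LHom.comp_cast_right, smul_smul]
      refine congrArg₂ _ ?_ (cup_congr g f ?_ (face_front_ge e s x) (face_back_ge e s x) _ _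
        (supp_le_front s p (r + 1) (by omega))
        ((supp_le_back s p (r + 1) (by omega)).trans (supp_le_face _ x)) (hd e))
      · simp only [← Units.val_mul, ← Int.negOnePow_add]
        refine congrArg _ ((Int.negOnePow_eq_iff _ _).2 ⟨p - m, ?_⟩)
        push_cast
        ring
      · rw [Simplex.face_apply, dif_pos (by dsimp; omega)]

theorem d_comp {m n k m' n' k' : ℤ} (h : m + n = k) (hm : m + 1 = m')
    (hn : n + 1 = n') (hk : k + 1 = k') (h₁ : m' + n = k') (h₂ : m + n' = k')
    (g : CechHom F G m) (f : CechHom E F n) :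
    d hk (comp h g f) = comp h₁ (d hm g) f + m.negOnePow • comp h₂ g (d hn f) := by
  rw [d_apply, comp_apply, dInt_mul h hm hn hk h₁ h₂, delta_mul h hm hn hk h₁ h₂, d_apply, d_apply,
    map_add, map_add, LinearMap.add_apply, Units.smul_def, smul_add]
  simp only [comp_apply]
  abel


end CechHom

variable (𝒜 U) in
/-- The dg-category of families of cohesive modules on the members of the cover, with the
Čech cochains as morphisms. -/
noncomputable def cechCat : DGCat.{max (u + 1) w, max u w} where
  Obj := CohesiveFamily 𝒜 U
  Hom E F n := CechHom E F n
  d h := CechHom.d h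
  id E := CechHom.id E
  comp h := CechHom.comp h
  id_comp h f := CechHom.id_comp h f
  comp_id h f := CechHom.comp_id h f
  assoc := CechHom.assoc
  d_d := CechHom.d_d
  d_id _ _ h := CechHom.d_id h
  d_comp := CechHom.d_comp

end Cech

namespace CohesiveModule

variable {A B B' C : DGAlg.{u}} {Q R : CohesiveModule A} {f : Hom A B} {f' : Hom A B'} (h : Hom B C)
  (h' : Hom B' C) {k : Hom A C} (hk : ∀ a, h.toFun (f.toFun a) = k.toFun a)
  (hk' : ∀ a, h'.toFun (f'.toFun a) = k.toFun a)

/-- The base change of a morphism `φ : Q → R` over `A` along `k : A → C`, for two factorizations of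
`k` through algebras `B` and `B'`, as a morphism between the pullbacks of `Q` to `B` and of `R` to
`B'`. -/
noncomputable def canonHom {n : ℤ} : DGMod.Hom Q.toDGMod R.toDGMod n →ₗ[ℂ]
    DGMod.Hom ((Q.pullback f).extend h) ((R.pullback f').extend h') n :=
  (DGMod.comp (zero_add n) (R.assocHomInv h' hk')) ∘ₗ
    ((DGMod.comp (add_zero n)).flip (Q.assocHom h hk)) ∘ₗ extendHom Q k

theorem canonHom_apply {n : ℤ} (φ : DGMod.Hom Q.toDGMod R.toDGMod n) :
    canonHom h h' hk hk' φ = DGMod.comp (zero_add n) (R.assocHomInv h' hk')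
      (DGMod.comp (add_zero n) (extendHom Q k φ) (Q.assocHom h hk)) := rfl

theorem canonHom_d {n m : ℤ} (hm : n + 1 = m) (φ : DGMod.Hom Q.toDGMod R.toDGMod n) :
    DGMod.d hm (canonHom h h' hk hk' φ) = canonHom h h' hk hk' (DGMod.d hm φ) := by
  rw [canonHom_apply, canonHom_apply, extendHom_d,
    DGMod.d_comp (zero_add n) rfl hm hm (by omega) (by omega),
    d_assocHomInv, map_zero, LinearMap.zero_apply, zero_add,
    DGMod.d_comp (add_zero n) hm rfl hm (by omega) (by omega), d_assocHom, map_zero,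
    smul_zero, add_zero, Int.negOnePow_zero, one_smul]

end CohesiveModule

/-! ### Twisted complexes and the twisting functor -/

section Tw

open Finset

variable {X : Type v} [TopologicalSpace X] (𝒜 : DGAlgPresheaf.{u} X) {ι : Type w}
  (U : ι → TopologicalSpace.Opens X)

/-- The degenerate `1`-simplex `i i`. -/
def Simplex.diag (i : ι) : Simplex ι 1 i i := ⟨fun _ => i, rfl, rfl⟩

/-- A twisted complex: cohesive modules `E_i` on the `U_i` and a Čech cochain
`a = ∑_{k ≥ 0} a^{k,1-k}` with `δ a + a · a = 0`.  The component `a^{0,1}_i` is the connection of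
`E_i`, so that the commutator with it is the differential of the morphisms.  Here the connection is
not a part of `a`, whose component for `k = 0` is therefore zero; its contribution to the equation
is the differential of the morphisms in the total differential `CechHom.d`. -/
structure TwistedComplex : Type (max (u + 1) w) where
  E : CohesiveFamily 𝒜 U
  a : CechHom E E 1
  a_zero : ∀ (i j : ι) (s : Simplex ι 0 i j), a 0 i j s = 0
  mc : CechHom.d one_add_one_eq_two a + CechHom.comp one_add_one_eq_two a a = 0
  invertible : ∀ i : ι,
    (DGMod.dgCat fun _ : Unit =>
      (E i).extend (𝒜.res (supp_le_last (Simplex.diag i)))).IsHomotopyEquiv (X := ()) (Y := ())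
        (LHom.cast (by norm_num) (a 1 i i (Simplex.diag i)))

/-- The dg-category of twisted complexes: morphisms are the Čech cochains with the product of
cochains as composition, and the differential is the total differential plus
`φ ↦ b · φ - (-1)^|φ| φ · a`. -/
noncomputable def twCat : DGCat.{max (u + 1) w, max u w} :=
  (cechCat 𝒜 U).twist (O := TwistedComplex 𝒜 U) (fun T => T.E) (fun T => T.a) (fun T => T.mc)

variable {𝒜}

/-- The restrictions `Q|_{U_i}` of a cohesive module on `X`. -/
noncomputable def restrFamily (Q : CohesiveModule (𝒜.obj ⊤)) : CohesiveFamily 𝒜 U :=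
  fun _ => Q.pullback (𝒜.res le_top)

variable {U}

section canon

variable {Q R S : CohesiveModule (𝒜.obj ⊤)} {V V' : TopologicalSpace.Opens X} {i j k : ι}

/-- The restriction to `V ⊆ U_i ∩ U_j` of a morphism `φ : Q → R`, as a morphism from `Q|_{U_i}` to
`R|_{U_j}`. -/
noncomputable def canon (hi : V ≤ U i) (hj : V ≤ U j) {n : ℤ} :
    DGMod.Hom Q.toDGMod R.toDGMod n →ₗ[ℂ] LHom (restrFamily U Q) (restrFamily U R) V hi hj n :=
  CohesiveModule.canonHom (𝒜.res hi) (𝒜.res hj) (𝒜.res_res hi le_top (le_top : V ≤ ⊤))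
    (𝒜.res_res hj le_top (le_top : V ≤ ⊤))

theorem canon_rs (hi : V ≤ U i) (hj : V ≤ U j) (hV : V' ≤ V) {n : ℤ}
    (φ : DGMod.Hom Q.toDGMod R.toDGMod n) :
    LHom.rs hV (canon hi hj φ) = canon (hV.trans hi) (hV.trans hj) φ := by
  have h1 := 𝒜.res_res hV (le_top : V ≤ ⊤) le_top
  refine (CohesiveModule.restr_comp (𝒜.res hV) _ h1 _ (zero_add n) _ _).trans ?_
  refine congrArg₂ (fun x y => DGMod.comp (zero_add n) x y) ?_ ?_
  · exact CohesiveModule.restr_assocHomInv R (𝒜.res hj) _ (𝒜.res hV) _ _ _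
  · refine (CohesiveModule.restr_comp (𝒜.res hV) _ h1 _ (add_zero n) _ _).trans ?_
    refine congrArg₂ (fun x y => DGMod.comp (add_zero n) x y) ?_ ?_
    · exact CohesiveModule.restr_extendHom Q (𝒜.res hV) _ φ
    · exact CohesiveModule.restr_assocHom Q (𝒜.res hi) _ (𝒜.res hV) _ _ _

theorem canon_comp (hi : V ≤ U i) (hj : V ≤ U j) (hk : V ≤ U k) {m n l : ℤ} (h : m + n = l)
    (ψ : DGMod.Hom R.toDGMod S.toDGMod m) (φ : DGMod.Hom Q.toDGMod R.toDGMod n) :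
    LHom.comp h (canon hj hk ψ) (canon hi hj φ) = canon hi hk (DGMod.comp h ψ φ) := by
  have key := R.assocTo_assocInv (𝒜.res hj) (𝒜.res_res hj le_top (le_top : V ≤ ⊤))
  have e := CohesiveModule.extendHom_comp Q (𝒜.res (le_top : V ≤ ⊤)) h ψ φ
  refine Subtype.ext (LinearMap.ext fun x => ?_)
  refine Eq.trans ?_ (congrArg (fun z => S.assocInv (𝒜.res hk)
    (𝒜.res_res hk le_top (le_top : V ≤ ⊤)) (z.1 (Q.assocTo (𝒜.res hi)
      (𝒜.res_res hi le_top (le_top : V ≤ ⊤)) x))) e).symm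
  exact congrArg (fun y => S.assocInv (𝒜.res hk) (𝒜.res_res hk le_top (le_top : V ≤ ⊤))
    ((CohesiveModule.extendHom R (𝒜.res (le_top : V ≤ ⊤)) ψ).1 y)) (key _)

theorem canon_d (hi : V ≤ U i) (hj : V ≤ U j) {n m : ℤ} (h : n + 1 = m)
    (φ : DGMod.Hom Q.toDGMod R.toDGMod n) :
    LHom.d h (canon hi hj φ) = canon hi hj (DGMod.d h φ) := by
  exact CohesiveModule.canonHom_d _ _ _ _ h φ

theorem canon_id (hi : V ≤ U i) (hj : V ≤ U j) (h : i = j) :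
    canon hi hj (DGMod.idHom Q.toDGMod) = LHom.eqId (restrFamily U Q) hi hj h := by
  subst h
  refine Subtype.ext (LinearMap.ext fun x => ?_)
  have e := CohesiveModule.extendHom_id Q (𝒜.res (le_top : V ≤ ⊤))
  refine Eq.trans (congrArg (fun z => Q.assocInv (𝒜.res hi)
    (𝒜.res_res hi le_top (le_top : V ≤ ⊤)) (z.1 (Q.assocTo (𝒜.res hi)
      (𝒜.res_res hi le_top (le_top : V ≤ ⊤)) x))) e) ?_
  exact Q.assocInv_assocTo (𝒜.res hi) (𝒜.res_res hi le_top (le_top : V ≤ ⊤)) x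

end canon

end Tw

theorem DGCat.isHomotopyEquiv_id (C : DGCat.{u, v}) (X : C.Obj) : C.IsHomotopyEquiv (C.id X) := by
  refine ⟨C.d_id X _, C.id X, C.d_id X _, ⟨0, ?_⟩, ⟨0, ?_⟩⟩
  · rw [map_zero, C.id_comp, sub_self]
  · rw [map_zero, C.id_comp, sub_self]

section Tw

open Finset

variable {X : Type v} [TopologicalSpace X] {𝒜 : DGAlgPresheaf.{u} X} {ι : Type w}
  {U : ι → TopologicalSpace.Opens X}

namespace CechHom

variable {E F G : CohesiveFamily 𝒜 U}

theorem mul_apply_ne {n₁ n₂ n : ℤ} (h : n₁ + n₂ = n) {u : CechHom F G n₁} {v : CechHom E F n₂}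
    {p r : ℕ} (hu : ∀ q, q ≠ p → ∀ a b s, u q a b s = 0)
    (hv : ∀ q, q ≠ r → ∀ a b s, v q a b s = 0) {m : ℕ} (hm : m ≠ p + r) (a b : ι)
    (s : Simplex ι m a b) : mul h u v m a b s = 0 := by
  rw [mul_apply]
  refine sum_eq_zero ?_
  rintro ⟨⟨i, j⟩, hx⟩ -
  have e : i + j = m := by simpa using hx
  by_cases hi : i = p
  · have hj : j ≠ r := by omega
    simp only [cup, hv j hj, map_zero, smul_zero]
  · simp only [cup, hu i hi, map_zero, LinearMap.zero_apply, smul_zero]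

theorem mul_apply_eq {n₁ n₂ n : ℤ} (h : n₁ + n₂ = n) {u : CechHom F G n₁} {v : CechHom E F n₂}
    {p r : ℕ} (hu : ∀ q, q ≠ p → ∀ a b s, u q a b s = 0) {m : ℕ} (hm : p + r = m) (a b : ι)
    (s : Simplex ι m a b) : mul h u v m a b s = ((n₁ - p) * r).negOnePow •
      cup u v (s.front p r hm) (s.back p r hm) (supp_le_front _ _ _ _) (supp_le_back _ _ _ _)
        (by omega) := by
  rw [mul_apply, sum_eq_single ⟨(p, r), by simpa using hm⟩]
  · rintro ⟨⟨i, j⟩, hx⟩ - hne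
    have e : i + j = m := by simpa using hx
    have hi : i ≠ p := by
      rintro rfl
      obtain rfl : j = r := by omega
      exact hne rfl
    simp only [cup, hu i hi, map_zero, LinearMap.zero_apply, smul_zero]
  · exact fun h => absurd (mem_univ _) h

end CechHom

variable {Q R S : CohesiveModule (𝒜.obj ⊤)}

/-- The cochain `a^{1,0}_{ij} = id` of the restrictions of a cohesive module on `X`. -/
noncomputable def twistCochain (U : ι → TopologicalSpace.Opens X) (Q : CohesiveModule (𝒜.obj ⊤)) :
    CechHom (restrFamily U Q) (restrFamily U Q) 1
  | 1, _, _, s => LHom.cast (by norm_num)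
      (canon (supp_le_last s) (supp_le_first s) (DGMod.idHom Q.toDGMod))
  | 0, _, _, _ => 0
  | _ + 2, _, _, _ => 0

/-- The cochain with `φ^{0,n}_i = φ|_{U_i}`, for a morphism `φ` of cohesive modules on `X`. -/
noncomputable def restrCochain (U : ι → TopologicalSpace.Opens X) {n : ℤ}
    (φ : DGMod.Hom Q.toDGMod R.toDGMod n) : CechHom (restrFamily U Q) (restrFamily U R) n
  | 0, _, _, s => LHom.cast (by simp) (canon (supp_le_last s) (supp_le_first s) φ)
  | _ + 1, _, _, _ => 0

/-- `restrCochain` as a linear map. -/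
noncomputable def mapCochain (U : ι → TopologicalSpace.Opens X) {n : ℤ} :
    DGMod.Hom Q.toDGMod R.toDGMod n →ₗ[ℂ] CechHom (restrFamily U Q) (restrFamily U R) n where
  toFun := restrCochain U
  map_add' φ ψ := CechHom.ext fun p a b s => by
    rw [CechHom.add_apply]
    cases p with
    | zero => simp only [restrCochain, map_add]
    | succ p => simp only [restrCochain, add_zero]
  map_smul' c φ := CechHom.ext fun p a b s => by
    rw [CechHom.smul_apply]
    cases p with
    | zero => simp only [restrCochain, map_smul, RingHom.id_apply]
    | succ p => simp only [restrCochain, smul_zero]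

theorem canon_comp_cast {V : TopologicalSpace.Opens X} {i j k : ι} (hi : V ≤ U i) (hj : V ≤ U j)
    (hk : V ≤ U k) {m n l l' : ℤ} (h : m + n = l) (e : l = l')
    (ψ : DGMod.Hom R.toDGMod S.toDGMod m) (φ : DGMod.Hom Q.toDGMod R.toDGMod n) :
    LHom.cast e (canon hi hk (DGMod.comp h ψ φ)) =
      LHom.comp (h.trans e) (canon hj hk ψ) (canon hi hj φ) := by
  rw [← canon_comp hi hj hk, LHom.cast_comp]

theorem twistCochain_ne (q : ℕ) (hq : q ≠ 1) (a b : ι) (s : Simplex ι q a b) :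
    twistCochain U Q q a b s = 0 := by
  match q, s with
  | 0, s => rfl
  | 1, s => exact absurd rfl hq
  | q + 2, s => rfl

theorem twistCochain_one (a b : ι) (s : Simplex ι 1 a b) :
    twistCochain U Q 1 a b s = LHom.cast (by norm_num)
      (canon (supp_le_last s) (supp_le_first s) (DGMod.idHom Q.toDGMod)) := rfl

theorem mapCochain_ne {n : ℤ} (φ : DGMod.Hom Q.toDGMod R.toDGMod n) (q : ℕ) (hq : q ≠ 0) (a b : ι)
    (s : Simplex ι q a b) : mapCochain U φ q a b s = 0 := by
  cases q with
  | zero => exact absurd rfl hq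
  | succ q => rfl

theorem mapCochain_zero {n : ℤ} (φ : DGMod.Hom Q.toDGMod R.toDGMod n) (a b : ι)
    (s : Simplex ι 0 a b) : mapCochain U φ 0 a b s =
      LHom.cast (by simp) (canon (supp_le_last s) (supp_le_first s) φ) := rfl

theorem mapCochain_comp {m n k : ℤ} (h : m + n = k) (ψ : DGMod.Hom R.toDGMod S.toDGMod m)
    (φ : DGMod.Hom Q.toDGMod R.toDGMod n) :
    mapCochain U (DGMod.comp h ψ φ) = CechHom.comp h (mapCochain U ψ) (mapCochain U φ) := by
  refine CechHom.ext fun p a b s => ?_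
  rw [CechHom.comp_apply]
  by_cases hp : p = 0
  · subst hp
    rw [CechHom.mul_apply_eq h (p := 0) (r := 0) (mapCochain_ne ψ) rfl]
    simp only [CechHom.cup, mapCochain_zero, LHom.rs_cast, LHom.comp_cast_left,
      LHom.comp_cast_right, canon_rs]
    rw [canon_comp_cast _ ((supp_le_front s 0 0 rfl).trans (supp_le_last _)) _ h _ ψ φ]
    simp
  · rw [CechHom.mul_apply_ne h (p := 0) (r := 0) (mapCochain_ne ψ) (mapCochain_ne φ) hp,
      mapCochain_ne _ p hp]

theorem mapCochain_id : mapCochain U (DGMod.idHom Q.toDGMod) = CechHom.id (restrFamily U Q) := by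
  refine CechHom.ext fun p a b s => ?_
  cases p with
  | zero =>
    rw [mapCochain_zero, canon_id _ _ (s.2.2.symm.trans s.2.1)]
    rfl
  | succ p => rfl

theorem mapCochain_d {n m : ℤ} (h : n + 1 = m) (φ : DGMod.Hom Q.toDGMod R.toDGMod n) :
    mapCochain U (DGMod.d h φ) = CechHom.d h (mapCochain U φ) := by
  refine CechHom.ext fun p a b s => ?_
  rw [CechHom.d_apply, CechHom.add_apply, CechHom.dInt_apply]
  match p, s with
  | 0, s =>
    rw [mapCochain_zero, mapCochain_zero, CechHom.delta_zero, ← canon_d, LHom.cast_d, LHom.d_cast]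
    simp
  | 1, s =>
    rw [mapCochain_ne _ _ one_ne_zero, mapCochain_ne _ _ one_ne_zero, map_zero, smul_zero, zero_add]
    rfl
  | p + 2, s =>
    rw [mapCochain_ne _ _ (Nat.succ_ne_zero _), mapCochain_ne _ _ (Nat.succ_ne_zero _), map_zero,
      smul_zero, zero_add, CechHom.delta_succ]
    simp only [mapCochain_ne _ _ (Nat.succ_ne_zero _), map_zero, smul_zero, sum_const_zero]

theorem comm_twistCochain {n m : ℤ} (h : n + 1 = m) (h' : 1 + n = m)
    (φ : DGMod.Hom Q.toDGMod R.toDGMod n) :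
    CechHom.comp h' (twistCochain U R) (mapCochain U φ) =
      n.negOnePow • CechHom.comp h (mapCochain U φ) (twistCochain U Q) := by
  refine CechHom.ext fun p a b s => ?_
  rw [CechHom.comp_apply, CechHom.comp_apply, Units.smul_def, CechHom.zsmul_apply]
  by_cases hp : p = 1
  · subst hp
    rw [CechHom.mul_apply_eq h' (p := 1) (r := 0) twistCochain_ne rfl,
      CechHom.mul_apply_eq h (p := 0) (r := 1) (mapCochain_ne φ) rfl]
    simp only [CechHom.cup, mapCochain_zero, twistCochain_one, LHom.rs_cast, LHom.comp_cast_left,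
      LHom.comp_cast_right, canon_rs, canon_comp]
    have e1 : ∀ {m l : ℤ} (h : 0 + m = l) (h' : m = l) (φ : DGMod.Hom Q.toDGMod R.toDGMod m),
      DGMod.comp h (DGMod.idHom R.toDGMod) φ = h' ▸ φ := by
      intro m l h h' φ
      subst h'
      rfl
    have e2 : ∀ {m l : ℤ} (h : m + 0 = l) (h' : m = l) (φ : DGMod.Hom Q.toDGMod R.toDGMod m),
      DGMod.comp h φ (DGMod.idHom Q.toDGMod) = h' ▸ φ := by
      intro m l h h' φ
      subst h'
      rfl
    rw [e1 _ (by simp; omega), e2 _ (by simp; omega)]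
    simp [Units.smul_def, smul_smul]
  · rw [CechHom.mul_apply_ne h' (p := 1) (r := 0) twistCochain_ne (mapCochain_ne φ) hp,
      CechHom.mul_apply_ne h (p := 0) (r := 1) (mapCochain_ne φ) twistCochain_ne hp, smul_zero]

theorem twistCochain_mc : CechHom.d one_add_one_eq_two (twistCochain U Q) +
    CechHom.comp one_add_one_eq_two (twistCochain U Q) (twistCochain U Q) = 0 := by
  refine CechHom.ext fun p a b s => ?_
  rw [CechHom.d_apply, CechHom.add_apply, CechHom.add_apply, CechHom.dInt_apply,
    CechHom.zero_apply, CechHom.comp_apply]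
  match p, s with
  | 0, s =>
    rw [CechHom.mul_apply_ne _ (p := 1) (r := 1) twistCochain_ne twistCochain_ne (by norm_num),
      CechHom.delta_zero, twistCochain_ne _ (by norm_num), map_zero, smul_zero, add_zero, add_zero]
  | 1, s =>
    rw [CechHom.mul_apply_ne _ (p := 1) (r := 1) twistCochain_ne twistCochain_ne (by norm_num),
      twistCochain_one, LHom.d_cast, add_zero, canon_d, DGMod.d_id, map_zero, smul_zero, zero_add]
    rfl
  | 2, s =>
    rw [CechHom.mul_apply_eq _ (p := 1) (r := 1) twistCochain_ne rfl,
      twistCochain_ne _ (by norm_num), map_zero, smul_zero, zero_add, CechHom.delta_succ]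
    simp only [CechHom.cup, twistCochain_one, LHom.rs_cast, LHom.comp_cast_left,
      LHom.comp_cast_right, canon_rs, LHom.cast_cast, canon_comp]
    have e : ∀ {l : ℤ} (h : 0 + 0 = l) (h' : 0 = l), canon (U := U) (supp_le_last s) (supp_le_first s)
        (DGMod.comp h (DGMod.idHom Q.toDGMod) (DGMod.idHom Q.toDGMod)) =
        LHom.cast h' (canon (supp_le_last s) (supp_le_first s) (DGMod.idHom Q.toDGMod)) := by
      intro l h h'
      subst h'
      rfl
    rw [e _ (by norm_num), Fin.sum_univ_one]
    simp
  | p + 3, s =>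
    rw [CechHom.mul_apply_ne _ (p := 1) (r := 1) twistCochain_ne twistCochain_ne (by omega),
      twistCochain_ne _ (by omega), map_zero, smul_zero, zero_add, add_zero, CechHom.delta_succ]
    simp only [twistCochain_ne (_ + 2) (by omega), map_zero, smul_zero, sum_const_zero]

theorem canon_id_invertible (U : ι → TopologicalSpace.Opens X) (i : ι) :
    (DGMod.dgCat fun _ : Unit =>
      (restrFamily U Q i).extend (𝒜.res (supp_le_last (Simplex.diag i)))).IsHomotopyEquiv
        (X := ()) (Y := ())
        (LHom.cast (by norm_num) (twistCochain U Q 1 i i (Simplex.diag i))) := by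
  rw [twistCochain_one, LHom.cast_cast, LHom.cast_rfl, canon_id _ _ rfl]
  exact DGCat.isHomotopyEquiv_id (DGMod.dgCat fun _ : Unit =>
    (restrFamily U Q i).extend (𝒜.res (supp_le_last (Simplex.diag i)))) ()

/-- The twisted complex of the restrictions of a cohesive module on `X`: `E_i = Q|_{U_i}`,
`a^{0,1}_i` is the connection of `Q|_{U_i}`, `a^{1,0}_{ij} = id` and `a^{k,1-k} = 0` for `k ≥ 2`. -/
noncomputable def CohesiveModule.toTwisted (U : ι → TopologicalSpace.Opens X)
    (Q : CohesiveModule (𝒜.obj ⊤)) : TwistedComplex 𝒜 U where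
  E := restrFamily U Q
  a := twistCochain U Q
  a_zero _ _ _ := rfl
  mc := twistCochain_mc
  invertible := canon_id_invertible U

/-- The twisting functor, from the cohesive modules on `X` to the twisted complexes. -/
noncomputable def twistingFunctor (𝒜 : DGAlgPresheaf.{u} X) (U : ι → TopologicalSpace.Opens X) :
    DGCat.Functor (cohesiveCat (𝒜.obj ⊤)) (twCat 𝒜 U) where
  obj Q := Q.toTwisted U
  map := mapCochain U
  map_id _ := mapCochain_id
  map_comp h ψ φ := mapCochain_comp h ψ φ
  map_d {Q R n m} h φ := by
    refine (mapCochain_d h φ).trans ?_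
    change _ = (CechHom.d h (mapCochain U φ) +
      CechHom.comp (by omega) (twistCochain U R) (mapCochain U φ)) -
      n.negOnePow • CechHom.comp h (mapCochain U φ) (twistCochain U Q)
    rw [comm_twistCochain h (by omega) φ, add_sub_cancel_right]

end Tw

/-! ### The Dolbeault algebra -/

section flat

variable {E : Type u} [NormedAddCommGroup E] [NormedSpace ℂ E]

/-- The conjugate-linear part of a real-linear map. -/
noncomputable def conjPart (L : E →L[ℝ] ℂ) : E →ₗ⋆[ℂ] ℂ where
  toFun v := (L v + Complex.I * L (Complex.I • v)) / 2
  map_add' v w := by rw [smul_add, map_add, map_add]; ring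
  map_smul' c v := by
    have h : ∀ (a b : ℝ) (w : E), L (a • w + b • (Complex.I • w)) =
        a * L w + b * L (Complex.I • w) := fun a b w => by
      rw [map_add, map_smul, map_smul]; simp
    have h1 : c • v = c.re • v + c.im • (Complex.I • v) := by
      conv_lhs => rw [← Complex.re_add_im c]
      rw [add_smul, mul_smul]
      simp
    have h2 : Complex.I • c • v = (-c.im) • v + c.re • (Complex.I • v) := by
      rw [h1, smul_add, smul_comm Complex.I c.re, smul_comm Complex.I c.im, smul_smul Complex.I,
        Complex.I_mul_I, neg_smul, one_smul, neg_smul, smul_neg, add_comm]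
    rw [h2, h1, h, h]
    have hc : (starRingEnd ℂ) c = c.re - c.im * Complex.I := by
      apply Complex.ext <;> simp
    rw [smul_eq_mul, hc]
    push_cast
    linear_combination (c.im * L (Complex.I • v) / 2) * Complex.I_mul_I

theorem conjPart_apply (L : E →L[ℝ] ℂ) (v : E) :
    conjPart L v = (L v + Complex.I * L (Complex.I • v)) / 2 := rfl

theorem conjPart_add (L L' : E →L[ℝ] ℂ) : conjPart (L + L') = conjPart L + conjPart L' := by
  ext v; simp only [conjPart_apply, LinearMap.add_apply, add_apply]; ring

theorem conjPart_zero : conjPart (0 : E →L[ℝ] ℂ) = 0 := by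
  ext v; simp [conjPart_apply]

theorem conjPart_smul (c : ℂ) (L : E →L[ℝ] ℂ) : conjPart (c • L) = c • conjPart L := by
  ext v
  simp only [conjPart_apply, LinearMap.smul_apply, smul_apply, smul_eq_mul]
  ring

/-- The Wirtinger derivative in the direction `v`. -/
noncomputable def wirt (v : E) (f : E → ℂ) (z : E) : ℂ := conjPart (fderiv ℝ f z) v

variable {O : Set E} {f g : E → ℂ}

theorem wirt_contDiffOn (hO : IsOpen O) (v : E) (hf : ContDiffOn ℝ ∞ f O) : ContDiffOn ℝ ∞ (wirt v f) O := by
  have h := hf.fderiv_of_isOpen (m := ∞) hO (by simp)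
  have h1 : ∀ w : E, ContDiffOn ℝ ∞ (fun z => fderiv ℝ f z w) O := fun w =>
    h.clm_apply contDiffOn_const
  change ContDiffOn ℝ ∞ (fun z => (fderiv ℝ f z v + Complex.I * fderiv ℝ f z (Complex.I • v)) / 2) O
  exact ((h1 v).add (contDiffOn_const.mul (h1 _))).div_const 2

theorem differentiableAt_of_contDiffOn (hO : IsOpen O) (hf : ContDiffOn ℝ ∞ f O) {z : E} (hz : z ∈ O) :
    DifferentiableAt ℝ f z :=
  (hf.contDiffAt (hO.mem_nhds hz)).differentiableAt (by simp)

theorem wirt_mul (v : E) {z : E} (hf : DifferentiableAt ℝ f z) (hg : DifferentiableAt ℝ g z) :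
    wirt v (fun y => f y * g y) z = f z * wirt v g z + wirt v f z * g z := by
  unfold wirt
  rw [fderiv_fun_mul hf hg, conjPart_add, conjPart_smul, conjPart_smul]
  simp only [LinearMap.add_apply, LinearMap.smul_apply, smul_eq_mul]
  ring

theorem wirt_congr (v : E) {z : E} (h : f =ᶠ[nhds z] g) : wirt v f z = wirt v g z := by
  unfold wirt; rw [h.fderiv_eq]

theorem wirt_const (v : E) (c : ℂ) (z : E) : wirt v (fun _ => c) z = 0 := by
  unfold wirt; rw [fderiv_fun_const]; simp [conjPart_apply]

theorem wirt_sum (v : E) {κ : Type*} (s : Finset κ) (F : κ → E → ℂ) {z : E}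
    (hF : ∀ k ∈ s, DifferentiableAt ℝ (F k) z) :
    wirt v (fun y => ∑ k ∈ s, F k y) z = ∑ k ∈ s, wirt v (F k) z := by
  unfold wirt
  rw [fderiv_fun_sum hF]
  simp only [conjPart_apply, sum_apply]
  rw [Finset.mul_sum, ← Finset.sum_add_distrib, Finset.sum_div]

theorem wirt_wirt (hO : IsOpen O) (v w : E) (hf : ContDiffOn ℝ ∞ f O) {z : E} (hz : z ∈ O) :
    wirt v (wirt w f) z = wirt w (wirt v f) z := by
  have hs : IsSymmSndFDerivAt ℝ f z :=
    ((hf.contDiffAt (hO.mem_nhds hz))).isSymmSndFDerivAt (by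
      rw [minSmoothness_of_isRCLikeNormedField]
      exact WithTop.coe_le_coe.2 (le_top : (2 : ℕ∞) ≤ ⊤))
  have h := hf.fderiv_of_isOpen (m := ∞) hO (by simp)
  have hd : DifferentiableAt ℝ (fderiv ℝ f) z :=
    (h.contDiffAt (hO.mem_nhds hz)).differentiableAt (by simp)
  have key : ∀ a b : E, fderiv ℝ (wirt a f) z b =
      (fderiv ℝ (fderiv ℝ f) z b a + Complex.I * fderiv ℝ (fderiv ℝ f) z b (Complex.I • a)) / 2 := by
    intro a b
    have h1 : ∀ c : E, HasFDerivAt (fun z => fderiv ℝ f z c)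
        ((fderiv ℝ (fderiv ℝ f) z).flip c) z := fun c => by
      simpa using hd.hasFDerivAt.clm_apply (hasFDerivAt_const c z)
    have h2 := ((h1 a).add ((h1 (Complex.I • a)).const_mul Complex.I)).mul_const (2⁻¹ : ℂ)
    have h3 : wirt a f = fun z => (fderiv ℝ f z a + Complex.I * fderiv ℝ f z (Complex.I • a)) * 2⁻¹ := by
      funext z; rw [wirt, conjPart_apply, div_eq_mul_inv]
    rw [h3, HasFDerivAt.fderiv (f := fun z => (fderiv ℝ f z a + Complex.I * fderiv ℝ f z (Complex.I • a)) * 2⁻¹) h2]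
    simp
    ring
  unfold wirt at key ⊢
  rw [conjPart_apply, conjPart_apply, key, key, key, key, hs v w, hs v, hs (Complex.I • v) w,
    hs (Complex.I • v)]
  ring

/-- The fibre of the `(0,•)`-forms on a manifold modelled on `E`: the exterior algebra of the
conjugate-linear forms on the tangent space. -/
abbrev FormFibre (E : Type u) [NormedAddCommGroup E] [NormedSpace ℂ E] : Type u :=
  ExteriorAlgebra ℂ (E →ₗ⋆[ℂ] ℂ)

/-- `∂̄f` for a function on `E`. -/
noncomputable def flatDbar (f : E → ℂ) (z : E) : FormFibre E :=
  ExteriorAlgebra.ι ℂ (conjPart (fderiv ℝ f z))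

section basis

variable {κ : Type} [Fintype κ] (b : Module.Basis κ ℂ E)

/-- The conjugates of the coordinate functionals. -/
noncomputable def conjCoord (j : κ) : E →ₗ⋆[ℂ] ℂ where
  toFun v := starRingEnd ℂ (b.repr v j)
  map_add' v w := by simp
  map_smul' c v := by simp

theorem conjPart_eq_sum (L : E →L[ℝ] ℂ) :
    conjPart L = ∑ j, conjPart L (b j) • conjCoord b j := by
  ext v
  conv_lhs => rw [← b.sum_repr v]
  rw [map_sum, LinearMap.sum_apply]
  refine Finset.sum_congr rfl fun j _ => ?_
  rw [LinearMap.map_smulₛₗ, LinearMap.smul_apply, smul_eq_mul, smul_eq_mul, mul_comm]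
  rfl

/-- The basic forms. -/
noncomputable def basicForm (j : κ) : FormFibre E := ExteriorAlgebra.ι ℂ (conjCoord b j)

theorem flatDbar_eq_sum (f : E → ℂ) (z : E) :
    flatDbar f z = ∑ j, wirt (b j) f z • basicForm b j := by
  unfold flatDbar
  rw [conjPart_eq_sum b, map_sum]
  simp only [map_smul]
  rfl

theorem basicForm_mul (j k : κ) :
    basicForm b j * basicForm b k = -(basicForm b k * basicForm b j) :=
  eq_neg_of_add_eq_zero_left (ExteriorAlgebra.ι_add_mul_swap _ _)

theorem flatDbar_mul {f g : E → ℂ} {z : E} (hf : DifferentiableAt ℝ f z)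
    (hg : DifferentiableAt ℝ g z) :
    flatDbar (fun y => f y * g y) z = f z • flatDbar g z + g z • flatDbar f z := by
  unfold flatDbar
  rw [fderiv_fun_mul hf hg, conjPart_add, conjPart_smul, conjPart_smul, map_add, map_smul, map_smul]

/-- `∂̄g₁ ⋯ ∂̄g_k` for functions on `E`. -/
noncomputable def flatProd (gs : List (E → ℂ)) (z : E) : FormFibre E :=
  (gs.map fun g => flatDbar g z).prod

theorem flatProd_cons (g : E → ℂ) (gs : List (E → ℂ)) (z : E) :
    flatProd (g :: gs) z = flatDbar g z * flatProd gs z := by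
  simp [flatProd]

theorem flatProd_smooth (b : Module.Basis κ ℂ E) (hO : IsOpen O) (gs : List (E → ℂ)) (hgs : ∀ g ∈ gs, ContDiffOn ℝ ∞ g O)
    (ℓ : FormFibre E →ₗ[ℂ] ℂ) : ContDiffOn ℝ ∞ (fun z => ℓ (flatProd gs z)) O := by
  induction gs generalizing ℓ with
  | nil =>
    change ContDiffOn ℝ ∞ (fun _ : E => ℓ 1) O
    exact contDiffOn_const
  | cons g gs ih =>
    have h : (fun z => ℓ (flatProd (g :: gs) z)) = fun z => ∑ j, wirt (b j) g z *
        (ℓ ∘ₗ LinearMap.mulLeft ℂ (basicForm b j)) (flatProd gs z) := by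
      funext z
      rw [flatProd_cons, flatDbar_eq_sum b, Finset.sum_mul, map_sum]
      refine Finset.sum_congr rfl fun j _ => ?_
      rw [smul_mul_assoc, map_smul]
      rfl
    rw [h]
    exact ContDiffOn.sum fun j _ => (wirt_contDiffOn hO (b j) (hgs g (by simp))).mul
      (ih (fun g' hg' => hgs g' (by simp [hg'])) _)

theorem flat_formula (hO : IsOpen O) (gs : List (E → ℂ)) (hgs : ∀ g ∈ gs, ContDiffOn ℝ ∞ g O)
    (f : E → ℂ) (hf : ContDiffOn ℝ ∞ f O) (ℓ : FormFibre E →ₗ[ℂ] ℂ) {z : E} (hz : z ∈ O) :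
    ∑ j, wirt (b j) (fun y => f y * ℓ (basicForm b j * flatProd gs y)) z =
      ℓ (flatDbar f z * flatProd gs z) := by
  induction gs generalizing f ℓ with
  | nil =>
    have : ∀ j, wirt (b j) (fun y => f y * ℓ (basicForm b j * flatProd [] y)) z =
        wirt (b j) f z * ℓ (basicForm b j) := fun j => by
      simp only [flatProd, List.map_nil, List.prod_nil, mul_one]
      rw [wirt_mul _ (differentiableAt_of_contDiffOn hO hf hz) (differentiableAt_const _),
        wirt_const, mul_zero, zero_add]
    simp only [this]
    rw [flatDbar_eq_sum b, flatProd, List.map_nil, List.prod_nil, mul_one, map_sum]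
    simp
  | cons g gs ih =>
    have hg := hgs g (by simp)
    have hgs' : ∀ g ∈ gs, ContDiffOn ℝ ∞ g O := fun g' hg' => hgs g' (by simp [hg'])
    have hW : ∀ k, ContDiffOn ℝ ∞ (wirt (b k) g) O := fun k => wirt_contDiffOn hO (b k) hg
    have e1 : ∀ j, wirt (b j) (fun y => f y * ℓ (basicForm b j * flatProd (g :: gs) y)) z =
        ∑ k, wirt (b j) (fun y => (f y * wirt (b k) g y) *
          (-(ℓ ∘ₗ LinearMap.mulLeft ℂ (basicForm b k))) (basicForm b j * flatProd gs y)) z := by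
      intro j
      rw [← wirt_sum]
      · congr 1
        funext y
        rw [flatProd_cons, flatDbar_eq_sum b, Finset.sum_mul, Finset.mul_sum, map_sum,
          Finset.mul_sum]
        refine Finset.sum_congr rfl fun k _ => ?_
        rw [smul_mul_assoc, mul_smul_comm, map_smul, ← mul_assoc, basicForm_mul, neg_mul, map_neg,
          LinearMap.neg_apply, LinearMap.comp_apply, LinearMap.mulLeft_apply, mul_assoc, smul_eq_mul]
        ring
      · intro k _
        refine ((differentiableAt_of_contDiffOn hO (hf.mul (hW k)) hz)).mul ?_
        exact differentiableAt_of_contDiffOn hO (flatProd_smooth b hO gs hgs'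
          ((-(ℓ ∘ₗ LinearMap.mulLeft ℂ (basicForm b k))) ∘ₗ LinearMap.mulLeft ℂ (basicForm b j))) hz
    simp only [e1]
    rw [Finset.sum_comm]
    have e2 : ∀ k, ∑ j, wirt (b j) (fun y => (f y * wirt (b k) g y) *
          (-(ℓ ∘ₗ LinearMap.mulLeft ℂ (basicForm b k))) (basicForm b j * flatProd gs y)) z =
        -ℓ (basicForm b k * (f z • flatDbar (wirt (b k) g) z + wirt (b k) g z • flatDbar f z) *
          flatProd gs z) := by
      intro k
      rw [ih hgs' (fun y => f y * wirt (b k) g y) (hf.mul (hW k)),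
        flatDbar_mul (differentiableAt_of_contDiffOn hO hf hz)
          (differentiableAt_of_contDiffOn hO (hW k) hz), LinearMap.neg_apply, LinearMap.comp_apply,
        LinearMap.mulLeft_apply, mul_assoc]
    simp only [e2]
    have e3 : ∑ k, basicForm b k * flatDbar (wirt (b k) g) z = 0 := by
      have : ∑ k, basicForm b k * flatDbar (wirt (b k) g) z =
          -∑ k, basicForm b k * flatDbar (wirt (b k) g) z := by
        conv_lhs => simp only [flatDbar_eq_sum b, Finset.mul_sum]
        rw [Finset.sum_comm]
        simp only [flatDbar_eq_sum b, Finset.mul_sum, ← Finset.sum_neg_distrib]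
        refine Finset.sum_congr rfl fun j _ => Finset.sum_congr rfl fun k _ => ?_
        rw [wirt_wirt hO _ _ hg hz, mul_smul_comm, mul_smul_comm, basicForm_mul, smul_neg]
      have h2 : (2 : ℂ) • ∑ k, basicForm b k * flatDbar (wirt (b k) g) z = 0 := by
        rw [two_smul]
        nth_rewrite 1 [this]
        exact neg_add_cancel _
      exact (smul_eq_zero.1 h2).resolve_left two_ne_zero
    rw [Finset.sum_neg_distrib, ← map_sum, ← map_neg, ← Finset.sum_mul]
    congr 1
    simp only [mul_add, Finset.sum_add_distrib, mul_smul_comm]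
    rw [← Finset.smul_sum, e3, smul_zero, zero_add, flatProd_cons, ← mul_assoc, ← neg_mul]
    congr 1
    rw [flatDbar_eq_sum b g, Finset.mul_sum, ← Finset.sum_neg_distrib]
    refine Finset.sum_congr rfl fun k _ => ?_
    rw [mul_smul_comm, ← smul_neg]
    congr 1
    rw [flatDbar, basicForm]
    exact neg_eq_of_add_eq_zero_right (ExteriorAlgebra.ι_add_mul_swap _ _)

end basis

end flat

section flat
variable {E : Type u} [NormedAddCommGroup E] [NormedSpace ℂ E]

theorem flat_list {κ : Type} [Fintype κ] (b : Module.Basis κ ℂ E) {O : Set E} (hO : IsOpen O)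
    (L : List ((E → ℂ) × List (E → ℂ)))
    (hL : ∀ t ∈ L, ContDiffOn ℝ ∞ t.1 O ∧ ∀ g ∈ t.2, ContDiffOn ℝ ∞ g O)
    (ℓ : FormFibre E →ₗ[ℂ] ℂ) :
    (∀ j, ContDiffOn ℝ ∞
      (fun y => ℓ (basicForm b j * (L.map fun t => t.1 y • flatProd t.2 y).sum)) O) ∧
    ∀ z ∈ O, ∑ j, wirt (b j)
        (fun y => ℓ (basicForm b j * (L.map fun t => t.1 y • flatProd t.2 y).sum)) z =
      ℓ (L.map fun t => flatDbar t.1 z * flatProd t.2 z).sum := by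
  induction L with
  | nil =>
    refine ⟨fun j => ?_, fun z _ => ?_⟩
    · simp only [List.map_nil, List.sum_nil]
      exact contDiffOn_const
    · simp only [List.map_nil, List.sum_nil, mul_zero, map_zero, wirt_const, Finset.sum_const_zero]
  | cons t L ih =>
    obtain ⟨h1, h2⟩ := ih fun t' ht' => hL t' (by simp [ht'])
    obtain ⟨ht1, ht2⟩ := hL t (by simp)
    have e : ∀ j, (fun y => ℓ (basicForm b j *
        ((t :: L).map fun t => t.1 y • flatProd t.2 y).sum)) =
        fun y => t.1 y * ℓ (basicForm b j * flatProd t.2 y) +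
          ℓ (basicForm b j * (L.map fun t => t.1 y • flatProd t.2 y).sum) := fun j => by
      funext y
      rw [List.map_cons, List.sum_cons, mul_add, map_add, mul_smul_comm, map_smul, smul_eq_mul]
    have h3 : ∀ j, ContDiffOn ℝ ∞ (fun y => t.1 y * ℓ (basicForm b j * flatProd t.2 y)) O :=
      fun j => ht1.mul (flatProd_smooth b hO t.2 ht2 (ℓ ∘ₗ LinearMap.mulLeft ℂ (basicForm b j)))
    refine ⟨fun j => ?_, fun z hz => ?_⟩
    · rw [e]
      exact (h3 j).add (h1 j)
    · simp only [e]
      have h4 : ∀ j, wirt (b j) (fun y => t.1 y * ℓ (basicForm b j * flatProd t.2 y) +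
          ℓ (basicForm b j * (L.map fun t => t.1 y • flatProd t.2 y).sum)) z =
          wirt (b j) (fun y => t.1 y * ℓ (basicForm b j * flatProd t.2 y)) z +
          wirt (b j) (fun y => ℓ (basicForm b j * (L.map fun t => t.1 y • flatProd t.2 y).sum)) z := by
        intro j
        unfold wirt
        rw [fderiv_fun_add (differentiableAt_of_contDiffOn hO (h3 j) hz)
          (differentiableAt_of_contDiffOn hO (h1 j) hz), conjPart_add]
        rfl
      simp only [h4]
      rw [Finset.sum_add_distrib, h2 z hz, flat_formula b hO t.2 ht2 t.1 ht1 ℓ hz, List.map_cons,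
        List.sum_cons, map_add]

theorem flat_unique [FiniteDimensional ℂ E] {O : Set E} (hO : IsOpen O)
    (L : List ((E → ℂ) × List (E → ℂ)))
    (hL : ∀ t ∈ L, ContDiffOn ℝ ∞ t.1 O ∧ ∀ g ∈ t.2, ContDiffOn ℝ ∞ g O)
    (h0 : ∀ y ∈ O, (L.map fun t => t.1 y • flatProd t.2 y).sum = 0) {z : E} (hz : z ∈ O) :
    (L.map fun t => flatDbar t.1 z * flatProd t.2 z).sum = 0 := by
  refine (Module.forall_dual_apply_eq_zero_iff ℂ _).1 fun ℓ => ?_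
  rw [← (flat_list (Module.finBasis ℂ E) hO L hL ℓ).2 z hz]
  refine Finset.sum_eq_zero fun j _ => ?_
  rw [wirt_congr (g := fun _ => 0), wirt_const]
  filter_upwards [hO.mem_nhds hz] with y hy
  rw [h0 y hy, mul_zero, map_zero]

/-- Composition of conjugate-linear forms with a linear map. -/
def precomp (A : E →ₗ[ℂ] E) : (E →ₗ⋆[ℂ] ℂ) →ₗ[ℂ] (E →ₗ⋆[ℂ] ℂ) where
  toFun w := w.comp A
  map_add' _ _ := rfl
  map_smul' _ _ := rfl

theorem conjPart_comp (L : E →L[ℝ] ℂ) (A : E →L[ℂ] E) :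
    conjPart (L.comp (A.restrictScalars ℝ)) = precomp A.toLinearMap (conjPart L) := by
  ext v
  change (L (A v) + Complex.I * L (A (Complex.I • v))) / 2 =
    (L (A v) + Complex.I * L (Complex.I • A v)) / 2
  rw [map_smul]

end flat

section manifold

variable {E : Type u} [NormedAddCommGroup E] [NormedSpace ℂ E] {X : Type v} [TopologicalSpace X]
  [ChartedSpace E X]

/-- The value at `x` of the form `∂̄f`, for a function `f` on `X`: the conjugate-linear part of the
differential of `f`. -/
noncomputable def dbarFun (f : X → ℂ) (x : X) : FormFibre E :=
  ExteriorAlgebra.ι ℂ (conjPart (E := E) (mfderiv 𝓘(ℝ, E) 𝓘(ℝ, ℂ) f x))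

theorem isManifold_real [IsManifold 𝓘(ℂ, E) ω X] : IsManifold 𝓘(ℝ, E) ∞ X := by
  refine isManifold_of_contDiffOn _ _ _ fun e e' he he' => ?_
  have h := (contDiffGroupoid ω 𝓘(ℂ, E)).compatible he he'
  rw [contDiffGroupoid, mem_groupoid_of_pregroupoid] at h
  have h1 : ContDiffOn ℂ ω (𝓘(ℂ, E) ∘ e.symm ≫ₕ e' ∘ 𝓘(ℂ, E).symm)
    (𝓘(ℂ, E).symm ⁻¹' (e.symm ≫ₕ e').source ∩ Set.range 𝓘(ℂ, E)) := h.1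
  exact (h1.restrict_scalars ℝ).of_le le_top

theorem mfderiv_eq {f : X → ℂ} {x : X} (hf : MDifferentiableAt 𝓘(ℝ, E) 𝓘(ℝ, ℂ) f x) :
    (mfderiv 𝓘(ℝ, E) 𝓘(ℝ, ℂ) f x : E →L[ℝ] ℂ) =
      fderiv ℝ (f ∘ (chartAt E x).symm) (chartAt E x x) := by
  have h : (fderivWithin ℝ (writtenInExtChartAt 𝓘(ℝ, E) 𝓘(ℝ, ℂ) x f) (Set.range 𝓘(ℝ, E))
      (extChartAt 𝓘(ℝ, E) x x)) = fderiv ℝ (f ∘ (chartAt E x).symm) (chartAt E x x) := by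
    rw [writtenInExtChartAt]
    simp only [mfld_simps, fderivWithin_univ]
    rfl
  exact (if_pos hf).trans h

theorem transition [IsManifold 𝓘(ℂ, E) ω X] (x y : X) {z : E} (hz : z ∈ (chartAt E y).target)
    (hz' : (chartAt E y).symm z ∈ (chartAt E x).source) :
    DifferentiableAt ℂ (chartAt E x ∘ (chartAt E y).symm) z := by
  have h := contDiffOn_ext_coord_change (I := 𝓘(ℂ, E)) (n := ω) x y
  have ho : IsOpen ((chartAt E y).symm ≫ₕ chartAt E x).source :=
    ((chartAt E y).symm ≫ₕ chartAt E x).open_source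
  have h1 : ContDiffOn ℂ ω (chartAt E x ∘ (chartAt E y).symm)
      ((chartAt E y).symm ≫ₕ chartAt E x).source := by
    simpa only [mfld_simps] using h
  refine (h1.contDiffAt (ho.mem_nhds ?_)).differentiableAt (by simp)
  simp only [mfld_simps]
  exact ⟨hz, hz'⟩

theorem smooth_in_chart [IsManifold 𝓘(ℂ, E) ω X] (x : X) {V : Set X} {f : X → ℂ}
    (hf : ContMDiffOn 𝓘(ℝ, E) 𝓘(ℝ, ℂ) ∞ f V) :
    ContDiffOn ℝ ∞ (f ∘ (chartAt E x).symm)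
      ((chartAt E x).target ∩ (chartAt E x).symm ⁻¹' V) := by
  have := isManifold_real (E := E) (X := X)
  have h := (contMDiffOn_iff.1 hf).2 x 0
  refine h.mono fun z hz => ⟨?_, hz.2, ?_⟩
  · simpa only [mfld_simps] using hz.1
  · rw [extChartAt_model_space_eq_id]
    exact Set.mem_univ _

/-- The derivative at `y` of the chart at `x`. -/
noncomputable def chartDeriv (x y : X) : E →L[ℂ] E :=
  fderiv ℂ (chartAt E x ∘ (chartAt E y).symm) (chartAt E y y)

theorem dbarFun_eq [IsManifold 𝓘(ℂ, E) ω X] (x : X) {V : Set X} (hV : IsOpen V) {f : X → ℂ}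
    (hf : ContMDiffOn 𝓘(ℝ, E) 𝓘(ℝ, ℂ) ∞ f V) {y : X} (hy : y ∈ V)
    (hyx : y ∈ (chartAt E x).source) :
    dbarFun (E := E) f y = ExteriorAlgebra.map (precomp (chartDeriv x y).toLinearMap)
      (flatDbar (f ∘ (chartAt E x).symm) (chartAt E x y)) := by
  have hd : MDifferentiableAt 𝓘(ℝ, E) 𝓘(ℝ, ℂ) f y :=
    ((hf y hy).contMDiffAt (hV.mem_nhds hy)).mdifferentiableAt (by simp)
  have ho : IsOpen ((chartAt E x).target ∩ (chartAt E x).symm ⁻¹' V) :=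
    (chartAt E x).isOpen_inter_preimage_symm hV
  have hm : chartAt E x y ∈ (chartAt E x).target ∩ (chartAt E x).symm ⁻¹' V :=
    ⟨(chartAt E x).map_source hyx, by simpa [(chartAt E x).left_inv hyx] using hy⟩
  have hy0 : chartAt E y y ∈ (chartAt E y).target := mem_chart_target E y
  have hy1 : (chartAt E y).symm (chartAt E y y) = y := (chartAt E y).left_inv (mem_chart_source E y)
  have ht := transition x y hy0 (by rwa [hy1])
  have e : f ∘ (chartAt E y).symm =ᶠ[nhds (chartAt E y y)]
      (f ∘ (chartAt E x).symm) ∘ (chartAt E x ∘ (chartAt E y).symm) := by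
    have : ((chartAt E y).target ∩ (chartAt E y).symm ⁻¹' (chartAt E x).source) ∈
        nhds (chartAt E y y) :=
      ((chartAt E y).isOpen_inter_preimage_symm (chartAt E x).open_source).mem_nhds
        ⟨hy0, by simpa [hy1] using hyx⟩
    filter_upwards [this] with z hz
    simp [(chartAt E x).left_inv hz.2]
  have hz1 : (chartAt E x ∘ (chartAt E y).symm) (chartAt E y y) = chartAt E x y := by
    simp [hy1]
  have key : fderiv ℝ (f ∘ (chartAt E y).symm) (chartAt E y y) =
      (fderiv ℝ (f ∘ (chartAt E x).symm) (chartAt E x y)).comp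
        ((chartDeriv x y).restrictScalars ℝ) := by
    rw [e.fderiv_eq]
    have h1 := differentiableAt_of_contDiffOn ho (smooth_in_chart x hf) hm
    rw [← hz1] at h1 ⊢
    exact (h1.hasFDerivAt.comp _ (ht.hasFDerivAt.restrictScalars ℝ)).fderiv
  unfold dbarFun flatDbar
  rw [ExteriorAlgebra.map_apply_ι, ← conjPart_comp, ← key, ← mfderiv_eq hd]

theorem chartDeriv_injective [IsManifold 𝓘(ℂ, E) ω X] (x : X) {y : X}
    (hyx : y ∈ (chartAt E x).source) :
    Function.Injective (ExteriorAlgebra.map (precomp (chartDeriv (E := E) x y).toLinearMap)) := by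
  have hy0 : chartAt E y y ∈ (chartAt E y).target := mem_chart_target E y
  have hy1 : (chartAt E y).symm (chartAt E y y) = y := (chartAt E y).left_inv (mem_chart_source E y)
  have hx0 : chartAt E x y ∈ (chartAt E x).target := (chartAt E x).map_source hyx
  have hx1 : (chartAt E x).symm (chartAt E x y) = y := (chartAt E x).left_inv hyx
  have ht := transition x y hy0 (by rwa [hy1])
  have ht' := transition y x hx0 (by rw [hx1]; exact mem_chart_source E y)
  refine ExteriorAlgebra.map_injective ⟨precomp
    (fderiv ℂ (chartAt E y ∘ (chartAt E x).symm) (chartAt E x y)).toLinearMap, ?_⟩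
  have hz : (chartAt E y ∘ (chartAt E x).symm) (chartAt E x y) = chartAt E y y := by simp [hx1]
  have e : (chartAt E x ∘ (chartAt E y).symm) ∘ (chartAt E y ∘ (chartAt E x).symm)
      =ᶠ[nhds (chartAt E x y)] id := by
    have : ((chartAt E x).target ∩ (chartAt E x).symm ⁻¹' (chartAt E y).source) ∈
        nhds (chartAt E x y) :=
      ((chartAt E x).isOpen_inter_preimage_symm (chartAt E y).open_source).mem_nhds
        ⟨hx0, by simp [hx1]⟩
    filter_upwards [this] with z hz
    simp [(chartAt E y).left_inv hz.2, (chartAt E x).right_inv hz.1]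
  have h1 : (chartDeriv (E := E) x y).comp
      (fderiv ℂ (chartAt E y ∘ (chartAt E x).symm) (chartAt E x y)) = ContinuousLinearMap.id ℂ E := by
    rw [← fderiv_id (𝕜 := ℂ) (x := chartAt E x y), ← e.fderiv_eq]
    rw [← hz] at ht
    have := (ht.hasFDerivAt.comp _ ht'.hasFDerivAt).fderiv
    rw [this, hz]
    rfl
  ext w v
  exact congrArg w (DFunLike.congr_fun h1 v)

end manifold

section forms

variable {E : Type u} [NormedAddCommGroup E] [NormedSpace ℂ E] {X : Type v} [TopologicalSpace X]
  [ChartedSpace E X]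

/-- The value at `y` of the form `∂̄g₁ ∧ ⋯ ∧ ∂̄g_k`. -/
noncomputable def dbarProd (gs : List (X → ℂ)) (y : X) : FormFibre E :=
  (gs.map fun g => dbarFun g y).prod

/-- The value at `y` of the form `∑ f ∂̄g₁ ∧ ⋯ ∧ ∂̄g_k`, the sum over the pairs `(f, [g₁, …, g_k])`
of the list `L`. -/
noncomputable def exprVal (L : List ((X → ℂ) × List (X → ℂ))) (y : X) : FormFibre E :=
  (L.map fun t => t.1 y • dbarProd t.2 y).sum

/-- The value at `y` of the form `∑ ∂̄f ∧ ∂̄g₁ ∧ ⋯ ∧ ∂̄g_k`. -/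
noncomputable def exprDbar (L : List ((X → ℂ) × List (X → ℂ))) (y : X) : FormFibre E :=
  (L.map fun t => dbarFun t.1 y * dbarProd t.2 y).sum

/-- On the open set `V`, the form `α` is `∑ f ∂̄g₁ ∧ ⋯ ∧ ∂̄g_k` with smooth functions. -/
structure IsExprOn (L : List ((X → ℂ) × List (X → ℂ))) (V : Set X) (α : X → FormFibre E) :
    Prop where
  isOpen : IsOpen V
  smooth : ∀ t ∈ L, ContMDiffOn 𝓘(ℝ, E) 𝓘(ℝ, ℂ) ∞ t.1 V ∧
    ∀ g ∈ t.2, ContMDiffOn 𝓘(ℝ, E) 𝓘(ℝ, ℂ) ∞ g V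
  eq : ∀ y ∈ V, α y = exprVal L y

/-- A `(0,•)`-form is smooth at `x` if near `x` it is a finite sum of forms
`f ∂̄g₁ ∧ ⋯ ∧ ∂̄g_k` with smooth functions `f, g₁, …, g_k`. -/
def SmoothFormAt (α : X → FormFibre E) (x : X) : Prop :=
  ∃ (L : List ((X → ℂ) × List (X → ℂ))) (V : Set X), x ∈ V ∧ IsExprOn L V α

open Classical in
/-- The operator `∂̄` on forms, `∂̄(f ∂̄g₁ ∧ ⋯ ∧ ∂̄g_k) = ∂̄f ∧ ∂̄g₁ ∧ ⋯ ∧ ∂̄g_k`; it does not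
depend on the local expression (`dbar_eq`).  At points where the form is not smooth it is zero. -/
noncomputable def dbar (α : X → FormFibre E) (x : X) : FormFibre E :=
  if h : SmoothFormAt α x then exprDbar h.choose x else 0

variable {L L' : List ((X → ℂ) × List (X → ℂ))} {V V' : Set X} {α β : X → FormFibre E}

theorem map_dbarProd [IsManifold 𝓘(ℂ, E) ω X] (x : X) (hV : IsOpen V) (gs : List (X → ℂ))
    (hgs : ∀ g ∈ gs, ContMDiffOn 𝓘(ℝ, E) 𝓘(ℝ, ℂ) ∞ g V) {y : X} (hy : y ∈ V)
    (hyx : y ∈ (chartAt E x).source) :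
    dbarProd (E := E) gs y = ExteriorAlgebra.map (precomp (chartDeriv x y).toLinearMap)
      (flatProd (gs.map fun g => g ∘ (chartAt E x).symm) (chartAt E x y)) := by
  induction gs with
  | nil => simp [dbarProd, flatProd]
  | cons g gs ih =>
    have h := ih fun g' hg' => hgs g' (by simp [hg'])
    simp only [dbarProd, flatProd, List.map_cons, List.prod_cons, map_mul] at h ⊢
    rw [h, dbarFun_eq x hV (hgs g (by simp)) hy hyx]

theorem expr_zero [FiniteDimensional ℂ E] [IsManifold 𝓘(ℂ, E) ω X] (h : IsExprOn (E := E) L V 0)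
    {x : X} (hx : x ∈ V) : exprDbar (E := E) L x = 0 := by
  let L₀ : List ((E → ℂ) × List (E → ℂ)) := L.map fun t =>
    (t.1 ∘ (chartAt E x).symm, t.2.map fun g => g ∘ (chartAt E x).symm)
  have h1 : ∀ y ∈ V, y ∈ (chartAt E x).source → exprVal (E := E) L y =
      ExteriorAlgebra.map (precomp (chartDeriv x y).toLinearMap)
        (L₀.map fun t => t.1 (chartAt E x y) • flatProd t.2 (chartAt E x y)).sum := by
    intro y hy hyx
    rw [exprVal, map_list_sum, List.map_map, List.map_map]
    congr 1
    refine List.map_congr_left fun t ht => ?_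
    simp only [Function.comp, map_smul]
    rw [map_dbarProd x h.isOpen t.2 (h.smooth t ht).2 hy hyx, (chartAt E x).left_inv hyx]
  have h2 : exprDbar (E := E) L x =
      ExteriorAlgebra.map (precomp (chartDeriv x x).toLinearMap)
        (L₀.map fun t => flatDbar t.1 (chartAt E x x) * flatProd t.2 (chartAt E x x)).sum := by
    rw [exprDbar, map_list_sum, List.map_map, List.map_map]
    congr 1
    refine List.map_congr_left fun t ht => ?_
    simp only [Function.comp, map_mul]
    rw [map_dbarProd x h.isOpen t.2 (h.smooth t ht).2 hx (mem_chart_source E x),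
      dbarFun_eq x h.isOpen (h.smooth t ht).1 hx (mem_chart_source E x)]
  rw [h2, flat_unique ((chartAt E x).isOpen_inter_preimage_symm h.isOpen) L₀, map_zero]
  · intro t ht
    obtain ⟨t', ht', rfl⟩ := List.mem_map.1 ht
    refine ⟨smooth_in_chart x (h.smooth t' ht').1, fun g hg => ?_⟩
    obtain ⟨g', hg', rfl⟩ := List.mem_map.1 hg
    exact smooth_in_chart x ((h.smooth t' ht').2 g' hg')
  · intro z hz
    have hs : (chartAt E x).symm z ∈ (chartAt E x).source := (chartAt E x).map_target hz.1
    refine chartDeriv_injective x hs ?_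
    have h3 := h1 _ hz.2 hs
    rw [(chartAt E x).right_inv hz.1] at h3
    rw [← h3, map_zero, ← h.eq _ hz.2]
    rfl
  · exact ⟨mem_chart_target E x, by
      simpa [(chartAt E x).left_inv (mem_chart_source E x)] using hx⟩

section functions

theorem smooth_mul {f g : X → ℂ} (hf : ContMDiffOn 𝓘(ℝ, E) 𝓘(ℝ, ℂ) ∞ f V)
    (hg : ContMDiffOn 𝓘(ℝ, E) 𝓘(ℝ, ℂ) ∞ g V) :
    ContMDiffOn 𝓘(ℝ, E) 𝓘(ℝ, ℂ) ∞ (fun y => f y * g y) V :=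
  (contDiff_mul (𝕜 := ℝ) (𝔸 := ℂ)).contMDiff.comp_contMDiffOn (hf.prodMk_space hg)

variable [IsManifold 𝓘(ℂ, E) ω X]

theorem dbarFun_flat (hV : IsOpen V) {f : X → ℂ} (hf : ContMDiffOn 𝓘(ℝ, E) 𝓘(ℝ, ℂ) ∞ f V) {y : X}
    (hy : y ∈ V) :
    dbarFun (E := E) f y = flatDbar (f ∘ (chartAt E y).symm) (chartAt E y y) ∧
      DifferentiableAt ℝ (f ∘ (chartAt E y).symm) (chartAt E y y) := by
  have hd : MDifferentiableAt 𝓘(ℝ, E) 𝓘(ℝ, ℂ) f y :=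
    ((hf y hy).contMDiffAt (hV.mem_nhds hy)).mdifferentiableAt (by simp)
  refine ⟨?_, differentiableAt_of_contDiffOn ((chartAt E y).isOpen_inter_preimage_symm hV)
    (smooth_in_chart y hf) ⟨mem_chart_target E y, by
      simpa [(chartAt E y).left_inv (mem_chart_source E y)] using hy⟩⟩
  unfold dbarFun flatDbar
  rw [← mfderiv_eq hd]

theorem dbarFun_mul (hV : IsOpen V) {f g : X → ℂ} (hf : ContMDiffOn 𝓘(ℝ, E) 𝓘(ℝ, ℂ) ∞ f V)
    (hg : ContMDiffOn 𝓘(ℝ, E) 𝓘(ℝ, ℂ) ∞ g V) {y : X} (hy : y ∈ V) :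
    dbarFun (E := E) (fun y => f y * g y) y = f y • dbarFun g y + g y • dbarFun f y := by
  obtain ⟨h1, h1'⟩ := dbarFun_flat hV hf hy
  obtain ⟨h2, h2'⟩ := dbarFun_flat hV hg hy
  have hfg : ContMDiffOn 𝓘(ℝ, E) 𝓘(ℝ, ℂ) ∞ (fun y => f y * g y) V := smooth_mul hf hg
  rw [h1, h2, (dbarFun_flat hV hfg hy).1]
  have := flatDbar_mul h1' h2'
  simp only [Function.comp, (chartAt E y).left_inv (mem_chart_source E y)] at this
  exact this

theorem dbarFun_const (c : ℂ) (y : X) : dbarFun (E := E) (fun _ : X => c) y = 0 := by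
  have h : (mfderiv 𝓘(ℝ, E) 𝓘(ℝ, ℂ) (fun _ : X => c) y : E →L[ℝ] ℂ) = 0 := mfderiv_const
  exact (congrArg (fun L : E →L[ℝ] ℂ => ExteriorAlgebra.ι ℂ (conjPart L)) h).trans
    (show ExteriorAlgebra.ι ℂ (conjPart (0 : E →L[ℝ] ℂ)) = 0 by rw [conjPart_zero, map_zero])

theorem dbarFun_const_mul (hV : IsOpen V) (c : ℂ) {g : X → ℂ}
    (hg : ContMDiffOn 𝓘(ℝ, E) 𝓘(ℝ, ℂ) ∞ g V) {y : X} (hy : y ∈ V) :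
    dbarFun (E := E) (fun y => c * g y) y = c • dbarFun g y := by
  rw [dbarFun_mul hV contMDiffOn_const hg hy, dbarFun_const, smul_zero, add_zero]

end functions

end forms

section forms

variable {E : Type u} [NormedAddCommGroup E] [NormedSpace ℂ E] {X : Type v} [TopologicalSpace X]
  [ChartedSpace E X]
variable {L L' : List ((X → ℂ) × List (X → ℂ))} {V V' : Set X} {α β : X → FormFibre E}

theorem dbarProd_nil (y : X) : dbarProd (E := E) [] y = 1 := rfl

theorem dbarProd_cons (g : X → ℂ) (gs : List (X → ℂ)) (y : X) :
    dbarProd (E := E) (g :: gs) y = dbarFun g y * dbarProd gs y := by simp [dbarProd]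

theorem dbarProd_append (gs gs' : List (X → ℂ)) (y : X) :
    dbarProd (E := E) (gs ++ gs') y = dbarProd gs y * dbarProd gs' y := by simp [dbarProd]

theorem exprVal_cons (t : (X → ℂ) × List (X → ℂ)) (y : X) :
    exprVal (E := E) (t :: L) y = t.1 y • dbarProd t.2 y + exprVal L y := by simp [exprVal]

theorem exprDbar_cons (t : (X → ℂ) × List (X → ℂ)) (y : X) :
    exprDbar (E := E) (t :: L) y = dbarFun t.1 y * dbarProd t.2 y + exprDbar L y := by
  simp [exprDbar]

theorem exprVal_append (y : X) :
    exprVal (E := E) (L ++ L') y = exprVal L y + exprVal L' y := by simp [exprVal]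

theorem exprDbar_append (y : X) :
    exprDbar (E := E) (L ++ L') y = exprDbar L y + exprDbar L' y := by simp [exprDbar]

theorem IsExprOn.congr (h : IsExprOn L V α) (hV' : IsOpen V') (hs : V' ⊆ V)
    (he : ∀ y ∈ V', β y = α y) : IsExprOn L V' β where
  isOpen := hV'
  smooth t ht := ⟨(h.smooth t ht).1.mono hs, fun g hg => ((h.smooth t ht).2 g hg).mono hs⟩
  eq y hy := (he y hy).trans (h.eq y (hs hy))

theorem IsExprOn.add (h : IsExprOn L V α) (h' : IsExprOn L' V β) :
    IsExprOn (L ++ L') V (fun y => α y + β y) where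
  isOpen := h.isOpen
  smooth t ht := (List.mem_append.1 ht).elim (h.smooth t) (h'.smooth t)
  eq y hy := by rw [exprVal_append, h.eq y hy, h'.eq y hy]

/-- Multiplication of an expression by a constant. -/
def smulExpr (c : ℂ) (L : List ((X → ℂ) × List (X → ℂ))) : List ((X → ℂ) × List (X → ℂ)) :=
  L.map fun t => (fun y => c * t.1 y, t.2)

theorem exprVal_smul (c : ℂ) (y : X) :
    exprVal (E := E) (smulExpr c L) y = c • exprVal L y := by
  induction L with
  | nil => simp [smulExpr, exprVal]
  | cons t L ih =>
    rw [smulExpr, List.map_cons, exprVal_cons, ← smulExpr, ih, exprVal_cons, smul_add, smul_smul]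

theorem IsExprOn.smul (c : ℂ) (h : IsExprOn L V α) : IsExprOn (smulExpr c L) V (fun y => c • α y) where
  isOpen := h.isOpen
  smooth t ht := by
    obtain ⟨t', ht', rfl⟩ := List.mem_map.1 ht
    exact ⟨smooth_mul contMDiffOn_const (h.smooth t' ht').1, (h.smooth t' ht').2⟩
  eq y hy := by rw [exprVal_smul, h.eq y hy]

/-- The product of two expressions. -/
def mulExpr (L L' : List ((X → ℂ) × List (X → ℂ))) : List ((X → ℂ) × List (X → ℂ)) :=
  L.flatMap fun t => L'.map fun t' => (fun y => t.1 y * t'.1 y, t.2 ++ t'.2)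

theorem mulExpr_cons (t : (X → ℂ) × List (X → ℂ)) :
    mulExpr (t :: L) L' =
      (L'.map fun t' => (fun y => t.1 y * t'.1 y, t.2 ++ t'.2)) ++ mulExpr L L' := by
  simp [mulExpr]

theorem exprVal_mul_term (t : (X → ℂ) × List (X → ℂ)) (y : X) :
    exprVal (E := E) (L'.map fun t' => (fun y => t.1 y * t'.1 y, t.2 ++ t'.2)) y =
      t.1 y • dbarProd t.2 y * exprVal L' y := by
  induction L' with
  | nil => simp [exprVal]
  | cons t' L' ih =>
    rw [List.map_cons, exprVal_cons, ih, exprVal_cons, mul_add, dbarProd_append, smul_mul_smul_comm]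

theorem exprVal_mul (y : X) :
    exprVal (E := E) (mulExpr L L') y = exprVal L y * exprVal L' y := by
  induction L with
  | nil => simp [mulExpr, exprVal]
  | cons t L ih =>
    rw [mulExpr_cons, exprVal_append, ih, exprVal_cons, add_mul, exprVal_mul_term]

theorem IsExprOn.mul (h : IsExprOn L V α) (h' : IsExprOn L' V β) :
    IsExprOn (mulExpr L L') V (fun y => α y * β y) where
  isOpen := h.isOpen
  smooth t ht := by
    obtain ⟨s, hs, ht⟩ := List.mem_flatMap.1 ht
    obtain ⟨s', hs', rfl⟩ := List.mem_map.1 ht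
    refine ⟨smooth_mul (h.smooth s hs).1 (h'.smooth s' hs').1, fun g hg => ?_⟩
    exact (List.mem_append.1 hg).elim ((h.smooth s hs).2 g) ((h'.smooth s' hs').2 g)
  eq y hy := by rw [exprVal_mul, h.eq y hy, h'.eq y hy]

theorem involute_dbarFun (f : X → ℂ) (y : X) :
    CliffordAlgebra.involute (dbarFun (E := E) f y) = -dbarFun f y :=
  CliffordAlgebra.involute_ι _

theorem dbarFun_anticomm (f g : X → ℂ) (y : X) :
    dbarFun (E := E) f y * dbarFun g y = -(dbarFun g y * dbarFun f y) :=
  eq_neg_of_add_eq_zero_left (ExteriorAlgebra.ι_add_mul_swap _ _)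

theorem dbarFun_mul_dbarProd (f : X → ℂ) (gs : List (X → ℂ)) (y : X) :
    dbarFun (E := E) f y * dbarProd gs y =
      CliffordAlgebra.involute (dbarProd (E := E) gs y) * dbarFun f y := by
  induction gs with
  | nil => rw [dbarProd_nil, map_one, mul_one, one_mul]
  | cons g gs ih =>
    rw [dbarProd_cons, map_mul, involute_dbarFun, ← mul_assoc, dbarFun_anticomm, neg_mul, mul_assoc,
      ih, neg_mul, neg_mul, mul_assoc]

section dbar

variable [IsManifold 𝓘(ℂ, E) ω X]

/-- The functions of an expression are smooth on `V`. -/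
def SmoothExpr (E : Type u) [NormedAddCommGroup E] [NormedSpace ℂ E] [ChartedSpace E X]
    (L : List ((X → ℂ) × List (X → ℂ))) (V : Set X) : Prop :=
  ∀ t ∈ L, ContMDiffOn 𝓘(ℝ, E) 𝓘(ℝ, ℂ) ∞ t.1 V

theorem IsExprOn.smoothExpr (h : IsExprOn L V α) : SmoothExpr E L V := fun t ht => (h.smooth t ht).1

theorem exprDbar_smul (c : ℂ) (hV : IsOpen V) (h : SmoothExpr E L V) {y : X} (hy : y ∈ V) :
    exprDbar (E := E) (smulExpr c L) y = c • exprDbar L y := by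
  induction L with
  | nil => simp [smulExpr, exprDbar]
  | cons t L ih =>
    rw [smulExpr, List.map_cons, exprDbar_cons, ← smulExpr, ih fun s hs => h s (by simp [hs]),
      exprDbar_cons, smul_add, dbarFun_const_mul hV c (h t (by simp)) hy, smul_mul_assoc]

theorem exprDbar_mul_term (hV : IsOpen V) {t : (X → ℂ) × List (X → ℂ)}
    (ht : ContMDiffOn 𝓘(ℝ, E) 𝓘(ℝ, ℂ) ∞ t.1 V) (h' : SmoothExpr E L' V) {y : X} (hy : y ∈ V) :
    exprDbar (E := E) (L'.map fun t' => (fun y => t.1 y * t'.1 y, t.2 ++ t'.2)) y =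
      dbarFun t.1 y * dbarProd t.2 y * exprVal L' y +
        CliffordAlgebra.involute (t.1 y • dbarProd (E := E) t.2 y) * exprDbar L' y := by
  induction L' with
  | nil => simp [exprVal, exprDbar]
  | cons t' L' ih =>
    rw [List.map_cons, exprDbar_cons, ih fun s hs => h' s (by simp [hs]), exprVal_cons,
      exprDbar_cons, dbarProd_append]
    dsimp only
    rw [dbarFun_mul hV ht (h' t' (by simp)) hy, add_mul, smul_mul_assoc, smul_mul_assoc,
      ← mul_assoc (dbarFun t'.1 y), dbarFun_mul_dbarProd, map_smul, mul_add, mul_add,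
      mul_smul_comm, smul_mul_assoc, smul_mul_assoc]
    simp only [mul_assoc]
    abel

theorem exprDbar_mul (hV : IsOpen V) (h : SmoothExpr E L V) (h' : SmoothExpr E L' V) {y : X}
    (hy : y ∈ V) :
    exprDbar (E := E) (mulExpr L L') y = exprDbar L y * exprVal L' y +
      CliffordAlgebra.involute (exprVal (E := E) L y) * exprDbar L' y := by
  induction L with
  | nil => simp [mulExpr, exprVal, exprDbar]
  | cons t L ih =>
    rw [mulExpr_cons, exprDbar_append, ih fun s hs => h s (by simp [hs]),
      exprDbar_mul_term hV (h t (by simp)) h' hy, exprVal_cons, exprDbar_cons, map_add, add_mul,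
      add_mul]
    abel

/-- The expression `∑ ∂̄f ∧ ∂̄g₁ ∧ ⋯ ∧ ∂̄g_k`. -/
def dExpr (L : List ((X → ℂ) × List (X → ℂ))) : List ((X → ℂ) × List (X → ℂ)) :=
  L.map fun t => (fun _ => 1, t.1 :: t.2)

theorem exprVal_dExpr (y : X) : exprVal (E := E) (dExpr L) y = exprDbar L y := by
  induction L with
  | nil => rfl
  | cons t L ih =>
    rw [dExpr, List.map_cons, exprVal_cons, ← dExpr, ih, exprDbar_cons, one_smul, dbarProd_cons]

theorem exprDbar_dExpr (y : X) : exprDbar (E := E) (dExpr L) y = 0 := by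
  induction L with
  | nil => rfl
  | cons t L ih =>
    rw [dExpr, List.map_cons, exprDbar_cons, ← dExpr, ih, dbarFun_const, zero_mul, zero_add]

variable [FiniteDimensional ℂ E]

theorem dbar_eq (h : IsExprOn L V α) {x : X} (hx : x ∈ V) : dbar α x = exprDbar L x := by
  have hs : SmoothFormAt α x := ⟨L, V, hx, h⟩
  unfold dbar
  rw [dif_pos hs]
  obtain ⟨W, hW, h'⟩ := hs.choose_spec
  have ho : IsOpen (V ∩ W) := h.isOpen.inter h'.isOpen
  have h1 : IsExprOn hs.choose (V ∩ W) α := h'.congr ho Set.inter_subset_right fun _ _ => rfl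
  have h2 : IsExprOn L (V ∩ W) α := h.congr ho Set.inter_subset_left fun _ _ => rfl
  have h3 := (h1.add (h2.smul (-1))).congr (β := 0) ho subset_rfl fun y _ => by simp
  have h4 := expr_zero h3 ⟨hx, hW⟩
  rw [exprDbar_append, exprDbar_smul _ ho h2.smoothExpr ⟨hx, hW⟩, neg_one_smul] at h4
  exact add_neg_eq_zero.1 h4

theorem IsExprOn.dbar (h : IsExprOn L V α) : IsExprOn (dExpr L) V (dbar α) where
  isOpen := h.isOpen
  smooth t ht := by
    obtain ⟨s, hs, rfl⟩ := List.mem_map.1 ht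
    refine ⟨contMDiffOn_const, fun g hg => ?_⟩
    rcases List.mem_cons.1 hg with rfl | hg
    · exact (h.smooth s hs).1
    · exact (h.smooth s hs).2 g hg
  eq y hy := by rw [dbar_eq h hy, exprVal_dExpr]

theorem SmoothFormAt.congr {x : X} (h : SmoothFormAt α x) (he : β =ᶠ[nhds x] α) :
    SmoothFormAt β x := by
  obtain ⟨L, V, hx, h⟩ := h
  obtain ⟨W, hW, ho, hxW⟩ := mem_nhds_iff.1 he
  exact ⟨L, V ∩ W, ⟨hx, hxW⟩, h.congr (h.isOpen.inter ho) Set.inter_subset_left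
    fun y hy => hW hy.2⟩

theorem dbar_congr {x : X} (he : β =ᶠ[nhds x] α) : dbar β x = dbar α x := by
  by_cases h : SmoothFormAt α x
  · obtain ⟨L, V, hx, h⟩ := h
    obtain ⟨W, hW, ho, hxW⟩ := mem_nhds_iff.1 he
    rw [dbar_eq h hx, dbar_eq (h.congr (h.isOpen.inter ho) Set.inter_subset_left
      fun y hy => hW hy.2) ⟨hx, hxW⟩]
  · have h' : ¬SmoothFormAt β x := fun hb => h (hb.congr he.symm)
    unfold dbar
    rw [dif_neg h, dif_neg h']

theorem SmoothFormAt.pair {x : X} (h : SmoothFormAt α x) (h' : SmoothFormAt β x) :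
    ∃ L L' V, x ∈ V ∧ IsExprOn L V α ∧ IsExprOn L' V β := by
  obtain ⟨L, V, hx, h⟩ := h
  obtain ⟨L', W, hx', h'⟩ := h'
  have ho : IsOpen (V ∩ W) := h.isOpen.inter h'.isOpen
  exact ⟨L, L', V ∩ W, ⟨hx, hx'⟩, h.congr ho Set.inter_subset_left fun _ _ => rfl,
    h'.congr ho Set.inter_subset_right fun _ _ => rfl⟩

theorem SmoothFormAt.add {x : X} (h : SmoothFormAt α x) (h' : SmoothFormAt β x) :
    SmoothFormAt (fun y => α y + β y) x := by
  obtain ⟨L, L', V, hx, h, h'⟩ := h.pair h'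
  exact ⟨_, V, hx, h.add h'⟩

theorem SmoothFormAt.mul {x : X} (h : SmoothFormAt α x) (h' : SmoothFormAt β x) :
    SmoothFormAt (fun y => α y * β y) x := by
  obtain ⟨L, L', V, hx, h, h'⟩ := h.pair h'
  exact ⟨_, V, hx, h.mul h'⟩

theorem SmoothFormAt.algebraMap (c : ℂ) (x : X) :
    SmoothFormAt (fun _ => algebraMap ℂ (FormFibre E) c) x :=
  ⟨[(fun _ => c, [])], Set.univ, trivial, isOpen_univ, by
    intro t ht
    rw [List.mem_singleton] at ht
    subst ht
    exact ⟨contMDiffOn_const, by simp⟩, fun y _ => by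
    simp [exprVal, dbarProd_nil, Algebra.algebraMap_eq_smul_one]⟩

theorem SmoothFormAt.dbar {x : X} (h : SmoothFormAt α x) : SmoothFormAt (dbar α) x := by
  obtain ⟨L, V, hx, h⟩ := h
  exact ⟨_, V, hx, h.dbar⟩

theorem dbar_add {x : X} (h : SmoothFormAt α x) (h' : SmoothFormAt β x) :
    dbar (fun y => α y + β y) x = dbar α x + dbar β x := by
  obtain ⟨L, L', V, hx, h, h'⟩ := h.pair h'
  rw [dbar_eq (h.add h') hx, dbar_eq h hx, dbar_eq h' hx, exprDbar_append]

theorem dbar_smul (c : ℂ) {x : X} (h : SmoothFormAt α x) :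
    dbar (fun y => c • α y) x = c • dbar α x := by
  obtain ⟨L, V, hx, h⟩ := h
  rw [dbar_eq (h.smul c) hx, dbar_eq h hx, exprDbar_smul c h.isOpen h.smoothExpr hx]

theorem dbar_mul {x : X} (h : SmoothFormAt α x) (h' : SmoothFormAt β x) :
    dbar (fun y => α y * β y) x =
      dbar α x * β x + CliffordAlgebra.involute (α x) * dbar β x := by
  obtain ⟨L, L', V, hx, h, h'⟩ := h.pair h'
  rw [dbar_eq (h.mul h') hx, dbar_eq h hx, dbar_eq h' hx,
    exprDbar_mul h.isOpen h.smoothExpr h'.smoothExpr hx, h.eq x hx, h'.eq x hx]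

theorem dbar_dbar {x : X} (h : SmoothFormAt α x) : dbar (dbar α) x = 0 := by
  obtain ⟨L, V, hx, h⟩ := h
  rw [dbar_eq h.dbar hx, exprDbar_dExpr]

end dbar

section grading

theorem dbarProd_mem (gs : List (X → ℂ)) (y : X) :
    dbarProd (E := E) gs y ∈ ⋀[ℂ]^gs.length (E →ₗ⋆[ℂ] ℂ) := by
  induction gs with
  | nil => rw [dbarProd_nil]; exact SetLike.GradedOne.one_mem
  | cons g gs ih =>
    rw [dbarProd_cons, List.length_cons, add_comm]
    refine SetLike.GradedMul.mul_mem ?_ ih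
    change _ ∈ LinearMap.range (ExteriorAlgebra.ι ℂ) ^ 1
    rw [pow_one]
    exact ⟨_, rfl⟩

theorem involute_of_mem {i : ℕ} {a : FormFibre E} (ha : a ∈ ⋀[ℂ]^i (E →ₗ⋆[ℂ] ℂ)) :
    CliffordAlgebra.involute a = (-1 : ℤ) ^ i • a := by
  induction ha using Submodule.pow_induction_on_left' with
  | algebraMap r => simp
  | add x y i hx hy ihx ihy => rw [map_add, ihx, ihy, smul_add]
  | mem_mul m hm i x hx ih =>
    obtain ⟨w, rfl⟩ := hm
    have h : CliffordAlgebra.involute (ExteriorAlgebra.ι ℂ w) = -ExteriorAlgebra.ι ℂ w :=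
      CliffordAlgebra.involute_ι w
    rw [map_mul, ih, h, pow_succ, mul_neg_one, neg_smul, mul_smul_comm, neg_mul, smul_neg]

/-- The component of degree `i` of an element of the exterior algebra. -/
noncomputable def formComp (i : ℕ) : FormFibre E →ₗ[ℂ] FormFibre E :=
  GradedAlgebra.proj (fun i : ℕ => ⋀[ℂ]^i (E →ₗ⋆[ℂ] ℂ)) i

theorem formComp_mem (i : ℕ) (a : FormFibre E) : formComp i a ∈ ⋀[ℂ]^i (E →ₗ⋆[ℂ] ℂ) :=
  SetLike.coe_mem _

theorem formComp_same {i : ℕ} {a : FormFibre E} (ha : a ∈ ⋀[ℂ]^i (E →ₗ⋆[ℂ] ℂ)) : formComp i a = a :=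
  DirectSum.decompose_of_mem_same (fun i : ℕ => ⋀[ℂ]^i (E →ₗ⋆[ℂ] ℂ)) ha

theorem formComp_ne {i j : ℕ} {a : FormFibre E} (ha : a ∈ ⋀[ℂ]^j (E →ₗ⋆[ℂ] ℂ)) (h : j ≠ i) :
    formComp i a = 0 :=
  DirectSum.decompose_of_mem_ne (fun i : ℕ => ⋀[ℂ]^i (E →ₗ⋆[ℂ] ℂ)) ha h

theorem finite_conj [FiniteDimensional ℂ E] : Module.Finite ℂ (E →ₗ⋆[ℂ] ℂ) := by
  let b := Module.finBasis ℂ E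
  let T : (E →ₗ⋆[ℂ] ℂ) →ₗ[ℂ] (Fin (Module.finrank ℂ E) → ℂ) :=
    { toFun := fun w j => w (b j), map_add' := fun _ _ => rfl, map_smul' := fun _ _ => rfl }
  exact Module.Finite.of_injective T fun w w' h => b.ext fun j => congrFun h j

theorem formComp_eq_zero [FiniteDimensional ℂ E] {i : ℕ}
    (hi : Module.finrank ℂ (E →ₗ⋆[ℂ] ℂ) < i) (a : FormFibre E) : formComp i a = 0 := by
  have := finite_conj (E := E)
  have h : Module.finrank ℂ (⋀[ℂ]^i (E →ₗ⋆[ℂ] ℂ)) = 0 := by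
    rw [exteriorPower.finrank_eq, Nat.choose_eq_zero_of_lt hi]
  have h' := Module.finrank_zero_iff.1 h
  exact congrArg Subtype.val (Subsingleton.elim (⟨formComp i a, formComp_mem i a⟩ : ⋀[ℂ]^i (E →ₗ⋆[ℂ] ℂ)) 0)

theorem sum_formComp [FiniteDimensional ℂ E] (a : FormFibre E) :
    ∑ i ∈ Finset.range (Module.finrank ℂ (E →ₗ⋆[ℂ] ℂ) + 1), formComp i a = a := by
  classical
  conv_rhs => rw [← DirectSum.sum_support_decompose (fun i : ℕ => ⋀[ℂ]^i (E →ₗ⋆[ℂ] ℂ)) a]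
  symm
  refine Finset.sum_subset (fun i hi => ?_) (fun i _ hi => ?_)
  · by_contra h
    have h2 : (DirectSum.decompose (fun i : ℕ => ⋀[ℂ]^i (E →ₗ⋆[ℂ] ℂ)) a) i = 0 :=
      Subtype.ext (formComp_eq_zero (by simpa [Nat.lt_succ_iff] using h) a)
    exact DFinsupp.mem_support_iff.1 hi h2
  · have h2 : (DirectSum.decompose (fun i : ℕ => ⋀[ℂ]^i (E →ₗ⋆[ℂ] ℂ)) a) i = 0 := by
      simpa using hi
    exact congrArg Subtype.val h2

/-- The terms of degree `i` of an expression. -/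
def compExpr (i : ℕ) (L : List ((X → ℂ) × List (X → ℂ))) : List ((X → ℂ) × List (X → ℂ)) :=
  L.filter fun t => t.2.length = i

theorem exprVal_comp (i : ℕ) (y : X) :
    exprVal (E := E) (compExpr i L) y = formComp i (exprVal L y) := by
  induction L with
  | nil => simp [compExpr, exprVal]
  | cons t L ih =>
    have hm := dbarProd_mem (E := E) t.2 y
    rw [exprVal_cons, map_add, map_smul, ← ih, compExpr]
    by_cases h : t.2.length = i
    · rw [List.filter_cons_of_pos (by simpa using h), exprVal_cons, formComp_same (h ▸ hm)]
      rfl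
    · rw [List.filter_cons_of_neg (by simpa using h), formComp_ne hm h, smul_zero, zero_add]
      rfl

theorem IsExprOn.comp (i : ℕ) (h : IsExprOn L V α) :
    IsExprOn (compExpr i L) V (fun y => formComp i (α y)) where
  isOpen := h.isOpen
  smooth t ht := h.smooth t (List.mem_filter.1 ht).1
  eq y hy := by rw [exprVal_comp, h.eq y hy]

theorem exprDbar_compExpr_mem (i : ℕ) (y : X) :
    exprDbar (E := E) (compExpr i L) y ∈ ⋀[ℂ]^(i + 1) (E →ₗ⋆[ℂ] ℂ) := by
  refine list_sum_mem fun a ha => ?_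
  obtain ⟨t, ht, rfl⟩ := List.mem_map.1 ha
  have h : t.2.length = i := by simpa using (List.mem_filter.1 ht).2
  rw [← dbarProd_cons]
  have := dbarProd_mem (E := E) (t.1 :: t.2) y
  rwa [List.length_cons, h] at this

theorem SmoothFormAt.comp (i : ℕ) {x : X} (h : SmoothFormAt α x) :
    SmoothFormAt (fun y => formComp i (α y)) x := by
  obtain ⟨L, V, hx, h⟩ := h
  exact ⟨_, V, hx, h.comp i⟩

theorem dbar_mem [IsManifold 𝓘(ℂ, E) ω X] [FiniteDimensional ℂ E] {i : ℕ} {x : X}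
    (h : SmoothFormAt α x) (hα : ∀ᶠ y in nhds x, α y ∈ ⋀[ℂ]^i (E →ₗ⋆[ℂ] ℂ)) :
    dbar α x ∈ ⋀[ℂ]^(i + 1) (E →ₗ⋆[ℂ] ℂ) := by
  have he : α =ᶠ[nhds x] fun y => formComp i (α y) := hα.mono fun y hy => (formComp_same hy).symm
  obtain ⟨L, V, hx, h⟩ := h
  rw [dbar_congr he, dbar_eq (h.comp i) hx]
  exact exprDbar_compExpr_mem i x

end grading

end forms

section general

variable {A : Type u} [Ring A] [Algebra ℂ A]

/-- The degree zero part of a graded algebra, as a subalgebra. -/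
def zeroPart (gr : ℕ → Submodule ℂ A) (one_mem : (1 : A) ∈ gr 0)
    (mul_mem : ∀ {i j : ℕ} {a b : A}, a ∈ gr i → b ∈ gr j → a * b ∈ gr (i + j)) :
    Subalgebra ℂ A where
  carrier := gr 0
  mul_mem' ha hb := mul_mem ha hb
  add_mem' ha hb := add_mem ha hb
  algebraMap_mem' c := by
    rw [Algebra.algebraMap_eq_smul_one]
    exact (gr 0).smul_mem c one_mem

/-- The dg-algebra given by a graded algebra with central degree zero part and a differential. -/
def DGAlg.ofGraded (A : Type u) [Ring A] [Algebra ℂ A] (gr : ℕ → Submodule ℂ A)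
    (one_mem : (1 : A) ∈ gr 0)
    (mul_mem : ∀ {i j : ℕ} {a b : A}, a ∈ gr i → b ∈ gr j → a * b ∈ gr (i + j))
    (internal : DirectSum.IsInternal gr) (central : ∀ a b : A, a ∈ gr 0 → a * b = b * a)
    (d : A →ₗ[ℂ] A) (d_mem : ∀ {i : ℕ} {a : A}, a ∈ gr i → d a ∈ gr (i + 1))
    (d_mul : ∀ {i : ℕ} {a : A} (b : A), a ∈ gr i →
      d (a * b) = d a * b + (-1 : ℤ) ^ i • (a * d b))
    (d_d : ∀ a : A, d (d a) = 0) : DGAlg.{u} :=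
  letI : CommRing (zeroPart gr one_mem mul_mem) :=
    { (inferInstance : Ring (zeroPart gr one_mem mul_mem)) with
      mul_comm := fun a b => Subtype.ext (central a b a.2) }
  { A := A
    Z := zeroPart gr one_mem mul_mem
    zeroAlgebra :=
      { smul := fun z a => z.1 * a
        algebraMap := (zeroPart gr one_mem mul_mem).val.toRingHom
        commutes' := fun z a => central z a z.2
        smul_def' := fun _ _ => rfl }
    gr := gr
    one_mem := one_mem
    mul_mem := mul_mem
    internal := internal
    zero_injective := Subtype.val_injective
    mem_gr_zero := fun a => ⟨fun h => ⟨⟨a, h⟩, rfl⟩, fun ⟨z, hz⟩ => hz ▸ z.2⟩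
    d := d
    d_mem := d_mem
    d_mul := d_mul
    d_d := d_d }

theorem isInternal_of_proj (gr : ℕ → Submodule ℂ A) (π : ℕ → A →+ A)
    (h1 : ∀ i a, π i a ∈ gr i) (h2 : ∀ i a, a ∈ gr i → π i a = a)
    (h3 : ∀ i j a, a ∈ gr j → j ≠ i → π i a = 0)
    (N : ℕ) (h4 : ∀ a, ∑ i ∈ Finset.range N, π i a = a) : DirectSum.IsInternal gr := by
  constructor
  · have key : ∀ (i : ℕ) (x : DirectSum ℕ fun i => gr i),
        π i (DirectSum.coeAddMonoidHom gr x) = x i := by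
      intro i x
      induction x using DirectSum.induction_on with
      | zero => simp
      | of j a =>
        rw [DirectSum.coeAddMonoidHom_of]
        by_cases h : j = i
        · subst h
          rw [DirectSum.of_eq_same, h2 _ _ a.2]
        · rw [h3 i j _ a.2 h, DirectSum.of_eq_of_ne _ _ _ (Ne.symm h)]
          rfl
      | add x y hx hy => rw [map_add, map_add, hx, hy]; rfl
    intro x y hxy
    refine DFinsupp.ext fun i => Subtype.ext ?_
    rw [← key, ← key, hxy]
  · intro a
    refine ⟨∑ i ∈ Finset.range N, DirectSum.of (fun i => gr i) i ⟨π i a, h1 i a⟩, ?_⟩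
    rw [map_sum]
    conv_rhs => rw [← h4 a]
    exact Finset.sum_congr rfl fun i _ => DirectSum.coeAddMonoidHom_of _ _ _

end general

/-- Germs of functions with values in an algebra form an algebra. -/
instance germAlgebra {X : Type v} (l : Filter X) {B : Type u} [Ring B] [Algebra ℂ B] :
    Algebra ℂ (Filter.Germ l B) :=
  Algebra.ofModule
    (fun c a b => Filter.Germ.inductionOn₂ a b fun f g =>
      congrArg (Filter.Germ.ofFun (l := l)) (smul_mul_assoc c f g))
    (fun c a b => Filter.Germ.inductionOn₂ a b fun f g =>
      congrArg (Filter.Germ.ofFun (l := l)) (mul_smul_comm c f g))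

section dolbeault

variable (E : Type u) [NormedAddCommGroup E] [NormedSpace ℂ E] [FiniteDimensional ℂ E]
  {X : Type v} [TopologicalSpace X] [ChartedSpace E X] [IsManifold 𝓘(ℂ, E) ω X]

/-- The algebra of germs along `K` of smooth `(0,•)`-forms defined near `K`. -/
def smoothForms (K : Set X) : Subalgebra ℂ (Filter.Germ (nhdsSet K) (FormFibre E)) where
  carrier := {a | ∃ α : X → FormFibre E, (∀ x ∈ K, SmoothFormAt α x) ∧ Filter.Germ.ofFun α = a}
  mul_mem' := by
    rintro _ _ ⟨α, hα, rfl⟩ ⟨β, hβ, rfl⟩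
    exact ⟨fun y => α y * β y, fun x hx => (hα x hx).mul (hβ x hx), rfl⟩
  add_mem' := by
    rintro _ _ ⟨α, hα, rfl⟩ ⟨β, hβ, rfl⟩
    exact ⟨fun y => α y + β y, fun x hx => (hα x hx).add (hβ x hx), rfl⟩
  algebraMap_mem' c := ⟨fun _ => algebraMap ℂ (FormFibre E) c,
    fun x _ => SmoothFormAt.algebraMap c x, by
      rw [Algebra.algebraMap_eq_smul_one, Algebra.algebraMap_eq_smul_one]; rfl⟩

variable {E} {K : Set X}

/-- The germ along `K` of a form. -/
def formGerm (α : X → FormFibre E) (h : ∀ x ∈ K, SmoothFormAt α x) : smoothForms E K :=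
  ⟨Filter.Germ.ofFun α, α, h, rfl⟩

theorem formGerm_surj (a : smoothForms E K) : ∃ α h, a = formGerm α h := by
  obtain ⟨_, α, h, rfl⟩ := a
  exact ⟨α, h, rfl⟩

theorem formGerm_congr {α β : X → FormFibre E} {h : ∀ x ∈ K, SmoothFormAt α x}
    {h' : ∀ x ∈ K, SmoothFormAt β x} (he : α =ᶠ[nhdsSet K] β) : formGerm α h = formGerm β h' :=
  Subtype.ext (Filter.Germ.coe_eq.2 he)

theorem SmoothFormAt.eventually {α : X → FormFibre E} (h : ∀ x ∈ K, SmoothFormAt α x) :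
    ∀ᶠ x in nhdsSet K, SmoothFormAt α x := by
  refine eventually_nhdsSet_iff_forall.2 fun x hx => ?_
  obtain ⟨L, V, hxV, hL⟩ := h x hx
  filter_upwards [hL.isOpen.mem_nhds hxV] with y hy
  exact ⟨L, V, hy, hL⟩

theorem dbar_germ : Relator.LiftFun (nhdsSet K).EventuallyEq (nhdsSet K).EventuallyEq
    (dbar (E := E) (X := X)) dbar := by
  intro α β h
  filter_upwards [h.eventually_nhdsSet] with x hx
  exact dbar_congr hx

variable (E K)

/-- The operator `∂̄` on germs of forms. -/
noncomputable def germDbar : smoothForms E K →ₗ[ℂ] smoothForms E K where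
  toFun a := ⟨Filter.Germ.map' dbar dbar_germ a.1, by
    obtain ⟨α, h, rfl⟩ := formGerm_surj a
    exact ⟨dbar α, fun x hx => (h x hx).dbar, rfl⟩⟩
  map_add' a b := by
    obtain ⟨α, h, rfl⟩ := formGerm_surj a
    obtain ⟨β, h', rfl⟩ := formGerm_surj b
    refine Subtype.ext (Filter.Germ.coe_eq.2 ?_)
    filter_upwards [SmoothFormAt.eventually h, SmoothFormAt.eventually h'] with x hx hx'
    exact dbar_add hx hx'
  map_smul' c a := by
    obtain ⟨α, h, rfl⟩ := formGerm_surj a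
    refine Subtype.ext (Filter.Germ.coe_eq.2 ?_)
    filter_upwards [SmoothFormAt.eventually h] with x hx
    exact dbar_smul c hx

/-- The germs of forms of degree `(0,i)`. -/
def germGr (i : ℕ) : Submodule ℂ (smoothForms E K) where
  carrier := {a | a.1.LiftPred (· ∈ ⋀[ℂ]^i (E →ₗ⋆[ℂ] ℂ))}
  zero_mem' := show ∀ᶠ _ in nhdsSet K, (0 : FormFibre E) ∈ ⋀[ℂ]^i (E →ₗ⋆[ℂ] ℂ) from
    Filter.Eventually.of_forall fun _ => zero_mem _
  add_mem' := by
    intro a b ha hb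
    obtain ⟨α, h, rfl⟩ := formGerm_surj a
    obtain ⟨β, h', rfl⟩ := formGerm_surj b
    have ha' : ∀ᶠ x in nhdsSet K, α x ∈ ⋀[ℂ]^i (E →ₗ⋆[ℂ] ℂ) := ha
    have hb' : ∀ᶠ x in nhdsSet K, β x ∈ ⋀[ℂ]^i (E →ₗ⋆[ℂ] ℂ) := hb
    change ∀ᶠ x in nhdsSet K, α x + β x ∈ ⋀[ℂ]^i (E →ₗ⋆[ℂ] ℂ)
    filter_upwards [ha', hb'] with x hx hx'
    exact add_mem hx hx'
  smul_mem' := by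
    intro c a ha
    obtain ⟨α, h, rfl⟩ := formGerm_surj a
    have ha' : ∀ᶠ x in nhdsSet K, α x ∈ ⋀[ℂ]^i (E →ₗ⋆[ℂ] ℂ) := ha
    change ∀ᶠ x in nhdsSet K, c • α x ∈ ⋀[ℂ]^i (E →ₗ⋆[ℂ] ℂ)
    filter_upwards [ha'] with x hx
    exact Submodule.smul_mem _ c hx

variable {E K}

theorem mem_germGr {i : ℕ} {α : X → FormFibre E} {h : ∀ x ∈ K, SmoothFormAt α x} :
    formGerm α h ∈ germGr E K i ↔ ∀ᶠ x in nhdsSet K, α x ∈ ⋀[ℂ]^i (E →ₗ⋆[ℂ] ℂ) := Iff.rfl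

/-- The component of degree `(0,i)` of a germ of forms. -/
noncomputable def germComp (i : ℕ) : smoothForms E K →+ smoothForms E K where
  toFun a := ⟨a.1.map (formComp i), by
    obtain ⟨α, h, rfl⟩ := formGerm_surj a
    exact ⟨fun y => formComp i (α y), fun x hx => (h x hx).comp i, rfl⟩⟩
  map_zero' := Subtype.ext (congrArg (Filter.Germ.ofFun (l := nhdsSet K))
    (funext fun _ => map_zero (formComp (E := E) i)))
  map_add' a b := by
    obtain ⟨α, h, rfl⟩ := formGerm_surj a
    obtain ⟨β, h', rfl⟩ := formGerm_surj b
    exact Subtype.ext (congrArg (Filter.Germ.ofFun (l := nhdsSet K))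
      (funext fun y => map_add (formComp (E := E) i) (α y) (β y)))

theorem germGr_internal : DirectSum.IsInternal (germGr E K) := by
  refine isInternal_of_proj _ germComp ?_ ?_ ?_ (Module.finrank ℂ (E →ₗ⋆[ℂ] ℂ) + 1) ?_
  · intro i a
    obtain ⟨α, h, rfl⟩ := formGerm_surj a
    exact show ∀ᶠ x in nhdsSet K, formComp i (α x) ∈ ⋀[ℂ]^i (E →ₗ⋆[ℂ] ℂ) from
      Filter.Eventually.of_forall fun x => formComp_mem i (α x)
  · intro i a ha
    obtain ⟨α, h, rfl⟩ := formGerm_surj a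
    exact Subtype.ext (Filter.Germ.coe_eq.2 ((mem_germGr.1 ha).mono fun x hx => formComp_same hx))
  · intro i j a ha hj
    obtain ⟨α, h, rfl⟩ := formGerm_surj a
    exact Subtype.ext (Filter.Germ.coe_eq.2 ((mem_germGr.1 ha).mono fun x hx => formComp_ne hx hj))
  · intro a
    obtain ⟨α, h, rfl⟩ := formGerm_surj a
    refine Subtype.ext ?_
    rw [AddSubmonoidClass.coe_finsetSum]
    have : ∀ i, ((germComp i (formGerm α h) : smoothForms E K) :
        Filter.Germ (nhdsSet K) (FormFibre E)) =
        Filter.Germ.coeAddHom (nhdsSet K) fun y => formComp i (α y) := fun _ => rfl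
    simp only [this]
    rw [← map_sum]
    refine congrArg (Filter.Germ.ofFun (l := nhdsSet K)) (funext fun y => ?_)
    rw [Finset.sum_apply]
    exact sum_formComp (α y)

theorem germGr_central (a b : smoothForms E K) (ha : a ∈ germGr E K 0) : a * b = b * a := by
  obtain ⟨α, h, rfl⟩ := formGerm_surj a
  obtain ⟨β, h', rfl⟩ := formGerm_surj b
  refine Subtype.ext (Filter.Germ.coe_eq.2 ?_)
  filter_upwards [mem_germGr.1 ha] with x hx
  change α x ∈ LinearMap.range (ExteriorAlgebra.ι ℂ) ^ 0 at hx
  rw [pow_zero, Submodule.mem_one] at hx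
  obtain ⟨c, hc⟩ := hx
  change α x * β x = β x * α x
  rw [← hc]
  exact Algebra.commutes c (β x)

variable (E K)

/-- The dg-algebra of germs along `K` of smooth `(0,•)`-forms, with the differential `∂̄`. -/
noncomputable def dolbeaultAlg : DGAlg.{max u v} :=
  DGAlg.ofGraded (smoothForms E K) (germGr E K)
    (show ∀ᶠ _ in nhdsSet K, (1 : FormFibre E) ∈ ⋀[ℂ]^0 (E →ₗ⋆[ℂ] ℂ) from
      Filter.Eventually.of_forall fun _ => SetLike.GradedOne.one_mem)
    (by
      intro i j a b ha hb
      obtain ⟨α, h, rfl⟩ := formGerm_surj a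
      obtain ⟨β, h', rfl⟩ := formGerm_surj b
      exact Filter.Germ.liftPred_coe.2 ((mem_germGr.1 ha).mp
        ((mem_germGr.1 hb).mono fun x hx hx' => SetLike.GradedMul.mul_mem hx' hx)))
    germGr_internal germGr_central (germDbar E K)
    (by
      intro i a ha
      obtain ⟨α, h, rfl⟩ := formGerm_surj a
      change ∀ᶠ x in nhdsSet K, dbar α x ∈ ⋀[ℂ]^(i + 1) (E →ₗ⋆[ℂ] ℂ)
      filter_upwards [SmoothFormAt.eventually h,
        Filter.Eventually.eventually_nhdsSet (mem_germGr.1 ha)] with x hx hx'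
      exact dbar_mem hx hx')
    (by
      intro i a b ha
      obtain ⟨α, h, rfl⟩ := formGerm_surj a
      obtain ⟨β, h', rfl⟩ := formGerm_surj b
      refine Subtype.ext (Filter.Germ.coe_eq.2 ?_)
      filter_upwards [SmoothFormAt.eventually h, SmoothFormAt.eventually h',
        mem_germGr.1 ha] with x hx hx' hi
      have := dbar_mul hx hx'
      rw [involute_of_mem hi, smul_mul_assoc] at this
      exact this)
    (by
      intro a
      obtain ⟨α, h, rfl⟩ := formGerm_surj a
      refine Subtype.ext (Filter.Germ.coe_eq.2 ?_)
      filter_upwards [SmoothFormAt.eventually h] with x hx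
      exact dbar_dbar hx)

variable {E K}

/-- Restriction of germs of forms to a smaller set. -/
def restrictGerm {K' : Set X} (h : K' ⊆ K) : smoothForms E K →ₐ[ℂ] smoothForms E K' where
  toFun a := ⟨a.1.compTendsto id (Filter.tendsto_id'.2 (nhdsSet_mono h)), by
    obtain ⟨α, hα, rfl⟩ := formGerm_surj a
    exact ⟨α, fun x hx => hα x (h hx), rfl⟩⟩
  map_one' := rfl
  map_mul' a b := by
    obtain ⟨α, hα, rfl⟩ := formGerm_surj a
    obtain ⟨β, hβ, rfl⟩ := formGerm_surj b
    rfl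
  map_zero' := rfl
  map_add' a b := by
    obtain ⟨α, hα, rfl⟩ := formGerm_surj a
    obtain ⟨β, hβ, rfl⟩ := formGerm_surj b
    rfl
  commutes' c := by
    refine Subtype.ext ?_
    change Filter.Germ.compTendsto (algebraMap ℂ (Filter.Germ (nhdsSet K) (FormFibre E)) c) id
      (Filter.tendsto_id'.2 (nhdsSet_mono h)) =
      algebraMap ℂ (Filter.Germ (nhdsSet K') (FormFibre E)) c
    rw [Algebra.algebraMap_eq_smul_one, Algebra.algebraMap_eq_smul_one]
    rfl

theorem restrictGerm_mem {K' : Set X} (h : K' ⊆ K) {i : ℕ} {a : smoothForms E K}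
    (ha : a ∈ germGr E K i) : restrictGerm h a ∈ germGr E K' i := by
  obtain ⟨α, hα, rfl⟩ := formGerm_surj a
  exact Filter.Germ.liftPred_coe.2 ((mem_germGr.1 ha).filter_mono (nhdsSet_mono h))

/-- Restriction as a morphism of dg-algebras. -/
def dolbeaultRes {K' : Set X} (h : K' ⊆ K) : Hom (dolbeaultAlg E K) (dolbeaultAlg E K') where
  toFun := restrictGerm h
  zero :=
    { toFun := fun z => ⟨restrictGerm h z.1, restrictGerm_mem h z.2⟩
      map_one' := Subtype.ext (map_one (restrictGerm (E := E) h))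
      map_mul' := fun z z' => Subtype.ext (map_mul (restrictGerm (E := E) h) z.1 z'.1)
      map_zero' := Subtype.ext (map_zero (restrictGerm (E := E) h))
      map_add' := fun z z' => Subtype.ext (map_add (restrictGerm (E := E) h) z.1 z'.1) }
  algebraMap_zero _ := rfl
  map_mem ha := restrictGerm_mem h ha
  map_d a := by
    obtain ⟨α, hα, rfl⟩ := formGerm_surj (E := E) a
    rfl

variable (E X)

/-- The presheaf of Dolbeault dg-algebras: `A(U)` consists of the germs along the closure of `U` of
smooth `(0,•)`-forms, that is, it is the direct limit of the algebras of smooth `(0,•)`-forms on the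
open neighbourhoods of the closure of `U`. -/
noncomputable def dolbeault : DGAlgPresheaf.{max u v} X where
  obj U := dolbeaultAlg E (closure (U : Set X))
  res h := dolbeaultRes (closure_mono h)
  res_id U h a := by
    obtain ⟨α, hα, rfl⟩ := formGerm_surj (E := E) a
    rfl
  res_res h h' h'' a := by
    obtain ⟨α, hα, rfl⟩ := formGerm_surj (E := E) a
    rfl

end dolbeault

noncomputable section

open TopologicalSpace (Opens)


/-! ### Filtered complexes and approximate homotopy equivalences -/

/-- An abelian group with an endomorphism `d` of degree one, a decreasing filtration and a family
of homogeneous parts.  It is not assumed that `d` squares to zero. -/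
structure FilCx (A : Type u) [AddCommGroup A] where
  d : A →+ A
  fil : ℕ → AddSubgroup A
  gr : ℤ → AddSubgroup A
  d_fil : ∀ {k x}, x ∈ fil k → d x ∈ fil k
  d_gr : ∀ {n m x}, n + 1 = m → x ∈ gr n → d x ∈ gr m

/-- Maps between filtered complexes that are mutually inverse up to homotopy on the associated
graded complexes. -/
structure FilCx.Approx {A : Type u} {B : Type v} [AddCommGroup A] [AddCommGroup B] (P : FilCx A)
    (Q : FilCx B) where
  φ : A →+ B
  ψ : B →+ A
  h : B →+ B
  h' : A →+ A
  φ_fil : ∀ {k x}, x ∈ P.fil k → φ x ∈ Q.fil k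
  ψ_fil : ∀ {k x}, x ∈ Q.fil k → ψ x ∈ P.fil k
  h_fil : ∀ {k x}, x ∈ Q.fil k → h x ∈ Q.fil k
  h'_fil : ∀ {k x}, x ∈ P.fil k → h' x ∈ P.fil k
  φ_gr : ∀ {n x}, x ∈ P.gr n → φ x ∈ Q.gr n
  ψ_gr : ∀ {n x}, x ∈ Q.gr n → ψ x ∈ P.gr n
  h_gr : ∀ {n m x}, m + 1 = n → x ∈ Q.gr n → h x ∈ Q.gr m
  h'_gr : ∀ {n m x}, m + 1 = n → x ∈ P.gr n → h' x ∈ P.gr m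
  dφ : ∀ {k x}, x ∈ P.fil k → Q.d (φ x) - φ (P.d x) ∈ Q.fil (k + 1)
  dψ : ∀ {k x}, x ∈ Q.fil k → P.d (ψ x) - ψ (Q.d x) ∈ P.fil (k + 1)
  φψ : ∀ {k x}, x ∈ Q.fil k → φ (ψ x) - x - Q.d (h x) - h (Q.d x) ∈ Q.fil (k + 1)
  ψφ : ∀ {k x}, x ∈ P.fil k → ψ (φ x) - x - P.d (h' x) - h' (P.d x) ∈ P.fil (k + 1)

lemma AddSubgroup.mem_of_eq {A : Type*} [AddGroup A] {S : AddSubgroup A} {x y : A} (hy : y ∈ S)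
    (h : x = y) : x ∈ S := h ▸ hy

namespace FilCx

variable {A : Type u} {B : Type v} [AddCommGroup A] [AddCommGroup B] {P : FilCx A} {Q : FilCx B}

/-- The mapping cone of an approximate equivalence is acyclic on the associated graded. -/
lemma Approx.step (e : Approx P Q) {k : ℕ} {l n m : ℤ} (hl : l + 1 = n) (hn : n + 1 = m) {w : A}
    {z : B}
    (hw : w ∈ P.fil k) (hz : z ∈ Q.fil k) (hwg : w ∈ P.gr m) (hzg : z ∈ Q.gr n)
    (hdw : P.d w ∈ P.fil (k + 1)) (hdz : Q.d z - e.φ w ∈ Q.fil (k + 1)) :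
    ∃ x ∈ P.fil k, ∃ y ∈ Q.fil k, x ∈ P.gr n ∧ y ∈ Q.gr l ∧ P.d x - w ∈ P.fil (k + 1) ∧
      z - e.φ x - Q.d y ∈ Q.fil (k + 1) := by
  set c : B := e.φ (e.h' w) - e.h (e.φ w) with hc
  have hcf : c ∈ Q.fil k := sub_mem (e.φ_fil (e.h'_fil hw)) (e.h_fil (e.φ_fil hw))
  have hcg : c ∈ Q.gr n := sub_mem (e.φ_gr (e.h'_gr hn hwg)) (e.h_gr hn (e.φ_gr hwg))
  have hdc : Q.d c ∈ Q.fil (k + 1) := by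
    have e1 := e.dφ (e.h'_fil hw)
    have e2 := e.φ_fil (e.ψφ hw)
    have e3 := e.φψ (e.φ_fil hw)
    have e4 := e.h_fil (e.dφ hw)
    have e5 := e.φ_fil (e.h'_fil hdw)
    have e6 := e.h_fil (e.φ_fil hdw)
    refine AddSubgroup.mem_of_eq (add_mem (sub_mem (add_mem (sub_mem e1 e2) e3) e5)
      (add_mem e4 e6)) ?_
    simp only [hc, map_sub, map_add]
    abel
  refine ⟨e.ψ z - e.h' w + e.ψ c, add_mem (sub_mem (e.ψ_fil hz) (e.h'_fil hw)) (e.ψ_fil hcf),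
    -(e.h z) - e.h c, sub_mem (neg_mem (e.h_fil hz)) (e.h_fil hcf),
    add_mem (sub_mem (e.ψ_gr hzg) (e.h'_gr hn hwg)) (e.ψ_gr hcg),
    sub_mem (neg_mem (e.h_gr hl hzg)) (e.h_gr hl hcg), ?_, ?_⟩
  · have e1 := e.dψ hz
    have e2 := e.ψ_fil hdz
    have e3 := e.ψφ hw
    have e4 := e.dψ hcf
    have e5 := e.ψ_fil hdc
    have e6 := e.h'_fil hdw
    refine AddSubgroup.mem_of_eq (add_mem (add_mem (add_mem (add_mem (add_mem e1 e2) e3) e4) e5)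
      e6) ?_
    simp only [map_sub, map_add]
    abel
  · have e1 := e.φψ hz
    have e2 := e.h_fil hdz
    have e3 := e.φψ hcf
    have e4 := e.h_fil hdc
    refine AddSubgroup.mem_of_eq (neg_mem (add_mem (add_mem (add_mem e1 e2) e3) e4)) ?_
    simp only [hc, map_sub, map_add, map_neg]
    abel

/-- The approximate solutions of `Approx.step` add up to solutions of any order. -/
lemma Approx.solve (e : Approx P Q) (hdP : ∀ x, P.d (P.d x) = 0) (hdQ : ∀ x, Q.d (Q.d x) = 0)
    (hφ : ∀ x, Q.d (e.φ x) = e.φ (P.d x)) (hP : ∀ x, x ∈ P.fil 0) (hQ : ∀ x, x ∈ Q.fil 0)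
    {l n m : ℤ} (hl : l + 1 = n) (hn : n + 1 = m) {w : A} {z : B}
    (hwg : w ∈ P.gr m) (hzg : z ∈ Q.gr n) (hdw : P.d w = 0) (hdz : Q.d z = e.φ w) (k : ℕ) :
    ∃ x ∈ P.gr n, ∃ y ∈ Q.gr l, P.d x - w ∈ P.fil k ∧ z - e.φ x - Q.d y ∈ Q.fil k := by
  induction k with
  | zero => exact ⟨0, zero_mem _, 0, zero_mem _, hP _, hQ _⟩
  | succ k ih =>
    obtain ⟨x, hx, y, hy, h1, h2⟩ := ih
    obtain ⟨x', -, y', -, hx', hy', h1', h2'⟩ := e.step (w := w - P.d x) (z := z - e.φ x - Q.d y)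
      hl hn (by rw [← neg_sub]; exact neg_mem h1) h2 (sub_mem hwg (P.d_gr hn hx))
      (sub_mem (sub_mem hzg (e.φ_gr hx)) (Q.d_gr hl hy))
      (by rw [map_sub, hdw, hdP, sub_zero]; exact zero_mem _)
      (by simp only [map_sub, hdz, hdQ, hφ]; simp)
    refine ⟨x + x', add_mem hx hx', y + y', add_mem hy hy', ?_, ?_⟩
    · refine AddSubgroup.mem_of_eq h1' ?_
      rw [map_add]; abel
    · refine AddSubgroup.mem_of_eq h2' ?_
      simp only [map_add]; abel

end FilCx

/-! ### The total category of a dg-category -/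

/-- A dg-category whose morphisms are not required to be homogeneous; `σ` is the sign
`(-1)^n` in degree `n`. -/
structure TotCat : Type (max (u + 1) (v + 1)) where
  Obj : Type u
  Hom : Obj → Obj → Type v
  [addCommGroup : ∀ X Y, AddCommGroup (Hom X Y)]
  comp : ∀ {X Y Z : Obj}, Hom Y Z →+ Hom X Y →+ Hom X Z
  id : ∀ X : Obj, Hom X X
  id_comp : ∀ {X Y : Obj} (f : Hom X Y), comp (id Y) f = f
  comp_id : ∀ {X Y : Obj} (f : Hom X Y), comp f (id X) = f
  assoc : ∀ {W X Y Z : Obj} (f : Hom Y Z) (g : Hom X Y) (e : Hom W X),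
    comp (comp f g) e = comp f (comp g e)
  D : ∀ {X Y : Obj}, Hom X Y →+ Hom X Y
  σ : ∀ {X Y : Obj}, Hom X Y →+ Hom X Y
  D_D : ∀ {X Y : Obj} (f : Hom X Y), D (D f) = 0
  D_σ : ∀ {X Y : Obj} (f : Hom X Y), D (σ f) = -σ (D f)
  σ_σ : ∀ {X Y : Obj} (f : Hom X Y), σ (σ f) = f
  σ_comp : ∀ {X Y Z : Obj} (g : Hom Y Z) (f : Hom X Y), σ (comp g f) = comp (σ g) (σ f)
  D_comp : ∀ {X Y Z : Obj} (g : Hom Y Z) (f : Hom X Y),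
    D (comp g f) = comp (D g) f + comp (σ g) (D f)
  gr : ∀ {X Y : Obj}, ℤ → AddSubgroup (Hom X Y)
  id_gr : ∀ X : Obj, id X ∈ gr 0
  σ_gr : ∀ {X Y : Obj} {n : ℤ} {f : Hom X Y}, f ∈ gr n → σ f = (n.negOnePow : ℤ) • f
  D_gr : ∀ {X Y : Obj} {n m : ℤ} {f : Hom X Y}, n + 1 = m → f ∈ gr n → D f ∈ gr m
  comp_gr : ∀ {X Y Z : Obj} {m n k : ℤ} {g : Hom Y Z} {f : Hom X Y}, m + n = k → g ∈ gr m →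
    f ∈ gr n → comp g f ∈ gr k

attribute [instance] TotCat.addCommGroup

infixr:80 "⊚" => TotCat.comp _

namespace TotCat

variable (C : TotCat.{u, v}) {X Y Z W : C.Obj}

lemma σ_even {f : C.Hom X Y} {n : ℤ} (h : f ∈ C.gr n) (hn : Even n) : C.σ f = f := by
  rw [C.σ_gr h, Int.negOnePow_even n hn, Units.val_one, one_smul]

lemma σ_odd {f : C.Hom X Y} {n : ℤ} (h : f ∈ C.gr n) (hn : Odd n) : C.σ f = -f := by
  rw [C.σ_gr h, Int.negOnePow_odd n hn, Units.val_neg, Units.val_one, neg_smul, one_smul]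

lemma σ_id (X : C.Obj) : C.σ (C.id X) = C.id X := C.σ_even (C.id_gr X) Even.zero

lemma D_id (X : C.Obj) : C.D (C.id X) = 0 := by
  have h := C.D_comp (C.id X) (C.id X)
  rw [C.σ_id, C.comp_id, C.comp_id, C.id_comp] at h
  simpa using h

lemma σ_mem_gr {f : C.Hom X Y} {n : ℤ} (h : f ∈ C.gr n) : C.σ f ∈ C.gr n := by
  rw [C.σ_gr h]
  exact zsmul_mem h _

/-- A multiplicative filtration of the morphisms of a dg-category. -/
structure Fil where
  fil : ∀ {X Y : C.Obj}, ℕ → AddSubgroup (C.Hom X Y)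
  zero : ∀ {X Y : C.Obj} (f : C.Hom X Y), f ∈ fil 0
  anti : ∀ {X Y : C.Obj} {k l : ℕ} {f : C.Hom X Y}, k ≤ l → f ∈ fil l → f ∈ fil k
  D_mem : ∀ {X Y : C.Obj} {k : ℕ} {f : C.Hom X Y}, f ∈ fil k → C.D f ∈ fil k
  σ_mem : ∀ {X Y : C.Obj} {k : ℕ} {f : C.Hom X Y}, f ∈ fil k → C.σ f ∈ fil k
  comp_mem : ∀ {X Y Z : C.Obj} {k l : ℕ} {g : C.Hom Y Z} {f : C.Hom X Y}, g ∈ fil k →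
    f ∈ fil l → g ⊚ f ∈ fil (k + l)

namespace Fil

variable {C} (𝓕 : C.Fil)

lemma comp_left {k : ℕ} (g : C.Hom Y Z) {f : C.Hom X Y} (hf : f ∈ 𝓕.fil k) :
    g ⊚ f ∈ 𝓕.fil k := by simpa using 𝓕.comp_mem (𝓕.zero g) hf

lemma comp_right {k : ℕ} {g : C.Hom Y Z} (f : C.Hom X Y) (hg : g ∈ 𝓕.fil k) :
    g ⊚ f ∈ 𝓕.fil k := by simpa using 𝓕.comp_mem hg (𝓕.zero f)

lemma comp_one {k : ℕ} {g : C.Hom Y Z} {f : C.Hom X Y} (hg : g ∈ 𝓕.fil 1) (hf : f ∈ 𝓕.fil k) :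
    g ⊚ f ∈ 𝓕.fil (k + 1) := by
  rw [add_comm]
  exact 𝓕.comp_mem hg hf

def cx (X Y : C.Obj) : FilCx (C.Hom X Y) where
  d := C.D
  fil := 𝓕.fil
  gr := C.gr
  d_fil := 𝓕.D_mem
  d_gr := C.D_gr

/-- Composition with a morphism that is closed and invertible up to homotopy modulo the first step
of the filtration. -/
def postcomp (φ : C.Hom X Y) (ψ : C.Hom Y X) (h : C.Hom Y Y) (h' : C.Hom X X) (hφ : φ ∈ C.gr 0)
    (hψ : ψ ∈ C.gr 0) (hh : h ∈ C.gr (-1)) (hh' : h' ∈ C.gr (-1)) (hdφ : C.D φ ∈ 𝓕.fil 1)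
    (hdψ : C.D ψ ∈ 𝓕.fil 1) (e : φ ⊚ ψ - C.id Y - C.D h ∈ 𝓕.fil 1)
    (e' : ψ ⊚ φ - C.id X - C.D h' ∈ 𝓕.fil 1) (W : C.Obj) :
    FilCx.Approx (𝓕.cx W X) (𝓕.cx W Y) where
  φ := C.comp φ
  ψ := C.comp ψ
  h := C.comp h
  h' := C.comp h'
  φ_fil := 𝓕.comp_left _
  ψ_fil := 𝓕.comp_left _
  h_fil := 𝓕.comp_left _
  h'_fil := 𝓕.comp_left _
  φ_gr hx := C.comp_gr (by omega) hφ hx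
  ψ_gr hx := C.comp_gr (by omega) hψ hx
  h_gr hm hx := C.comp_gr (by omega) hh hx
  h'_gr hm hx := C.comp_gr (by omega) hh' hx
  dφ {k x} hx := by
    refine AddSubgroup.mem_of_eq (𝓕.comp_one hdφ hx) ?_
    simp only [cx, C.D_comp, C.σ_even hφ Even.zero]
    abel
  dψ {k x} hx := by
    refine AddSubgroup.mem_of_eq (𝓕.comp_one hdψ hx) ?_
    simp only [cx, C.D_comp, C.σ_even hψ Even.zero]
    abel
  φψ {k x} hx := by
    refine AddSubgroup.mem_of_eq (𝓕.comp_one e hx) ?_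
    simp only [cx, C.D_comp, C.σ_odd hh (by decide), map_sub, AddMonoidHom.sub_apply, C.id_comp,
      C.assoc, map_neg, AddMonoidHom.neg_apply]
    abel
  ψφ {k x} hx := by
    refine AddSubgroup.mem_of_eq (𝓕.comp_one e' hx) ?_
    simp only [cx, C.D_comp, C.σ_odd hh' (by decide), map_sub, AddMonoidHom.sub_apply, C.id_comp,
      C.assoc, map_neg, AddMonoidHom.neg_apply]
    abel

/-- A closed morphism that is invertible up to homotopy modulo the first step of a filtration
has a right inverse up to homotopy, provided the filtration is finite in each degree. -/
lemma exists_right_inverse (hfin : ∀ (n : ℤ) (X Y : C.Obj), ∃ k, ∀ f : C.Hom X Y, f ∈ C.gr n →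
    f ∈ 𝓕.fil k → f = 0) (φ : C.Hom X Y) (ψ : C.Hom Y X) (h : C.Hom Y Y) (h' : C.Hom X X)
    (hφ : φ ∈ C.gr 0) (hψ : ψ ∈ C.gr 0) (hh : h ∈ C.gr (-1)) (hh' : h' ∈ C.gr (-1))
    (hdφ : C.D φ = 0) (hdψ : C.D ψ ∈ 𝓕.fil 1) (e : φ ⊚ ψ - C.id Y - C.D h ∈ 𝓕.fil 1)
    (e' : ψ ⊚ φ - C.id X - C.D h' ∈ 𝓕.fil 1) :
    (∃ g ∈ C.gr 0, C.D g = 0 ∧ ∃ y ∈ C.gr (-1), φ ⊚ g - C.id Y = C.D y) := by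
  obtain ⟨k, hk⟩ := hfin 0 Y Y
  obtain ⟨l, hl⟩ := hfin 1 Y X
  obtain ⟨g, hg, y, hy, h1, h2⟩ := (𝓕.postcomp φ ψ h h' hφ hψ hh hh' (by rw [hdφ]; exact zero_mem _)
    hdψ e e' Y).solve C.D_D C.D_D
    (fun x => by simp [postcomp, cx, C.D_comp, hdφ, C.σ_even hφ Even.zero]) 𝓕.zero 𝓕.zero
    (l := -1) (n := 0) (m := 1) (by omega) (by omega) (w := 0) (z := C.id Y) (zero_mem _)
    (C.id_gr Y) (map_zero _) (by simp [cx, C.D_id]) (max k l)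
  simp only [cx, postcomp, sub_zero] at h1 h2 hg hy
  refine ⟨g, hg, hl _ (C.D_gr (by omega) hg) (𝓕.anti (le_max_right _ _) h1), -y, neg_mem hy, ?_⟩
  have := hk _ (sub_mem (sub_mem (C.id_gr Y) (C.comp_gr (by omega) hφ hg))
    (C.D_gr (by omega) hy)) (𝓕.anti (le_max_left _ _) h2)
  rw [map_neg, ← sub_eq_zero, ← neg_eq_zero, ← this]
  abel

lemma exists_inverse (hfin : ∀ (n : ℤ) (X Y : C.Obj), ∃ k, ∀ f : C.Hom X Y, f ∈ C.gr n →
    f ∈ 𝓕.fil k → f = 0) (φ : C.Hom X Y) (ψ : C.Hom Y X) (h : C.Hom Y Y) (h' : C.Hom X X)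
    (hφ : φ ∈ C.gr 0) (hψ : ψ ∈ C.gr 0) (hh : h ∈ C.gr (-1)) (hh' : h' ∈ C.gr (-1))
    (hdφ : C.D φ = 0) (hdψ : C.D ψ ∈ 𝓕.fil 1) (e : φ ⊚ ψ - C.id Y - C.D h ∈ 𝓕.fil 1)
    (e' : ψ ⊚ φ - C.id X - C.D h' ∈ 𝓕.fil 1) :
    ∃ g ∈ C.gr 0, C.D g = 0 ∧ (∃ y ∈ C.gr (-1), g ⊚ φ - C.id X = C.D y) ∧
      (∃ y ∈ C.gr (-1), φ ⊚ g - C.id Y = C.D y) := by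
  obtain ⟨g, hg, hdg, y, hy, h1⟩ := 𝓕.exists_right_inverse hfin φ ψ h h' hφ hψ hh hh' hdφ hdψ e e'
  refine ⟨g, hg, hdg, ?_, y, hy, h1⟩
  obtain ⟨k, hk⟩ := hfin 0 X X
  obtain ⟨x, hx, z, -, h2, -⟩ := (𝓕.postcomp φ ψ h h' hφ hψ hh hh' (by rw [hdφ]; exact zero_mem _)
    hdψ e e' X).solve C.D_D C.D_D
    (fun x => by simp [postcomp, cx, C.D_comp, hdφ, C.σ_even hφ Even.zero]) 𝓕.zero 𝓕.zero
    (l := -2) (n := -1) (m := 0) (by omega) (by omega) (w := g ⊚ φ - C.id X) (z := y ⊚ φ)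
    (sub_mem (C.comp_gr (by omega) hg hφ) (C.id_gr X)) (C.comp_gr (by omega) hy hφ)
    (by simp [cx, C.D_comp, hdg, hdφ, C.D_id])
    (by
      have := congrArg (fun t => t ⊚ φ) h1
      simp only [map_sub, AddMonoidHom.sub_apply, C.assoc, C.id_comp] at this
      simp only [cx, postcomp, C.D_comp, hdφ, map_zero, add_zero, ← this, map_sub, C.comp_id]) k
  refine ⟨x, hx, ?_⟩
  have := hk _ (sub_mem (C.D_gr (by omega) hx) (sub_mem (C.comp_gr (by omega) hg hφ) (C.id_gr X))) h2
  exact (sub_eq_zero.1 this).symm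

end Fil

end TotCat

namespace DGCat

open DirectSum

variable (C : DGCat.{u, v})

/-- Morphisms of a dg-category that are not necessarily homogeneous. -/
abbrev THom (X Y : C.Obj) : Type v := ⨁ n : ℤ, C.Hom X Y n

variable {C} {X Y Z W : C.Obj}

/-- A homogeneous morphism as a morphism of the total category. -/
def tof {n : ℤ} (f : C.Hom X Y n) : C.THom X Y := DirectSum.of (fun n => C.Hom X Y n) n f

lemma tof_add {n : ℤ} (f g : C.Hom X Y n) : tof (f + g) = tof f + tof g := map_add _ _ _

lemma tof_neg {n : ℤ} (f : C.Hom X Y n) : tof (-f) = -tof f := map_neg _ _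

lemma tof_sub {n : ℤ} (f g : C.Hom X Y n) : tof (f - g) = tof f - tof g := map_sub _ _ _

lemma tof_zero {n : ℤ} : tof (0 : C.Hom X Y n) = 0 := map_zero _

lemma tof_zsmul {n : ℤ} (k : ℤ) (f : C.Hom X Y n) : tof (k • f) = k • tof f := map_zsmul _ _ _

lemma tof_injective {n : ℤ} : Function.Injective (tof : C.Hom X Y n → C.THom X Y) :=
  DirectSum.of_injective n

@[elab_as_elim]
lemma tof_induction {P : C.THom X Y → Prop} (x : C.THom X Y) (h : ∀ n (f : C.Hom X Y n), P (tof f))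
    (ha : ∀ x y, P x → P y → P (x + y)) : P x :=
  DirectSum.induction_on x (by simpa [tof_zero] using h 0 0) h ha

def tcomp : C.THom Y Z →+ C.THom X Y →+ C.THom X Z :=
  DirectSum.toAddMonoid fun m => AddMonoidHom.flip (DirectSum.toAddMonoid fun n =>
    AddMonoidHom.mk' (fun f => AddMonoidHom.mk' (fun g => tof (C.comp (rfl : m + n = m + n) g f))
      (fun g g' => by rw [map_add, LinearMap.add_apply, tof_add]))
      (fun f f' => by
        ext g : 1
        change tof (C.comp _ g (f + f')) = tof (C.comp _ g f) + tof (C.comp _ g f')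
        rw [map_add, tof_add]))

lemma tcomp_tof {m n k : ℤ} (h : m + n = k) (g : C.Hom Y Z m) (f : C.Hom X Y n) :
    tcomp (tof g) (tof f) = tof (C.comp h g f) := by
  subst h
  simp only [tcomp, tof, DirectSum.toAddMonoid_of, AddMonoidHom.flip_apply]
  rfl

def tD : C.THom X Y →+ C.THom X Y :=
  DirectSum.toAddMonoid fun n => AddMonoidHom.mk' (fun f => tof (C.d (rfl : n + 1 = n + 1) f))
    (fun f f' => by rw [map_add, tof_add])

lemma tD_tof {n m : ℤ} (h : n + 1 = m) (f : C.Hom X Y n) : tD (tof f) = tof (C.d h f) := by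
  subst h
  exact DirectSum.toAddMonoid_of _ _ _

def tσ : C.THom X Y →+ C.THom X Y :=
  DirectSum.toAddMonoid fun n => AddMonoidHom.mk' (fun f => tof ((n.negOnePow : ℤ) • f))
    (fun f f' => by rw [smul_add, tof_add])

lemma tσ_tof {n : ℤ} (f : C.Hom X Y n) : tσ (tof f) = (n.negOnePow : ℤ) • tof f :=
  (DirectSum.toAddMonoid_of _ _ _).trans (tof_zsmul _ _)

variable (C) in
abbrev tot : TotCat.{u, v} where
  Obj := C.Obj
  Hom X Y := C.THom X Y
  comp := tcomp
  id X := tof (C.id X)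
  id_comp f := by
    induction f using tof_induction with
    | h n f => rw [tcomp_tof (zero_add n), C.id_comp]
    | ha x y hx hy => rw [map_add, hx, hy]
  comp_id f := by
    induction f using tof_induction with
    | h n f => rw [tcomp_tof (add_zero n), C.comp_id]
    | ha x y hx hy => rw [map_add, AddMonoidHom.add_apply, hx, hy]
  assoc f g e := by
    induction f using tof_induction with
    | ha x y hx hy => simp only [map_add, AddMonoidHom.add_apply, hx, hy]
    | h l f =>
      induction g using tof_induction with
      | ha x y hx hy => simp only [map_add, AddMonoidHom.add_apply, hx, hy]
      | h m g =>
        induction e using tof_induction with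
        | ha x y hx hy => simp only [map_add, AddMonoidHom.add_apply, hx, hy]
        | h n e =>
          rw [tcomp_tof rfl, tcomp_tof rfl, tcomp_tof rfl, tcomp_tof (add_assoc l m n).symm,
            C.assoc rfl rfl rfl (add_assoc l m n).symm]
  D := tD
  σ := tσ
  D_D f := by
    induction f using tof_induction with
    | ha x y hx hy => simp only [map_add, hx, hy, add_zero]
    | h l f => rw [tD_tof rfl, tD_tof rfl, C.d_d, tof_zero]
  D_σ f := by
    induction f using tof_induction with
    | ha x y hx hy => simp only [map_add, hx, hy, neg_add]
    | h l f => rw [tσ_tof, map_zsmul, tD_tof rfl, tσ_tof, Int.negOnePow_succ, Units.val_neg,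
        neg_smul, neg_neg]
  σ_σ f := by
    induction f using tof_induction with
    | ha x y hx hy => simp only [map_add, hx, hy]
    | h l f => rw [tσ_tof, map_zsmul, tσ_tof, smul_smul, Int.units_coe_mul_self, one_smul]
  σ_comp g f := by
    induction g using tof_induction with
    | ha x y hx hy => simp only [map_add, AddMonoidHom.add_apply, hx, hy]
    | h m g =>
      induction f using tof_induction with
      | ha x y hx hy => simp only [map_add, AddMonoidHom.add_apply, hx, hy]
      | h n f =>
        rw [tcomp_tof rfl, tσ_tof, tσ_tof, tσ_tof, map_zsmul, map_zsmul, AddMonoidHom.zsmul_apply,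
          tcomp_tof rfl, smul_smul, Int.negOnePow_add, Units.val_mul, mul_comm]
  D_comp g f := by
    induction g using tof_induction with
    | ha x y hx hy => simp only [map_add, AddMonoidHom.add_apply, hx, hy]; abel
    | h m g =>
      induction f using tof_induction with
      | ha x y hx hy => simp only [map_add, AddMonoidHom.add_apply, hx, hy]; abel
      | h n f =>
        rw [tcomp_tof rfl, tD_tof rfl, tD_tof rfl, tD_tof rfl, tσ_tof, map_zsmul,
          AddMonoidHom.zsmul_apply, tcomp_tof (show m + 1 + n = m + n + 1 by omega),
          tcomp_tof (show m + (n + 1) = m + n + 1 by omega),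
          C.d_comp rfl rfl rfl rfl (by omega) (by omega), tof_add, Units.smul_def, tof_zsmul]
  gr n := (DirectSum.of (fun n => C.Hom _ _ n) n).range
  id_gr X := ⟨_, rfl⟩
  σ_gr := by
    rintro X Y n _ ⟨f, rfl⟩
    exact tσ_tof f
  D_gr := by
    rintro X Y n m _ h ⟨f, rfl⟩
    exact ⟨_, (tD_tof h f).symm⟩
  comp_gr := by
    rintro X Y Z m n k _ _ h ⟨g, rfl⟩ ⟨f, rfl⟩
    exact ⟨_, (tcomp_tof h g f).symm⟩

lemma tof_mem_gr {n : ℤ} (f : C.Hom X Y n) : (tof f : C.tot.Hom X Y) ∈ C.tot.gr n := ⟨f, rfl⟩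

end DGCat

/-! ### Complexes dominated by bounded graded free modules -/

section Domination

def IsDeg {R : Type*} [CommRing R] {M N : Type*} [AddCommGroup M] [AddCommGroup N] [Module R M]
    [Module R N] (𝓜 : ℤ → Submodule R M) (𝓝 : ℤ → Submodule R N) (k : ℤ) (f : M →ₗ[R] N) : Prop :=
  ∀ ⦃n m : ℤ⦄, n + k = m → ∀ ⦃x⦄, x ∈ 𝓜 n → f x ∈ 𝓝 m

/-- The grading of the free module `κ → R` for which the `x`-th basis vector has degree `deg x`. -/
def piGr (R : Type*) [CommRing R] {κ : Type*} (deg : κ → ℤ) (n : ℤ) : Submodule R (κ → R) where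
  carrier := {f | ∀ x, deg x ≠ n → f x = 0}
  add_mem' hf hg x hx := by simp [hf x hx, hg x hx]
  zero_mem' _ _ := rfl
  smul_mem' c f hf x hx := by simp [hf x hx]

lemma single_mem_piGr {R : Type*} [CommRing R] {κ : Type*} [DecidableEq κ] (deg : κ → ℤ) (x : κ)
    (r : R) : Pi.single x r ∈ piGr R deg (deg x) := fun y hy => by
  rw [Pi.single_apply, if_neg (fun h : y = x => hy (by rw [h]))]

/-- The complex `(S, D)` is a direct summand up to homotopy of the graded free module `κ → R` with
the differential `δ`. -/
structure Dominated {R : Type u} [CommRing R] {S : Type v} [AddCommGroup S] [Module R S]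
    (gr : ℤ → Submodule R S) (D : S →ₗ[R] S) {κ : Type w} (deg : κ → ℤ) where
  δ : (κ → R) →ₗ[R] (κ → R)
  r : (κ → R) →ₗ[R] S
  s : S →ₗ[R] (κ → R)
  h : S →ₗ[R] S
  δ_deg : IsDeg (piGr R deg) (piGr R deg) 1 δ
  r_deg : IsDeg (piGr R deg) gr 0 r
  s_deg : IsDeg gr (piGr R deg) 0 s
  h_deg : IsDeg gr gr (-1) h
  δ_δ : ∀ x, δ (δ x) = 0
  D_r : ∀ x, D (r x) = r (δ x)
  s_D : ∀ x, s (D x) = δ (s x)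
  r_s : ∀ x, r (s x) = x + D (h x) + h (D x)

/-- A homotopy equivalence between `(S, D)` and the bounded complex of projective modules given by
an idempotent `p` of a graded free module `L` and a differential `δ` on the image of `p`. -/
structure ProjRes {R : Type u} [CommRing R] {S : Type v} [AddCommGroup S] [Module R S]
    (gr : ℤ → Submodule R S) (D : S →ₗ[R] S) (L : Type*) [AddCommGroup L] [Module R L]
    (grL : ℤ → Submodule R L) where
  p : L →ₗ[R] L
  δ : L →ₗ[R] L
  q : L →ₗ[R] S
  j : S →ₗ[R] L
  H : S →ₗ[R] S
  H' : L →ₗ[R] L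
  p_deg : IsDeg grL grL 0 p
  δ_deg : IsDeg grL grL 1 δ
  q_deg : IsDeg grL gr 0 q
  j_deg : IsDeg gr grL 0 j
  H_deg : IsDeg gr gr (-1) H
  H'_deg : IsDeg grL grL (-1) H'
  p_p : ∀ x, p (p x) = p x
  p_δ : ∀ x, p (δ x) = δ x
  δ_p : ∀ x, δ (p x) = δ x
  δ_δ : ∀ x, δ (δ x) = 0
  q_p : ∀ x, q (p x) = q x
  p_j : ∀ x, p (j x) = j x
  D_q : ∀ x, D (q x) = q (δ x)
  j_D : ∀ x, j (D x) = δ (j x)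
  q_j : ∀ x, q (j x) = x + D (H x) + H (D x)
  j_q : ∀ x, j (q x) = p x + δ (H' x) + H' (δ x)

variable {R : Type u} [CommRing R]

lemma prod_mk_apply {M N P : Type*} [AddCommGroup M] [AddCommGroup N] [AddCommGroup P] [Module R M]
    [Module R N] [Module R P] (f : M →ₗ[R] N) (g : M →ₗ[R] P) (x : M) : f.prod g x = (f x, g x) := rfl

lemma IsDeg.comp {M N P : Type*} [AddCommGroup M] [AddCommGroup N] [AddCommGroup P] [Module R M]
    [Module R N] [Module R P] {𝓜 : ℤ → Submodule R M} {𝓝 : ℤ → Submodule R N}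
    {𝓟 : ℤ → Submodule R P} {k l m : ℤ} {g : N →ₗ[R] P} {f : M →ₗ[R] N} (hg : IsDeg 𝓝 𝓟 k g)
    (hf : IsDeg 𝓜 𝓝 l f) (h : k + l = m) : IsDeg 𝓜 𝓟 m (g ∘ₗ f) := fun n m' hm x hx =>
  hg (show n + l + k = m' by omega) (hf rfl hx)

lemma IsDeg.add {M N : Type*} [AddCommGroup M] [AddCommGroup N] [Module R M]
    [Module R N] {𝓜 : ℤ → Submodule R M} {𝓝 : ℤ → Submodule R N} {k : ℤ}
    {g f : M →ₗ[R] N} (hg : IsDeg 𝓜 𝓝 k g) (hf : IsDeg 𝓜 𝓝 k f) : IsDeg 𝓜 𝓝 k (g + f) :=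
  fun _ _ h _ hx => add_mem (hg h hx) (hf h hx)

lemma IsDeg.sub {M N : Type*} [AddCommGroup M] [AddCommGroup N] [Module R M]
    [Module R N] {𝓜 : ℤ → Submodule R M} {𝓝 : ℤ → Submodule R N} {k : ℤ}
    {g f : M →ₗ[R] N} (hg : IsDeg 𝓜 𝓝 k g) (hf : IsDeg 𝓜 𝓝 k f) : IsDeg 𝓜 𝓝 k (g - f) :=
  fun _ _ h _ hx => sub_mem (hg h hx) (hf h hx)

namespace Dominated

variable {S : Type v} [AddCommGroup S] [Module R S] {gr : ℤ → Submodule R S} {D : S →ₗ[R] S}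
  {κ : Type w} {deg : κ → ℤ}

/-- A complex dominated by a free module concentrated in one degree. -/
lemma exists_projRes_zero {S : Type (max u v w)} [AddCommGroup S] [Module R S]
    {gr : ℤ → Submodule R S} {D : S →ₗ[R] S} (hD : IsDeg gr gr 1 D) (hDD : ∀ x, D (D x) = 0)
    (e : Dominated gr D deg) {b : ℤ} (hb : ∀ x, deg x = b) :
    ∃ (L : Type (max u v w)) (_ : AddCommGroup L) (_ : Module R L) (f : L ≃ₗ[R] (κ → R)),
      Nonempty (ProjRes gr D L fun n => (piGr R deg n).comap f.toLinearMap) := by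
  have hδ : ∀ f, e.δ f = 0 := fun f => by
    have hf : f ∈ piGr R deg b := fun x hx => absurd (hb x) hx
    ext x
    exact e.δ_deg rfl hf x (by rw [hb x]; omega)
  have hDr : ∀ f, D (e.r f) = 0 := fun f => by rw [e.D_r, hδ, map_zero]
  have hsD : ∀ x, e.s (D x) = 0 := fun x => by rw [e.s_D, hδ]
  have hp : ∀ f, e.s (e.r (e.s (e.r f))) = e.s (e.r f) := fun f => by
    rw [e.r_s (e.r f), hDr, map_zero, add_zero, map_add, hsD, add_zero]
  let f : ULift.{max u v} (κ → R) ≃ₗ[R] (κ → R) := ULift.moduleEquiv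
  have hf : IsDeg (fun n => (piGr R deg n).comap f.toLinearMap) (piGr R deg) 0 f.toLinearMap := by
    intro n m h x hx
    obtain rfl : n = m := by omega
    exact hx
  have hf' : IsDeg (piGr R deg) (fun n => (piGr R deg n).comap f.toLinearMap) 0
      f.symm.toLinearMap := by
    intro n m h x hx
    obtain rfl : n = m := by omega
    exact hx
  refine ⟨ULift.{max u v} (κ → R), inferInstance, inferInstance, f, ⟨{
    p := f.symm.toLinearMap ∘ₗ e.s ∘ₗ e.r ∘ₗ f.toLinearMap
    δ := 0
    q := e.r ∘ₗ e.s ∘ₗ e.r ∘ₗ f.toLinearMap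
    j := f.symm.toLinearMap ∘ₗ e.s ∘ₗ e.r ∘ₗ e.s
    H := e.h + e.h + (D ∘ₗ e.h + e.h ∘ₗ D) ∘ₗ e.h
    H' := 0
    p_deg := hf'.comp (e.s_deg.comp (e.r_deg.comp hf rfl) rfl) rfl
    δ_deg := fun n m h x hx => zero_mem _
    q_deg := e.r_deg.comp (e.s_deg.comp (e.r_deg.comp hf rfl) rfl) rfl
    j_deg := hf'.comp (e.s_deg.comp (e.r_deg.comp e.s_deg rfl) rfl) rfl
    H_deg := (e.h_deg.add e.h_deg).add (((hD.comp e.h_deg rfl).add (e.h_deg.comp hD rfl)).comp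
      e.h_deg rfl)
    H'_deg := fun n m h x hx => zero_mem _
    p_p := fun x => by simp [hp]
    p_δ := fun x => by simp
    δ_p := fun x => by simp
    δ_δ := fun x => by simp
    q_p := fun x => by simp [hp]
    p_j := fun x => by simp [hp]
    D_q := fun x => by simp [hDr]
    j_D := fun x => by simp [hsD]
    q_j := fun x => by
      have h3 := hp (e.s x)
      simp only [LinearMap.comp_apply, LinearEquiv.coe_coe, LinearEquiv.apply_symm_apply,
        LinearMap.add_apply, map_add, h3, hDD, zero_add, map_zero, add_zero]
      rw [e.r_s (e.r (e.s x)), e.r_s x]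
      simp only [map_add, hDD, map_zero, add_zero, zero_add]
      abel
    j_q := fun x => by simp [hp] }⟩⟩

section step

variable (e : Dominated gr D deg) (b : ℤ)

def topPr (deg : κ → ℤ) (b : ℤ) : (κ → R) →ₗ[R] ({x // deg x = b} → R) := LinearMap.funLeft R R Subtype.val

open Classical in
def topIn (deg : κ → ℤ) (b : ℤ) : ({x // deg x = b} → R) →ₗ[R] (κ → R) where
  toFun g x := if h : deg x = b then g ⟨x, h⟩ else 0
  map_add' g g' := by ext x; by_cases h : deg x = b <;> simp [h]
  map_smul' c g := by ext x; by_cases h : deg x = b <;> simp [h]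

lemma topPr_topIn (g : {x // deg x = b} → R) : topPr deg b (topIn deg b g) = g := by
  ext ⟨x, hx⟩
  simp [topPr, topIn, hx, LinearMap.funLeft_apply]

lemma topIn_mem (g : {x // deg x = b} → R) : topIn deg b g ∈ piGr R deg b := fun x hx => by
  simp [topIn, hx]

lemma topIn_topPr {f : κ → R} (hf : f ∈ piGr R deg b) : topIn deg b (topPr deg b f) = f := by
  ext x
  by_cases h : deg x = b
  · simp [topPr, topIn, h, LinearMap.funLeft_apply]
  · simp [topPr, topIn, h, hf x h]

lemma topPr_eq_zero {f : κ → R} {n : ℤ} (hn : n ≠ b) (hf : f ∈ piGr R deg n) : topPr deg b f = 0 := by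
  ext ⟨x, hx⟩
  exact hf x (by omega)

def lowerDeg (deg : κ → ℤ) (b : ℤ) (x : κ) : ℤ := if deg x = b then b - 1 else deg x

/-- The grading of `S × F^b`, the summand of top degree `b` being put in degree `b - 1`. -/
def coneGr (gr : ℤ → Submodule R S) (deg : κ → ℤ) (b : ℤ) (n : ℤ) :
    Submodule R (S × ({x // deg x = b} → R)) :=
  (gr n).prod (piGr R (fun _ : {x // deg x = b} => b - 1) n)

def coneD : (S × ({x // deg x = b} → R)) →ₗ[R] (S × ({x // deg x = b} → R)) :=
  LinearMap.prod (D ∘ₗ LinearMap.fst _ _ _ + e.r ∘ₗ topIn deg b ∘ₗ LinearMap.snd _ _ _) 0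

lemma coneD_apply (x : S) (g : {x // deg x = b} → R) :
    e.coneD b (x, g) = (D x + e.r (topIn deg b g), 0) := rfl

lemma mem_piGr_lowerDeg {f : κ → R} {n : ℤ} (h : ∀ x, deg x ≤ b) :
    f ∈ piGr R (lowerDeg deg b) n ↔ f - topIn deg b (topPr deg b f) ∈ piGr R deg n ∧
      (n ≠ b - 1 → topPr deg b f = 0) := by
  classical
  constructor
  · intro hf
    refine ⟨fun x hx => ?_, fun hn => ?_⟩
    · by_cases hb : deg x = b
      · simp [topPr, topIn, hb, LinearMap.funLeft_apply]
      · have := hf x (by simp [lowerDeg, hb, hx])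
        simp [topPr, topIn, hb, this, LinearMap.funLeft_apply]
    · ext ⟨x, hx⟩
      exact hf x (by simp [lowerDeg, hx, Ne.symm hn])
  · rintro ⟨h1, h2⟩ x hx
    by_cases hb : deg x = b
    · have := congrFun (h2 (by rintro rfl; simp [lowerDeg, hb] at hx)) ⟨x, hb⟩
      exact this
    · have := h1 x (by simpa [lowerDeg, hb] using hx)
      simpa [topIn, hb] using this

variable {b}

lemma δ_topIn (hb : ∀ x, deg x ≤ b) (g : {x // deg x = b} → R) : e.δ (topIn deg b g) = 0 := by
  ext x
  exact e.δ_deg rfl (topIn_mem b g) x (by have := hb x; omega)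

lemma r_topIn_deg {n : ℤ} {g : {x // deg x = b} → R}
    (hg : g ∈ piGr R (fun _ : {x // deg x = b} => b - 1) n) : e.r (topIn deg b g) ∈ gr (n + 1) := by
  by_cases hn : n = b - 1
  · subst hn
    exact e.r_deg (by omega) (topIn_mem b g)
  · have : g = 0 := by ext x; exact hg x (Ne.symm hn)
    rw [this, map_zero, map_zero]
    exact zero_mem _

lemma topPr_mem {n m : ℤ} (h : m + 1 = n) {f : κ → R} (hf : f ∈ piGr R deg n) :
    topPr deg b f ∈ piGr R (fun _ : {x // deg x = b} => b - 1) m := fun x hx =>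
  hf x (by have := x.2; have h' : b - 1 ≠ m := hx; omega)

/-- The cone of `F^b → S` is dominated by a free module in degrees less than `b`. -/
def cone (hD : IsDeg gr gr 1 D) (hb : ∀ x, deg x ≤ b) :
    Dominated (coneGr gr deg b) (e.coneD b) (lowerDeg deg b) where
  δ := e.δ - topIn deg b ∘ₗ topPr deg b ∘ₗ e.δ
  r := LinearMap.prod (e.r - e.r ∘ₗ topIn deg b ∘ₗ topPr deg b +
      e.h ∘ₗ e.r ∘ₗ topIn deg b ∘ₗ topPr deg b)
    (topPr deg b - topPr deg b ∘ₗ e.δ - topPr deg b ∘ₗ e.s ∘ₗ e.r ∘ₗ topIn deg b ∘ₗ topPr deg b)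
  s := (e.s - topIn deg b ∘ₗ topPr deg b ∘ₗ e.s) ∘ₗ LinearMap.fst _ _ _ +
    topIn deg b ∘ₗ LinearMap.snd _ _ _
  h := LinearMap.prod (e.h ∘ₗ LinearMap.fst _ _ _)
    (-(topPr deg b ∘ₗ e.s ∘ₗ LinearMap.fst _ _ _))
  δ_deg n m h f hf := by
    rw [mem_piGr_lowerDeg b hb] at hf ⊢
    have h1 : e.δ f = e.δ (f - topIn deg b (topPr deg b f)) := by
      rw [map_sub, e.δ_topIn hb, sub_zero]
    have h2 := e.δ_deg h hf.1
    rw [← h1] at h2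
    simp only [LinearMap.sub_apply, LinearMap.comp_apply, map_sub, topPr_topIn, sub_self, map_zero,
      sub_zero, implies_true, and_true]
    by_cases hm : m = b
    · subst hm
      rw [topIn_topPr _ h2, sub_self]
      exact zero_mem _
    · rw [topPr_eq_zero b hm h2, map_zero, sub_zero]
      exact h2
  r_deg n m h f hf := by
    obtain rfl : n = m := by omega
    rw [mem_piGr_lowerDeg b hb] at hf
    have h1 : e.δ f = e.δ (f - topIn deg b (topPr deg b f)) := by
      rw [map_sub, e.δ_topIn hb, sub_zero]
    have h2 := e.δ_deg rfl hf.1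
    rw [← h1] at h2
    have h3 := e.r_deg (add_zero n) hf.1
    refine ⟨?_, ?_⟩
    · have h4 : e.h (e.r (topIn deg b (topPr deg b f))) ∈ gr n := by
        by_cases hn : n = b - 1
        · subst hn
          exact e.h_deg (n := b) (by omega) (e.r_deg (add_zero b) (topIn_mem b _))
        · rw [hf.2 hn]
          simp
      rw [map_sub] at h3
      exact add_mem h3 h4
    · have h4 : ∀ g : {x // deg x = b} → R, (n ≠ b - 1 → g = 0) →
          g ∈ piGr R (fun _ : {x // deg x = b} => b - 1) n := fun g hg x hx => by
        rw [hg (show n ≠ b - 1 from Ne.symm hx)]; rfl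
      refine sub_mem (sub_mem (h4 _ hf.2) (topPr_mem rfl h2)) (h4 _ fun hn => ?_)
      rw [LinearMap.comp_apply, LinearMap.comp_apply, LinearMap.comp_apply, LinearMap.comp_apply,
        hf.2 hn]
      simp
  s_deg n m h := by
    rintro ⟨x, g⟩ ⟨hx, hg⟩
    obtain rfl : n = m := by omega
    rw [mem_piGr_lowerDeg b hb]
    have h1 := e.s_deg (add_zero n) hx
    simp only [LinearMap.add_apply, LinearMap.comp_apply, LinearMap.fst_apply, LinearMap.snd_apply,
      LinearMap.sub_apply, map_add, map_sub, topPr_topIn, sub_self, zero_add, add_sub_cancel_right,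
      sub_zero]
    refine ⟨?_, fun hn => ?_⟩
    · by_cases hn : n = b
      · subst hn
        rw [topIn_topPr _ h1]
        simp
      · rw [topPr_eq_zero b hn h1]
        simpa using h1
    · ext y
      exact hg y (Ne.symm hn)
  h_deg n m h := by
    rintro ⟨x, g⟩ ⟨hx, hg⟩
    exact ⟨e.h_deg h hx, neg_mem (topPr_mem (by omega) (e.s_deg (add_zero n) hx))⟩
  δ_δ f := by
    simp only [LinearMap.sub_apply, LinearMap.comp_apply, map_sub, e.δ_δ, e.δ_topIn hb, map_zero,
      sub_zero]
  D_r f := by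
    have h1 : topIn deg b (topPr deg b (e.s (e.r (topIn deg b (topPr deg b f))))) =
        e.s (e.r (topIn deg b (topPr deg b f))) :=
      topIn_topPr _ (e.s_deg (add_zero b) (e.r_deg (add_zero b) (topIn_mem b _)))
    have h2 := e.r_s (e.r (topIn deg b (topPr deg b f)))
    rw [e.D_r, e.δ_topIn hb, map_zero, map_zero, add_zero] at h2
    have h3 : D (e.h (e.r (topIn deg b (topPr deg b f)))) =
      e.r (e.s (e.r (topIn deg b (topPr deg b f)))) - e.r (topIn deg b (topPr deg b f)) := by
      rw [h2]; abel
    simp only [prod_mk_apply, coneD_apply, LinearMap.add_apply, LinearMap.sub_apply,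
      LinearMap.comp_apply, map_sub, map_add, e.D_r, e.δ_topIn hb, e.δ_δ, topPr_topIn, map_zero, h1,
      h3, sub_self, sub_zero]
    refine Prod.ext ?_ ?_ <;> simp only [Prod.fst_sub, Prod.snd_sub] <;> abel
  s_D := by
    rintro ⟨x, g⟩
    have h1 : topIn deg b (topPr deg b (e.s (e.r (topIn deg b g)))) = e.s (e.r (topIn deg b g)) :=
      topIn_topPr _ (e.s_deg (add_zero b) (e.r_deg (add_zero b) (topIn_mem b _)))
    simp only [LinearMap.comp_apply, LinearMap.add_apply, coneD_apply, LinearMap.sub_apply, map_add,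
      LinearMap.fst_apply, LinearMap.snd_apply, e.s_D, h1, e.δ_topIn hb, map_sub, map_zero, sub_zero,
      add_zero]
    abel
  r_s := by
    rintro ⟨x, g⟩
    simp only [prod_mk_apply, LinearMap.comp_apply, LinearMap.add_apply,
      coneD_apply, LinearMap.sub_apply, map_add, LinearMap.neg_apply,
      LinearMap.fst_apply, LinearMap.snd_apply, e.s_D, e.δ_topIn hb, map_sub, map_zero, sub_zero,
      add_zero, e.r_s, topPr_topIn, map_neg]
    refine Prod.ext ?_ ?_ <;>
      simp only [Prod.fst_sub, Prod.snd_sub, Prod.fst_add, Prod.snd_add] <;> abel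

end step

end Dominated

namespace ProjRes

variable {κ : Type w} {deg : κ → ℤ} {b : ℤ}

/-- A resolution of the cone of `F^b → S` gives a resolution of `S`. -/
def ofCone (hb : ∀ x, deg x ≤ b) {L : Type max u v w} [AddCommGroup L]
    [Module R L] {S : Type max u v w} [AddCommGroup S] [Module R S] {gr : ℤ → Submodule R S} {D : S →ₗ[R] S}
    (hD : IsDeg gr gr 1 D) (e : Dominated gr D deg)
    {grL : ℤ → Submodule R L}
    (c : ProjRes (Dominated.coneGr gr deg b) (e.coneD b) L grL) :
    ProjRes gr D (L × ({x // deg x = b} → R))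
      (fun n => (grL n).prod (piGr R (fun _ : {x // deg x = b} => b) n)) :=
  let qS : L →ₗ[R] S := LinearMap.fst _ _ _ ∘ₗ c.q
  let qF : L →ₗ[R] ({x // deg x = b} → R) := LinearMap.snd _ _ _ ∘ₗ c.q
  let HF : S × ({x // deg x = b} → R) →ₗ[R] ({x // deg x = b} → R) := LinearMap.snd _ _ _ ∘ₗ c.H
  let t : L →ₗ[R] S × ({x // deg x = b} → R) := c.H ∘ₗ c.q - c.q ∘ₗ c.H'
  let inl : S →ₗ[R] S × ({x // deg x = b} → R) := LinearMap.inl _ _ _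
  let inr : ({x // deg x = b} → R) →ₗ[R] S × ({x // deg x = b} → R) := LinearMap.inr _ _ _
  have q_eq : ∀ x, c.q x = (qS x, qF x) := fun x => rfl
  have H_eq : ∀ x, (c.H x).2 = HF x := fun x => rfl
  have hDq : ∀ x, D (qS x) + e.r (Dominated.topIn deg b (qF x)) = qS (c.δ x) := fun x =>
    congrArg Prod.fst (c.D_q x)
  have hqF : ∀ x, qF (c.δ x) = 0 := fun x => (congrArg Prod.snd (c.D_q x)).symm
  have hri : ∀ g, D (e.r (Dominated.topIn deg b g)) = 0 := fun g => by
    rw [e.D_r, e.δ_topIn hb, map_zero]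
  have hsplit : ∀ (x : S) (g : {x // deg x = b} → R), (x, g) = inl x + inr g := fun x g => by
    simp [inl, inr]
  have hinl : ∀ x, e.coneD b (inl x) = inl (D x) := fun x => by
    simp [inl, Dominated.coneD_apply]
  have hinr : ∀ g, e.coneD b (inr g) = inl (e.r (Dominated.topIn deg b g)) := fun g => by
    simp [inl, inr, Dominated.coneD_apply]
  have hcone : ∀ y, (e.coneD b y).2 = 0 := fun y => rfl
  have hcone1 : ∀ y, (e.coneD b y).1 = D y.1 + e.r (Dominated.topIn deg b y.2) := fun y => rfl
  have hfst : IsDeg (Dominated.coneGr gr deg b) gr 0 (LinearMap.fst R S _) := fun n m h x hx => by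
    obtain rfl : n = m := by omega
    exact hx.1
  have hsnd : IsDeg (Dominated.coneGr gr deg b) (piGr R (fun _ : {x // deg x = b} => b)) 1
      (LinearMap.snd R S _) := fun n m h x hx y hy =>
    hx.2 y (show b - 1 ≠ n by have h' : b ≠ m := hy; omega)
  have hinlg : IsDeg gr (Dominated.coneGr gr deg b) 0 inl := fun n m h x hx => by
    obtain rfl : n = m := by omega
    exact ⟨hx, zero_mem _⟩
  have hinrg : IsDeg (piGr R (fun _ : {x // deg x = b} => b)) (Dominated.coneGr gr deg b) (-1)
      inr := fun n m h x hx => ⟨zero_mem _, fun y hy =>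
    hx y (show b ≠ n by have h' : b - 1 ≠ m := hy; omega)⟩
  have htg : IsDeg grL (Dominated.coneGr gr deg b) (-1) t :=
    (c.H_deg.comp c.q_deg rfl).sub (c.q_deg.comp c.H'_deg rfl)
  have ht : ∀ x, e.coneD b (t x) + t (c.δ x) = 0 := fun x => by
    have h1 := c.q_j (c.q x)
    have h2 := c.j_q x
    rw [h2] at h1
    simp only [map_add, c.q_p, c.D_q] at h1
    simp only [t, LinearMap.sub_apply, LinearMap.comp_apply, map_sub, c.D_q]
    rw [← sub_eq_zero] at h1
    rw [← neg_eq_zero, ← h1]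
    abel
  have hH'' : ∀ x, HF (c.q x) - qF (c.H' x) - qF (c.j (t x)) = HF (t (c.δ x)) := fun x => by
    have h1 := congrArg Prod.snd (c.q_j (t x))
    have h2 : (t x).2 = HF (c.q x) - qF (c.H' x) := rfl
    rw [Prod.snd_add, Prod.snd_add, hcone, h2, eq_neg_of_add_eq_zero_left (ht x), map_neg,
      Prod.snd_neg, H_eq, add_zero] at h1
    change qF (c.j (t x)) = _ at h1
    rw [h1]
    abel
  { p := LinearMap.prodMap c.p LinearMap.id
    δ := LinearMap.prod (c.δ ∘ₗ LinearMap.fst _ _ _) (-(qF ∘ₗ LinearMap.fst _ _ _))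
    q := qS ∘ₗ LinearMap.fst _ _ _ + e.r ∘ₗ Dominated.topIn deg b ∘ₗ LinearMap.snd _ _ _
    j := LinearMap.prod (c.j ∘ₗ inl) (-(HF ∘ₗ inl))
    H := LinearMap.fst _ _ _ ∘ₗ c.H ∘ₗ inl
    H' := LinearMap.prod
      ((c.H' + c.j ∘ₗ t) ∘ₗ LinearMap.fst _ _ _ + c.j ∘ₗ inr ∘ₗ LinearMap.snd _ _ _)
      (-(HF ∘ₗ t ∘ₗ LinearMap.fst _ _ _) - HF ∘ₗ inr ∘ₗ LinearMap.snd _ _ _)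
    p_deg := fun n m h x hx => by
      obtain rfl : n = m := by omega
      exact ⟨c.p_deg h hx.1, hx.2⟩
    δ_deg := fun n m h x hx => ⟨c.δ_deg h hx.1, neg_mem (hsnd h (c.q_deg (add_zero n) hx.1))⟩
    q_deg := fun n m h x hx => by
      obtain rfl : n = m := by omega
      refine add_mem (hfst h (c.q_deg h hx.1)) ?_
      have := e.r_topIn_deg (b := b) (n := n - 1) (g := x.2) (fun y hy =>
        hx.2 y (show b ≠ n by have h' : b - 1 ≠ n - 1 := hy; omega))
      rwa [sub_add_cancel] at this
    j_deg := fun n m h x hx => by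
      obtain rfl : n = m := by omega
      exact ⟨c.j_deg h (hinlg h hx), neg_mem (hsnd (sub_add_cancel n 1)
        (c.H_deg (by omega) (hinlg h hx)))⟩
    H_deg := hfst.comp (c.H_deg.comp hinlg rfl) rfl
    H'_deg := fun n m h x hx => by exact ⟨add_mem (add_mem (c.H'_deg h hx.1)
      (c.j_deg (add_zero m) (htg h hx.1))) (c.j_deg (add_zero m) (hinrg h hx.2)),
      sub_mem (neg_mem (hsnd (sub_add_cancel m 1) (c.H_deg (by omega) (htg h hx.1))))
        (hsnd (sub_add_cancel m 1) (c.H_deg (by omega) (hinrg h hx.2)))⟩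
    p_p := by
      rintro ⟨x, f⟩
      simp [c.p_p]
    p_δ := by
      rintro ⟨x, f⟩
      simp [c.p_δ, prod_mk_apply]
    δ_p := by
      rintro ⟨x, f⟩
      simp [c.δ_p, prod_mk_apply, qF, c.q_p]
    δ_δ := by
      rintro ⟨x, f⟩
      simp [c.δ_δ, prod_mk_apply, hqF]
    q_p := by
      rintro ⟨x, f⟩
      simp [qS, c.q_p]
    p_j := fun x => by simp [prod_mk_apply, c.p_j]
    D_q := by
      rintro ⟨x, f⟩
      simp only [LinearMap.add_apply, LinearMap.comp_apply, LinearMap.fst_apply,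
        LinearMap.snd_apply, prod_mk_apply, map_add, hri, ← hDq, LinearMap.neg_apply, map_neg]
      abel
    j_D := fun x => by
      have h1 := congrArg Prod.snd (c.q_j (inl x))
      rw [Prod.snd_add, Prod.snd_add, hcone, hinl] at h1
      simp only [prod_mk_apply, LinearMap.comp_apply, LinearMap.neg_apply, LinearMap.fst_apply]
      rw [← hinl, c.j_D, hinl]
      refine Prod.ext rfl ?_
      change (c.q (c.j (inl x))).2 = 0 + 0 + HF (inl (D x)) at h1
      change -HF (inl (D x)) = -(c.q (c.j (inl x))).2
      rw [h1, zero_add, zero_add]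
    q_j := fun x => by
      have h1 := congrArg Prod.fst (c.q_j (inl x))
      rw [Prod.fst_add, Prod.fst_add, hcone1, hinl] at h1
      simp only [LinearMap.add_apply, LinearMap.comp_apply, LinearMap.fst_apply,
        LinearMap.snd_apply, prod_mk_apply, LinearMap.neg_apply, map_neg]
      change (c.q (c.j (inl x))).1 + _ = _
      rw [h1, H_eq]
      change x + _ + _ + _ = _
      abel
    j_q := by
      rintro ⟨x, f⟩
      have h1 := c.j_q x
      rw [q_eq, hsplit, map_add] at h1
      have h2 := c.j_D (inr f)
      rw [hinr] at h2
      have h3 := congrArg Prod.snd (c.q_j (inr f))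
      rw [Prod.snd_add, Prod.snd_add, hcone, hinr, H_eq] at h3
      change qF (c.j (inr f)) = f + 0 + _ at h3
      have h4 := hH'' x
      rw [q_eq, hsplit, map_add] at h4
      have h5 : c.δ (c.j (t x)) + c.j (t (c.δ x)) = 0 := by
        rw [← c.j_D, ← map_add, ht, map_zero]
      simp only [LinearMap.add_apply, LinearMap.comp_apply, LinearMap.fst_apply,
        LinearMap.snd_apply, prod_mk_apply, LinearMap.neg_apply, LinearMap.sub_apply, map_neg,
        map_add, LinearMap.prodMap_apply, LinearMap.id_apply, Prod.mk_add_mk, Prod.mk.injEq]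
      constructor
      · rw [h2, eq_sub_of_add_eq h1, eq_neg_of_add_eq_zero_right h5]
        abel
      · rw [h3, ← h4]
        abel }

end ProjRes

/-- A complex that is dominated by a bounded graded free module of finite rank is homotopy
equivalent to a bounded complex of finitely generated projective modules. -/
lemma Dominated.exists_projRes {κ : Type w} [Finite κ] (n : ℕ) :
    ∀ {S : Type (max u v w)} [AddCommGroup S] [Module R S] {gr : ℤ → Submodule R S} {D : S →ₗ[R] S}
      {deg : κ → ℤ} (hD : IsDeg gr gr 1 D) (hDD : ∀ x, D (D x) = 0) (e : Dominated gr D deg) {b : ℤ}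
      (hb : ∀ x, b - n ≤ deg x ∧ deg x ≤ b),
    ∃ (κ' : Type w) (_ : Finite κ') (deg' : κ' → ℤ) (L : Type (max u v w)) (_ : AddCommGroup L)
      (_ : Module R L) (f : L ≃ₗ[R] (κ' → R)),
      Nonempty (ProjRes gr D L fun n => (piGr R deg' n).comap f.toLinearMap) := by
  induction n with
  | zero =>
    intro S _ _ gr D deg hD hDD e b hb
    exact ⟨κ, inferInstance, deg, exists_projRes_zero.{u, v, w} hD hDD e (b := b)
      (fun x => by have := hb x; push_cast at this; omega)⟩
  | succ n ih =>
    intro S _ _ gr D deg hD hDD e b hb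
    have hb' : ∀ x, deg x ≤ b := fun x => (hb x).2
    obtain ⟨κ', _, deg', L, _, _, f, ⟨c⟩⟩ :=
      @ih (S × ({x // deg x = b} → R)) _ _ (coneGr gr deg b) (e.coneD b) (lowerDeg deg b)
      (fun n m h x hx => ⟨add_mem (hD h hx.1) (h ▸ e.r_topIn_deg hx.2), zero_mem _⟩)
      (by
        rintro ⟨x, g⟩
        rw [coneD_apply, coneD_apply, map_add, hDD, e.D_r, e.δ_topIn hb']
        simp)
      (e.cone hD hb') (b - 1) (fun x => by
        have := hb x
        unfold lowerDeg
        push_cast at this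
        split_ifs <;> omega)
    refine ⟨κ' ⊕ {x // deg x = b}, inferInstance, Sum.elim deg' (fun _ => b),
      L × ({x // deg x = b} → R), inferInstance, inferInstance,
      (f.prodCongr (LinearEquiv.refl R _)).trans (LinearEquiv.sumArrowLequivProdArrow κ' _ R R).symm,
      ⟨?_⟩⟩
    have := ProjRes.ofCone.{u, v, w} hb' hD e c
    convert this using 2 with n
    ext ⟨x, g⟩
    constructor
    · intro h
      exact ⟨fun y hy => h (Sum.inl y) hy, fun y hy => h (Sum.inr y) hy⟩
    · rintro ⟨h1, h2⟩ (y | y) hy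
      · exact h1 y hy
      · exact h2 y hy

end Domination

/-! ### Functors between total categories -/

namespace TotCat

/-- A functor of total categories. -/
structure Func (P : TotCat.{u, v}) (C : TotCat) where
  obj : P.Obj → C.Obj
  map : ∀ {X Y : P.Obj}, P.Hom X Y →+ C.Hom (obj X) (obj Y)
  map_id : ∀ X, map (P.id X) = C.id (obj X)
  map_comp : ∀ {X Y Z : P.Obj} (g : P.Hom Y Z) (f : P.Hom X Y), map (g ⊚ f) = map g ⊚ map f
  map_D : ∀ {X Y : P.Obj} (f : P.Hom X Y), map (P.D f) = C.D (map f)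
  map_σ : ∀ {X Y : P.Obj} (f : P.Hom X Y), map (P.σ f) = C.σ (map f)
  map_gr : ∀ {X Y : P.Obj} {n : ℤ} {f : P.Hom X Y}, f ∈ P.gr n → map f ∈ C.gr n

/-- A natural retraction `ε` of a functor on morphisms together with a natural map `K` of degree
`-1`, a candidate for a homotopy between the identity and the composite of the functor with `ε`. -/
structure Transfer {P C : TotCat} (T : Func P C) where
  ε : ∀ {X Y : P.Obj}, C.Hom (T.obj X) (T.obj Y) →+ P.Hom X Y
  K : ∀ {X Y : P.Obj}, C.Hom (T.obj X) (T.obj Y) →+ C.Hom (T.obj X) (T.obj Y)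
  ε_gr : ∀ {X Y : P.Obj} {n : ℤ} {x : C.Hom (T.obj X) (T.obj Y)}, x ∈ C.gr n → ε x ∈ P.gr n
  K_gr : ∀ {X Y : P.Obj} {n m : ℤ} {x : C.Hom (T.obj X) (T.obj Y)}, m + 1 = n → x ∈ C.gr n →
    K x ∈ C.gr m
  ε_σ : ∀ {X Y : P.Obj} (x : C.Hom (T.obj X) (T.obj Y)), ε (C.σ x) = P.σ (ε x)
  K_σ : ∀ {X Y : P.Obj} (x : C.Hom (T.obj X) (T.obj Y)), K (C.σ x) = -C.σ (K x)
  ε_map : ∀ {X Y : P.Obj} (f : P.Hom X Y), ε (T.map f) = f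
  K_map : ∀ {X Y : P.Obj} (f : P.Hom X Y), K (T.map f) = 0
  ε_left : ∀ {X Y Z : P.Obj} (a : P.Hom Y Z) (x : C.Hom (T.obj X) (T.obj Y)),
    ε (T.map a ⊚ x) = a ⊚ ε x
  ε_right : ∀ {X Y Z : P.Obj} (x : C.Hom (T.obj Y) (T.obj Z)) (a : P.Hom X Y),
    ε (x ⊚ T.map a) = ε x ⊚ a
  K_left : ∀ {X Y Z : P.Obj} (a : P.Hom Y Z) (x : C.Hom (T.obj X) (T.obj Y)),
    K (T.map a ⊚ x) = C.σ (T.map a) ⊚ K x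
  K_right : ∀ {X Y Z : P.Obj} (x : C.Hom (T.obj Y) (T.obj Z)) (a : P.Hom X Y),
    K (x ⊚ T.map a) = K x ⊚ T.map a

/-- An object with an action of a commutative ring `R`. -/
structure UnitObj (P : TotCat.{v, w}) (R : Type u) [CommRing R] where
  one : P.Obj
  z : R →+ P.Hom one one
  z_one : z 1 = P.id one
  z_mul : ∀ a b, z (a * b) = z a ⊚ z b
  z_gr : ∀ a, z a ∈ P.gr 0

/-- `F` is the direct sum of shifts of the unit object indexed by `κ`. -/
structure FreeOn {P : TotCat.{v, w}} {R : Type u} [CommRing R] (𝕀 : P.UnitObj R) {κ : Type}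
    [Fintype κ] [DecidableEq κ] (deg : κ → ℤ) (F : P.Obj) where
  e : κ → P.Hom 𝕀.one F
  l : κ → P.Hom F 𝕀.one
  e_gr : ∀ x, e x ∈ P.gr (deg x)
  l_gr : ∀ x, l x ∈ P.gr (-deg x)
  l_e : ∀ x y, l x ⊚ e y = if x = y then P.id 𝕀.one else 0
  sum_e_l : ∑ x, e x ⊚ l x = P.id F
  D_e : ∀ x, P.D (e x) = 0
  D_l : ∀ x, P.D (l x) = 0

namespace FreeOn

variable {P : TotCat.{v, w}} {R : Type u} [CommRing R] {𝕀 : P.UnitObj R} {κ κ' κ'' : Type}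
  [Fintype κ] [DecidableEq κ] [Fintype κ'] [DecidableEq κ'] [Fintype κ''] [DecidableEq κ'']
  {deg : κ → ℤ} {deg' : κ' → ℤ} {deg'' : κ'' → ℤ} {F F' F'' : P.Obj}
  (φ : FreeOn 𝕀 deg F) (φ' : FreeOn 𝕀 deg' F') (φ'' : FreeOn 𝕀 deg'' F'')

def mat : ((κ → R) →ₗ[R] (κ' → R)) →+ P.Hom F F' :=
  AddMonoidHom.mk' (fun f => ∑ y, ∑ x, φ'.e x ⊚ 𝕀.z (f (Pi.single y 1) x) ⊚ φ.l y) (fun f g => by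
    simp only [LinearMap.add_apply, Pi.add_apply, map_add, AddMonoidHom.add_apply,
      Finset.sum_add_distrib])

lemma mat_apply (f : (κ → R) →ₗ[R] (κ' → R)) :
    φ.mat φ' f = ∑ y, ∑ x, φ'.e x ⊚ 𝕀.z (f (Pi.single y 1) x) ⊚ φ.l y := rfl

lemma mat_e (f : (κ → R) →ₗ[R] (κ' → R)) (y : κ) :
    φ.mat φ' f ⊚ φ.e y = ∑ x, φ'.e x ⊚ 𝕀.z (f (Pi.single y 1) x) := by
  simp only [mat_apply, map_sum, AddMonoidHom.finsetSum_apply, P.assoc, φ.l_e, apply_ite, map_zero,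
    P.comp_id]
  rw [Finset.sum_eq_single y]
  · simp
  · intro b _ hb
    simp [hb]
  · simp

lemma l_mat (f : (κ → R) →ₗ[R] (κ' → R)) (x : κ') :
    φ'.l x ⊚ φ.mat φ' f = ∑ y, 𝕀.z (f (Pi.single y 1) x) ⊚ φ.l y := by
  simp only [mat_apply, map_sum]
  refine Finset.sum_congr rfl fun y _ => ?_
  rw [Finset.sum_eq_single x]
  · rw [← P.assoc, φ'.l_e, if_pos rfl, P.id_comp]
  · intro b _ hb
    rw [← P.assoc, φ'.l_e, if_neg (Ne.symm hb)]
    simp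
  · simp

lemma hom_ext {X : P.Obj} {f g : P.Hom F X} (h : ∀ x, f ⊚ φ.e x = g ⊚ φ.e x) : f = g := by
  rw [← P.comp_id f, ← P.comp_id g, ← φ.sum_e_l, map_sum, map_sum]
  refine Finset.sum_congr rfl fun x _ => ?_
  rw [← P.assoc, h, P.assoc]

lemma hom_ext' {X : P.Obj} {f g : P.Hom X F} (h : ∀ x, φ.l x ⊚ f = φ.l x ⊚ g) : f = g := by
  rw [← P.id_comp f, ← P.id_comp g, ← φ.sum_e_l]
  simp only [map_sum, AddMonoidHom.finsetSum_apply, P.assoc, h]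

lemma apply_eq_sum (f : (κ' → R) →ₗ[R] (κ'' → R)) (g : κ' → R) :
    f g = ∑ y, g y • f (Pi.single y 1) := by
  conv_lhs => rw [← Finset.univ_sum_single g, map_sum]
  refine Finset.sum_congr rfl fun y _ => ?_
  rw [← map_smul, ← Pi.single_smul', smul_eq_mul, mul_one]

lemma mat_comp (g : (κ' → R) →ₗ[R] (κ'' → R)) (f : (κ → R) →ₗ[R] (κ' → R)) :
    φ.mat φ'' (g ∘ₗ f) = φ'.mat φ'' g ⊚ φ.mat φ' f := by
  refine φ.hom_ext fun y => ?_
  rw [P.assoc, mat_e, mat_e, map_sum]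
  simp only [← P.assoc, mat_e]
  simp only [map_sum, AddMonoidHom.finsetSum_apply, P.assoc, ← 𝕀.z_mul]
  rw [Finset.sum_comm]
  refine Finset.sum_congr rfl fun x _ => ?_
  rw [← map_sum, ← map_sum, LinearMap.comp_apply, apply_eq_sum g]
  simp only [Finset.sum_apply, Pi.smul_apply, smul_eq_mul, mul_comm]

lemma mat_gr {f : (κ → R) →ₗ[R] (κ' → R)} {n : ℤ} (hf : IsDeg (piGr R deg) (piGr R deg') n f) :
    φ.mat φ' f ∈ P.gr n := by
  rw [mat_apply]
  refine sum_mem fun y _ => sum_mem fun x _ => ?_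
  by_cases h : deg' x = deg y + n
  · exact P.comp_gr (n := -deg y) (by omega) (φ'.e_gr x)
      (P.comp_gr (by omega) (𝕀.z_gr _) (φ.l_gr y))
  · rw [hf rfl (single_mem_piGr deg y 1) x h]
    simp

end FreeOn

end TotCat

/-! ### Objects dominated by free objects -/

namespace TotCat

/-- Morphisms from the image of the unit object to `E`, a module over `R`. -/
def Sec {P : TotCat.{v, w}} {C : TotCat} (T : Func P C) {R : Type u} [CommRing R]
    (𝕀 : P.UnitObj R) (E : C.Obj) : Type _ := C.Hom (T.obj 𝕀.one) E

namespace Sec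

variable {P : TotCat.{v, w}} {C : TotCat} (T : Func P C) {R : Type u} [CommRing R]
    (𝕀 : P.UnitObj R) (E : C.Obj)

instance : AddCommGroup (Sec T 𝕀 E) := inferInstanceAs (AddCommGroup (C.Hom (T.obj 𝕀.one) E))

variable {T 𝕀 E}

def of : C.Hom (T.obj 𝕀.one) E →+ Sec T 𝕀 E := AddMonoidHom.id _

def hom : Sec T 𝕀 E →+ C.Hom (T.obj 𝕀.one) E := AddMonoidHom.id _

@[simp] lemma hom_of (x : C.Hom (T.obj 𝕀.one) E) : hom (of x) = x := rfl

@[simp] lemma of_hom (x : Sec T 𝕀 E) : of (hom x) = x := rfl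

lemma hom_inj {x y : Sec T 𝕀 E} (h : hom x = hom y) : x = y := h

instance : SMul R (Sec T 𝕀 E) := ⟨fun r x => of (hom x ⊚ T.map (𝕀.z r))⟩

lemma hom_smul (r : R) (x : Sec T 𝕀 E) : hom (r • x) = hom x ⊚ T.map (𝕀.z r) := rfl

instance : Module R (Sec T 𝕀 E) where
  one_smul x := hom_inj (by rw [hom_smul, 𝕀.z_one, T.map_id, C.comp_id])
  mul_smul r s x := hom_inj (by
    rw [hom_smul, hom_smul, hom_smul, mul_comm, 𝕀.z_mul, T.map_comp, C.assoc])
  smul_zero r := hom_inj (by rw [hom_smul, map_zero, map_zero, AddMonoidHom.zero_apply])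
  smul_add r x y := hom_inj (by simp only [hom_smul, map_add, AddMonoidHom.add_apply])
  add_smul r s x := hom_inj (by simp only [hom_smul, map_add])
  zero_smul x := hom_inj (by simp only [hom_smul, map_zero])

variable (T 𝕀 E) in
def gr (n : ℤ) : Submodule R (Sec T 𝕀 E) where
  carrier := {x | hom x ∈ C.gr n}
  add_mem' := (C.gr n).add_mem
  zero_mem' := (C.gr n).zero_mem
  smul_mem' r x hx := C.comp_gr (by omega) hx (T.map_gr (𝕀.z_gr r))

end Sec

/-- Exact transfer data for which the endomorphisms of the unit object are the elements of `R`. -/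
structure LevelZero {P : TotCat.{v, w}} {C : TotCat} (T : Func P C) {R : Type u} [CommRing R]
    (𝕀 : P.UnitObj R) extends Transfer T where
  D_ε : ∀ {X Y : P.Obj} (x : C.Hom (T.obj X) (T.obj Y)), P.D (ε x) = ε (C.D x)
  htpy : ∀ {X Y : P.Obj} (x : C.Hom (T.obj X) (T.obj Y)), T.map (ε x) = x - C.D (K x) - K (C.D x)
  red : P.Hom 𝕀.one 𝕀.one →+ R
  z_red : ∀ x, 𝕀.z (red x) = x
  red_z : ∀ r, red (𝕀.z r) = r
  one_gr : ∀ {n : ℤ} {x : P.Hom 𝕀.one 𝕀.one}, n ≠ 0 → x ∈ P.gr n → x = 0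

namespace LevelZero

variable {P : TotCat.{v, w}} {C : TotCat} {T : Func P C} {R : Type u} [CommRing R]
    {𝕀 : P.UnitObj R} (τ : LevelZero T 𝕀) {E : C.Obj} {κ κ' κ'' : Type}
  [Fintype κ] [DecidableEq κ] [Fintype κ'] [DecidableEq κ'] [Fintype κ''] [DecidableEq κ'']
  {deg : κ → ℤ} {deg' : κ' → ℤ} {deg'' : κ'' → ℤ} {F F' F'' : P.Obj}
  (φ : FreeOn 𝕀 deg F) (φ' : FreeOn 𝕀 deg' F') (φ'' : FreeOn 𝕀 deg'' F'')

lemma D_one (τ : LevelZero T 𝕀) (x : P.Hom 𝕀.one 𝕀.one) : P.D x = 0 := by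
  rw [← τ.z_red x]
  exact τ.one_gr (n := 1) one_ne_zero (P.D_gr (by omega) (𝕀.z_gr _))

lemma D_mat (τ : LevelZero T 𝕀) (f : (κ → R) →ₗ[R] (κ' → R)) : P.D (φ.mat φ' f) = 0 := by
  simp only [FreeOn.mat_apply, map_sum, P.D_comp, φ.D_l, φ'.D_e, τ.D_one, map_zero,
    AddMonoidHom.zero_apply, add_zero, Finset.sum_const_zero]

def secD (τ : LevelZero T 𝕀) (E : C.Obj) : Sec T 𝕀 E →ₗ[R] Sec T 𝕀 E where
  toFun x := Sec.of (C.D (Sec.hom x))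
  map_add' x y := by simp only [map_add]
  map_smul' r x := Sec.hom_inj (by
    have h : C.D (T.map (𝕀.z r)) = 0 := by rw [← T.map_D, τ.D_one, map_zero]
    simp only [Sec.hom_of, Sec.hom_smul, C.D_comp, h, map_zero, add_zero, RingHom.id_apply])

lemma hom_secD (x : Sec T 𝕀 E) : Sec.hom (τ.secD E x) = C.D (Sec.hom x) := rfl

def secComp {E E' : C.Obj} (f : C.Hom E E') : Sec T 𝕀 E →ₗ[R] Sec T 𝕀 E' where
  toFun x := Sec.of (f ⊚ Sec.hom x)
  map_add' x y := by simp only [map_add]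
  map_smul' r x := Sec.hom_inj (by simp only [Sec.hom_of, Sec.hom_smul, C.assoc, RingHom.id_apply])

/-- The linear map from a free module given by a morphism from the free object. -/
def secOf (f : C.Hom (T.obj F) E) : (κ → R) →ₗ[R] Sec T 𝕀 E :=
  ∑ x, LinearMap.toSpanSingleton R (Sec T 𝕀 E) (Sec.of (f ⊚ T.map (φ.e x))) ∘ₗ LinearMap.proj x

lemma hom_secOf (f : C.Hom (T.obj F) E) (g : κ → R) :
    Sec.hom (secOf φ f g) = ∑ x, f ⊚ T.map (φ.e x) ⊚ T.map (𝕀.z (g x)) := by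
  simp only [secOf, LinearMap.sum_apply, map_sum, LinearMap.comp_apply, LinearMap.proj_apply,
    LinearMap.toSpanSingleton_apply, Sec.hom_smul, Sec.hom_of, C.assoc]

def coords : Sec T 𝕀 (T.obj F) →ₗ[R] (κ → R) where
  toFun x y := τ.red (τ.ε (T.map (φ.l y) ⊚ Sec.hom x))
  map_add' x y := by ext; simp only [map_add, Pi.add_apply]
  map_smul' r x := by
    ext y
    simp only [Sec.hom_smul, ← C.assoc, τ.ε_right, RingHom.id_apply, Pi.smul_apply, smul_eq_mul]
    rw [mul_comm, ← τ.red_z (_ * r), 𝕀.z_mul, τ.z_red]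

def hat : ((κ → R) →ₗ[R] Sec T 𝕀 E) →+ C.Hom (T.obj F) E :=
  AddMonoidHom.mk' (fun q => ∑ y, Sec.hom (q (Pi.single y 1)) ⊚ T.map (φ.l y)) (fun f g => by
    simp only [LinearMap.add_apply, map_add, AddMonoidHom.add_apply, Finset.sum_add_distrib])

lemma hat_apply (q : (κ → R) →ₗ[R] Sec T 𝕀 E) :
    hat φ q = ∑ y, Sec.hom (q (Pi.single y 1)) ⊚ T.map (φ.l y) := rfl

lemma map_hom_ext {f g : C.Hom (T.obj F) E} (h : ∀ x, f ⊚ T.map (φ.e x) = g ⊚ T.map (φ.e x)) :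
    f = g := by
  rw [← C.comp_id f, ← C.comp_id g, ← T.map_id, ← φ.sum_e_l]
  simp only [map_sum, T.map_comp, ← C.assoc, h]

lemma hat_e (q : (κ → R) →ₗ[R] Sec T 𝕀 E) (x : κ) :
    hat φ q ⊚ T.map (φ.e x) = Sec.hom (q (Pi.single x 1)) := by
  simp only [hat_apply, map_sum, AddMonoidHom.finsetSum_apply, C.assoc, ← T.map_comp, φ.l_e,
    apply_ite, map_zero, T.map_id, C.comp_id]
  rw [Finset.sum_eq_single x]
  · simp
  · intro b _ hb
    simp [hb]
  · simp

lemma hat_secOf (f : C.Hom (T.obj F) E) : hat φ (secOf φ f) = f := by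
  refine map_hom_ext φ fun x => ?_
  rw [hat_e, hom_secOf, Finset.sum_eq_single x]
  · simp [𝕀.z_one, T.map_id, C.comp_id]
  · intro b _ hb
    simp [hb]
  · simp

lemma hom_apply_eq_sum (q : (κ → R) →ₗ[R] Sec T 𝕀 E) (g : κ → R) :
    Sec.hom (q g) = ∑ y, Sec.hom (q (Pi.single y 1)) ⊚ T.map (𝕀.z (g y)) := by
  conv_lhs => rw [← Finset.univ_sum_single g, map_sum, map_sum]
  refine Finset.sum_congr rfl fun y _ => ?_
  rw [← Sec.hom_smul, ← map_smul, ← Pi.single_smul', smul_eq_mul, mul_one]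

lemma hat_mat (q : (κ' → R) →ₗ[R] Sec T 𝕀 E) (f : (κ → R) →ₗ[R] (κ' → R)) :
    hat φ' q ⊚ T.map (φ.mat φ' f) = hat φ (q ∘ₗ f) := by
  refine map_hom_ext φ fun y => ?_
  rw [hat_e, C.assoc, ← T.map_comp, φ.mat_e]
  simp only [map_sum, T.map_comp, ← C.assoc, hat_e]
  exact (hom_apply_eq_sum q _).symm

lemma D_hat (q : (κ → R) →ₗ[R] Sec T 𝕀 E) : C.D (hat φ q) = hat φ (τ.secD E ∘ₗ q) := by
  simp only [hat_apply, map_sum, C.D_comp, ← T.map_D, φ.D_l, map_zero, add_zero]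
  rfl

lemma hat_gr {q : (κ → R) →ₗ[R] Sec T 𝕀 E} {n : ℤ}
    (hq : IsDeg (piGr R deg) (Sec.gr T 𝕀 E) n q) : hat φ q ∈ C.gr n := by
  rw [hat_apply]
  exact sum_mem fun y _ => C.comp_gr (n := -deg y) (m := deg y + n) (by omega)
    (show Sec.hom _ ∈ C.gr _ from hq rfl (single_mem_piGr deg y 1)) (T.map_gr (φ.l_gr y))

lemma secOf_coords (x : Sec T 𝕀 (T.obj F)) (f : C.Hom (T.obj F) E) :
    Sec.hom (secOf φ f (τ.coords φ x)) = f ⊚ T.map (τ.ε (Sec.hom x)) := by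
  rw [hom_secOf]
  simp only [coords, LinearMap.coe_mk, AddHom.coe_mk, τ.z_red, τ.ε_left, T.map_comp]
  rw [← map_sum]
  congr 1
  conv_rhs => rw [← P.id_comp (τ.ε (Sec.hom x)), ← φ.sum_e_l]
  simp only [map_sum, AddMonoidHom.finsetSum_apply, P.assoc, T.map_comp]

lemma ε_eq_mat (f : C.Hom (T.obj F) (T.obj F')) :
    τ.ε f = φ.mat φ' (τ.coords φ' ∘ₗ secOf φ f) := by
  refine φ.hom_ext fun y => φ'.hom_ext' fun x => ?_
  rw [← P.assoc (φ'.l x) (φ.mat φ' _), φ.l_mat, ← τ.ε_right, ← τ.ε_left, map_sum, AddMonoidHom.finsetSum_apply,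
    Finset.sum_eq_single y]
  · rw [P.assoc, φ.l_e, if_pos rfl, P.comp_id]
    simp only [LinearMap.comp_apply, coords, LinearMap.coe_mk, AddHom.coe_mk, τ.z_red, hom_secOf]
    rw [Finset.sum_eq_single y]
    · simp [𝕀.z_one, T.map_id, C.comp_id]
    · intro b _ hb
      simp [hb]
    · simp
  · intro b _ hb
    rw [P.assoc, φ.l_e, if_neg hb, map_zero]
  · simp

lemma coords_mat (x : Sec T 𝕀 (T.obj F)) (f : (κ → R) →ₗ[R] (κ' → R)) :
    τ.coords φ' (Sec.of (T.map (φ.mat φ' f) ⊚ Sec.hom x)) = f (τ.coords φ x) := by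
  ext y
  simp only [coords, LinearMap.coe_mk, AddHom.coe_mk, Sec.hom_of]
  rw [← C.assoc, ← T.map_comp, φ.l_mat, FreeOn.apply_eq_sum f]
  simp only [map_sum, AddMonoidHom.finsetSum_apply, T.map_comp, C.assoc, τ.ε_left]
  rw [Finset.sum_apply]
  refine Finset.sum_congr rfl fun b _ => ?_
  rw [Pi.smul_apply, smul_eq_mul, mul_comm, ← τ.red_z (_ * _), 𝕀.z_mul, τ.z_red]

variable (T) in
/-- An object `E` is dominated by a free object `F` with differential `δ`. -/
structure DominatedObj (E : C.Obj) (δ : (κ → R) →ₗ[R] (κ → R)) where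
  r : C.Hom (T.obj F) E
  s : C.Hom E (T.obj F)
  h : C.Hom E E
  r_gr : r ∈ C.gr 0
  s_gr : s ∈ C.gr 0
  h_gr : h ∈ C.gr (-1)
  δ_deg : IsDeg (piGr R deg) (piGr R deg) 1 δ
  δ_δ : ∀ x, δ (δ x) = 0
  D_r : C.D r = r ⊚ T.map (φ.mat φ δ)
  D_s : C.D s = -(T.map (φ.mat φ δ) ⊚ s)
  r_s : r ⊚ s = C.id E + C.D h

/-- The complex of sections of a dominated object is dominated. -/
def DominatedObj.sec {δ : (κ → R) →ₗ[R] (κ → R)} (e : DominatedObj T φ E δ) :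
    Dominated (Sec.gr T 𝕀 E) (τ.secD E) deg where
  δ := δ
  r := secOf φ e.r
  s := τ.coords φ ∘ₗ secComp e.s
  h := secComp e.h - secComp e.r ∘ₗ
    { toFun := fun x => Sec.of (τ.K (e.s ⊚ Sec.hom x))
      map_add' := fun x y => by simp only [map_add]
      map_smul' := fun r x => Sec.hom_inj (by
        simp only [Sec.hom_of, Sec.hom_smul, ← C.assoc, τ.K_right, RingHom.id_apply]) }
  δ_deg := e.δ_deg
  r_deg n m h x hx := by
    obtain rfl : n = m := by omega
    change Sec.hom (secOf φ e.r x) ∈ C.gr n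
    rw [hom_secOf]
    refine sum_mem fun y _ => ?_
    by_cases hy : deg y = n
    · subst hy
      exact C.comp_gr (zero_add _) e.r_gr (C.comp_gr (add_zero _) (T.map_gr (φ.e_gr y))
        (T.map_gr (𝕀.z_gr _)))
    · rw [hx y hy]
      simp
  s_deg n m h x hx y hy := by
    have h1 : Sec.hom x ∈ C.gr n := hx
    have := τ.one_gr (n := -deg y + (0 + n)) (by omega)
      (τ.ε_gr (C.comp_gr rfl (T.map_gr (φ.l_gr y)) (C.comp_gr rfl e.s_gr h1)))
    change τ.red (τ.ε (T.map (φ.l y) ⊚ (e.s ⊚ Sec.hom x))) = 0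
    rw [this, map_zero]
  h_deg n m h x hx := by
    have h1 : Sec.hom x ∈ C.gr n := hx
    exact sub_mem (C.comp_gr (by omega) e.h_gr h1) (C.comp_gr (zero_add m) e.r_gr
      (τ.K_gr (n := n) (by omega) (C.comp_gr (zero_add n) e.s_gr h1)))
  δ_δ := e.δ_δ
  D_r x := by
    have h1 : τ.secD E ∘ₗ secOf φ e.r = secOf φ e.r ∘ₗ δ := by
      refine LinearMap.pi_ext' fun y => LinearMap.ext_ring ?_
      have h2 := τ.D_hat φ (secOf φ e.r)
      rw [hat_secOf, e.D_r] at h2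
      have h3 := hat_mat φ φ (secOf φ e.r) δ
      rw [hat_secOf, h2] at h3
      have h4 := congrArg (fun f => f ⊚ T.map (φ.e y)) h3
      simp only [hat_e] at h4
      exact Sec.hom_inj h4
    exact LinearMap.congr_fun h1 x
  s_D x := by
    change τ.coords φ (Sec.of (e.s ⊚ C.D (Sec.hom x))) = δ (τ.coords φ (Sec.of (e.s ⊚ Sec.hom x)))
    rw [← τ.coords_mat φ φ, ← sub_eq_zero, ← map_sub, ← map_sub]
    have h1 : e.s ⊚ C.D (Sec.hom x) - T.map (φ.mat φ δ) ⊚ Sec.hom (Sec.of (e.s ⊚ Sec.hom x)) =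
        C.D (e.s ⊚ Sec.hom x) := by
      rw [C.D_comp, C.σ_even e.s_gr Even.zero, e.D_s, map_neg, AddMonoidHom.neg_apply, C.assoc,
        Sec.hom_of]
      abel
    rw [h1]
    ext y
    have h2 : T.map (φ.l y) ⊚ C.D (e.s ⊚ Sec.hom x) =
        C.D (C.σ (T.map (φ.l y)) ⊚ (e.s ⊚ Sec.hom x)) := by
      rw [C.D_comp (C.σ _), C.D_σ, ← T.map_D, φ.D_l, C.σ_σ]
      simp
    change τ.red (τ.ε (T.map (φ.l y) ⊚ C.D (e.s ⊚ Sec.hom x))) = 0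
    rw [h2, ← τ.D_ε, τ.D_one, map_zero]
  r_s x := by
    refine Sec.hom_inj ?_
    rw [LinearMap.comp_apply, secOf_coords, τ.htpy]
    simp only [map_add, hom_secD, LinearMap.sub_apply, map_sub, LinearMap.comp_apply, secComp,
      LinearMap.coe_mk, AddHom.coe_mk, Sec.hom_of, C.D_comp]
    rw [C.σ_odd e.h_gr (by decide), C.σ_even e.r_gr Even.zero, C.σ_even e.s_gr Even.zero, e.D_r,
      e.D_s]
    simp only [map_neg, AddMonoidHom.neg_apply, C.assoc, τ.K_left]
    rw [← C.assoc e.r e.s, e.r_s, map_add, AddMonoidHom.add_apply, C.id_comp,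
      C.σ_odd (T.map_gr (φ.mat_gr φ e.δ_deg)) (by decide)]
    simp only [map_neg, AddMonoidHom.neg_apply]
    abel

variable (T) in
/-- An object is homotopy equivalent to the image of the idempotent `p` of a free object, with a
differential given by `δ`. -/
structure ProjObj (E : C.Obj) (p δ : (κ → R) →ₗ[R] (κ → R)) where
  q : C.Hom (T.obj F) E
  j : C.Hom E (T.obj F)
  h : C.Hom E E
  h' : C.Hom (T.obj F) (T.obj F)
  q_gr : q ∈ C.gr 0
  j_gr : j ∈ C.gr 0
  h_gr : h ∈ C.gr (-1)
  h'_gr : h' ∈ C.gr (-1)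
  p_deg : IsDeg (piGr R deg) (piGr R deg) 0 p
  δ_deg : IsDeg (piGr R deg) (piGr R deg) 1 δ
  p_p : ∀ x, p (p x) = p x
  p_δ : ∀ x, p (δ x) = δ x
  δ_p : ∀ x, δ (p x) = δ x
  δ_δ : ∀ x, δ (δ x) = 0
  q_p : q ⊚ T.map (φ.mat φ p) = q
  p_j : T.map (φ.mat φ p) ⊚ j = j
  D_q : C.D q = q ⊚ T.map (φ.mat φ δ)
  D_j : C.D j = -(T.map (φ.mat φ δ) ⊚ j)
  q_j : q ⊚ j = C.id E + C.D h
  j_q : j ⊚ q = T.map (φ.mat φ p) + C.D h' + T.map (φ.mat φ δ) ⊚ h' + h' ⊚ T.map (φ.mat φ δ)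

/-- The resolution of the complex of sections gives a resolution of the object. -/
def DominatedObj.proj {δ : (κ → R) →ₗ[R] (κ → R)} (e : DominatedObj T φ E δ)
    (c : ProjRes (Sec.gr T 𝕀 E) (τ.secD E) (κ' → R) (piGr R deg')) 
    : ProjObj T φ' E c.p c.δ :=
  let d := e.sec τ φ
  let r' : (κ → R) →ₗ[R] (κ' → R) := c.j ∘ₗ d.r
  let y : C.Hom (T.obj F) E := hat φ (c.H ∘ₗ d.r)
  have r'_gr : T.map (φ.mat φ' r') ∈ C.gr 0 := T.map_gr (φ.mat_gr φ' (c.j_deg.comp d.r_deg rfl))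
  have y_gr : y ∈ C.gr (-1) := hat_gr φ (c.H_deg.comp d.r_deg rfl)
  have q_gr : hat φ' c.q ∈ C.gr 0 := hat_gr φ' c.q_deg
  have hr' : r' ∘ₗ δ = c.δ ∘ₗ r' := by
    ext1 x
    refine LinearMap.ext_ring ?_
    simp only [r', LinearMap.comp_apply]
    rw [← c.j_D, d.D_r]
    rfl
  have hr'' : T.map (φ.mat φ' r') ⊚ T.map (φ.mat φ δ) = T.map (φ'.mat φ' c.δ) ⊚ T.map (φ.mat φ' r') := by
    rw [← T.map_comp, ← T.map_comp, ← FreeOn.mat_comp, ← FreeOn.mat_comp, hr']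
  have hD : ∀ {κ κ' : Type} [Fintype κ] [DecidableEq κ] [Fintype κ'] [DecidableEq κ']
      {deg : κ → ℤ} {deg' : κ' → ℤ} {F F' : P.Obj} (φ : FreeOn 𝕀 deg F) (φ' : FreeOn 𝕀 deg' F')
      (f : (κ → R) →ₗ[R] (κ' → R)), C.D (T.map (φ.mat φ' f)) = 0 := fun φ φ' f => by
    rw [← T.map_D, τ.D_mat, map_zero]
  have hDq : C.D (hat φ' c.q) = hat φ' c.q ⊚ T.map (φ'.mat φ' c.δ) := by
    rw [τ.D_hat, hat_mat]
    congr 1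
    ext1 x
    exact LinearMap.ext_ring (c.D_q _)
  { q := hat φ' c.q
    j := T.map (φ.mat φ' r') ⊚ e.s
    h := e.h + y ⊚ e.s
    h' := T.map (φ'.mat φ' (c.H' + c.j ∘ₗ d.h ∘ₗ c.q)) +
      T.map (φ.mat φ' r') ⊚ τ.K (e.s ⊚ hat φ' c.q)
    q_gr := q_gr
    j_gr := C.comp_gr rfl r'_gr e.s_gr
    h_gr := add_mem e.h_gr (C.comp_gr rfl y_gr e.s_gr)
    h'_gr := add_mem (T.map_gr (φ'.mat_gr φ' (c.H'_deg.add
        (c.j_deg.comp (d.h_deg.comp c.q_deg rfl) rfl))))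
      (C.comp_gr (zero_add _) r'_gr (τ.K_gr (n := 0) rfl (C.comp_gr rfl e.s_gr q_gr)))
    p_deg := c.p_deg
    δ_deg := c.δ_deg
    p_p := c.p_p
    p_δ := c.p_δ
    δ_p := c.δ_p
    δ_δ := c.δ_δ
    q_p := by
      rw [hat_mat]
      congr 1
      ext1 x
      exact LinearMap.ext_ring (c.q_p _)
    p_j := by
      rw [← C.assoc, ← T.map_comp, ← FreeOn.mat_comp]
      congr 4
      ext1 x
      exact LinearMap.ext_ring (c.p_j _)
    D_q := hDq
    D_j := by
      rw [C.D_comp, hD, C.σ_even r'_gr Even.zero, e.D_s, map_neg, ← C.assoc, hr'']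
      simp [C.assoc]
    q_j := by
      have h1 : hat φ' c.q ⊚ T.map (φ.mat φ' r') = e.r + C.D y + y ⊚ T.map (φ.mat φ δ) := by
        rw [hat_mat]
        simp only [y]
        rw [hat_mat, τ.D_hat]
        conv_rhs => rw [← hat_secOf φ e.r]
        rw [← map_add, ← map_add]
        congr 1
        ext1 x
        refine LinearMap.ext_ring ?_
        have := c.q_j (d.r (Pi.single x 1))
        rw [d.D_r] at this
        exact this
      rw [← C.assoc, h1]
      simp only [map_add, AddMonoidHom.add_apply, C.assoc, C.D_comp]
      rw [e.r_s, e.D_s, C.σ_odd y_gr (by decide)]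
      simp only [map_neg, AddMonoidHom.neg_apply, neg_neg]
      abel
    j_q := by
      have h1 : T.map (φ.mat φ' r') ⊚ T.map (τ.ε (e.s ⊚ hat φ' c.q)) =
          T.map (φ'.mat φ' c.p) + T.map (φ'.mat φ' c.δ) ⊚
            T.map (φ'.mat φ' (c.H' + c.j ∘ₗ d.h ∘ₗ c.q)) +
            T.map (φ'.mat φ' (c.H' + c.j ∘ₗ d.h ∘ₗ c.q)) ⊚ T.map (φ'.mat φ' c.δ) := by
        rw [← T.map_comp, ← T.map_comp, ← T.map_comp, τ.ε_eq_mat φ' φ]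
        simp only [← FreeOn.mat_comp]
        rw [← map_add, ← map_add, ← map_add, ← map_add]
        congr 2
        ext1 x
        refine LinearMap.ext_ring ?_
        have h2 : secOf φ' (e.s ⊚ hat φ' c.q) (Pi.single x 1) =
            secComp e.s (c.q (Pi.single x 1)) := by
          refine Sec.hom_inj ?_
          rw [hom_secOf, Finset.sum_eq_single x]
          · simp only [Pi.single_eq_same, 𝕀.z_one, T.map_id, C.comp_id, C.assoc, hat_e]
            rfl
          · intro b _ hb
            simp [hb]
          · simp
        simp only [LinearMap.comp_apply, LinearMap.add_apply, LinearMap.single_apply]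
        rw [h2]
        change c.j (d.r (d.s (c.q (Pi.single x 1)))) = _
        rw [d.r_s, map_add, map_add, c.j_D, c.D_q, c.j_q]
        simp only [map_add]
        abel
      have h2 := τ.htpy (e.s ⊚ hat φ' c.q)
      have h3 : e.s ⊚ hat φ' c.q = T.map (τ.ε (e.s ⊚ hat φ' c.q)) +
          C.D (τ.K (e.s ⊚ hat φ' c.q)) + τ.K (C.D (e.s ⊚ hat φ' c.q)) := by
        rw [h2]; abel
      have h4 : C.D (e.s ⊚ hat φ' c.q) = -(T.map (φ.mat φ δ) ⊚ e.s ⊚ hat φ' c.q) +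
          (e.s ⊚ hat φ' c.q) ⊚ T.map (φ'.mat φ' c.δ) := by
        rw [C.D_comp, e.D_s, C.σ_even e.s_gr Even.zero, hDq]
        simp [C.assoc]
      have h5 := congrArg (C.comp (T.map (φ.mat φ' r'))) h3
      rw [C.assoc, h5, h4]
      simp only [map_add, map_neg, τ.K_left, τ.K_right, AddMonoidHom.add_apply,
        AddMonoidHom.neg_apply]
      rw [h1, C.σ_odd (T.map_gr (φ.mat_gr φ e.δ_deg)) (by decide)]
      simp only [map_neg, AddMonoidHom.neg_apply, neg_neg]
      rw [← C.assoc _ (T.map (φ.mat φ δ)), hr'']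
      simp only [C.D_comp, hD, C.assoc, map_add, AddMonoidHom.add_apply, map_zero,
        AddMonoidHom.zero_apply]
      rw [C.σ_even r'_gr Even.zero]
      abel }

end LevelZero

end TotCat

/-! ### Quotients by the first step of a filtration -/

namespace TotCat

namespace Fil

variable {C : TotCat.{u, v}} (𝓕 : C.Fil) {X Y Z : C.Obj}

@[elab_as_elim]
lemma induction_mk {P : C.Hom X Y ⧸ (𝓕.fil 1 : AddSubgroup (C.Hom X Y)) → Prop}
    (x : C.Hom X Y ⧸ (𝓕.fil 1 : AddSubgroup (C.Hom X Y)))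
    (h : ∀ f : C.Hom X Y, P (QuotientAddGroup.mk' _ f)) : P x := by
  obtain ⟨f, rfl⟩ := QuotientAddGroup.mk'_surjective _ x
  exact h f

/-- The quotient by the ideal of morphisms of positive filtration. -/
abbrev quot : TotCat.{u, v} where
  Obj := C.Obj
  Hom X Y := C.Hom X Y ⧸ (𝓕.fil 1 : AddSubgroup (C.Hom X Y))
  comp {X Y Z} := QuotientAddGroup.lift _ (AddMonoidHom.mk' (fun g : C.Hom Y Z =>
      QuotientAddGroup.map (𝓕.fil 1) (𝓕.fil 1) (C.comp (X := X) g) (fun f hf => 𝓕.comp_left g hf))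
    (fun g g' => by
      ext f
      change QuotientAddGroup.mk' _ ((g + g') ⊚ f) = QuotientAddGroup.mk' _ (g ⊚ f) +
        QuotientAddGroup.mk' _ (g' ⊚ f)
      rw [map_add, AddMonoidHom.add_apply, map_add])) (fun g hg => by
        ext f
        exact (QuotientAddGroup.eq_zero_iff _).2 (𝓕.comp_right f hg))
  id X := QuotientAddGroup.mk' _ (C.id X)
  id_comp f := 𝓕.induction_mk f fun f => congrArg (QuotientAddGroup.mk' _) (C.id_comp f)
  comp_id f := 𝓕.induction_mk f fun f => congrArg (QuotientAddGroup.mk' _) (C.comp_id f)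
  assoc f g e := 𝓕.induction_mk f fun f => 𝓕.induction_mk g fun g => 𝓕.induction_mk e fun e =>
    congrArg (QuotientAddGroup.mk' _) (C.assoc f g e)
  D := QuotientAddGroup.map _ _ C.D fun f hf => 𝓕.D_mem hf
  σ := QuotientAddGroup.map _ _ C.σ fun f hf => 𝓕.σ_mem hf
  D_D f := 𝓕.induction_mk f fun f => (congrArg (QuotientAddGroup.mk' _) (C.D_D f)).trans (map_zero _)
  D_σ f := 𝓕.induction_mk f fun f => (congrArg (QuotientAddGroup.mk' _) (C.D_σ f)).trans (map_neg _ _)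
  σ_σ f := 𝓕.induction_mk f fun f => congrArg (QuotientAddGroup.mk' _) (C.σ_σ f)
  σ_comp g f := 𝓕.induction_mk f fun f => 𝓕.induction_mk g fun g =>
    congrArg (QuotientAddGroup.mk' _) (C.σ_comp g f)
  D_comp g f := 𝓕.induction_mk f fun f => 𝓕.induction_mk g fun g =>
    (congrArg (QuotientAddGroup.mk' _) (C.D_comp g f)).trans (map_add _ _ _)
  gr n := (C.gr n).map (QuotientAddGroup.mk' _)
  id_gr X := ⟨_, C.id_gr X, rfl⟩
  σ_gr := by
    rintro X Y n _ ⟨f, hf, rfl⟩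
    exact (congrArg (QuotientAddGroup.mk' _) (C.σ_gr hf)).trans (map_zsmul _ _ _)
  D_gr := by
    rintro X Y n m _ h ⟨f, hf, rfl⟩
    exact ⟨_, C.D_gr h hf, rfl⟩
  comp_gr := by
    rintro X Y Z m n k _ _ h ⟨g, hg, rfl⟩ ⟨f, hf, rfl⟩
    exact ⟨_, C.comp_gr h hg hf, rfl⟩

def cls : C.Hom X Y →+ 𝓕.quot.Hom X Y := QuotientAddGroup.mk' _

lemma cls_comp (g : C.Hom Y Z) (f : C.Hom X Y) : 𝓕.cls (g ⊚ f) = 𝓕.cls g ⊚ 𝓕.cls f := rfl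

lemma cls_D (f : C.Hom X Y) : 𝓕.cls (C.D f) = 𝓕.quot.D (𝓕.cls f) := rfl

lemma cls_id (X : C.Obj) : 𝓕.cls (C.id X) = 𝓕.quot.id X := rfl

lemma cls_eq_zero {f : C.Hom X Y} : 𝓕.cls f = 0 ↔ f ∈ 𝓕.fil 1 := QuotientAddGroup.eq_zero_iff _

lemma cls_eq {f g : C.Hom X Y} : 𝓕.cls f = 𝓕.cls g ↔ f - g ∈ 𝓕.fil 1 := by
  rw [← sub_eq_zero, ← map_sub, cls_eq_zero]

lemma cls_gr {n : ℤ} {f : C.Hom X Y} (hf : f ∈ C.gr n) : 𝓕.cls f ∈ 𝓕.quot.gr n := ⟨f, hf, rfl⟩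

lemma exists_of_gr {n : ℤ} {x : 𝓕.quot.Hom X Y} (hx : x ∈ 𝓕.quot.gr n) :
    ∃ f ∈ C.gr n, 𝓕.cls f = x := hx

end Fil

/-- A transfer that is a homotopy inverse of the functor on the associated graded complexes. -/
structure FilTransfer {P C : TotCat} (T : Func P C) (𝓟 : P.Fil) (𝓒 : C.Fil) extends
    Transfer T where
  map_fil : ∀ {X Y : P.Obj} {k : ℕ} {f : P.Hom X Y}, f ∈ 𝓟.fil k → T.map f ∈ 𝓒.fil k
  ε_fil : ∀ {X Y : P.Obj} {k : ℕ} {x : C.Hom (T.obj X) (T.obj Y)}, x ∈ 𝓒.fil k → ε x ∈ 𝓟.fil k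
  K_fil : ∀ {X Y : P.Obj} {k : ℕ} {x : C.Hom (T.obj X) (T.obj Y)}, x ∈ 𝓒.fil k → K x ∈ 𝓒.fil k
  D_ε : ∀ {X Y : P.Obj} {k : ℕ} {x : C.Hom (T.obj X) (T.obj Y)}, x ∈ 𝓒.fil k →
    P.D (ε x) - ε (C.D x) ∈ 𝓟.fil (k + 1)
  htpy : ∀ {X Y : P.Obj} {k : ℕ} {x : C.Hom (T.obj X) (T.obj Y)}, x ∈ 𝓒.fil k →
    x - T.map (ε x) - C.D (K x) - K (C.D x) ∈ 𝓒.fil (k + 1)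

namespace FilTransfer

variable {P C : TotCat} {T : Func P C} {𝓟 : P.Fil} {𝓒 : C.Fil} (τ : FilTransfer T 𝓟 𝓒)

def approx (X Y : P.Obj) : FilCx.Approx (𝓟.cx X Y) (𝓒.cx (T.obj X) (T.obj Y)) where
  φ := T.map
  ψ := τ.ε
  h := -τ.K
  h' := 0
  φ_fil := τ.map_fil
  ψ_fil := τ.ε_fil
  h_fil hx := neg_mem (τ.K_fil hx)
  h'_fil hx := zero_mem _
  φ_gr := T.map_gr
  ψ_gr := τ.ε_gr
  h_gr h hx := neg_mem (τ.K_gr h hx)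
  h'_gr h hx := zero_mem _
  dφ {k x} hx := by simp [Fil.cx, T.map_D]
  dψ := τ.D_ε
  φψ {k x} hx := by
    refine AddSubgroup.mem_of_eq (neg_mem (τ.htpy hx)) ?_
    simp only [Fil.cx, AddMonoidHom.neg_apply, map_neg]
    abel
  ψφ {k x} hx := by simp [τ.ε_map]

lemma solve (τ : FilTransfer T 𝓟 𝓒) (hP : ∃ k, ∀ {X Y : P.Obj} {f : P.Hom X Y}, f ∈ 𝓟.fil k → f = 0)
    (hC : ∃ k, ∀ {X Y : C.Obj} {f : C.Hom X Y}, f ∈ 𝓒.fil k → f = 0) {X Y : P.Obj} {l n m : ℤ}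
    (hl : l + 1 = n) (hn : n + 1 = m) {w : P.Hom X Y} {z : C.Hom (T.obj X) (T.obj Y)}
    (hw : w ∈ P.gr m) (hz : z ∈ C.gr n) (hdw : P.D w = 0) (hdz : C.D z = T.map w) :
    ∃ x ∈ P.gr n, ∃ y ∈ C.gr l, P.D x = w ∧ z - T.map x = C.D y := by
  obtain ⟨k, hk⟩ := hP
  obtain ⟨k', hk'⟩ := hC
  obtain ⟨x, hx, y, hy, h1, h2⟩ := (τ.approx X Y).solve P.D_D C.D_D (fun x => (T.map_D x).symm)
    𝓟.zero 𝓒.zero hl hn hw hz hdw hdz (max k k')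
  exact ⟨x, hx, y, hy, sub_eq_zero.1 (hk (𝓟.anti (le_max_left _ _) h1)),
    sub_eq_zero.1 (hk' (𝓒.anti (le_max_right _ _) h2))⟩

abbrev quotFunc : Func 𝓟.quot 𝓒.quot where
  obj := T.obj
  map := QuotientAddGroup.map _ _ T.map fun f hf => τ.map_fil hf
  map_id X := congrArg 𝓒.cls (T.map_id X)
  map_comp g f := 𝓟.induction_mk f fun f => 𝓟.induction_mk g fun g =>
    congrArg 𝓒.cls (T.map_comp g f)
  map_D f := 𝓟.induction_mk f fun f => congrArg 𝓒.cls (T.map_D f)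
  map_σ f := 𝓟.induction_mk f fun f => congrArg 𝓒.cls (T.map_σ f)
  map_gr := by
    rintro X Y n _ ⟨f, hf, rfl⟩
    exact ⟨_, T.map_gr hf, rfl⟩

end FilTransfer

abbrev UnitObj.quot {P : TotCat} {R : Type u} [CommRing R] (𝕀 : P.UnitObj R) (𝓟 : P.Fil) :
    𝓟.quot.UnitObj R where
  one := 𝕀.one
  z := 𝓟.cls.comp 𝕀.z
  z_one := congrArg 𝓟.cls 𝕀.z_one
  z_mul a b := congrArg 𝓟.cls (𝕀.z_mul a b)
  z_gr a := 𝓟.cls_gr (𝕀.z_gr a)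

def FreeOn.quot {P : TotCat} {R : Type u} [CommRing R] {𝕀 : P.UnitObj R} (𝓟 : P.Fil) {κ : Type}
    [Fintype κ] [DecidableEq κ] {deg : κ → ℤ} {F : P.Obj} (φ : FreeOn 𝕀 deg F) :
    FreeOn (P := 𝓟.quot) (𝕀.quot 𝓟) deg F where
  e x := 𝓟.cls (φ.e x)
  l x := 𝓟.cls (φ.l x)
  e_gr x := 𝓟.cls_gr (φ.e_gr x)
  l_gr x := 𝓟.cls_gr (φ.l_gr x)
  l_e x y := by
    refine (congrArg 𝓟.cls (φ.l_e x y)).trans ?_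
    split_ifs
    · rfl
    · exact map_zero _
  sum_e_l := by
    refine Eq.trans ?_ (congrArg 𝓟.cls φ.sum_e_l)
    rw [map_sum]
    rfl
  D_e x := (congrArg 𝓟.cls (φ.D_e x)).trans (map_zero _)
  D_l x := (congrArg 𝓟.cls (φ.D_l x)).trans (map_zero _)

lemma FreeOn.quot_mat {P : TotCat} {R : Type u} [CommRing R] {𝕀 : P.UnitObj R} (𝓟 : P.Fil)
    {κ : Type} [Fintype κ] [DecidableEq κ] {deg : κ → ℤ} {F : P.Obj} (φ : FreeOn 𝕀 deg F)
    (f : (κ → R) →ₗ[R] (κ → R)) :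
    (φ.quot 𝓟).mat (φ.quot 𝓟) f = 𝓟.cls (φ.mat φ f) := by
  simp only [FreeOn.mat_apply, map_sum]
  rfl

/-- The endomorphisms of the unit object are the elements of `R`, up to positive filtration. -/
structure UnitObj.Reduced {P : TotCat} {R : Type u} [CommRing R] (𝕀 : P.UnitObj R) (𝓟 : P.Fil) where
  red : P.Hom 𝕀.one 𝕀.one →+ R
  red_z : ∀ r, red (𝕀.z r) = r
  z_red : ∀ x, 𝕀.z (red x) - x ∈ 𝓟.fil 1
  red_fil : ∀ x ∈ 𝓟.fil 1, red x = 0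
  one_gr : ∀ {n : ℤ} {x : P.Hom 𝕀.one 𝕀.one}, n ≠ 0 → x ∈ P.gr n → x ∈ 𝓟.fil 1

def FilTransfer.levelZero {P C : TotCat} {T : Func P C} {𝓟 : P.Fil} {𝓒 : C.Fil}
    (τ : FilTransfer T 𝓟 𝓒) {R : Type u} [CommRing R] {𝕀 : P.UnitObj R} (ρ : 𝕀.Reduced 𝓟) :
    LevelZero τ.quotFunc (𝕀.quot 𝓟) where
  ε := QuotientAddGroup.map _ _ τ.ε fun f hf => τ.ε_fil hf
  K := QuotientAddGroup.map _ _ τ.K fun f hf => τ.K_fil hf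
  ε_gr := by
    rintro X Y n _ ⟨f, hf, rfl⟩
    exact ⟨_, τ.ε_gr hf, rfl⟩
  K_gr := by
    rintro X Y n m _ h ⟨f, hf, rfl⟩
    exact ⟨_, τ.K_gr h hf, rfl⟩
  ε_σ x := 𝓒.induction_mk x fun x => congrArg 𝓟.cls (τ.ε_σ x)
  K_σ x := 𝓒.induction_mk x fun x => (congrArg 𝓒.cls (τ.K_σ x)).trans (map_neg _ _)
  ε_map f := 𝓟.induction_mk f fun f => congrArg 𝓟.cls (τ.ε_map f)
  K_map f := 𝓟.induction_mk f fun f => (congrArg 𝓒.cls (τ.K_map f)).trans (map_zero _)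
  ε_left a x := 𝓟.induction_mk a fun a => 𝓒.induction_mk x fun x => congrArg 𝓟.cls (τ.ε_left a x)
  ε_right x a := 𝓟.induction_mk a fun a => 𝓒.induction_mk x fun x => congrArg 𝓟.cls (τ.ε_right x a)
  K_left a x := 𝓟.induction_mk a fun a => 𝓒.induction_mk x fun x => congrArg 𝓒.cls (τ.K_left a x)
  K_right x a := 𝓟.induction_mk a fun a => 𝓒.induction_mk x fun x => congrArg 𝓒.cls (τ.K_right x a)
  D_ε x := 𝓒.induction_mk x fun x =>
    𝓟.cls_eq.2 (𝓟.anti (Nat.le_add_left 1 0) (τ.D_ε (𝓒.zero x)))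
  htpy x := 𝓒.induction_mk x fun x => by
    have h := (𝓒.cls_eq_zero.2 (τ.htpy (𝓒.zero x)))
    simp only [map_sub] at h
    rw [sub_right_comm _ (𝓒.cls (T.map (τ.ε x))), sub_right_comm _ (𝓒.cls (T.map (τ.ε x)))] at h
    exact (sub_eq_zero.1 h).symm
  red := QuotientAddGroup.lift _ ρ.red ρ.red_fil
  z_red x := 𝓟.induction_mk x fun x => 𝓟.cls_eq.2 (ρ.z_red x)
  red_z := ρ.red_z
  one_gr := by
    rintro n _ hn ⟨f, hf, rfl⟩
    exact 𝓟.cls_eq_zero.2 (ρ.one_gr hn hf)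

end TotCat

/-! ### Correcting a connection and a morphism order by order -/

namespace TotCat

/-- The curvature of the connection `p D p + θ` on the image of the idempotent `p`. -/
def curv (P : TotCat.{u, v}) {F : P.Obj} (p θ : P.Hom F F) : P.Hom F F :=
  p ⊚ P.D p ⊚ P.D p ⊚ p + p ⊚ P.D θ ⊚ p + θ ⊚ θ

section curv

variable {P : TotCat.{u, v}} {F : P.Obj} {p θ : P.Hom F F} (hp : p ∈ P.gr 0) (hpp : p ⊚ p = p)
  (hθ : θ ∈ P.gr 1) (hpθ : p ⊚ θ = θ) (hθp : θ ⊚ p = θ)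

include hp hpp

lemma D_idem : P.D p = P.D p ⊚ p + p ⊚ P.D p := by
  have h := P.D_comp p p
  rwa [hpp, P.σ_even hp Even.zero] at h

lemma idem_D_idem : p ⊚ P.D p ⊚ p = 0 := by
  have h := congrArg (fun x => p ⊚ x ⊚ p) (D_idem hp hpp)
  simp only [map_add, AddMonoidHom.add_apply, P.assoc, hpp] at h
  rw [← P.assoc p p, hpp] at h
  simpa using h

lemma D_D_idem : P.D p ⊚ P.D p ⊚ p = p ⊚ P.D p ⊚ P.D p := by
  have h1 := congrArg (fun x => P.D p ⊚ x) (D_idem hp hpp)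
  have h2 := congrArg (fun x => x ⊚ P.D p) (D_idem hp hpp)
  simp only [map_add, AddMonoidHom.add_apply, P.assoc] at h1 h2
  exact add_right_cancel ((h1.symm.trans h2).trans (add_comm _ _))

include hθ hpθ hθp

lemma curv_gr : P.curv p θ ∈ P.gr 2 :=
  add_mem (add_mem (P.comp_gr (zero_add 2) hp (P.comp_gr (m := 1) (n := 1) rfl (P.D_gr rfl hp)
    (P.comp_gr (n := 0) rfl (P.D_gr rfl hp) hp)))
    (P.comp_gr (zero_add 2) hp (P.comp_gr (n := 0) rfl (P.D_gr rfl hθ) hp)))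
    (P.comp_gr rfl hθ hθ)

lemma idem_curv : p ⊚ P.curv p θ = P.curv p θ := by
  simp only [curv, map_add, ← P.assoc, hpp, hpθ]

lemma curv_idem : P.curv p θ ⊚ p = P.curv p θ := by
  simp only [curv, map_add, AddMonoidHom.add_apply, P.assoc, hpp, hθp]

lemma bianchi : p ⊚ P.D (P.curv p θ) ⊚ p + θ ⊚ P.curv p θ - P.curv p θ ⊚ θ = 0 := by
  have pp : ∀ {X : P.Obj} (x : P.Hom X F), p ⊚ p ⊚ x = p ⊚ x := fun x => by rw [← P.assoc, hpp]
  have pθ : ∀ {X : P.Obj} (x : P.Hom X F), p ⊚ θ ⊚ x = θ ⊚ x := fun x => by rw [← P.assoc, hpθ]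
  have θp : ∀ {X : P.Obj} (x : P.Hom X F), θ ⊚ p ⊚ x = θ ⊚ x := fun x => by rw [← P.assoc, hθp]
  have h0 := idem_D_idem hp hpp
  have h0' : ∀ {X : P.Obj} (x : P.Hom X F), p ⊚ P.D p ⊚ p ⊚ x = 0 := fun x => by
    rw [← P.assoc (P.D p), ← P.assoc p, h0, map_zero, AddMonoidHom.zero_apply]
  have h1 : p ⊚ P.D p ⊚ P.D p ⊚ P.D p ⊚ p = 0 := by rw [D_D_idem hp hpp, h0']
  have e1 : P.D θ = P.D p ⊚ θ + p ⊚ P.D θ := by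
    have h := P.D_comp p θ
    rwa [hpθ, P.σ_even hp Even.zero] at h
  have e2 : P.D θ = P.D θ ⊚ p - θ ⊚ P.D p := by
    have h := P.D_comp θ p
    rwa [hθp, P.σ_odd hθ (by decide), map_neg, AddMonoidHom.neg_apply, ← sub_eq_add_neg] at h
  have h2 : p ⊚ P.D p ⊚ P.D θ ⊚ p = p ⊚ P.D p ⊚ P.D p ⊚ θ := by
    have h := congrArg (fun x => p ⊚ P.D p ⊚ x ⊚ p) e1
    simpa only [map_add, AddMonoidHom.add_apply, P.assoc, h0', add_zero, hθp] using h
  have h3 : p ⊚ P.D θ ⊚ P.D p ⊚ p = -(θ ⊚ P.D p ⊚ P.D p ⊚ p) := by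
    have h := congrArg (fun x => p ⊚ x ⊚ P.D p ⊚ p) e2
    simpa only [map_sub, AddMonoidHom.sub_apply, P.assoc, h0, map_zero, zero_sub, map_neg, pθ] using h
  have hDp : P.σ (P.D p) = -P.D p := P.σ_odd (P.D_gr (zero_add 1) hp) (by decide)
  have hDθ : P.σ (P.D θ) = P.D θ := P.σ_even (P.D_gr one_add_one_eq_two hθ) (by decide)
  have hσp := P.σ_even hp Even.zero
  have hσθ : P.σ θ = -θ := P.σ_odd hθ (by decide)
  simp only [curv, map_add, P.D_comp, P.D_D, P.assoc, AddMonoidHom.add_apply, hDp, hDθ, hσp, hσθ,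
    map_neg, AddMonoidHom.neg_apply, map_zero, AddMonoidHom.zero_apply, P.σ_comp]
  simp only [pp, pθ, θp, hpp, hpθ, hθp, h1, h2, h3, neg_zero, zero_add, add_zero, neg_neg, map_neg, map_zero]
  abel

end curv

section defect

variable {P C : TotCat} {T : Func P C} {F : P.Obj} {E : C.Obj} {p θ : P.Hom F F}
  {q : C.Hom (T.obj F) E} (hp : p ∈ P.gr 0) (hpp : p ⊚ p = p) (hθ : θ ∈ P.gr 1) (hpθ : p ⊚ θ = θ)
  (hθp : θ ⊚ p = θ) (hq : q ∈ C.gr 0) (hqp : q ⊚ T.map p = q)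

/-- The failure of `q` to be closed for the connection `p D p + θ`. -/
def defect (T : Func P C) (p θ : P.Hom F F) (q : C.Hom (T.obj F) E) : C.Hom (T.obj F) E :=
  C.D q ⊚ T.map p - q ⊚ T.map θ

include hp hpp hθ hpθ hθp hq hqp

lemma D_defect : C.D (defect T p θ q) ⊚ T.map p + defect T p θ q ⊚ T.map θ =
    -(q ⊚ T.map (P.curv p θ)) := by
  have qp : ∀ {X : C.Obj} (x : C.Hom X (T.obj F)), q ⊚ T.map p ⊚ x = q ⊚ x := fun x => by
    rw [← C.assoc, hqp]
  have hDq : C.D q = C.D q ⊚ T.map p + q ⊚ C.D (T.map p) := by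
    have h := C.D_comp q (T.map p)
    rwa [hqp, C.σ_even hq Even.zero] at h
  have h0 : T.map p ⊚ C.D (T.map p) ⊚ T.map p = 0 := by
    rw [← T.map_D, ← T.map_comp, ← T.map_comp, idem_D_idem hp hpp, map_zero]
  have h1 : C.D q ⊚ C.D (T.map p) ⊚ T.map p = q ⊚ C.D (T.map p) ⊚ C.D (T.map p) ⊚ T.map p := by
    have h := congrArg (fun x => x ⊚ C.D (T.map p) ⊚ T.map p) hDq
    simpa only [map_add, AddMonoidHom.add_apply, C.assoc, h0, map_zero, zero_add] using h
  have hσ : C.σ (C.D q) = -C.D q := C.σ_odd (C.D_gr (zero_add 1) hq) (by decide)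
  have pθ : T.map p ⊚ T.map θ = T.map θ := by rw [← T.map_comp, hpθ]
  have θp : T.map θ ⊚ T.map p = T.map θ := by rw [← T.map_comp, hθp]
  simp only [defect, curv, map_sub, AddMonoidHom.sub_apply, C.D_comp, C.D_D, map_add, T.map_comp,
    T.map_D, hσ, C.σ_even hq Even.zero, AddMonoidHom.add_apply, map_neg, AddMonoidHom.neg_apply,
    C.assoc, map_zero, AddMonoidHom.zero_apply, zero_add, h1, qp, pθ, θp]
  abel

end defect

/-- A morphism `q : T F → E` and a connection `p D p + θ` on the image of `p`, such that `q` is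
invertible up to homotopy modulo positive filtration. -/
structure Approximation {P C : TotCat} {T : Func P C} {𝓟 : P.Fil} {𝓒 : C.Fil}
    (τ : FilTransfer T 𝓟 𝓒) {F : P.Obj} {E : C.Obj} (p : P.Hom F F) (j : C.Hom E (T.obj F))
    (h : C.Hom E E) (h' : C.Hom (T.obj F) (T.obj F)) (θ : P.Hom F F) (q : C.Hom (T.obj F) E) :
    Prop where
  p_gr : p ∈ P.gr 0
  p_p : p ⊚ p = p
  D_p : P.D p ∈ 𝓟.fil 1
  j_gr : j ∈ C.gr 0
  p_j : T.map p ⊚ j = j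
  h_gr : h ∈ C.gr (-1)
  h'_gr : h' ∈ C.gr (-1)
  p_h' : T.map p ⊚ h' = h'
  h'_p : h' ⊚ T.map p = h'
  θ_gr : θ ∈ P.gr 1
  p_θ : p ⊚ θ = θ
  θ_p : θ ⊚ p = θ
  q_gr : q ∈ C.gr 0
  q_p : q ⊚ T.map p = q
  D_j : C.D j + T.map θ ⊚ j ∈ 𝓒.fil 1
  q_j : q ⊚ j - C.id E - C.D h ∈ 𝓒.fil 1
  j_q : j ⊚ q - T.map p - C.D h' - T.map θ ⊚ h' - h' ⊚ T.map θ ∈ 𝓒.fil 1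
  defect_fil : defect T p θ q ∈ 𝓒.fil 1

namespace Approximation

variable {P C : TotCat} {T : Func P C} {𝓟 : P.Fil} {𝓒 : C.Fil} {τ : FilTransfer T 𝓟 𝓒}
  {F : P.Obj} {E : C.Obj} {p : P.Hom F F} {j : C.Hom E (T.obj F)} {h : C.Hom E E}
  {h' : C.Hom (T.obj F) (T.obj F)} {θ : P.Hom F F} {q : C.Hom (T.obj F) E}
  (a : Approximation τ p j h h' θ q)

include a

lemma p_p' : T.map p ⊚ T.map p = T.map p := by rw [← T.map_comp, a.p_p]

lemma θ_p' : T.map θ ⊚ T.map p = T.map θ := by rw [← T.map_comp, a.θ_p]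

/-- The endomorphisms of the image of `p`, with the differential of the connection. -/
def cxEnd : FilCx (P.Hom F F) where
  d := AddMonoidHom.mk' (fun x => p ⊚ P.D x ⊚ p + θ ⊚ x - P.σ x ⊚ θ) (fun x y => by
    simp only [map_add, AddMonoidHom.add_apply]; abel)
  fil k := 𝓟.fil k ⊓ ((P.comp p).eqLocus (AddMonoidHom.id _) ⊓
    (P.comp.flip p).eqLocus (AddMonoidHom.id _))
  gr := P.gr
  d_fil {k x} hx := by
    obtain ⟨hx, h1, h2⟩ := hx
    change p ⊚ x = x at h1
    change x ⊚ p = x at h2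
    have hx : x ∈ 𝓟.fil k := hx
    have hpp := a.p_p
    have hpθ := a.p_θ
    have hθp := a.θ_p
    refine ⟨show _ ∈ 𝓟.fil k from sub_mem (add_mem (𝓟.comp_left _ (𝓟.comp_right _ (𝓟.D_mem hx))) (𝓟.comp_left _ hx))
      (𝓟.comp_right _ (𝓟.σ_mem hx)), ?_, ?_⟩
    · change p ⊚ (p ⊚ P.D x ⊚ p + θ ⊚ x - P.σ x ⊚ θ) = p ⊚ P.D x ⊚ p + θ ⊚ x - P.σ x ⊚ θ
      have h3 : p ⊚ P.σ x = P.σ x := by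
        conv_rhs => rw [← h1, P.σ_comp, P.σ_even a.p_gr Even.zero]
      simp only [map_add, map_sub, ← P.assoc, hpp, hpθ, h3]
    · change (p ⊚ P.D x ⊚ p + θ ⊚ x - P.σ x ⊚ θ) ⊚ p = p ⊚ P.D x ⊚ p + θ ⊚ x - P.σ x ⊚ θ
      simp only [map_add, map_sub, AddMonoidHom.add_apply, AddMonoidHom.sub_apply, P.assoc, hpp, hθp,
        h2]
  d_gr {n m x} hm hx := sub_mem (add_mem (P.comp_gr (zero_add m) a.p_gr (P.comp_gr (add_zero m)
    (P.D_gr hm hx) a.p_gr)) (P.comp_gr (by omega) a.θ_gr hx)) (P.comp_gr hm (P.σ_mem_gr hx) a.θ_gr)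

/-- The morphisms from the image of `p` to `E`, with the differential of the connection. -/
def cxHom : FilCx (C.Hom (T.obj F) E) where
  d := AddMonoidHom.mk' (fun x => C.D x ⊚ T.map p - C.σ x ⊚ T.map θ) (fun x y => by
    simp only [map_add, AddMonoidHom.add_apply]; abel)
  fil k := 𝓒.fil k ⊓ (C.comp.flip (T.map p)).eqLocus (AddMonoidHom.id _)
  gr := C.gr
  d_fil {k x} hx := by
    obtain ⟨hx, h1⟩ := hx
    have hx : x ∈ 𝓒.fil k := hx
    have hpp := a.p_p'
    have hθp := a.θ_p'
    refine ⟨show _ ∈ 𝓒.fil k from sub_mem (𝓒.comp_right _ (𝓒.D_mem hx)) (𝓒.comp_right _ (𝓒.σ_mem hx)), ?_⟩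
    change (C.D x ⊚ T.map p - C.σ x ⊚ T.map θ) ⊚ T.map p = C.D x ⊚ T.map p - C.σ x ⊚ T.map θ
    simp only [map_sub, AddMonoidHom.sub_apply, C.assoc, hpp, hθp]
  d_gr {n m x} hm hx := sub_mem (C.comp_gr (add_zero m) (C.D_gr hm hx) (T.map_gr a.p_gr))
    (C.comp_gr hm (C.σ_mem_gr hx) (T.map_gr a.θ_gr))

lemma D_left {k : ℕ} {x : P.Hom F F} (hx : x ∈ 𝓟.fil k) (h1 : p ⊚ x = x) (h2 : x ⊚ p = x) :
    P.D x - p ⊚ P.D x ⊚ p ∈ 𝓟.fil (k + 1) := by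
  have e1 := P.D_comp p (x ⊚ p)
  rw [P.D_comp x p, h2, h1, P.σ_even a.p_gr Even.zero] at e1
  refine AddSubgroup.mem_of_eq (add_mem (𝓟.comp_one a.D_p hx)
    (𝓟.comp_left p (𝓟.comp_mem (𝓟.σ_mem hx) a.D_p))) ?_
  nth_rewrite 1 [e1]
  rw [map_add]
  abel

lemma D_right {k : ℕ} {x : C.Hom (T.obj F) E} (hx : x ∈ 𝓒.fil k) (h1 : x ⊚ T.map p = x) :
    C.D x - C.D x ⊚ T.map p ∈ 𝓒.fil (k + 1) := by
  have e1 := C.D_comp x (T.map p)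
  rw [h1] at e1
  refine AddSubgroup.mem_of_eq (𝓒.comp_mem (𝓒.σ_mem hx)
    (show C.D (T.map p) ∈ 𝓒.fil 1 by rw [← T.map_D]; exact τ.map_fil a.D_p)) ?_
  nth_rewrite 1 [e1]
  abel

lemma comp_mem_cxHom {k : ℕ} {x : P.Hom F F} (hx : x ∈ a.cxEnd.fil k) :
    q ⊚ T.map x ∈ a.cxHom.fil k := ⟨𝓒.comp_left _ (τ.map_fil hx.1), by
  have h2 : x ⊚ p = x := hx.2.2
  change (q ⊚ T.map x) ⊚ T.map p = q ⊚ T.map x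
  rw [C.assoc, ← T.map_comp, h2]⟩

lemma ε_mem_cxEnd {k : ℕ} {x : C.Hom (T.obj F) E} (hx : x ∈ a.cxHom.fil k) :
    τ.ε (j ⊚ x) ∈ a.cxEnd.fil k := ⟨τ.ε_fil (𝓒.comp_left _ hx.1), by
  change p ⊚ τ.ε (j ⊚ x) = τ.ε (j ⊚ x)
  rw [← τ.ε_left, ← C.assoc, a.p_j], by
  have h2 : x ⊚ T.map p = x := hx.2
  change τ.ε (j ⊚ x) ⊚ p = τ.ε (j ⊚ x)
  rw [← τ.ε_right, C.assoc, h2]⟩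

lemma comp_h_mem {k : ℕ} {x : C.Hom (T.obj F) E} (hx : x ∈ a.cxHom.fil k) :
    h ⊚ x ∈ a.cxHom.fil k := ⟨𝓒.comp_left _ hx.1, by
  have h2 : x ⊚ T.map p = x := hx.2
  change (h ⊚ x) ⊚ T.map p = h ⊚ x
  rw [C.assoc, h2]⟩

lemma comp_K_mem {k : ℕ} {x : C.Hom (T.obj F) E} (hx : x ∈ a.cxHom.fil k) :
    q ⊚ τ.K (j ⊚ x) ∈ a.cxHom.fil k := ⟨𝓒.comp_left _ (τ.K_fil (𝓒.comp_left _ hx.1)), by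
  have h2 : x ⊚ T.map p = x := hx.2
  change (q ⊚ τ.K (j ⊚ x)) ⊚ T.map p = q ⊚ τ.K (j ⊚ x)
  rw [C.assoc, ← τ.K_right, C.assoc, h2]⟩

lemma ε_h'_mem {k : ℕ} {x : P.Hom F F} (hx : x ∈ a.cxEnd.fil k) :
    τ.ε h' ⊚ x ∈ a.cxEnd.fil k := ⟨𝓟.comp_left _ hx.1, by
  change p ⊚ τ.ε h' ⊚ x = τ.ε h' ⊚ x
  rw [← P.assoc, ← τ.ε_left, a.p_h'], by
  have h2 : x ⊚ p = x := hx.2.2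
  change (τ.ε h' ⊚ x) ⊚ p = τ.ε h' ⊚ x
  rw [P.assoc, h2]⟩

lemma cxEnd_d (x : P.Hom F F) : a.cxEnd.d x = p ⊚ P.D x ⊚ p + θ ⊚ x - P.σ x ⊚ θ := rfl

lemma cxHom_d (x : C.Hom (T.obj F) E) : a.cxHom.d x = C.D x ⊚ T.map p - C.σ x ⊚ T.map θ := rfl

def approx : FilCx.Approx a.cxEnd a.cxHom where
  φ := (C.comp q).comp T.map
  ψ := τ.ε.comp (C.comp j)
  h := C.comp h - (C.comp q).comp (τ.K.comp (C.comp j))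
  h' := P.comp (τ.ε h')
  φ_fil := a.comp_mem_cxHom
  ψ_fil := a.ε_mem_cxEnd
  h_fil hx := sub_mem (a.comp_h_mem hx) (a.comp_K_mem hx)
  h'_fil := a.ε_h'_mem
  φ_gr hx := C.comp_gr (zero_add _) a.q_gr (T.map_gr hx)
  ψ_gr hx := τ.ε_gr (C.comp_gr (zero_add _) a.j_gr hx)
  h_gr hm hx := sub_mem (C.comp_gr (by omega) a.h_gr hx) (C.comp_gr (zero_add _) a.q_gr
    (τ.K_gr hm (C.comp_gr (zero_add _) a.j_gr hx)))
  h'_gr hm hx := P.comp_gr (by omega) (τ.ε_gr a.h'_gr) hx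
  dφ {k x} hx := by
    refine ⟨?_, (sub_mem (a.cxHom.d_fil (a.comp_mem_cxHom hx))
      (a.comp_mem_cxHom (a.cxEnd.d_fil hx))).2⟩
    obtain ⟨hx, h1, h2⟩ := hx
    change p ⊚ x = x at h1
    change x ⊚ p = x at h2
    have hx : x ∈ 𝓟.fil k := hx
    have qp : ∀ {X : C.Obj} (x : C.Hom X (T.obj F)), q ⊚ T.map p ⊚ x = q ⊚ x := fun x => by
      rw [← C.assoc, a.q_p]
    have h2' : T.map x ⊚ T.map p = T.map x := by rw [← T.map_comp, h2]
    have h1' : T.map p ⊚ T.map x = T.map x := by rw [← T.map_comp, h1]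
    have hσ := C.σ_even a.q_gr Even.zero
    refine AddSubgroup.mem_of_eq (𝓒.comp_one a.defect_fil (τ.map_fil hx)) ?_
    change C.D (q ⊚ T.map x) ⊚ T.map p - C.σ (q ⊚ T.map x) ⊚ T.map θ -
        q ⊚ T.map (p ⊚ P.D x ⊚ p + θ ⊚ x - P.σ x ⊚ θ) = defect T p θ q ⊚ T.map x
    simp only [defect, C.D_comp, C.σ_comp, hσ, map_add, map_sub, AddMonoidHom.add_apply,
        AddMonoidHom.sub_apply, C.assoc, T.map_comp, T.map_D, T.map_σ, qp, h1', h2']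
    abel
  dψ {k x} hx := by
    refine ⟨?_, (sub_mem (a.cxEnd.d_fil (a.ε_mem_cxEnd hx))
      (a.ε_mem_cxEnd (a.cxHom.d_fil hx))).2⟩
    obtain ⟨hy, hy1, hy2⟩ := a.ε_mem_cxEnd hx
    obtain ⟨hx, h2⟩ := hx
    change x ⊚ T.map p = x at h2
    have hx : x ∈ 𝓒.fil k := hx
    have hσ := C.σ_even a.j_gr Even.zero
    have h1 := τ.D_ε (𝓒.comp_left j hx)
    have h3 := τ.ε_fil (𝓒.comp_one a.D_j hx)
    have h4 := τ.ε_fil (𝓒.comp_left j (a.D_right hx h2))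
    have h5 := a.D_left hy hy1 hy2
    have h6 := τ.ε_left θ (j ⊚ x)
    have h7 := τ.ε_right (j ⊚ C.σ x) θ
    have h8 := τ.ε_σ (j ⊚ x)
    rw [C.σ_comp, hσ] at h8
    refine AddSubgroup.mem_of_eq (add_mem (sub_mem (add_mem h1 h3) h5) h4) ?_
    change a.cxEnd.d (τ.ε (j ⊚ x)) - τ.ε (j ⊚ a.cxHom.d x) = _
    rw [cxEnd_d, cxHom_d]
    simp only [map_add, map_sub, AddMonoidHom.add_apply, C.D_comp, hσ, C.assoc] at h6 h7 h8 ⊢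
    rw [h6, h7, h8]
    abel
  φψ {k x} hx := by
    refine ⟨?_, (sub_mem (sub_mem (sub_mem (a.comp_mem_cxHom (a.ε_mem_cxEnd hx)) hx)
      (a.cxHom.d_fil (sub_mem (a.comp_h_mem hx) (a.comp_K_mem hx))))
      (sub_mem (a.comp_h_mem (a.cxHom.d_fil hx)) (a.comp_K_mem (a.cxHom.d_fil hx)))).2⟩
    have h1 := a.comp_h_mem hx
    have h2 := a.comp_K_mem hx
    obtain ⟨hx, h3⟩ := hx
    change x ⊚ T.map p = x at h3
    have hx : x ∈ 𝓒.fil k := hx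
    have hK : T.map p ⊚ τ.K (j ⊚ x) = τ.K (j ⊚ x) := by
      have := τ.K_left p (j ⊚ x)
      rw [← C.assoc, a.p_j, C.σ_even (T.map_gr a.p_gr) Even.zero] at this
      exact this.symm
    have hKθ : τ.K (T.map θ ⊚ j ⊚ x) = -(T.map θ ⊚ τ.K (j ⊚ x)) := by
      rw [τ.K_left, C.σ_odd (T.map_gr a.θ_gr) (by decide), map_neg, AddMonoidHom.neg_apply]
    have hσq := C.σ_even a.q_gr Even.zero
    have hσj := C.σ_even a.j_gr Even.zero
    have hσh : C.σ h = -h := C.σ_odd a.h_gr (by decide)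
    have hKσ := τ.K_σ (j ⊚ x)
    rw [C.σ_comp, hσj] at hKσ
    have hKr := τ.K_right (j ⊚ C.σ x) θ
    have e1 := 𝓒.comp_left q (τ.htpy (𝓒.comp_left j hx))
    have e2 := 𝓒.comp_one a.q_j hx
    have e3 := a.D_right h1.1 h1.2
    have e4 := a.D_right h2.1 h2.2
    have e5 := a.D_right hx h3
    have e6 := 𝓒.comp_one a.defect_fil (τ.K_fil (𝓒.comp_left j hx))
    have e7 := 𝓒.comp_left q (τ.K_fil (𝓒.comp_one a.D_j hx))
    have e8 := 𝓒.comp_left q (τ.K_fil (𝓒.comp_left j e5))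
    refine AddSubgroup.mem_of_eq (sub_mem (sub_mem (add_mem (sub_mem (add_mem (add_mem (add_mem
      (neg_mem e1) e2) e3) (𝓒.comp_left h e5)) e4) e6) e7) e8) ?_
    change q ⊚ T.map (τ.ε (j ⊚ x)) - x - a.cxHom.d (h ⊚ x - q ⊚ τ.K (j ⊚ x)) -
      (h ⊚ a.cxHom.d x - q ⊚ τ.K (j ⊚ a.cxHom.d x)) = _
    rw [cxHom_d, cxHom_d]
    simp only [map_add, map_sub, AddMonoidHom.add_apply, AddMonoidHom.sub_apply, C.D_comp, hσq,
      hσj, hσh, C.assoc, C.σ_comp, map_neg, AddMonoidHom.neg_apply, defect, C.id_comp] at hKr ⊢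
    rw [hKr, hKσ, hK, hKθ]
    simp only [map_neg, AddMonoidHom.neg_apply, C.assoc]
    abel
  ψφ {k x} hx := by
    refine ⟨?_, (sub_mem (sub_mem (sub_mem (a.ε_mem_cxEnd (a.comp_mem_cxHom hx)) hx)
      (a.cxEnd.d_fil (a.ε_h'_mem hx))) (a.ε_h'_mem (a.cxEnd.d_fil hx))).2⟩
    obtain ⟨hy, hy1, hy2⟩ := a.ε_h'_mem hx
    obtain ⟨hx, h1, h2⟩ := hx
    change p ⊚ x = x at h1
    change x ⊚ p = x at h2
    have hx : x ∈ 𝓟.fil k := hx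
    have hσ : P.σ (τ.ε h') = -τ.ε h' := P.σ_odd (τ.ε_gr a.h'_gr) (by decide)
    have h3 := τ.ε_right (j ⊚ q) x
    have h4 := τ.ε_left θ h'
    have h5 := τ.ε_right h' θ
    have h6 := τ.ε_map p
    have e1 := 𝓟.comp_one (τ.ε_fil a.j_q) hx
    have e2 := 𝓟.comp_one (τ.D_ε (𝓒.zero h')) hx
    have e3 := a.D_left hy hy1 hy2
    have e4 := 𝓟.comp_left (τ.ε h') (a.D_left hx h1 h2)
    refine AddSubgroup.mem_of_eq (add_mem (add_mem (sub_mem e1 e2) e3) e4) ?_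
    change τ.ε (j ⊚ q ⊚ T.map x) - x - a.cxEnd.d (τ.ε h' ⊚ x) - τ.ε h' ⊚ a.cxEnd.d x = _
    rw [cxEnd_d, cxEnd_d]
    simp only [map_add, map_sub, AddMonoidHom.add_apply, AddMonoidHom.sub_apply, P.D_comp, hσ,
      P.assoc, C.assoc, P.σ_comp, map_neg, AddMonoidHom.neg_apply] at h3 h4 h5 ⊢
    rw [h3, h4, h5, h6, h1]
    simp only [P.assoc]
    abel

end Approximation

end TotCat

namespace TotCat

namespace Approximation

variable {P C : TotCat} {T : Func P C} {𝓟 : P.Fil} {𝓒 : C.Fil} {τ : FilTransfer T 𝓟 𝓒}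
  {F : P.Obj} {E : C.Obj} {p : P.Hom F F} {j : C.Hom E (T.obj F)} {h : C.Hom E E}
  {h' : C.Hom (T.obj F) (T.obj F)} {θ : P.Hom F F} {q : C.Hom (T.obj F) E}

/-- The error terms of an approximation can be moved up one step in the filtration. -/
lemma improve (a : Approximation τ p j h h' θ q) {k : ℕ} (hk : 1 ≤ k)
    (hcurv : P.curv p θ ∈ 𝓟.fil k) (hdef : defect T p θ q ∈ 𝓒.fil k) :
    ∃ θ' q', Approximation τ p j h h' θ' q' ∧ P.curv p θ' ∈ 𝓟.fil (k + 1) ∧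
      defect T p θ' q' ∈ 𝓒.fil (k + 1) := by
  have hdg : defect T p θ q ∈ C.gr 1 := sub_mem (C.comp_gr (add_zero 1) (C.D_gr (zero_add 1) a.q_gr)
    (T.map_gr a.p_gr)) (C.comp_gr (zero_add 1) a.q_gr (T.map_gr a.θ_gr))
  have hcg := curv_gr a.p_gr a.p_p a.θ_gr a.p_θ a.θ_p
  have hdp : defect T p θ q ⊚ T.map p = defect T p θ q := by
    simp only [defect, map_sub, AddMonoidHom.sub_apply, C.assoc]
    rw [a.p_p', a.θ_p']
  have hbi := bianchi a.p_gr a.p_p a.θ_gr a.p_θ a.θ_p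
  have hdd := D_defect (T := T) a.p_gr a.p_p a.θ_gr a.p_θ a.θ_p a.q_gr a.q_p
  obtain ⟨x, ⟨hx, hx1, hx2⟩, y, ⟨hy, hy1⟩, hxg, hyg, e1, e2⟩ := a.approx.step (l := 0) (n := 1)
    (m := 2) (by omega) (by omega) (w := P.curv p θ) (z := -defect T p θ q) (k := k)
    ⟨hcurv, idem_curv a.p_gr a.p_p a.θ_gr a.p_θ a.θ_p, curv_idem a.p_gr a.p_p a.θ_gr a.p_θ a.θ_p⟩
    (neg_mem ⟨hdef, hdp⟩) hcg (neg_mem hdg)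
    (by
      rw [cxEnd_d, P.σ_even hcg (by decide), hbi]
      exact zero_mem _)
    (by
      refine AddSubgroup.mem_of_eq (zero_mem _) ?_
      change a.cxHom.d (-defect T p θ q) - q ⊚ T.map (P.curv p θ) = 0
      rw [map_neg, cxHom_d, C.σ_odd hdg (by decide), map_neg, AddMonoidHom.neg_apply,
        sub_neg_eq_add, hdd]
      abel)
  have hx : x ∈ 𝓟.fil k := hx
  have hy : y ∈ 𝓒.fil k := hy
  change p ⊚ x = x at hx1
  change x ⊚ p = x at hx2
  change y ⊚ T.map p = y at hy1
  have e1 := e1.1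
  have e2 := e2.1
  change a.cxEnd.d x - P.curv p θ ∈ 𝓟.fil (k + 1) at e1
  change -defect T p θ q - q ⊚ T.map x - a.cxHom.d y ∈ 𝓒.fil (k + 1) at e2
  rw [cxEnd_d, P.σ_odd hxg (by decide), map_neg, AddMonoidHom.neg_apply] at e1
  rw [cxHom_d, C.σ_even hyg Even.zero] at e2
  have hx' : T.map x ∈ 𝓒.fil 1 := τ.map_fil (𝓟.anti hk hx)
  have hy' : y ∈ 𝓒.fil 1 := 𝓒.anti hk hy
  have hdef' : defect T p (θ - x) (q + y) ∈ 𝓒.fil (k + 1) := by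
    refine AddSubgroup.mem_of_eq (add_mem (neg_mem e2)
      (𝓒.comp_mem hy hx')) ?_
    simp only [defect, map_add, map_sub, AddMonoidHom.add_apply]
    abel
  refine ⟨θ - x, q + y, ⟨a.p_gr, a.p_p, a.D_p, a.j_gr, a.p_j, a.h_gr, a.h'_gr, a.p_h', a.h'_p,
    sub_mem a.θ_gr hxg, by rw [map_sub, a.p_θ, hx1],
    by rw [map_sub, AddMonoidHom.sub_apply, a.θ_p, hx2], add_mem a.q_gr hyg,
    by rw [map_add, AddMonoidHom.add_apply, a.q_p, hy1], ?_, ?_, ?_, 𝓒.anti (by omega) hdef'⟩, ?_,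
    hdef'⟩
  · refine AddSubgroup.mem_of_eq (sub_mem a.D_j (𝓒.comp_right j hx')) ?_
    simp only [map_sub, AddMonoidHom.sub_apply]
    abel
  · refine AddSubgroup.mem_of_eq (add_mem a.q_j (𝓒.comp_right j hy')) ?_
    simp only [map_add, AddMonoidHom.add_apply]
    abel
  · refine AddSubgroup.mem_of_eq (add_mem (add_mem (add_mem a.j_q (𝓒.comp_left j hy'))
      (𝓒.comp_right h' hx')) (𝓒.comp_left h' hx')) ?_
    simp only [map_add, map_sub, AddMonoidHom.sub_apply]
    abel
  · refine AddSubgroup.mem_of_eq (add_mem (neg_mem e1)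
      (𝓟.comp_mem hx (𝓟.anti hk hx))) ?_
    simp only [curv, map_add, map_sub, AddMonoidHom.add_apply, AddMonoidHom.sub_apply]
    abel

lemma exists_exact (a : Approximation τ p j h h' θ q) (hcurv : P.curv p θ ∈ 𝓟.fil 1)
    (hP : ∃ k, ∀ {X Y : P.Obj} {f : P.Hom X Y}, f ∈ 𝓟.fil k → f = 0)
    (hC : ∃ k, ∀ {X Y : C.Obj} {f : C.Hom X Y}, f ∈ 𝓒.fil k → f = 0) :
    ∃ θ' q', Approximation τ p j h h' θ' q' ∧ P.curv p θ' = 0 ∧ defect T p θ' q' = 0 := by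
  obtain ⟨k, hk⟩ := hP
  obtain ⟨k', hk'⟩ := hC
  have key : ∀ n, ∃ θ' q', Approximation τ p j h h' θ' q' ∧ P.curv p θ' ∈ 𝓟.fil (n + 1) ∧
      defect T p θ' q' ∈ 𝓒.fil (n + 1) := by
    intro n
    induction n with
    | zero => exact ⟨θ, q, a, hcurv, a.defect_fil⟩
    | succ n ih =>
      obtain ⟨θ', q', a', h1, h2⟩ := ih
      exact a'.improve (Nat.le_add_left _ _) h1 h2
  obtain ⟨θ', q', a', h1, h2⟩ := key (max k k')
  exact ⟨θ', q', a', hk (𝓟.anti (by omega) h1), hk' (𝓒.anti (by omega) h2)⟩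

/-- If `q` is closed for a flat connection and the image of `p` is represented by an object `Q`,
then `E` is homotopy equivalent to the image of `Q`. -/
lemma exists_equiv (a : Approximation τ p j h h' θ q) (hdef : defect T p θ q = 0)
    (hC : ∃ k, ∀ {X Y : C.Obj} {f : C.Hom X Y}, f ∈ 𝓒.fil k → f = 0) {Q : P.Obj} {i : P.Hom Q F}
    {r : P.Hom F Q} (hi : i ∈ P.gr 0) (hr : r ∈ P.gr 0) (hri : r ⊚ i = P.id Q) (hir : i ⊚ r = p)
    (hDi : p ⊚ P.D i = -(θ ⊚ i)) :
    ∃ f : C.Hom (T.obj Q) E, f ∈ C.gr 0 ∧ C.D f = 0 ∧ ∃ g ∈ C.gr 0, C.D g = 0 ∧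
      (∃ y ∈ C.gr (-1), g ⊚ f - C.id (T.obj Q) = C.D y) ∧
      (∃ y ∈ C.gr (-1), f ⊚ g - C.id E = C.D y) := by
  obtain ⟨k, hk⟩ := hC
  have hpi : p ⊚ i = i := by rw [← hir, P.assoc, hri, P.comp_id]
  have hrp : r ⊚ p = r := by rw [← hir, ← P.assoc, hri, P.id_comp]
  have hDr : P.D r ⊚ p = r ⊚ θ := by
    have h1 := P.D_comp r i
    rw [hri, P.D_id, P.σ_even hr Even.zero] at h1
    have h2 : r ⊚ P.D i = -(r ⊚ θ ⊚ i) := by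
      rw [← hrp, P.assoc, hDi, map_neg, hrp]
    rw [h2] at h1
    have h3 := congrArg (fun x => x ⊚ r) (sub_eq_zero.1 ((sub_eq_add_neg _ _).trans h1.symm))
    simp only [P.assoc] at h3
    rwa [hir, a.θ_p] at h3
  have hri' : T.map r ⊚ T.map i = C.id _ := by rw [← T.map_comp, hri, T.map_id]
  have hir' : T.map i ⊚ T.map r = T.map p := by rw [← T.map_comp, hir]
  have hDi' : T.map p ⊚ C.D (T.map i) = -(T.map θ ⊚ T.map i) := by
    rw [← T.map_D, ← T.map_comp, hDi, map_neg, T.map_comp]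
  have hDr' : C.D (T.map r) ⊚ T.map p = T.map r ⊚ T.map θ := by
    rw [← T.map_D, ← T.map_comp, hDr, T.map_comp]
  have hpi' : T.map p ⊚ T.map i = T.map i := by rw [← T.map_comp, hpi]
  have hrp' : T.map r ⊚ T.map p = T.map r := by rw [← T.map_comp, hrp]
  have hσr := C.σ_even (T.map_gr hr) Even.zero
  have hσq := C.σ_even a.q_gr Even.zero
  have hσh' : C.σ h' = -h' := C.σ_odd a.h'_gr (by decide)
  have hDrj : ∀ {X : C.Obj} (x : C.Hom X (T.obj F)), T.map p ⊚ x = x →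
      C.D (T.map r) ⊚ x = T.map r ⊚ T.map θ ⊚ x := fun x hx => by
    conv_lhs => rw [← hx, ← C.assoc, hDr', C.assoc]
  have hxi : ∀ {X : C.Obj} (x : C.Hom (T.obj F) X), x ⊚ T.map p = x →
      x ⊚ C.D (T.map i) = -(x ⊚ T.map θ ⊚ T.map i) := fun x hx => by
    conv_lhs => rw [← hx, C.assoc, hDi', map_neg]
  refine ⟨q ⊚ T.map i, C.comp_gr (zero_add 0) a.q_gr (T.map_gr hi), ?_, ?_⟩
  · rw [C.D_comp, hσq, hxi q a.q_p]
    have h1 := congrArg (fun x => x ⊚ T.map i) hdef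
    simp only [defect, map_sub, AddMonoidHom.sub_apply, C.assoc, hpi', map_zero,
      AddMonoidHom.zero_apply] at h1
    rw [← sub_eq_add_neg, h1]
  refine 𝓒.exists_inverse (fun _ _ _ => ⟨k, fun f _ hf => hk hf⟩) (q ⊚ T.map i) (T.map r ⊚ j) h
    (T.map r ⊚ h' ⊚ T.map i) (C.comp_gr (zero_add 0) a.q_gr (T.map_gr hi))
    (C.comp_gr (zero_add 0) (T.map_gr hr) a.j_gr) a.h_gr
    (C.comp_gr (zero_add _) (T.map_gr hr) (C.comp_gr (add_zero _) a.h'_gr (T.map_gr hi))) ?_ ?_ ?_ ?_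
  · rw [C.D_comp, hσq, hxi q a.q_p]
    have h1 := congrArg (fun x => x ⊚ T.map i) hdef
    simp only [defect, map_sub, AddMonoidHom.sub_apply, C.assoc, hpi', map_zero,
      AddMonoidHom.zero_apply] at h1
    rw [← sub_eq_add_neg, h1]
  · refine AddSubgroup.mem_of_eq (𝓒.comp_left (T.map r) a.D_j) ?_
    rw [C.D_comp, hσr, hDrj j a.p_j, map_add, add_comm]
  · refine AddSubgroup.mem_of_eq a.q_j ?_
    rw [C.assoc, ← C.assoc (T.map i), hir', a.p_j]
  · refine AddSubgroup.mem_of_eq (𝓒.comp_left (T.map r) (𝓒.comp_right (T.map i) a.j_q)) ?_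
    have h1 : T.map p ⊚ h' ⊚ T.map i = h' ⊚ T.map i := by rw [← C.assoc, a.p_h']
    have h2 := hxi h' a.h'_p
    have h3 := hDrj (h' ⊚ T.map i) h1
    simp only [map_sub, AddMonoidHom.sub_apply, C.D_comp, hσr, hσh', C.assoc, hpi', hri', h2, h3,
      map_add, map_neg, AddMonoidHom.neg_apply]
    abel

end Approximation

lemma conj_homotopy {C : TotCat} {A E : C.Obj} {p δ h' : C.Hom A A} {j : C.Hom E A} {q : C.Hom A E}
    (hσ : C.σ p = p) (hD : C.D p = 0) (pp : p ⊚ p = p) (pδ : p ⊚ δ = δ) (δp : δ ⊚ p = δ)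
    (q_p : q ⊚ p = q) (p_j : p ⊚ j = j) (j_q : j ⊚ q = p + C.D h' + δ ⊚ h' + h' ⊚ δ) :
    (p ⊚ j) ⊚ (q ⊚ p) - p - C.D (p ⊚ h' ⊚ p) - δ ⊚ (p ⊚ h' ⊚ p) - (p ⊚ h' ⊚ p) ⊚ δ = 0 := by
  have h1 : C.D (p ⊚ h' ⊚ p) = p ⊚ C.D h' ⊚ p := by
    rw [C.D_comp, C.D_comp, hD, hσ]
    simp
  have h2 : (p ⊚ j) ⊚ (q ⊚ p) = p ⊚ (j ⊚ q) ⊚ p := by simp only [C.assoc]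
  have h3 : δ ⊚ (p ⊚ h' ⊚ p) = p ⊚ (δ ⊚ h') ⊚ p := by
    rw [C.assoc, ← C.assoc δ p, δp, ← C.assoc p δ, pδ]
  have h4 : (p ⊚ h' ⊚ p) ⊚ δ = p ⊚ (h' ⊚ δ) ⊚ p := by
    rw [C.assoc, C.assoc, C.assoc, pδ, δp]
  rw [h1, h2, h3, h4, j_q]
  simp only [map_add, AddMonoidHom.add_apply]
  rw [pp, pp]
  abel

lemma conj_defect {C : TotCat} {A E : C.Obj} {p δ : C.Hom A A} {q : C.Hom A E}
    (δp : δ ⊚ p = δ) (q_p : q ⊚ p = q) (D_q : C.D q = q ⊚ δ) :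
    C.D (q ⊚ p) ⊚ p - (q ⊚ p) ⊚ δ = 0 := by
  rw [q_p, D_q, C.assoc, δp, sub_self]

/-- A resolution in the quotient categories lifts to an approximation. -/
lemma exists_approximation {P C : TotCat} {T : Func P C} {𝓟 : P.Fil} {𝓒 : C.Fil}
    (τ : FilTransfer T 𝓟 𝓒) {R : Type u} [CommRing R] {𝕀 : P.UnitObj R} (ρ : 𝕀.Reduced 𝓟)
    {κ : Type} [Fintype κ] [DecidableEq κ] {deg : κ → ℤ} {F : P.Obj} (φ : FreeOn 𝕀 deg F)
    {E : C.Obj} {p δ : (κ → R) →ₗ[R] (κ → R)}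
    (e : LevelZero.ProjObj τ.quotFunc (φ.quot 𝓟) E p δ) :
    ∃ j h h' q, Approximation τ (φ.mat φ p) (E := E) j h h' (φ.mat φ δ) q ∧
      P.curv (φ.mat φ p) (φ.mat φ δ) ∈ 𝓟.fil 1 := by
  have pp : φ.mat φ p ⊚ φ.mat φ p = φ.mat φ p := by
    rw [← FreeOn.mat_comp]; congr 1; exact LinearMap.ext e.p_p
  have pδ : φ.mat φ p ⊚ φ.mat φ δ = φ.mat φ δ := by
    rw [← FreeOn.mat_comp]; congr 1; exact LinearMap.ext e.p_δ
  have δp : φ.mat φ δ ⊚ φ.mat φ p = φ.mat φ δ := by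
    rw [← FreeOn.mat_comp]; congr 1; exact LinearMap.ext e.δ_p
  have δδ : φ.mat φ δ ⊚ φ.mat φ δ = 0 := by
    rw [← FreeOn.mat_comp, ← map_zero (φ.mat φ)]; congr 1; exact LinearMap.ext e.δ_δ
  have hD : ∀ f, P.D (φ.mat φ f) ∈ 𝓟.fil 1 := fun f => by
    have := (τ.levelZero ρ).D_mat (φ.quot 𝓟) (φ.quot 𝓟) f
    rw [FreeOn.quot_mat] at this
    exact 𝓟.cls_eq_zero.1 this
  have pgr : φ.mat φ p ∈ P.gr 0 := φ.mat_gr φ e.p_deg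
  have δgr : φ.mat φ δ ∈ P.gr 1 := φ.mat_gr φ e.δ_deg
  obtain ⟨q, hq, eq⟩ := 𝓒.exists_of_gr e.q_gr
  obtain ⟨j, hj, ej⟩ := 𝓒.exists_of_gr e.j_gr
  obtain ⟨h, hh, eh⟩ := 𝓒.exists_of_gr e.h_gr
  obtain ⟨h', hh', eh'⟩ := 𝓒.exists_of_gr e.h'_gr
  have hp : τ.quotFunc.map ((φ.quot 𝓟).mat (φ.quot 𝓟) p) = 𝓒.cls (T.map (φ.mat φ p)) := by
    rw [FreeOn.quot_mat]; rfl
  have hδ : τ.quotFunc.map ((φ.quot 𝓟).mat (φ.quot 𝓟) δ) = 𝓒.cls (T.map (φ.mat φ δ)) := by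
    rw [FreeOn.quot_mat]; rfl
  have q_p := e.q_p
  have p_j := e.p_j
  have D_q := e.D_q
  have D_j := e.D_j
  have q_j := e.q_j
  have j_q := e.j_q
  rw [hp, ← eq] at q_p
  rw [hp, ← ej] at p_j
  rw [hδ, ← eq] at D_q
  rw [hδ, ← ej] at D_j
  rw [← eq, ← ej, ← eh] at q_j
  rw [← eq, ← ej, ← eh', hp, hδ] at j_q
  set p' := T.map (φ.mat φ p) with hp'
  set δ' := T.map (φ.mat φ δ) with hδ'
  have pp' : p' ⊚ p' = p' := by rw [hp', ← T.map_comp, pp]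
  have pδ' : p' ⊚ δ' = δ' := by rw [hp', hδ', ← T.map_comp, pδ]
  have δp' : δ' ⊚ p' = δ' := by rw [hp', hδ', ← T.map_comp, δp]
  have pgr' : p' ∈ C.gr 0 := T.map_gr pgr
  have hDp' : 𝓒.quot.D (𝓒.cls p') = 0 := by
    rw [← 𝓒.cls_D, hp', ← T.map_D]
    exact 𝓒.cls_eq_zero.2 (τ.map_fil (hD p))
  have hσ : 𝓒.quot.σ (𝓒.cls p') = 𝓒.cls p' := 𝓒.quot.σ_even (𝓒.cls_gr pgr') Even.zero
  have hσ' : 𝓒.quot.σ (𝓒.cls h') = -𝓒.cls h' := 𝓒.quot.σ_odd (𝓒.cls_gr hh') (by decide)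
  have cpp : 𝓒.cls p' ⊚ 𝓒.cls p' = 𝓒.cls p' := congrArg 𝓒.cls pp'
  have cpδ : 𝓒.cls p' ⊚ 𝓒.cls δ' = 𝓒.cls δ' := congrArg 𝓒.cls pδ'
  have cδp : 𝓒.cls δ' ⊚ 𝓒.cls p' = 𝓒.cls δ' := congrArg 𝓒.cls δp'
  refine ⟨p' ⊚ j, h, p' ⊚ h' ⊚ p', q ⊚ p', ⟨pgr, pp, hD p, C.comp_gr (zero_add 0) pgr' hj, ?_, hh,
    C.comp_gr (zero_add _) pgr' (C.comp_gr (add_zero _) hh' pgr'), ?_, ?_, δgr, pδ, δp,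
    C.comp_gr (zero_add 0) hq pgr', ?_, ?_, ?_, ?_, ?_⟩, ?_⟩
  · rw [← C.assoc, pp']
  · rw [← C.assoc, pp']
  · rw [C.assoc, C.assoc, pp']
  · rw [C.assoc, pp']
  · refine 𝓒.cls_eq_zero.1 ?_
    rw [map_add, 𝓒.cls_D, 𝓒.cls_comp, 𝓒.cls_comp, 𝓒.cls_comp, p_j, D_j]
    abel
  · refine 𝓒.cls_eq_zero.1 ?_
    rw [map_sub, map_sub, 𝓒.cls_comp, 𝓒.cls_comp, 𝓒.cls_comp, q_p, p_j, q_j, 𝓒.cls_D, 𝓒.cls_id]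
    abel
  · exact 𝓒.cls_eq_zero.1 (conj_homotopy (C := 𝓒.quot) hσ hDp' cpp cpδ cδp q_p p_j j_q)
  · exact 𝓒.cls_eq_zero.1 (conj_defect (C := 𝓒.quot) cδp q_p D_q)
  · rw [curv, δδ, add_zero]
    exact add_mem (𝓟.comp_left _ (𝓟.comp_right _ (hD p)))
      (𝓟.comp_left _ (𝓟.comp_right _ (hD δ)))

end TotCat

/-- A resolution can be transported along an isomorphism of graded modules. -/
def ProjRes.transport {R : Type u} [CommRing R] {S : Type v} [AddCommGroup S] [Module R S]
    {gr : ℤ → Submodule R S} {D : S →ₗ[R] S} {L L' : Type*} [AddCommGroup L] [Module R L]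
    [AddCommGroup L'] [Module R L'] {grL : ℤ → Submodule R L'} (f : L ≃ₗ[R] L')
    (c : ProjRes gr D L fun n => (grL n).comap f.toLinearMap) : ProjRes gr D L' grL where
  p := f.toLinearMap ∘ₗ c.p ∘ₗ f.symm.toLinearMap
  δ := f.toLinearMap ∘ₗ c.δ ∘ₗ f.symm.toLinearMap
  q := c.q ∘ₗ f.symm.toLinearMap
  j := f.toLinearMap ∘ₗ c.j
  H := c.H
  H' := f.toLinearMap ∘ₗ c.H' ∘ₗ f.symm.toLinearMap
  p_deg n m h x hx := c.p_deg h (x := f.symm x) (by simpa using hx)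
  δ_deg n m h x hx := c.δ_deg h (x := f.symm x) (by simpa using hx)
  q_deg n m h x hx := c.q_deg h (x := f.symm x) (by simpa using hx)
  j_deg n m h x hx := c.j_deg h hx
  H_deg := c.H_deg
  H'_deg n m h x hx := c.H'_deg h (x := f.symm x) (by simpa using hx)
  p_p x := by simp [c.p_p]
  p_δ x := by simp [c.p_δ]
  δ_p x := by simp [c.δ_p]
  δ_δ x := by simp [c.δ_δ]
  q_p x := by simp [c.q_p]
  p_j x := by simp [c.p_j]
  D_q x := by simp [c.D_q]
  j_D x := by simp [c.j_D]
  q_j x := by simp [c.q_j]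
  j_q x := by simp [c.j_q]

namespace TotCat

/-- A closed morphism of degree zero that is invertible up to homotopy. -/
def IsEquiv (C : TotCat) {X Y : C.Obj} (f : C.Hom X Y) : Prop :=
  f ∈ C.gr 0 ∧ C.D f = 0 ∧ ∃ g ∈ C.gr 0, C.D g = 0 ∧
      (∃ y ∈ C.gr (-1), g ⊚ f - C.id X = C.D y) ∧
      (∃ y ∈ C.gr (-1), f ⊚ g - C.id Y = C.D y)

/-- An object that is dominated by a free object modulo positive filtration is homotopy equivalent to
an object in the image of the functor. -/
lemma exists_isEquiv_of_dominated {P : TotCat} {C : TotCat.{w, max u v}} {T : Func P C}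
    {𝓟 : P.Fil} {𝓒 : C.Fil} (τ : FilTransfer T 𝓟 𝓒) {R : Type u} [CommRing R] {𝕀 : P.UnitObj R}
    (ρ : 𝕀.Reduced 𝓟)
    (hP : ∃ k, ∀ {X Y : P.Obj} {f : P.Hom X Y}, f ∈ 𝓟.fil k → f = 0)
    (hC : ∃ k, ∀ {X Y : C.Obj} {f : C.Hom X Y}, f ∈ 𝓒.fil k → f = 0)
    (fr : ∀ (κ : Type) [Fintype κ] [DecidableEq κ] (deg : κ → ℤ), P.Obj)
    (φ : ∀ (κ : Type) [Fintype κ] [DecidableEq κ] (deg : κ → ℤ), FreeOn 𝕀 deg (fr κ deg))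
    (split : ∀ (κ : Type) [Fintype κ] [DecidableEq κ] (deg : κ → ℤ) (p : (κ → R) →ₗ[R] (κ → R))
      (θ : P.Hom (fr κ deg) (fr κ deg)), IsDeg (piGr R deg) (piGr R deg) 0 p →
      (∀ x, p (p x) = p x) → θ ∈ P.gr 1 → (φ κ deg).mat (φ κ deg) p ⊚ θ = θ →
      θ ⊚ (φ κ deg).mat (φ κ deg) p = θ → P.curv ((φ κ deg).mat (φ κ deg) p) θ = 0 →
      ∃ (Q : P.Obj) (i : P.Hom Q (fr κ deg)) (r : P.Hom (fr κ deg) Q), i ∈ P.gr 0 ∧ r ∈ P.gr 0 ∧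
        r ⊚ i = P.id Q ∧ i ⊚ r = (φ κ deg).mat (φ κ deg) p ∧
        (φ κ deg).mat (φ κ deg) p ⊚ P.D i = -(θ ⊚ i))
    {κ : Type} [Fintype κ] [DecidableEq κ] {deg : κ → ℤ} {E : C.Obj} {δ : (κ → R) →ₗ[R] (κ → R)}
    (e : LevelZero.DominatedObj τ.quotFunc ((φ κ deg).quot 𝓟) E δ) :
    ∃ (Q : P.Obj) (f : C.Hom (T.obj Q) E), C.IsEquiv f := by
  classical
  obtain ⟨b, n, hb⟩ : ∃ (b : ℤ) (n : ℕ), ∀ x, b - n ≤ deg x ∧ deg x ≤ b := by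
    obtain ⟨b, hb⟩ := (Set.finite_range deg).bddAbove
    obtain ⟨a, ha⟩ := (Set.finite_range deg).bddBelow
    refine ⟨b, (b - a).toNat, fun x => ?_⟩
    have h1 := hb (Set.mem_range_self x)
    have h2 := ha (Set.mem_range_self x)
    omega
  obtain ⟨κ', _, deg', L, _, _, f, ⟨c⟩⟩ := Dominated.exists_projRes.{u, v, 0} n
    (S := Sec τ.quotFunc (𝕀.quot 𝓟) E) (D := (τ.levelZero ρ).secD E)
    (fun a b h x hx => 𝓒.quot.D_gr h hx) (fun x => Sec.hom_inj (𝓒.quot.D_D _))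
    (e.sec (τ.levelZero ρ) ((φ κ deg).quot 𝓟)) hb
  have := Fintype.ofFinite κ'
  obtain ⟨j, h, h', q, a, hcurv⟩ := exists_approximation τ ρ (φ κ' deg')
    (e.proj (τ.levelZero ρ) ((φ κ deg).quot 𝓟) ((φ κ' deg').quot 𝓟) (c.transport f))
  obtain ⟨θ, q', a', h1, h2⟩ := a.exists_exact hcurv hP hC
  obtain ⟨Q, i, r, hi, hr, hri, hir, hDi⟩ := split κ' deg' (c.transport f).p θ (c.transport f).p_deg
    (c.transport f).p_p a'.θ_gr a'.p_θ a'.θ_p h1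
  exact ⟨Q, a'.exists_equiv h2 hC hi hr hri hir hDi⟩

end TotCat

namespace DGCat

open DirectSum

/-- A multiplicative filtration of the morphisms of a dg-category. -/
structure Filt (C : DGCat.{u, v}) where
  fil : ∀ {X Y : C.Obj} {n : ℤ}, ℕ → AddSubgroup (C.Hom X Y n)
  zero : ∀ {X Y : C.Obj} {n : ℤ} (f : C.Hom X Y n), f ∈ fil 0
  anti : ∀ {X Y : C.Obj} {n : ℤ} {k l : ℕ} {f : C.Hom X Y n}, k ≤ l → f ∈ fil l → f ∈ fil k
  d_mem : ∀ {X Y : C.Obj} {n m : ℤ} {k : ℕ} {f : C.Hom X Y n} (h : n + 1 = m), f ∈ fil k →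
    C.d h f ∈ fil k
  comp_mem : ∀ {X Y Z : C.Obj} {m n l : ℤ} {i j : ℕ} (h : m + n = l) {g : C.Hom Y Z m}
    {f : C.Hom X Y n}, g ∈ fil i → f ∈ fil j → C.comp h g f ∈ fil (i + j)

variable {C : DGCat.{u, v}} {X Y : C.Obj}

lemma tof_apply {n : ℤ} (f : C.Hom X Y n) : (tof f : C.THom X Y) n = f := DirectSum.of_eq_same _ _

lemma tof_apply_ne {n m : ℤ} (h : m ≠ n) (f : C.Hom X Y n) : (tof f : C.THom X Y) m = 0 :=
  DirectSum.of_eq_of_ne _ _ _ h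

def tfil (S : ∀ n, AddSubgroup (C.Hom X Y n)) : AddSubgroup (C.THom X Y) where
  carrier := {x | ∀ n, x n ∈ S n}
  add_mem' hx hy n := by rw [DirectSum.add_apply]; exact add_mem (hx n) (hy n)
  zero_mem' n := zero_mem _
  neg_mem' {x} hx n := neg_mem (hx n)

lemma tof_mem_tfil {S : ∀ n, AddSubgroup (C.Hom X Y n)} {n : ℤ} {f : C.Hom X Y n} :
    tof f ∈ tfil S ↔ f ∈ S n := by
  refine ⟨fun h => tof_apply f ▸ h n, fun h m => ?_⟩
  by_cases hm : m = n
  · subst hm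
    rwa [tof_apply]
  · rw [tof_apply_ne hm]
    exact zero_mem _

@[elab_as_elim]
lemma tfil_induction {S : ∀ n, AddSubgroup (C.Hom X Y n)} {P : ∀ x : C.THom X Y, x ∈ tfil S → Prop}
    {x : C.THom X Y} (hx : x ∈ tfil S) (h : ∀ n f (hf : f ∈ S n), P (tof f) (tof_mem_tfil.2 hf))
    (ha : ∀ x y (hx : x ∈ tfil S) (hy : y ∈ tfil S), P x hx → P y hy → P (x + y) (add_mem hx hy)) :
    P x hx := by
  classical
  have key : ∃ h : ∑ n ∈ DFinsupp.support x, tof (x n) ∈ tfil S, P _ h := by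
    refine Finset.sum_induction _ (fun y => ∃ h : y ∈ tfil S, P y h) ?_ ?_ fun n _ => ?_
    · rintro y z ⟨hy, h1⟩ ⟨hz, h2⟩
      exact ⟨_, ha y z hy hz h1 h2⟩
    · have := h 0 0 (zero_mem _)
      simp only [tof_zero] at this
      exact ⟨_, this⟩
    · exact ⟨_, h n _ (hx n)⟩
  obtain ⟨h1, h2⟩ := key
  have e : ∑ n ∈ DFinsupp.support x, tof (x n) = x := DirectSum.sum_support_of x
  simp only [e] at h2
  exact h2

def Filt.tot (𝓕 : C.Filt) : C.tot.Fil where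
  fil k := tfil fun n => 𝓕.fil k
  zero f n := 𝓕.zero _
  anti h hf n := 𝓕.anti h (hf n)
  D_mem {X Y k f} hf := by
    induction hf using tfil_induction with
    | h n f hf =>
      change tD (tof f) ∈ _
      rw [tD_tof rfl]
      exact tof_mem_tfil.2 (𝓕.d_mem rfl hf)
    | ha x y _ _ hx hy => rw [map_add]; exact add_mem hx hy
  σ_mem {X Y k f} hf := by
    induction hf using tfil_induction with
    | h n f hf =>
      change tσ (tof f) ∈ _
      rw [tσ_tof]
      exact zsmul_mem (tof_mem_tfil.2 hf) _
    | ha x y _ _ hx hy => rw [map_add]; exact add_mem hx hy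
  comp_mem {X Y Z k l g f} hg hf := by
    induction hg using tfil_induction with
    | ha x y _ _ hx hy => rw [map_add, AddMonoidHom.add_apply]; exact add_mem hx hy
    | h m g hg =>
      induction hf using tfil_induction with
      | ha x y _ _ hx hy => rw [map_add]; exact add_mem hx hy
      | h n f hf =>
        change tcomp (tof g) (tof f) ∈ _
        rw [tcomp_tof rfl]
        exact tof_mem_tfil.2 (𝓕.comp_mem rfl hg hf)

lemma Filt.tof_mem {𝓕 : C.Filt} {n : ℤ} {k : ℕ} {f : C.Hom X Y n} :
    (tof f : C.tot.Hom X Y) ∈ 𝓕.tot.fil k ↔ f ∈ 𝓕.fil k := tof_mem_tfil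

variable {P : DGCat}

/-- A family of additive maps between morphism groups, extended to the total categories. -/
def tmap {D : DGCat} {X Y : C.Obj} {X' Y' : D.Obj} (e : ℤ → ℤ)
    (f : ∀ n, C.Hom X Y n →+ D.Hom X' Y' (e n)) : C.THom X Y →+ D.THom X' Y' :=
  DirectSum.toAddMonoid fun n => (DirectSum.of (fun n => D.Hom X' Y' n) (e n)).comp (f n)

lemma tmap_tof {D : DGCat} {X Y : C.Obj} {X' Y' : D.Obj} (e : ℤ → ℤ)
    (f : ∀ n, C.Hom X Y n →+ D.Hom X' Y' (e n)) {n : ℤ} (x : C.Hom X Y n) :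
    tmap e f (tof x) = tof (f n x) := DirectSum.toAddMonoid_of _ _ _

abbrev Functor.tot (T : Functor P C) : TotCat.Func P.tot C.tot where
  obj := T.obj
  map {X Y} := tmap (fun n => n) fun n => (T.map (X := X) (Y := Y) (n := n)).toAddMonoidHom
  map_id X := (tmap_tof _ _ _).trans (congrArg tof (T.map_id X))
  map_comp {X Y Z} g f := by
    induction g using tof_induction with
    | ha x y hx hy => simp only [map_add, AddMonoidHom.add_apply, hx, hy]
    | h m g =>
      induction f using tof_induction with
      | ha x y hx hy => simp only [map_add, hx, hy]
      | h n f =>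
        change tmap _ _ (tcomp (tof g) (tof f)) = tcomp (tmap _ _ (tof g)) (tmap _ _ (tof f))
        rw [tcomp_tof rfl, tmap_tof, tmap_tof, tmap_tof, tcomp_tof rfl]
        exact congrArg tof (T.map_comp rfl g f)
  map_D f := by
    induction f using tof_induction with
    | ha x y hx hy => simp only [map_add, hx, hy]
    | h n f =>
      change tmap _ _ (tD (tof f)) = tD (tmap _ _ (tof f))
      rw [tD_tof rfl, tmap_tof, tmap_tof, tD_tof rfl]
      exact congrArg tof (T.map_d rfl f)
  map_σ f := by
    induction f using tof_induction with
    | ha x y hx hy => simp only [map_add, hx, hy]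
    | h n f =>
      change tmap _ _ (tσ (tof f)) = tσ (tmap _ _ (tof f))
      rw [tσ_tof, map_zsmul, tmap_tof, tσ_tof]
  map_gr := by
    rintro X Y n _ ⟨f, rfl⟩
    exact ⟨T.map f, (tmap_tof (fun n => n) (fun n => T.map.toAddMonoidHom) f).symm⟩

lemma Functor.tot_map (T : Functor P C) {X Y : P.Obj} {n : ℤ} (f : P.Hom X Y n) :
    T.tot.map (tof f) = tof (T.map f) := tmap_tof _ _ f

/-- A retraction of a functor that is a homotopy inverse on the associated graded complexes. -/
structure FilTransfer (T : Functor P C) (𝓟 : P.Filt) (𝓒 : C.Filt) where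
  ε : ∀ {X Y : P.Obj} {n : ℤ}, C.Hom (T.obj X) (T.obj Y) n →+ P.Hom X Y n
  K : ∀ {X Y : P.Obj} {m n : ℤ}, m + 1 = n →
    (C.Hom (T.obj X) (T.obj Y) n →+ C.Hom (T.obj X) (T.obj Y) m)
  ε_map : ∀ {X Y : P.Obj} {n : ℤ} (f : P.Hom X Y n), ε (T.map f) = f
  K_map : ∀ {X Y : P.Obj} {m n : ℤ} (h : m + 1 = n) (f : P.Hom X Y n), K h (T.map f) = 0
  ε_left : ∀ {X Y Z : P.Obj} {m n k : ℤ} (h : m + n = k) (a : P.Hom Y Z m)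
    (x : C.Hom (T.obj X) (T.obj Y) n), ε (C.comp h (T.map a) x) = P.comp h a (ε x)
  ε_right : ∀ {X Y Z : P.Obj} {m n k : ℤ} (h : m + n = k) (x : C.Hom (T.obj Y) (T.obj Z) m)
    (a : P.Hom X Y n), ε (C.comp h x (T.map a)) = P.comp h (ε x) a
  K_left : ∀ {X Y Z : P.Obj} {m n k n' k' : ℤ} (h : m + n = k) (hn : n' + 1 = n) (hk : k' + 1 = k)
    (h' : m + n' = k') (a : P.Hom Y Z m) (x : C.Hom (T.obj X) (T.obj Y) n),
    K hk (C.comp h (T.map a) x) = (m.negOnePow : ℤ) • C.comp h' (T.map a) (K hn x)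
  K_right : ∀ {X Y Z : P.Obj} {m n k m' k' : ℤ} (h : m + n = k) (hm : m' + 1 = m) (hk : k' + 1 = k)
    (h' : m' + n = k') (x : C.Hom (T.obj Y) (T.obj Z) m) (a : P.Hom X Y n),
    K hk (C.comp h x (T.map a)) = C.comp h' (K hm x) (T.map a)
  map_fil : ∀ {X Y : P.Obj} {n : ℤ} {k : ℕ} {f : P.Hom X Y n}, f ∈ 𝓟.fil k → T.map f ∈ 𝓒.fil k
  ε_fil : ∀ {X Y : P.Obj} {n : ℤ} {k : ℕ} {x : C.Hom (T.obj X) (T.obj Y) n}, x ∈ 𝓒.fil k →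
    ε x ∈ 𝓟.fil k
  K_fil : ∀ {X Y : P.Obj} {m n : ℤ} (h : m + 1 = n) {k : ℕ} {x : C.Hom (T.obj X) (T.obj Y) n},
    x ∈ 𝓒.fil k → K h x ∈ 𝓒.fil k
  d_ε : ∀ {X Y : P.Obj} {n m : ℤ} (h : n + 1 = m) {k : ℕ} {x : C.Hom (T.obj X) (T.obj Y) n},
    x ∈ 𝓒.fil k → P.d h (ε x) - ε (C.d h x) ∈ 𝓟.fil (k + 1)
  htpy : ∀ {X Y : P.Obj} {l n m : ℤ} (hl : l + 1 = n) (hm : n + 1 = m) {k : ℕ}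
    {x : C.Hom (T.obj X) (T.obj Y) n}, x ∈ 𝓒.fil k →
    x - T.map (ε x) - C.d hl (K hl x) - K hm (C.d hm x) ∈ 𝓒.fil (k + 1)

namespace FilTransfer

variable {T : Functor P C} {𝓟 : P.Filt} {𝓒 : C.Filt} (τ : FilTransfer T 𝓟 𝓒)

def tε {X Y : P.Obj} : C.THom (T.obj X) (T.obj Y) →+ P.THom X Y := tmap (fun n => n) fun _ => τ.ε

def tK {X Y : P.Obj} : C.THom (T.obj X) (T.obj Y) →+ C.THom (T.obj X) (T.obj Y) :=
  tmap (fun n => n - 1) fun n => τ.K (sub_add_cancel n 1)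

lemma tε_tof {X Y : P.Obj} {n : ℤ} (x : C.Hom (T.obj X) (T.obj Y) n) :
    τ.tε (tof x) = tof (τ.ε x) := tmap_tof _ _ _

lemma tK_tof {X Y : P.Obj} {m n : ℤ} (h : m + 1 = n) (x : C.Hom (T.obj X) (T.obj Y) n) :
    τ.tK (tof x) = tof (τ.K h x) := by
  obtain rfl : m = n - 1 := by omega
  exact tmap_tof _ _ _

def tot : TotCat.FilTransfer T.tot 𝓟.tot 𝓒.tot where
  ε := τ.tε
  K := τ.tK
  ε_gr := by
    rintro X Y n _ ⟨f, rfl⟩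
    exact ⟨_, (τ.tε_tof f).symm⟩
  K_gr := by
    rintro X Y n m _ h ⟨f, rfl⟩
    exact ⟨_, (τ.tK_tof h f).symm⟩
  ε_σ x := by
    induction x using tof_induction with
    | ha x y hx hy => simp only [map_add, hx, hy]
    | h n f =>
      change τ.tε (tσ (tof f)) = tσ (τ.tε (tof f))
      rw [tσ_tof, map_zsmul, tε_tof, tσ_tof]
  K_σ x := by
    induction x using tof_induction with
    | ha x y hx hy => simp only [map_add, hx, hy, neg_add]
    | h n f =>
      change τ.tK (tσ (tof f)) = -tσ (τ.tK (tof f))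
      rw [tσ_tof, map_zsmul, τ.tK_tof (sub_add_cancel n 1), tσ_tof, Int.negOnePow_sub,
        Int.negOnePow_one, mul_neg_one, Units.val_neg, neg_smul, neg_neg]
  ε_map f := by
    induction f using tof_induction with
    | ha x y hx hy => simp only [map_add, hx, hy]
    | h n f => exact (congrArg τ.tε (T.tot_map f)).trans ((τ.tε_tof _).trans
        (congrArg tof (τ.ε_map f)))
  K_map f := by
    induction f using tof_induction with
    | ha x y hx hy => simp only [map_add, hx, hy, add_zero]
    | h n f => exact (congrArg τ.tK (T.tot_map f)).trans ((τ.tK_tof (sub_add_cancel n 1) _).trans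
        ((congrArg tof (τ.K_map _ f)).trans tof_zero))
  ε_left a x := by
    induction a using tof_induction with
    | ha x y hx hy => simp only [map_add, AddMonoidHom.add_apply, hx, hy]
    | h m a =>
      induction x using tof_induction with
      | ha x y hx hy => simp only [map_add, hx, hy]
      | h n x =>
        rw [T.tot_map]
        change τ.tε (tcomp (tof _) (tof x)) = tcomp (tof a) (τ.tε (tof x))
        rw [tcomp_tof rfl, tε_tof, tε_tof, tcomp_tof rfl, τ.ε_left]
  ε_right x a := by
    induction a using tof_induction with
    | ha x y hx hy => simp only [map_add, AddMonoidHom.add_apply, hx, hy]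
    | h m a =>
      induction x using tof_induction with
      | ha x y hx hy => simp only [map_add, AddMonoidHom.add_apply, hx, hy]
      | h n x =>
        rw [T.tot_map]
        change τ.tε (tcomp (tof x) (tof _)) = tcomp (τ.tε (tof x)) (tof a)
        rw [tcomp_tof rfl, tε_tof, tε_tof, tcomp_tof rfl, τ.ε_right]
  K_left a x := by
    induction a using tof_induction with
    | ha x y hx hy => simp only [map_add, AddMonoidHom.add_apply, hx, hy]
    | h m a =>
      induction x using tof_induction with
      | ha x y hx hy => simp only [map_add, hx, hy]
      | h n x =>
        rw [T.tot_map]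
        change τ.tK (tcomp (tof _) (tof x)) = tcomp (tσ (tof _)) (τ.tK (tof x))
        rw [tσ_tof, tcomp_tof rfl, τ.tK_tof (show m + (n - 1) + 1 = m + n by omega),
          τ.tK_tof (sub_add_cancel n 1), map_zsmul, AddMonoidHom.zsmul_apply, tcomp_tof rfl,
          τ.K_left rfl (sub_add_cancel n 1) (by omega) rfl, tof_zsmul]
  K_right x a := by
    induction a using tof_induction with
    | ha x y hx hy => simp only [map_add, AddMonoidHom.add_apply, hx, hy]
    | h n a =>
      induction x using tof_induction with
      | ha x y hx hy => simp only [map_add, AddMonoidHom.add_apply, hx, hy]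
      | h m x =>
        rw [T.tot_map]
        change τ.tK (tcomp (tof x) (tof _)) = tcomp (τ.tK (tof x)) (tof _)
        rw [tcomp_tof rfl, τ.tK_tof (show m - 1 + n + 1 = m + n by omega),
          τ.tK_tof (sub_add_cancel m 1), tcomp_tof rfl,
          τ.K_right rfl (sub_add_cancel m 1) (by omega) rfl]
  map_fil {X Y k f} hf := by
    induction hf using tfil_induction with
    | ha x y _ _ hx hy => rw [map_add]; exact add_mem hx hy
    | h n f hf =>
      rw [T.tot_map]
      exact tof_mem_tfil.2 (τ.map_fil hf)
  ε_fil {X Y k f} hf := by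
    induction hf using tfil_induction with
    | ha x y _ _ hx hy => rw [map_add]; exact add_mem hx hy
    | h n f hf =>
      rw [tε_tof]
      exact tof_mem_tfil.2 (τ.ε_fil hf)
  K_fil {X Y k f} hf := by
    induction hf using tfil_induction with
    | ha x y _ _ hx hy => rw [map_add]; exact add_mem hx hy
    | h n f hf =>
      rw [τ.tK_tof (sub_add_cancel n 1)]
      exact tof_mem_tfil.2 (τ.K_fil _ hf)
  D_ε {X Y k f} hf := by
    induction hf using tfil_induction with
    | ha x y _ _ hx hy =>
      refine AddSubgroup.mem_of_eq (add_mem hx hy) ?_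
      simp only [map_add]
      abel
    | h n f hf =>
      change tD (τ.tε (tof f)) - τ.tε (tD (tof f)) ∈ _
      rw [tD_tof rfl, tε_tof, tε_tof, tD_tof rfl, ← tof_sub]
      exact tof_mem_tfil.2 (τ.d_ε rfl hf)
  htpy {X Y k f} hf := by
    induction hf using tfil_induction with
    | ha x y _ _ hx hy =>
      refine AddSubgroup.mem_of_eq (add_mem hx hy) ?_
      simp only [map_add]
      abel
    | h n f hf =>
      rw [tε_tof, T.tot_map]
      change tof f - tof _ - tD (τ.tK (tof f)) - τ.tK (tD (tof f)) ∈ _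
      rw [tD_tof rfl, τ.tK_tof rfl, τ.tK_tof (sub_add_cancel n 1), tD_tof (sub_add_cancel n 1),
        ← tof_sub, ← tof_sub, ← tof_sub]
      exact tof_mem_tfil.2 (τ.htpy _ rfl hf)

end FilTransfer

def Filt.IsFinite (𝓕 : C.Filt) : Prop :=
  ∃ k, ∀ {X Y : C.Obj} {n : ℤ} {f : C.Hom X Y n}, f ∈ 𝓕.fil k → f = 0

lemma Filt.IsFinite.tot {𝓕 : C.Filt} (h : 𝓕.IsFinite) :
    ∃ k, ∀ {X Y : C.Obj} {f : C.tot.Hom X Y}, f ∈ 𝓕.tot.fil k → f = 0 := by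
  obtain ⟨k, hk⟩ := h
  refine ⟨k, fun {X Y f} hf => ?_⟩
  induction hf using tfil_induction with
  | ha x y _ _ hx hy => rw [hx, hy, add_zero]
  | h n f hf => rw [hk hf, tof_zero]

lemma isHomotopyEquiv_of_isEquiv {f : C.tot.Hom X Y} (hf : C.tot.IsEquiv f) :
    ∃ f : C.Hom X Y 0, C.IsHomotopyEquiv f := by
  obtain ⟨⟨f, rfl⟩, h1, _, ⟨g, rfl⟩, h2, ⟨_, ⟨y, rfl⟩, h3⟩, _, ⟨z, rfl⟩, h4⟩ := hf
  change tD (tof f) = 0 at h1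
  change tD (tof g) = 0 at h2
  change tcomp (tof g) (tof f) - tof (C.id X) = tD (tof y) at h3
  change tcomp (tof f) (tof g) - tof (C.id Y) = tD (tof z) at h4
  rw [tD_tof (zero_add 1), ← tof_zero] at h1 h2
  rw [tD_tof (neg_add_cancel 1), tcomp_tof (zero_add 0), ← tof_sub] at h3 h4
  exact ⟨f, tof_injective h1, g, tof_injective h2, ⟨y, tof_injective h3⟩, ⟨z, tof_injective h4⟩⟩

lemma FilTransfer.isQuasiEquivalence {T : Functor P C} {𝓟 : P.Filt} {𝓒 : C.Filt}
    (τ : FilTransfer T 𝓟 𝓒) (hP : 𝓟.IsFinite) (hC : 𝓒.IsFinite)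
    (ess : ∀ Y : C.Obj, ∃ (Q : P.Obj) (f : C.tot.Hom (T.obj Q) Y), C.tot.IsEquiv f) :
    T.IsQuasiEquivalence where
  surjective {X Y l m n} hl hm g hg := by
    obtain ⟨_, ⟨x, rfl⟩, _, ⟨y, rfl⟩, h1, h2⟩ := τ.tot.solve hP.tot hC.tot hl hm (w := 0)
      (z := tof g) (zero_mem _) (tof_mem_gr g) (map_zero _)
      (by rw [map_zero]; exact (tD_tof hm g).trans (by rw [hg, tof_zero]))
    refine ⟨x, tof_injective ?_, y, tof_injective ?_⟩
    · rw [tof_zero, ← tD_tof]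
      exact h1
    · rw [tof_sub, ← tD_tof, ← T.tot_map]
      exact h2
  injective {X Y l m n} hl hm f hf := by
    rintro ⟨h, hh⟩
    obtain ⟨_, ⟨x, rfl⟩, _, -, h1, -⟩ := τ.tot.solve hP.tot hC.tot (sub_add_cancel l 1) hl
      (w := tof f) (z := tof h) (tof_mem_gr f) (tof_mem_gr h) ((tD_tof hm f).trans (by rw [hf, tof_zero]))
      (by rw [T.tot_map, hh]; exact tD_tof hl h)
    refine ⟨x, tof_injective ?_⟩
    rw [← tD_tof]
    exact h1.symm
  essSurj Y := by
    obtain ⟨Q, f, hf⟩ := ess Y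
    exact ⟨Q, isHomotopyEquiv_of_isEquiv hf⟩

end DGCat

/-! ### Homogeneous dual bases -/

/-- A finite homogeneous dual basis of a cohesive module. -/
structure DualBasis {A : DGAlg.{u}} (E : CohesiveModule A) where
  κ : Type
  [fintype : Fintype κ]
  [decEq : DecidableEq κ]
  deg : κ → ℤ
  e : κ → E.E
  l : κ → E.E →ₗ[A.Z] A.Z
  e_mem : ∀ x, e x ∈ E.gr (deg x)
  l_eq_zero : ∀ x {m : ℤ} {v : E.E}, v ∈ E.gr m → m ≠ deg x → l x v = 0
  sum_l_e : ∀ v, ∑ x, l x v • e x = v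

attribute [instance] DualBasis.fintype DualBasis.decEq

namespace CohesiveModule

variable {A : DGAlg.{u}} (E : CohesiveModule A)

def proj (n : ℤ) : E.E →ₗ[A.Z] E.E :=
  (E.gr n).subtype ∘ₗ DirectSum.component A.Z ℤ (fun n => E.gr n) n ∘ₗ
    (LinearEquiv.ofBijective (DirectSum.coeLinearMap E.gr) E.internal).symm.toLinearMap

lemma proj_mem (n : ℤ) (v : E.E) : E.proj n v ∈ E.gr n := SetLike.coe_mem _

lemma symm_apply {n : ℤ} {v : E.E} (hv : v ∈ E.gr n) :
    (LinearEquiv.ofBijective (DirectSum.coeLinearMap E.gr) E.internal).symm v =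
      DirectSum.lof A.Z ℤ (fun n => E.gr n) n ⟨v, hv⟩ := by
  rw [LinearEquiv.symm_apply_eq]
  exact (DirectSum.coeLinearMap_lof E.gr n ⟨v, hv⟩).symm

lemma proj_apply {n : ℤ} {v : E.E} (hv : v ∈ E.gr n) : E.proj n v = v := by
  simp [proj, E.symm_apply hv, DirectSum.component.lof_self]

lemma proj_apply_ne {n m : ℤ} {v : E.E} (hv : v ∈ E.gr m) (h : m ≠ n) : E.proj n v = 0 := by
  simp only [proj, LinearMap.comp_apply, LinearEquiv.coe_coe, E.symm_apply hv]
  have h1 : DirectSum.component A.Z ℤ (fun n => E.gr n) n (DirectSum.lof A.Z ℤ (fun n => E.gr n) m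
      ⟨v, hv⟩) = 0 := by
    rw [DirectSum.component.of, dif_neg h]
  rw [h1, map_zero]

lemma exists_finset_proj (v : E.E) : ∃ D : Finset ℤ, ∀ n ∉ D, E.proj n v = 0 := by
  classical
  induction v using E.gr_induction with
  | hm n e he => exact ⟨{n}, fun m hm => E.proj_apply_ne he fun h => hm (by simp [h])⟩
  | ha x y hx hy =>
    obtain ⟨D, hD⟩ := hx
    obtain ⟨D', hD'⟩ := hy
    refine ⟨D ∪ D', fun n hn => ?_⟩
    rw [map_add, hD n (fun h => hn (Finset.mem_union_left _ h)),
      hD' n (fun h => hn (Finset.mem_union_right _ h)), add_zero]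

lemma sum_proj {D : Finset ℤ} {v : E.E} : (∀ n ∉ D, E.proj n v = 0) → ∑ n ∈ D, E.proj n v = v := by
  intro h
  obtain ⟨D', hD'⟩ : ∃ D' : Finset ℤ, D ⊆ D' ∧ ∑ n ∈ D', E.proj n v = v := by
    classical
    suffices H : ∃ D₀ : Finset ℤ, ∀ D', D₀ ⊆ D' → ∑ n ∈ D', E.proj n v = v by
      obtain ⟨D₀, h0⟩ := H
      exact ⟨D ∪ D₀, Finset.subset_union_left, h0 _ Finset.subset_union_right⟩
    clear h
    induction v using E.gr_induction with
    | hm n e he =>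
      refine ⟨{n}, fun D' hD => ?_⟩
      rw [Finset.sum_eq_single n, E.proj_apply he]
      · exact fun m _ hm => E.proj_apply_ne he hm.symm
      · exact fun hn => absurd (hD (by simp)) hn
    | ha x y hx hy =>
      obtain ⟨D, hD⟩ := hx
      obtain ⟨D', hD'⟩ := hy
      refine ⟨D ∪ D', fun D'' h => ?_⟩
      simp only [map_add, Finset.sum_add_distrib]
      rw [hD _ (Finset.subset_union_left.trans h), hD' _ (Finset.subset_union_right.trans h)]
  exact (Finset.sum_subset hD'.1 fun n _ hn => h n hn).trans hD'.2

lemma exists_dualBasis : Nonempty (DualBasis E) := by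
  classical
  have := E.finite
  have := E.projective
  obtain ⟨n, π, s, -, -, h⟩ := Module.Finite.exists_comp_eq_id_of_projective A.Z E.E
  have hs : ∀ v, π (s v) = v := fun v => LinearMap.congr_fun h v
  let v : Fin n → E.E := fun i => π (Pi.single i 1)
  have hv : ∀ g : Fin n → A.Z, π g = ∑ i, g i • v i := fun g => by
    conv_lhs => rw [pi_eq_sum_univ' g, map_sum]
    refine Finset.sum_congr rfl fun i _ => ?_
    rw [map_smul]
  choose D hD using fun i => E.exists_finset_proj (v i)
  let D' : Finset ℤ := Finset.univ.biUnion D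
  have hD' : ∀ m ∉ D', ∀ w, E.proj m w = 0 := fun m hm w => by
    rw [← hs w, hv, map_sum]
    refine Finset.sum_eq_zero fun i _ => ?_
    rw [map_smul, hD i m (fun h => hm (Finset.mem_biUnion.2 ⟨i, Finset.mem_univ _, h⟩)), smul_zero]
  refine ⟨{
    κ := D' × Fin n
    deg := fun x => x.1
    e := fun x => E.proj x.1 (v x.2)
    l := fun x => LinearMap.proj x.2 ∘ₗ s ∘ₗ E.proj x.1
    e_mem := fun x => E.proj_mem _ _
    l_eq_zero := fun x m w hw h => by simp [E.proj_apply_ne hw h]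
    sum_l_e := fun w => ?_ }⟩
  rw [Fintype.sum_prod_type]
  refine Eq.trans ?_ (E.sum_proj fun n hn => hD' n hn w)
  rw [← Finset.sum_coe_sort D' fun n => E.proj n w]
  refine Finset.sum_congr rfl fun m _ => ?_
  have := hv (s (E.proj m w))
  rw [hs] at this
  conv_rhs => rw [← E.proj_apply (E.proj_mem m w), this, map_sum]
  refine Finset.sum_congr rfl fun i _ => ?_
  rw [map_smul]
  rfl

end CohesiveModule

/-! ### The filtration by form degree -/

namespace ScalarExt

section fil

variable {A B C D : DGAlg.{u}} (f : Hom A B) {E : Type u} [AddCommGroup E] [Module A.Z E]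

def filGr (𝓔 : ℤ → Submodule A.Z E) (k : ℕ) (m : ℤ) : Submodule ℂ (ScalarExt f E) :=
  Submodule.span ℂ {x | ∃ (j : ℕ) (n : ℤ) (b : B.A) (e : E),
    b ∈ B.gr j ∧ e ∈ 𝓔 n ∧ (j : ℤ) + n = m ∧ k ≤ j ∧ x = mk f b e}

variable {f} {𝓔 : ℤ → Submodule A.Z E}

lemma mk_mem_filGr {j k : ℕ} {n m : ℤ} {b : B.A} {e : E} (hb : b ∈ B.gr j) (he : e ∈ 𝓔 n)
    (h : (j : ℤ) + n = m) (hk : k ≤ j) : mk f b e ∈ filGr f 𝓔 k m :=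
  Submodule.subset_span ⟨j, n, b, e, hb, he, h, hk, rfl⟩

lemma filGr_induction {k : ℕ} {m : ℤ}
    {P : ScalarExt f E → Prop} {x : ScalarExt f E} (hx : x ∈ filGr f 𝓔 k m) (h0 : P 0)
    (hm : ∀ (j : ℕ) (n : ℤ) (b : B.A) (e : E), b ∈ B.gr j → e ∈ 𝓔 n → (j : ℤ) + n = m → k ≤ j →
      P (mk f b e))
    (ha : ∀ x y, P x → P y → P (x + y)) : P x := by
  refine Submodule.span_induction (p := fun x _ => ∀ c : ℂ, P (c • x)) ?_ ?_ ?_ ?_ hx 1 |>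
    fun h => by simpa using h
  · rintro x ⟨j, n, b, e, hb, he, h, hk, rfl⟩ c
    rw [csmul_mk]
    exact hm j n _ e ((B.gr j).smul_mem c hb) he h hk
  · intro c; simpa using h0
  · intro x y _ _ hx hy c
    rw [smul_add]
    exact ha _ _ (hx c) (hy c)
  · intro a x _ hx c
    rw [smul_smul]
    exact hx _

lemma mem_filGr_zero {m : ℤ} {x : ScalarExt f E} : x ∈ filGr f 𝓔 0 m ↔ x ∈ gr f 𝓔 m := by
  constructor
  · intro hx
    exact filGr_induction (P := fun x => x ∈ gr f 𝓔 m) hx (zero_mem _)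
      (fun j n b e hb he h _ => mk_mem f 𝓔 hb he h) fun _ _ => add_mem
  · intro hx
    exact gr_induction f (P := fun x => x ∈ filGr f 𝓔 0 m) hx (zero_mem _)
      (fun j n b e hb he h => mk_mem_filGr hb he h (Nat.zero_le _)) fun _ _ => add_mem

lemma filGr_anti {k l : ℕ} (h : k ≤ l) {m : ℤ} {x : ScalarExt f E} (hx : x ∈ filGr f 𝓔 l m) :
    x ∈ filGr f 𝓔 k m :=
  filGr_induction (P := fun x => x ∈ filGr f 𝓔 k m) hx (zero_mem _)
    (fun j n b e hb he hm hl => mk_mem_filGr hb he hm (h.trans hl)) fun _ _ => add_mem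

lemma smul_mem_filGr {k l j : ℕ} {m n : ℤ} {x : ScalarExt f E} {b : B.A} (hx : x ∈ filGr f 𝓔 k m)
    (hb : b ∈ B.gr j) (h : m + j = n) (hl : l ≤ k + j) : x <• b ∈ filGr f 𝓔 l n :=
  filGr_induction (P := fun x => x <• b ∈ filGr f 𝓔 l n) hx (by simp)
    (fun i n b' e hb' he hi hk => by
      rw [mk_mul]
      exact mk_mem_filGr (B.mul_mem hb' hb) he (by push_cast; omega) (by omega))
    (fun x y hx hy => by rw [smul_add]; exact add_mem hx hy)

lemma push_mem_filGr {f' : Hom A C} (h : Hom B C) (hf : ∀ a, h.toFun (f.toFun a) = f'.toFun a) {k : ℕ}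
    {m : ℤ} {x : ScalarExt f E} (hx : x ∈ filGr f 𝓔 k m) : push h hf x ∈ filGr f' 𝓔 k m :=
  filGr_induction (P := fun x => push h hf x ∈ filGr f' 𝓔 k m) hx (by simp)
    (fun i n b e hb he hi hk => mk_mem_filGr (h.map_mem hb) he hi hk)
    (fun x y hx hy => by rw [map_add]; exact add_mem hx hy)

/-- A morphism of dg-algebras that is surjective in each degree. -/
def _root_.DGAlg.Hom.GrSurj (h : Hom B C) : Prop := ∀ (j : ℕ), ∀ c ∈ C.gr j, ∃ b ∈ B.gr j, h.toFun b = c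

lemma exists_push {f' : Hom A C} (h : Hom B C) (hf : ∀ a, h.toFun (f.toFun a) = f'.toFun a)
    (hh : h.GrSurj) {k : ℕ} {m : ℤ} {y : ScalarExt f' E} (hy : y ∈ filGr f' 𝓔 k m) :
    ∃ x ∈ filGr f 𝓔 k m, push h hf x = y :=
  filGr_induction (P := fun y => ∃ x ∈ filGr f 𝓔 k m, push h hf x = y) hy
    ⟨0, zero_mem _, map_zero _⟩
    (fun j n c e hc he hj hk => by
      obtain ⟨b, hb, rfl⟩ := hh j c hc
      exact ⟨_, mk_mem_filGr hb he hj hk, push_mk _ _ _ _⟩)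
    (by
      rintro _ _ ⟨x, hx, rfl⟩ ⟨y, hy, rfl⟩
      exact ⟨x + y, add_mem hx hy, map_add _ _ _⟩)

lemma filGr_eq_zero {k : ℕ} (hB : ∀ j, k ≤ j → ∀ b ∈ B.gr j, b = 0) {m : ℤ} {x : ScalarExt f E}
    (hx : x ∈ filGr f 𝓔 k m) : x = 0 :=
  filGr_induction (P := fun x => x = 0) hx rfl
    (fun j n b e hb _ _ hk => by rw [hB j hk b hb, zero_mk])
    (fun x y hx hy => by rw [hx, hy, add_zero])

end fil

section hom

variable {A A' A'' B C D : DGAlg.{u}} {E F G : Type u} [AddCommGroup E] [Module A.Z E]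
  [AddCommGroup F] [Module A'.Z F] [AddCommGroup G] [Module A''.Z G]
  {f : Hom A B} {g : Hom A' B} {k : Hom A'' B} {f' : Hom A C} {g' : Hom A' C}
  {𝓔 : ℤ → Submodule A.Z E} {𝓕 : ℤ → Submodule A'.Z F} {𝓖 : ℤ → Submodule A''.Z G}

variable (f g 𝓔 𝓕) in
/-- The morphisms of degree `n` that raise the form degree by at least `i`. -/
def homFil (i : ℕ) (n : ℤ) : AddSubgroup (ScalarExt f E →ₗ[(B.A)ᵐᵒᵖ] ScalarExt g F) where
  carrier := {φ | ∀ m, ∀ e ∈ 𝓔 m, φ (mk f 1 e) ∈ filGr g 𝓕 i (m + n)}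
  add_mem' h₁ h₂ m e he := add_mem (h₁ m e he) (h₂ m e he)
  zero_mem' _ _ _ := zero_mem _
  neg_mem' h m e he := neg_mem (h m e he)

lemma homFil_apply {φ : ScalarExt f E →ₗ[(B.A)ᵐᵒᵖ] ScalarExt g F} {i j l : ℕ} {n m q : ℤ}
    (hφ : φ ∈ homFil f g 𝓔 𝓕 i n) {x : ScalarExt f E} (hx : x ∈ filGr f 𝓔 j m) (hl : l ≤ i + j)
    (hq : m + n = q) : φ x ∈ filGr g 𝓕 l q :=
  filGr_induction (P := fun x => φ x ∈ filGr g 𝓕 l q) hx (by simp)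
    (fun a m b e hb he ha hj => by
      rw [mk_eq, map_smul]
      exact smul_mem_filGr (hφ m e he) hb (by omega) (by omega))
    (fun x y hx hy => by rw [map_add]; exact add_mem hx hy)

lemma homFil_anti {φ : ScalarExt f E →ₗ[(B.A)ᵐᵒᵖ] ScalarExt g F} {i j : ℕ} {n : ℤ} (h : i ≤ j)
    (hφ : φ ∈ homFil f g 𝓔 𝓕 j n) : φ ∈ homFil f g 𝓔 𝓕 i n := fun m e he => filGr_anti h (hφ m e he)

lemma mem_homFil_zero {φ : ScalarExt f E →ₗ[(B.A)ᵐᵒᵖ] ScalarExt g F} {n : ℤ} :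
    φ ∈ homFil f g 𝓔 𝓕 0 n ↔ ∀ m, ∀ x ∈ gr f 𝓔 m, φ x ∈ gr g 𝓕 (m + n) := by
  constructor
  · intro h m x hx
    exact mem_filGr_zero.1 (homFil_apply h (mem_filGr_zero.2 hx) (Nat.zero_le _) rfl)
  · intro h m e he
    exact mem_filGr_zero.2 (h m _ (mk_mem f 𝓔 B.one_mem he (zero_add m)))

lemma homFil_comp {ψ : ScalarExt g F →ₗ[(B.A)ᵐᵒᵖ] ScalarExt k G}
    {φ : ScalarExt f E →ₗ[(B.A)ᵐᵒᵖ] ScalarExt g F} {i j : ℕ} {m n q : ℤ}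
    (hψ : ψ ∈ homFil g k 𝓕 𝓖 i m) (hφ : φ ∈ homFil f g 𝓔 𝓕 j n) (h : m + n = q) :
    ψ ∘ₗ φ ∈ homFil f k 𝓔 𝓖 (i + j) q := fun a e he =>
  homFil_apply hψ (hφ a e he) le_rfl (by omega)

lemma homFil_restr (h : Hom B C) (hf : ∀ a, h.toFun (f.toFun a) = f'.toFun a)
    (hg : ∀ a, h.toFun (g.toFun a) = g'.toFun a) {φ : ScalarExt f E →ₗ[(B.A)ᵐᵒᵖ] ScalarExt g F} {i : ℕ}
    {n : ℤ} (hφ : φ ∈ homFil f g 𝓔 𝓕 i n) : restr h hf hg φ ∈ homFil f' g' 𝓔 𝓕 i n := fun m e he => by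
  rw [mk_one_eq_push h hf, restr_push]
  exact push_mem_filGr h hg (hφ m e he)

lemma homFil_eq_zero (h𝓔 : DirectSum.IsInternal 𝓔) {i : ℕ} (hB : ∀ j, i ≤ j → ∀ b ∈ B.gr j, b = 0)
    {n : ℤ} {φ : ScalarExt f E →ₗ[(B.A)ᵐᵒᵖ] ScalarExt g F} (hφ : φ ∈ homFil f g 𝓔 𝓕 i n) : φ = 0 := by
  refine LinearMap.ext fun x => ?_
  refine hom_induction f h𝓔 x (map_zero _) (fun j n b e hb he => ?_)
    (fun x y hx hy => by rw [map_add, hx, hy]; simp)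
  rw [mk_eq, map_smul, filGr_eq_zero hB (hφ n e he), smul_zero]
  rfl

end hom

section zmul

variable {A A' B C : DGAlg.{u}} {f : Hom A B} {g : Hom A' B} {E F : Type u} [AddCommGroup E]
  [Module A.Z E] [AddCommGroup F] [Module A'.Z F]

variable (f E) in
def zmul (z : B.Z) : ScalarExt f E →ₗ[(B.A)ᵐᵒᵖ] ScalarExt f E where
  toFun x := x <• algebraMap B.Z B.A z
  map_add' x y := smul_add _ x y
  map_smul' b x := by
    rw [RingHom.id_apply, smul_smul, smul_smul]
    congr 1
    exact MulOpposite.unop_injective (Algebra.commutes z b.unop).symm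

lemma zmul_apply (z : B.Z) (x : ScalarExt f E) : zmul f E z x = x <• algebraMap B.Z B.A z := rfl

lemma zmul_comm (z : B.Z) (φ : ScalarExt f E →ₗ[(B.A)ᵐᵒᵖ] ScalarExt g F) :
    zmul g F z ∘ₗ φ = φ ∘ₗ zmul f E z := LinearMap.ext fun x => (map_smul φ _ x).symm

lemma zmul_mem (𝓔 : ℤ → Submodule A.Z E) (z : B.Z) : zmul f E z ∈ homFil f f 𝓔 𝓔 0 0 := fun m e he => by
  rw [zmul_apply, mk_mul, one_mul]
  exact mk_mem_filGr ((B.mem_gr_zero _).2 ⟨z, rfl⟩) he (by simp) le_rfl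

def coord (f : Hom A B) (l : E →ₗ[A.Z] A.Z) : ScalarExt f E →ₗ[(B.A)ᵐᵒᵖ] B.A :=
  lift f (AddMonoidHom.mk' (fun e => algebraMap B.Z B.A (f.zero (l e)))
    (fun e e' => by rw [map_add, map_add, map_add])) (fun z e => by
      change algebraMap B.Z B.A (f.zero (l (z • e))) = algebraMap B.Z B.A (f.zero (l e)) *
        algebraMap B.Z B.A (f.zero z)
      rw [map_smul, smul_eq_mul, map_mul, map_mul, Algebra.commutes])

lemma coord_mk (l : E →ₗ[A.Z] A.Z) (b : B.A) (e : E) :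
    coord f l (mk f b e) = algebraMap B.Z B.A (f.zero (l e)) * b := rfl

lemma coord_push {f' : Hom A C} (h : Hom B C) (hf : ∀ a, h.toFun (f.toFun a) = f'.toFun a)
    (l : E →ₗ[A.Z] A.Z) (x : ScalarExt f E) :
    coord f' l (push h hf x) = h.toFun (coord f l x) := by
  induction x using ScalarExt.induction with
  | h0 => simp
  | hm b e => rw [push_mk, coord_mk, coord_mk, map_mul, f.algebraMap_zero, hf, f'.algebraMap_zero]
  | ha x y hx hy => simp only [map_add, hx, hy]

end zmul

section dualBasis

variable {A A' B C : DGAlg.{u}} {E : CohesiveModule A} {F : CohesiveModule A'} {f : Hom A B}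
  {g : Hom A' B} {f' : Hom A C} {g' : Hom A' C} (h : Hom B C)
  (hf : ∀ a, h.toFun (f.toFun a) = f'.toFun a) (hg : ∀ a, h.toFun (g.toFun a) = g'.toFun a)

lemma eq_sum_coord (b : DualBasis E) (x : ScalarExt f E.E) :
    x = ∑ i, mk f (coord f (b.l i) x) (b.e i) := by
  induction x using ScalarExt.induction with
  | h0 => simp
  | hm c e =>
    conv_lhs => rw [← b.sum_l_e e]
    rw [show mk f c (∑ i, b.l i e • b.e i) = ∑ i, mk f c (b.l i e • b.e i) from
      map_sum (AddMonoidHom.mk' (mk f c) (mk_add f c)) _ _]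
    exact Finset.sum_congr rfl fun i _ => by rw [mk_smul, coord_mk]
  | ha x y hx hy =>
    simp only [map_add, add_mk, Finset.sum_add_distrib]
    rw [← hx, ← hy]

lemma zmul_eq_zero_of_push {z : B.Z} (hz : ∀ b, h.toFun b = 0 → algebraMap B.Z B.A z * b = 0)
    {x : ScalarExt f E.E} (hx : push h hf x = 0) : zmul f E.E z x = 0 := by
  obtain ⟨b⟩ := E.exists_dualBasis
  rw [eq_sum_coord b x, map_sum]
  refine Finset.sum_eq_zero fun i _ => ?_
  rw [zmul_apply, mk_mul, ← Algebra.commutes, hz _ (by rw [← coord_push h hf, hx, map_zero]), zero_mk]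

lemma zmul_comp_eq_zero {z : B.Z} (hz : ∀ b, h.toFun b = 0 → algebraMap B.Z B.A z * b = 0)
    {φ : ScalarExt f E.E →ₗ[(B.A)ᵐᵒᵖ] ScalarExt g F.E} (hφ : restr h hf hg φ = 0) :
    zmul g F.E z ∘ₗ φ = 0 := by
  refine LinearMap.ext fun x => ?_
  refine zmul_eq_zero_of_push h hg hz ?_
  rw [← restr_push h hf hg, hφ]
  rfl

lemma exists_restr (hh : h.GrSurj) {i : ℕ} {n : ℤ}
    {φ : ScalarExt f' E.E →ₗ[(C.A)ᵐᵒᵖ] ScalarExt g' F.E} (hφ : φ ∈ homFil f' g' E.gr F.gr i n) :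
    ∃ ψ ∈ homFil f g E.gr F.gr i n, restr h hf hg ψ = φ := by
  obtain ⟨b⟩ := E.exists_dualBasis
  choose y hy hy' using fun x => exists_push h hg hh (hφ _ _ (b.e_mem x))
  let ψ : ScalarExt f E.E →ₗ[(B.A)ᵐᵒᵖ] ScalarExt g F.E :=
    lift f (AddMonoidHom.mk' (fun e => ∑ x, y x <• algebraMap B.Z B.A (f.zero (b.l x e)))
      (fun e e' => by simp only [map_add, MulOpposite.op_add, add_smul, Finset.sum_add_distrib]))
      (fun z e => by
        change ∑ x, y x <• algebraMap B.Z B.A (f.zero (b.l x (z • e))) =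
          (∑ x, y x <• algebraMap B.Z B.A (f.zero (b.l x e))) <• _
        rw [Finset.smul_sum]
        refine Finset.sum_congr rfl fun x _ => ?_
        rw [map_smul, smul_eq_mul, map_mul, map_mul, smul_smul, ← MulOpposite.op_mul,
          Algebra.commutes])
  have hψ : ∀ e, ψ (mk f 1 e) = ∑ x, y x <• algebraMap B.Z B.A (f.zero (b.l x e)) := fun e =>
    (lift_mk f _ _ 1 e).trans (by rw [MulOpposite.op_one, one_smul]; rfl)
  refine ⟨ψ, fun m e he => ?_, hom_ext _ fun e => ?_⟩
  · rw [hψ]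
    refine sum_mem fun x _ => ?_
    by_cases hm : m = b.deg x
    · subst hm
      exact smul_mem_filGr (hy x) ((B.mem_gr_zero _).2 ⟨_, rfl⟩) (by simp) (by simp)
    · rw [b.l_eq_zero x he hm]
      simp
  · rw [restr_mk, hψ, MulOpposite.op_one, one_smul, map_sum]
    conv_rhs => rw [← b.sum_l_e e]
    rw [show mk f' 1 (∑ i, b.l i e • b.e i) = ∑ i, mk f' 1 (b.l i e • b.e i) from
      map_sum (AddMonoidHom.mk' (mk f' 1) (mk_add f' 1)) _ _, map_sum]
    refine Finset.sum_congr rfl fun x _ => ?_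
    rw [push_smul, hy', mk_smul, mul_one, mk_eq f' (algebraMap _ _ _), map_smul, f.algebraMap_zero, hf,
      f'.algebraMap_zero]

end dualBasis

end ScalarExt

namespace CohesiveModule

variable {A B : DGAlg.{u}} (E : CohesiveModule A)

lemma connExt_mem_filGr (f : Hom A B) {i : ℕ} {m n : ℤ} {x : ScalarExt f E.E}
    (hx : x ∈ ScalarExt.filGr f E.gr i m) (h : m + 1 = n) :
    E.connExt f x ∈ ScalarExt.filGr f E.gr i n :=
  ScalarExt.filGr_induction (P := fun x => E.connExt f x ∈ ScalarExt.filGr f E.gr i n) hx (by simp)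
    (fun j m b e hb he hj hi => by
      rw [connExt_mk]
      refine add_mem ?_ (ScalarExt.mk_mem_filGr (B.d_mem hb) (E.sign_mem he) (by push_cast; omega)
        (by omega))
      exact ScalarExt.smul_mem_filGr (ScalarExt.mem_filGr_zero.2 (ScalarExt.push_mem f (id_push f)
        (E.conn₁_mem he))) hb (by omega) (by omega))
    (fun x y hx hy => by rw [map_add]; exact add_mem hx hy)

end CohesiveModule

/-! ### Morphisms over open sets and their extension by cutoff functions -/

/-- A map that kills the kernel of a surjection factors through it. -/
def extendAlong {M M' N : Type*} [AddCommGroup M] [AddCommGroup M'] [AddCommGroup N]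
    (r : M →+ M') (hr : Function.Surjective r) (ρ : M →+ N) (h : ∀ x, r x = 0 → ρ x = 0) : M' →+ N :=
  AddMonoidHom.mk' (fun y => ρ (Function.surjInv hr y)) (fun x y => by
    rw [← map_add, ← sub_eq_zero, ← map_sub]
    refine h _ ?_
    rw [map_sub, map_add, Function.surjInv_eq hr, Function.surjInv_eq hr, Function.surjInv_eq hr,
      sub_self])

lemma extendAlong_apply {M M' N : Type*} [AddCommGroup M] [AddCommGroup M'] [AddCommGroup N]
    (r : M →+ M') (hr : Function.Surjective r) (ρ : M →+ N) (h : ∀ x, r x = 0 → ρ x = 0) (x : M) :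
    extendAlong r hr ρ h (r x) = ρ x := by
  change ρ (Function.surjInv hr (r x)) = ρ x
  rw [← sub_eq_zero, ← map_sub]
  refine h _ ?_
  rw [map_sub, Function.surjInv_eq hr, sub_self]

section Soft

variable {X : Type v} [TopologicalSpace X] {𝒜 : DGAlgPresheaf.{u} X} {ι : Type w}
  {U : ι → Opens X}

variable (𝒜 U) in
/-- A partition of unity for a presheaf of dg-algebras with surjective restrictions. -/
structure SoftCover where
  surj : ∀ {W V : Opens X} (h : W ≤ V), (𝒜.res h).GrSurj
  J : Finset ι
  ρ : ι → (𝒜.obj ⊤).Z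
  sum_ρ : ∑ j ∈ J, ρ j = 1
  mul_eq_zero : ∀ (j : ι) {W V : Opens X} (h : W ≤ V), V ⊓ U j ≤ W →
    ∀ b, (𝒜.res h).toFun b = 0 →
      algebraMap (𝒜.obj V).Z (𝒜.obj V).A ((𝒜.res le_top).zero (ρ j)) * b = 0
  eq_zero : ∀ i ∉ J, ∀ a : (𝒜.obj (U i)).A, a = 0
  N : ℕ
  gr_eq_zero : ∀ (V : Opens X) (j : ℕ), N < j → ∀ b ∈ (𝒜.obj V).gr j, b = 0

namespace LHom

variable {E F G H : CohesiveFamily 𝒜 U} {V V' V'' : Opens X} {i j k l : ι}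
  {hi : V ≤ U i} {hj : V ≤ U j} {hk : V ≤ U k} {hl : V ≤ U l}

def fil (p : ℕ) {n : ℤ} : AddSubgroup (LHom E F V hi hj n) :=
  (ScalarExt.homFil (𝒜.res hi) (𝒜.res hj) (E i).gr (F j).gr p n).comap
    (DGMod.Hom ((E i).extend (𝒜.res hi)) ((F j).extend (𝒜.res hj)) n).subtype.toAddMonoidHom

lemma mem_fil_zero {n : ℤ} (x : LHom E F V hi hj n) : x ∈ fil 0 :=
  ScalarExt.mem_homFil_zero.2 x.2

lemma fil_anti {p q : ℕ} (h : p ≤ q) {n : ℤ} {x : LHom E F V hi hj n} (hx : x ∈ fil q) : x ∈ fil p :=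
  ScalarExt.homFil_anti h hx

lemma cast_mem_fil {p : ℕ} {n m : ℤ} (h : n = m) {x : LHom E F V hi hj n} (hx : x ∈ fil p) :
    cast h x ∈ fil p := by
  subst h
  exact hx

lemma comp_mem_fil {p q : ℕ} {m n k' : ℤ} (h : m + n = k') {x : LHom F G V hj hk m}
    {y : LHom E F V hi hj n} (hx : x ∈ fil p) (hy : y ∈ fil q) : comp h x y ∈ fil (p + q) :=
  ScalarExt.homFil_comp hx hy h

lemma rs_mem_fil (hV : V' ≤ V) {p : ℕ} {n : ℤ} {x : LHom E F V hi hj n} (hx : x ∈ fil p) :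
    rs hV x ∈ fil p := 
  ScalarExt.homFil_restr (𝒜.res hV) (𝒜.res_res hV hi (hV.trans hi)) (𝒜.res_res hV hj (hV.trans hj)) hx

lemma d_mem_fil {p : ℕ} {n m : ℤ} (h : n + 1 = m) {x : LHom E F V hi hj n} (hx : x ∈ fil p) :
    d h x ∈ fil p := fun q e he => by
  refine sub_mem ?_ ?_
  · exact (F j).connExt_mem_filGr _ (hx q e he) (by omega)
  · have h1 : (E i).connExt (𝒜.res hi) (ScalarExt.mk _ 1 e) ∈ ScalarExt.filGr (𝒜.res hi) (E i).gr 0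
        (q + 1) := (E i).connExt_mem_filGr _ (ScalarExt.mk_mem_filGr (𝒜.obj V).one_mem he (by simp)
          le_rfl) rfl
    exact zsmul_mem (ScalarExt.homFil_apply hx h1 le_rfl (by omega)) _

lemma fil_eq_zero (S : SoftCover 𝒜 U) {p : ℕ} (hp : S.N < p) {n : ℤ} {x : LHom E F V hi hj n}
    (hx : x ∈ fil p) : x = 0 :=
  Subtype.ext (ScalarExt.homFil_eq_zero (E i).internal
    (fun q hq => S.gr_eq_zero V q (hp.trans_le hq)) hx)

def zid (E : CohesiveFamily 𝒜 U) (hi : V ≤ U i) (z : (𝒜.obj V).Z) : LHom E E V hi hi 0 :=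
  ⟨ScalarExt.zmul (𝒜.res hi) (E i).E z, ScalarExt.mem_homFil_zero.1 (ScalarExt.zmul_mem (E i).gr z)⟩

lemma zid_comp_eq {z : (𝒜.obj V).Z} {n m : ℤ} (h : 0 + n = m) (h' : n + 0 = m)
    (x : LHom E F V hi hj n) : comp h (zid F hj z) x = comp h' x (zid E hi z) :=
  Subtype.ext (ScalarExt.zmul_comm z x.1)

lemma rs_zid (hV : V' ≤ V) (z : (𝒜.obj V).Z) :
    rs hV (zid E hi z) = zid E (hV.trans hi) ((𝒜.res hV).zero z) := by
  refine Subtype.ext (ScalarExt.hom_ext _ fun e => ?_)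
  have h1 : (rs hV (zid E hi z)).1 (ScalarExt.mk _ 1 e) = ScalarExt.push (𝒜.res hV)
      (𝒜.res_res hV hi (hV.trans hi))
      (ScalarExt.zmul (𝒜.res hi) (E i).E z (ScalarExt.mk _ 1 e)) <• (1 : (𝒜.obj V').A) := rfl
  refine h1.trans ?_
  change _ = ScalarExt.zmul (𝒜.res (hV.trans hi)) (E i).E ((𝒜.res hV).zero z) (ScalarExt.mk _ 1 e)
  rw [MulOpposite.op_one, one_smul, ScalarExt.zmul_apply, ScalarExt.zmul_apply, ScalarExt.push_smul,
    ScalarExt.push_mk, map_one, (𝒜.res hV).algebraMap_zero]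

lemma d_zid_mem (z : (𝒜.obj V).Z) {m : ℤ} (h : 0 + 1 = m) : d h (zid E hi z) ∈ fil 1 := by
  subst h
  intro q e he
  have h1 := (E i).connExt_leibniz (𝒜.res hi) (algebraMap (𝒜.obj V).Z (𝒜.obj V).A z)
    (ScalarExt.mk_mem (𝒜.res hi) (E i).gr (𝒜.obj V).one_mem he (zero_add q))
  have h2 : (d (m := 0 + 1) rfl (zid E hi z)).1 (ScalarExt.mk _ 1 e) = q.negOnePow •
      (ScalarExt.mk (𝒜.res hi) 1 e <• (𝒜.obj V).d (algebraMap (𝒜.obj V).Z (𝒜.obj V).A z)) := by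
    change (E i).connExt (𝒜.res hi) (ScalarExt.mk (𝒜.res hi) 1 e <• algebraMap (𝒜.obj V).Z (𝒜.obj V).A z) -
      (0 : ℤ).negOnePow • ((E i).connExt (𝒜.res hi) (ScalarExt.mk (𝒜.res hi) 1 e) <•
        algebraMap (𝒜.obj V).Z (𝒜.obj V).A z) = _
    rw [h1, Int.negOnePow_zero, one_smul, add_sub_cancel_left]
  have h3 : (d (m := 0 + 1) rfl (zid E hi z)).1 (ScalarExt.mk (𝒜.res hi) 1 e) ∈
      ScalarExt.filGr (𝒜.res hi) (E i).gr 1 (q + (0 + 1)) := by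
    refine (congrArg (· ∈ ScalarExt.filGr (𝒜.res hi) (E i).gr 1 (q + (0 + 1))) h2).mpr ?_
    rw [ScalarExt.mk_mul, one_mul]
    exact zsmul_mem (ScalarExt.mk_mem_filGr ((𝒜.obj V).d_mem (((𝒜.obj V).mem_gr_zero _).2 ⟨z, rfl⟩)) he
      (by push_cast; ring) le_rfl) _
  exact h3

lemma exists_rs (S : SoftCover 𝒜 U) (hV : V' ≤ V) {p : ℕ} {n : ℤ}
    {y : LHom E F V' (hV.trans hi) (hV.trans hj) n} (hy : y ∈ fil p) :
    ∃ x : LHom E F V hi hj n, x ∈ fil p ∧ rs hV x = y := by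
  obtain ⟨ψ, h1, h2⟩ := ScalarExt.exists_restr (𝒜.res hV) (𝒜.res_res hV hi (hV.trans hi))
    (𝒜.res_res hV hj (hV.trans hj)) (S.surj hV) hy
  exact ⟨⟨ψ, ScalarExt.mem_homFil_zero.1 (ScalarExt.homFil_anti (Nat.zero_le _) h1)⟩, h1,
    Subtype.ext h2⟩

def rmul (S : SoftCover 𝒜 U) (c : ι) {n : ℤ} : LHom E F V hi hj n →+ LHom E F V hi hj n :=
  (comp (zero_add n) (zid F hj ((𝒜.res le_top).zero (S.ρ c)))).toAddMonoidHom

variable (S : SoftCover 𝒜 U) (c : ι)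

lemma rmul_apply {n : ℤ} (x : LHom E F V hi hj n) :
    rmul S c x = comp (zero_add n) (zid F hj ((𝒜.res le_top).zero (S.ρ c))) x := rfl

lemma rmul_comp {m n k' : ℤ} (h : m + n = k') (x : LHom F G V hj hk m) (y : LHom E F V hi hj n) :
    rmul S c (comp h x y) = comp h (rmul S c x) y := rfl

lemma comp_rmul {m n k' : ℤ} (h : m + n = k') (x : LHom F G V hj hk m) (y : LHom E F V hi hj n) :
    comp h x (rmul S c y) = comp h (rmul S c x) y := by
  rw [rmul_apply, rmul_apply, zid_comp_eq _ (add_zero m)]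
  rfl

lemma rs_rmul (hV : V' ≤ V) {n : ℤ} (x : LHom E F V hi hj n) :
    rs hV (rmul S c x) = rmul S c (rs hV x) := by
  rw [rmul_apply, rmul_apply, rs_comp, rs_zid]
  congr 3
  refine (𝒜.obj V').zero_injective ?_
  rw [(𝒜.res hV).algebraMap_zero, (𝒜.res _).algebraMap_zero, (𝒜.res _).algebraMap_zero, 𝒜.res_res]

lemma rmul_mem_fil {p : ℕ} {n : ℤ} {x : LHom E F V hi hj n} (hx : x ∈ fil p) : rmul S c x ∈ fil p := by
  have := comp_mem_fil (zero_add n) (mem_fil_zero (zid F hj ((𝒜.res le_top).zero (S.ρ c)))) hx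
  rw [zero_add] at this
  exact this

lemma d_rmul {p : ℕ} {n m : ℤ} (h : n + 1 = m) {x : LHom E F V hi hj n} (hx : x ∈ fil p) :
    d h (rmul S c x) - rmul S c (d h x) ∈ fil (p + 1) := by
  rw [rmul_apply, d_comp (zero_add n) (zero_add 1) h h (by omega) (zero_add m), Int.negOnePow_zero,
    one_smul, rmul_apply, add_sub_cancel_right, add_comm p]
  exact comp_mem_fil _ (d_zid_mem _ _) hx

lemma sum_zmul {A B : DGAlg.{u}} {f : DGAlg.Hom A B} {M : Type u} [AddCommGroup M] [Module A.Z M]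
    {T : Type u} [CommRing T] (h : T →+* B.Z) (r : ι → T) (s : Finset ι) (y : ScalarExt f M) :
    ∑ c ∈ s, ScalarExt.zmul f M (h (r c)) y = ScalarExt.zmul f M (h (∑ c ∈ s, r c)) y := by
  simp only [ScalarExt.zmul_apply, map_sum, Finset.op_sum, Finset.sum_smul]

lemma zmul_one {A B : DGAlg.{u}} {f : DGAlg.Hom A B} {M : Type u} [AddCommGroup M] [Module A.Z M]
    (y : ScalarExt f M) : ScalarExt.zmul f M 1 y = y := by
  rw [ScalarExt.zmul_apply, map_one, MulOpposite.op_one, one_smul]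

lemma sum_rmul {n : ℤ} (x : LHom E F V hi hj n) : ∑ c ∈ S.J, rmul S c x = x := by
  refine Subtype.ext (LinearMap.ext fun y => ?_)
  have key : (∑ c ∈ S.J, rmul S c x).1 y = ∑ c ∈ S.J,
      ScalarExt.zmul (𝒜.res hj) (F j).E ((𝒜.res le_top).zero (S.ρ c)) (x.1 y) := by
    have h1 := map_sum ((LinearMap.applyₗ' ℤ y).toAddMonoidHom.comp
      (DGMod.Hom ((E i).extend (𝒜.res hi)) ((F j).extend (𝒜.res hj)) n).subtype.toAddMonoidHom)
      (fun c => rmul S c x) S.J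
    exact h1
  refine key.trans ((sum_zmul (f := 𝒜.res hj) (𝒜.res le_top).zero S.ρ S.J _).trans ?_)
  rw [S.sum_ρ, map_one]
  exact zmul_one _

lemma rmul_eq_zero (hV : V' ≤ V) (hc : V ⊓ U c ≤ V') {n : ℤ} {x : LHom E F V hi hj n}
    (hx : rs hV x = 0) : rmul S c x = 0 :=
  Subtype.ext (ScalarExt.zmul_comp_eq_zero (𝒜.res hV) (𝒜.res_res hV hi (hV.trans hi))
    (𝒜.res_res hV hj (hV.trans hj)) (S.mul_eq_zero c hV hc) (congrArg Subtype.val hx))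

/-- The extension by zero of the product of a morphism with a member of the partition of unity. -/
def ex (hV : V' ≤ V) (hc : V ⊓ U c ≤ V') {n : ℤ} :
    LHom E F V' (hV.trans hi) (hV.trans hj) n →+ LHom E F V hi hj n :=
  extendAlong (rs hV).toAddMonoidHom
    (fun y => by
      obtain ⟨x, -, hx⟩ := exists_rs (hi := hi) (hj := hj) S hV (mem_fil_zero y)
      exact ⟨x, hx⟩)
    (rmul S c) (fun x hx => rmul_eq_zero S c hV hc hx)

variable {c} {hV : V' ≤ V} (hc : V ⊓ U c ≤ V')

lemma ex_rs {n : ℤ} (x : LHom E F V hi hj n) : ex S c hV hc (rs hV x) = rmul S c x :=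
  extendAlong_apply _ _ _ _ x

lemma ex_cast {n m : ℤ} (h : n = m) (x : LHom E F V' (hV.trans hi) (hV.trans hj) n) :
    ex S c hV hc (cast h x) = cast h (ex S c hV hc x : LHom E F V hi hj n) := by subst h; rfl

lemma ex_mem_fil {p : ℕ} {n : ℤ} {x : LHom E F V' (hV.trans hi) (hV.trans hj) n} (hx : x ∈ fil p) :
    (ex S c hV hc x : LHom E F V hi hj n) ∈ fil p := by
  obtain ⟨x, hx', rfl⟩ := exists_rs (hi := hi) (hj := hj) S hV hx
  rw [ex_rs]
  exact rmul_mem_fil S c hx'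

lemma d_ex {p : ℕ} {n m : ℤ} (h : n + 1 = m) {x : LHom E F V' (hV.trans hi) (hV.trans hj) n}
    (hx : x ∈ fil p) : d h (ex S c hV hc x : LHom E F V hi hj n) - ex S c hV hc (d h x) ∈ fil (p + 1) := by
  obtain ⟨x, hx', rfl⟩ := exists_rs (hi := hi) (hj := hj) S hV hx
  rw [← rs_d, ex_rs, ex_rs]
  exact d_rmul S c h hx'

lemma ex_comp_rs {m n k' : ℤ} (h : m + n = k') (x : LHom F G V' (hV.trans hj) (hV.trans hk) m)
    (y : LHom E F V hi hj n) : (ex S c hV hc (comp h x (rs hV y)) : LHom E G V hi hk k') =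
      comp h (ex S c hV hc x : LHom F G V hj hk m) y := by
  obtain ⟨x, -, rfl⟩ := exists_rs (hi := hj) (hj := hk) S hV (mem_fil_zero x)
  rw [← rs_comp, ex_rs, ex_rs, rmul_comp]

lemma ex_rs_comp {m n k' : ℤ} (h : m + n = k') (x : LHom F G V hj hk m)
    (y : LHom E F V' (hV.trans hi) (hV.trans hj) n) :
    (ex S c hV hc (comp h (rs hV x) y) : LHom E G V hi hk k') =
      comp h x (ex S c hV hc y : LHom E F V hi hj n) := by
  obtain ⟨y, -, rfl⟩ := exists_rs (hi := hi) (hj := hj) S hV (mem_fil_zero y)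
  rw [← rs_comp, ex_rs, ex_rs, rmul_comp, comp_rmul]

lemma rs_ex {V₁ V₁' : Opens X} (h₁ : V₁' ≤ V₁) (hc₁ : V₁ ⊓ U c ≤ V₁') (h : V₁ ≤ V)
    (h' : V₁' ≤ V') {n : ℤ} (x : LHom E F V' (hV.trans hi) (hV.trans hj) n) :
    rs h (ex S c hV hc x : LHom E F V hi hj n) = ex S c h₁ hc₁ (rs h' x) := by
  obtain ⟨x, -, rfl⟩ := exists_rs (hi := hi) (hj := hj) S hV (mem_fil_zero x)
  rw [ex_rs, rs_rmul, rs_rs, ← rs_rs h h₁, ex_rs]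

lemma eq_zero_of_notMem {c : ι} (hcJ : c ∉ S.J) (hV : V ≤ U c) {n : ℤ} (x : LHom E F V hi hj n) :
    x = 0 := by
  have h0 : ∀ a : (𝒜.obj V).A, a = 0 := fun a => by
    have h1 := congrArg (𝒜.res hV).toFun (S.eq_zero c hcJ 1)
    rw [map_one, map_zero] at h1
    rw [← mul_one a, h1, mul_zero]
  exact Subtype.ext (ScalarExt.homFil_eq_zero (i := 0) (E i).internal (fun _ _ b _ => h0 b)
    (mem_fil_zero x))

end LHom

end Soft

/-! ### The contraction of Čech cochains by a partition of unity -/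

namespace Simplex

variable {ι : Type w} {p : ℕ} {a b : ι}

def pt (c : ι) : Simplex ι 0 c c := ⟨fun _ => c, rfl, rfl⟩

def cons (s : Simplex ι p a b) (c : ι) : Simplex ι (p + 1) c b :=
  ⟨Fin.cons c s.1, rfl, s.2.2⟩

def snoc (s : Simplex ι p a b) (c : ι) : Simplex ι (p + 1) a c :=
  ⟨fun k => if h : (k : ℕ) ≤ p then s.1 ⟨k, by omega⟩ else c, s.2.1, by simp⟩

lemma snoc_apply (s : Simplex ι p a b) (c : ι) (k : Fin (p + 2)) :
    (s.snoc c).1 k = if h : (k : ℕ) ≤ p then s.1 ⟨k, by omega⟩ else c := rfl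

lemma cons_face_zero (s : Simplex ι (p + 1) a b) (c : ι) :
    ((s.cons c).face 0).1 = ((s.back 1 p (by omega)).cons c).1 := by
  funext k
  rw [face_apply]
  refine Fin.cases ?_ (fun k => ?_) k
  · rfl
  · rw [dif_neg (by simp)]
    exact congrArg s.1 (Fin.ext (by simp; omega))

lemma cons_face_succ (s : Simplex ι (p + 1) a b) (c : ι) (k : Fin p) :
    ((s.cons c).face k.succ).1 = ((s.face k).cons c).1 := by
  funext l
  rw [face_apply]
  refine Fin.cases ?_ (fun l => ?_) l
  · rfl
  · change _ = (s.face k).1 l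
    rw [face_apply]
    split_ifs with h h' h'
    · rfl
    · simp at h; omega
    · simp at h; omega
    · rfl

lemma snoc_face_last (s : Simplex ι (p + 1) a b) (c : ι) :
    ((s.snoc c).face (Fin.last p)).1 = ((s.front p 1 rfl).snoc c).1 := by
  funext k
  simp only [face_apply, snoc_apply, Fin.val_last]
  split_ifs <;> first | rfl | omega

lemma snoc_face_castSucc (s : Simplex ι (p + 1) a b) (c : ι) (k : Fin p) :
    ((s.snoc c).face k.castSucc).1 = ((s.face k).snoc c).1 := by
  funext l
  simp only [face_apply, snoc_apply, Fin.val_castSucc]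
  split_ifs <;> first | rfl | omega

lemma cons_front_zero (s : Simplex ι p a b) (c : ι) :
    ((s.cons c).front 0 (p + 1) (zero_add _)).1 = (pt c).1 := by
  funext k
  obtain rfl : k = 0 := Fin.ext (by omega)
  rfl

lemma cons_back_zero (s : Simplex ι p a b) (c : ι) :
    ((s.cons c).back 0 (p + 1) (zero_add _)).1 = (s.cons c).1 :=
  funext fun k => congrArg (s.cons c).1 (Fin.ext (zero_add _) : (⟨0 + k, by omega⟩ : Fin (p + 2)) = k)

lemma cons_front_succ (s : Simplex ι p a b) (c : ι) {q r : ℕ} (h : q + r = p)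
    (h' : q + 1 + r = p + 1) : ((s.cons c).front (q + 1) r h').1 = ((s.front q r h).cons c).1 :=
  funext fun k => Fin.cases rfl (fun _ => rfl) k

lemma cons_back_succ (s : Simplex ι p a b) (c : ι) {q r : ℕ} (h : q + r = p)
    (h' : q + 1 + r = p + 1) : ((s.cons c).back (q + 1) r h').1 = (s.back q r h).1 := by
  funext k
  change (Fin.cons c s.1 : Fin (p + 2) → ι) ⟨q + 1 + k, _⟩ = s.1 ⟨q + k, _⟩
  have : (⟨q + 1 + k, by omega⟩ : Fin (p + 2)) = Fin.succ ⟨q + k, by omega⟩ :=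
    Fin.ext (by simp; omega)
  rw [this, Fin.cons_succ]

lemma snoc_front_last (s : Simplex ι p a b) (c : ι) :
    ((s.snoc c).front (p + 1) 0 rfl).1 = (s.snoc c).1 := rfl

lemma snoc_last (s : Simplex ι p a b) (c : ι) : (s.snoc c).1 ⟨p + 1, by omega⟩ = c :=
  dif_neg (by simp)

lemma snoc_back_last (s : Simplex ι p a b) (c : ι) :
    ((s.snoc c).back (p + 1) 0 rfl).1 = (pt c).1 := by
  funext k
  obtain rfl : k = 0 := Fin.ext (by omega)
  exact dif_neg (by simp)

lemma snoc_castSucc (s : Simplex ι p a b) (c : ι) {q r : ℕ} (h : q + r = p) :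
    (s.snoc c).1 ⟨q, by omega⟩ = s.1 ⟨q, by omega⟩ := dif_pos (by dsimp; omega)

lemma snoc_front (s : Simplex ι p a b) (c : ι) {q r : ℕ} (h : q + r = p)
    (h' : q + (r + 1) = p + 1) : ((s.snoc c).front q (r + 1) h').1 = (s.front q r h).1 :=
  funext fun k => dif_pos (by dsimp; omega)

lemma snoc_back (s : Simplex ι p a b) (c : ι) {q r : ℕ} (h : q + r = p)
    (h' : q + (r + 1) = p + 1) : ((s.snoc c).back q (r + 1) h').1 = ((s.back q r h).snoc c).1 := by
  funext k
  change (s.snoc c).1 ⟨q + k, _⟩ = _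
  simp only [snoc_apply]
  split_ifs <;> first | rfl | omega

end Simplex

lemma mem_of_eq {M : Type*} [AddGroup M] {H : AddSubgroup M} {x y : M} (h : x = y) (hy : y ∈ H) : x ∈ H :=
  h ▸ hy

section Contraction

open Finset

variable {X : Type v} [TopologicalSpace X] {𝒜 : DGAlgPresheaf.{u} X} {ι : Type w}
  {U : ι → Opens X} {p : ℕ} {a b : ι}

lemma inf_le_cons (s : Simplex ι p a b) (c : ι) : supp U s ⊓ U c ≤ supp U (s.cons c) :=
  le_iInf fun k => Fin.cases inf_le_right (fun k => inf_le_left.trans (iInf_le _ k)) k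

lemma inf_le_snoc (s : Simplex ι p a b) (c : ι) : supp U s ⊓ U c ≤ supp U (s.snoc c) :=
  le_iInf fun k => by
    rw [Simplex.snoc_apply]
    split_ifs with h
    · exact inf_le_left.trans (iInf_le _ (⟨k, _⟩ : Fin (p + 1)))
    · exact inf_le_right

lemma le_pt {V : Opens X} {c : ι} (h : V ≤ U c) : V ≤ supp U (Simplex.pt c) :=
  le_iInf fun _ => h

namespace LHom

variable {E F G H : CohesiveFamily 𝒜 U} {V V' : Opens X} {i j k l : ι}
  {hi : V ≤ U i} {hj : V ≤ U j} {hk : V ≤ U k} {hl : V ≤ U l} (S : SoftCover 𝒜 U) (c : ι)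

/-- The extension by zero of the product of a morphism on `V ∩ U_c` with `ρ_c`. -/
def bump {n : ℤ} :
    LHom E F (V ⊓ U c) (inf_le_left.trans hi) (inf_le_left.trans hj) n →+ LHom E F V hi hj n :=
  ex S c inf_le_left le_rfl

lemma rs_bump (h : V' ≤ V) {n : ℤ}
    (x : LHom E F (V ⊓ U c) (inf_le_left.trans hi) (inf_le_left.trans hj) n) :
    rs h (bump S c x : LHom E F V hi hj n) = bump S c (rs (inf_le_inf_right _ h) x) :=
  rs_ex S le_rfl inf_le_left le_rfl h _ x

lemma bump_rs {n : ℤ} (x : LHom E F V hi hj n) : bump S c (rs inf_le_left x) = rmul S c x :=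
  ex_rs S le_rfl x

lemma bump_cast {n m : ℤ} (h : n = m)
    (x : LHom E F (V ⊓ U c) (inf_le_left.trans hi) (inf_le_left.trans hj) n) :
    bump S c (cast h x) = cast h (bump S c x : LHom E F V hi hj n) := ex_cast S le_rfl h x

lemma bump_mem_fil {q : ℕ} {n : ℤ}
    {x : LHom E F (V ⊓ U c) (inf_le_left.trans hi) (inf_le_left.trans hj) n} (hx : x ∈ fil q) :
    (bump S c x : LHom E F V hi hj n) ∈ fil q := ex_mem_fil S le_rfl hx

lemma d_bump {q : ℕ} {n m : ℤ} (h : n + 1 = m)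
    {x : LHom E F (V ⊓ U c) (inf_le_left.trans hi) (inf_le_left.trans hj) n} (hx : x ∈ fil q) :
    d h (bump S c x : LHom E F V hi hj n) - bump S c (d h x) ∈ fil (q + 1) := d_ex S le_rfl h hx

lemma bump_comp_rs {m n k' : ℤ} (h : m + n = k')
    (x : LHom F G (V ⊓ U c) (inf_le_left.trans hj) (inf_le_left.trans hk) m) (y : LHom E F V hi hj n) :
    (bump S c (comp h x (rs inf_le_left y)) : LHom E G V hi hk k') =
      comp h (bump S c x : LHom F G V hj hk m) y := ex_comp_rs S le_rfl h x y

lemma bump_rs_comp {m n k' : ℤ} (h : m + n = k') (x : LHom F G V hj hk m)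
    (y : LHom E F (V ⊓ U c) (inf_le_left.trans hi) (inf_le_left.trans hj) n) :
    (bump S c (comp h (rs inf_le_left x) y) : LHom E G V hi hk k') =
      comp h x (bump S c y : LHom E F V hi hj n) := ex_rs_comp S le_rfl h x y

end LHom

/-- The morphism `E_c → Q|_{U_a}` given by a morphism `E_c → Q|_{U_c}`. -/
def lam {E : CohesiveFamily 𝒜 U} {Q : CohesiveModule (𝒜.obj ⊤)} {c : ι}
    (l : LHom E (restrFamily U Q) (U c) le_rfl le_rfl 0) {W : Opens X} {a : ι}
    (hc : W ≤ U c) (ha : W ≤ U a) : LHom E (restrFamily U Q) W hc ha 0 :=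
  LHom.comp (zero_add 0) (canon hc ha (DGMod.idHom Q.toDGMod)) (LHom.rs hc l)

lemma rs_lam {E : CohesiveFamily 𝒜 U} {Q : CohesiveModule (𝒜.obj ⊤)} {c : ι}
    (l : LHom E (restrFamily U Q) (U c) le_rfl le_rfl 0) {W W' : Opens X} {a : ι}
    (hc : W ≤ U c) (ha : W ≤ U a) (h : W' ≤ W) :
    LHom.rs h (lam l hc ha) = lam l (h.trans hc) (h.trans ha) := by
  rw [lam, LHom.rs_comp, canon_rs, LHom.rs_rs]
  rfl

lemma canon_id_comp {Q : CohesiveModule (𝒜.obj ⊤)} {W : Opens X} {a b c : ι}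
    (hc : W ≤ U c) (ha : W ≤ U a) (hb : W ≤ U b) :
    LHom.comp (zero_add 0) (canon ha hb (DGMod.idHom Q.toDGMod)) (canon hc ha (DGMod.idHom Q.toDGMod)) =
      canon hc hb (DGMod.idHom Q.toDGMod) := canon_comp hc ha hb (zero_add 0) _ _

lemma canon_comp_lam {E : CohesiveFamily 𝒜 U} {Q : CohesiveModule (𝒜.obj ⊤)} {c : ι}
    (l : LHom E (restrFamily U Q) (U c) le_rfl le_rfl 0) {W : Opens X} {a b : ι}
    (hc : W ≤ U c) (ha : W ≤ U a) (hb : W ≤ U b) :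
    LHom.comp (zero_add 0) (canon ha hb (DGMod.idHom Q.toDGMod)) (lam l hc ha) = lam l hc hb := by
  rw [lam, ← LHom.comp_assoc (zero_add 0) (zero_add 0) (zero_add 0) (zero_add 0), canon_id_comp]
  rfl

/-- The morphism `Q|_{U_a} → E_c` given by a morphism `Q|_{U_c} → E_c`. -/
def eta {E : CohesiveFamily 𝒜 U} {Q : CohesiveModule (𝒜.obj ⊤)} {c : ι}
    (l : LHom (restrFamily U Q) E (U c) le_rfl le_rfl 0) {W : Opens X} {a : ι}
    (ha : W ≤ U a) (hc : W ≤ U c) : LHom (restrFamily U Q) E W ha hc 0 :=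
  LHom.comp (zero_add 0) (LHom.rs hc l) (canon ha hc (DGMod.idHom Q.toDGMod))

lemma rs_eta {E : CohesiveFamily 𝒜 U} {Q : CohesiveModule (𝒜.obj ⊤)} {c : ι}
    (l : LHom (restrFamily U Q) E (U c) le_rfl le_rfl 0) {W W' : Opens X} {a : ι}
    (ha : W ≤ U a) (hc : W ≤ U c) (h : W' ≤ W) :
    LHom.rs h (eta l ha hc) = eta l (h.trans ha) (h.trans hc) := by
  rw [eta, LHom.rs_comp, canon_rs, LHom.rs_rs]
  rfl

lemma eta_comp_canon {E : CohesiveFamily 𝒜 U} {Q : CohesiveModule (𝒜.obj ⊤)} {c : ι}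
    (l : LHom (restrFamily U Q) E (U c) le_rfl le_rfl 0) {W : Opens X} {a b : ι}
    (ha : W ≤ U a) (hb : W ≤ U b) (hc : W ≤ U c) :
    LHom.comp (zero_add 0) (eta l ha hc) (canon hb ha (DGMod.idHom Q.toDGMod)) = eta l hb hc := by
  rw [eta, LHom.comp_assoc (zero_add 0) (zero_add 0) (zero_add 0) (zero_add 0), canon_id_comp]
  rfl

lemma canon_comp_canon_id {Q R : CohesiveModule (𝒜.obj ⊤)} {W : Opens X} {a b c : ι}
    (hc : W ≤ U c) (ha : W ≤ U a) (hb : W ≤ U b) {n : ℤ} (h : n + 0 = n)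
    (φ : DGMod.Hom Q.toDGMod R.toDGMod n) :
    LHom.comp h (canon ha hb φ) (canon hc ha (DGMod.idHom Q.toDGMod)) = canon hc hb φ :=
  (canon_comp hc ha hb h _ _).trans (congrArg _ (Subtype.ext rfl))

lemma canon_id_comp_canon {Q R : CohesiveModule (𝒜.obj ⊤)} {W : Opens X} {a b c : ι}
    (hc : W ≤ U c) (ha : W ≤ U a) (hb : W ≤ U b) {n : ℤ} (h : 0 + n = n)
    (φ : DGMod.Hom Q.toDGMod R.toDGMod n) :
    LHom.comp h (canon ha hb (DGMod.idHom R.toDGMod)) (canon hc ha φ) = canon hc hb φ :=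
  (canon_comp hc ha hb h _ _).trans (congrArg _ (Subtype.ext rfl))

lemma d_lam_mem {E : CohesiveFamily 𝒜 U} {Q : CohesiveModule (𝒜.obj ⊤)} {c : ι}
    {l : LHom E (restrFamily U Q) (U c) le_rfl le_rfl 0} {δ : DGMod.Hom Q.toDGMod Q.toDGMod 1}
    (hl : LHom.d (zero_add 1) l + LHom.comp (add_zero 1) (canon le_rfl le_rfl δ) l ∈ LHom.fil 1)
    {W : Opens X} {a : ι} (hc : W ≤ U c) (ha : W ≤ U a) :
    LHom.d (zero_add 1) (lam l hc ha) + LHom.comp (add_zero 1) (canon ha ha δ) (lam l hc ha) ∈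
      LHom.fil 1 := by
  have h1 : LHom.d (zero_add 1) (lam l hc ha) +
      LHom.comp (add_zero 1) (canon ha ha δ) (lam l hc ha) =
      LHom.comp (zero_add 1) (canon hc ha (DGMod.idHom Q.toDGMod)) (LHom.rs hc
        (LHom.d (zero_add 1) l + LHom.comp (add_zero 1) (canon le_rfl le_rfl δ) l)) := by
    rw [lam, LHom.d_comp (zero_add 0) (zero_add 1) (zero_add 1) (zero_add 1) (by omega) (by omega), canon_d,
      DGMod.d_id, map_zero, map_zero, LinearMap.zero_apply, zero_add, Int.negOnePow_zero, one_smul,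
      map_add, map_add, LHom.rs_d, LHom.rs_comp, canon_rs,
      ← LHom.comp_assoc (add_zero 1) (zero_add 0) (add_zero 1) (add_zero 1),
      ← LHom.comp_assoc (zero_add 1) (add_zero 1) (add_zero 1) (zero_add 1), canon_comp_canon_id,
      canon_id_comp_canon]
  rw [h1]
  have h2 := LHom.comp_mem_fil (zero_add 1) (LHom.mem_fil_zero (canon hc ha (DGMod.idHom Q.toDGMod)))
    (LHom.rs_mem_fil hc hl)
  rw [zero_add (1 : ℕ)] at h2
  exact h2

lemma d_bump_lam {E F : CohesiveFamily 𝒜 U} {Q : CohesiveModule (𝒜.obj ⊤)} (S : SoftCover 𝒜 U) {c : ι}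
    {l : LHom F (restrFamily U Q) (U c) le_rfl le_rfl 0} {δ : DGMod.Hom Q.toDGMod Q.toDGMod 1}
    (hl : LHom.d (zero_add 1) l + LHom.comp (add_zero 1) (canon le_rfl le_rfl δ) l ∈ LHom.fil 1)
    {V : Opens X} {i a : ι} (hi : V ≤ U i) (ha : V ≤ U a) {n m n' m' : ℤ} {k : ℕ}
    (h : 0 + n = m) (hn : n + 1 = n') (hm : m + 1 = m') (h' : 0 + n' = m') (h1 : 1 + m = m')
    {y : LHom E F (V ⊓ U c) (inf_le_left.trans hi) inf_le_right n} (hy : y ∈ LHom.fil k) :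
    LHom.d hm (LHom.bump S c (LHom.comp h (lam l inf_le_right (inf_le_left.trans ha)) y) :
        LHom E (restrFamily U Q) V hi ha m) -
      LHom.bump S c (LHom.comp h' (lam l inf_le_right (inf_le_left.trans ha)) (LHom.d hn y)) +
      LHom.comp h1 (canon ha ha δ) (LHom.bump S c (LHom.comp h
        (lam l inf_le_right (inf_le_left.trans ha)) y) : LHom E (restrFamily U Q) V hi ha m) ∈
      LHom.fil (k + 1) := by
  have e1 := LHom.d_bump S c (hi := hi) (hj := ha) hm (LHom.comp_mem_fil h
    (LHom.mem_fil_zero (lam l inf_le_right (inf_le_left.trans ha))) hy)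
  have e2 := LHom.bump_mem_fil S c (hi := hi) (hj := ha) (LHom.comp_mem_fil (by omega : 1 + n = m')
    (d_lam_mem hl inf_le_right (inf_le_left.trans ha)) hy)
  rw [add_comm 1 k] at e2
  rw [zero_add] at e1
  rw [LHom.d_comp h (zero_add 1) hn hm (by omega : 1 + n = m') h', Int.negOnePow_zero, one_smul] at e1
  rw [map_add, LinearMap.add_apply, LHom.comp_assoc (add_zero 1) h _ h1, ← canon_rs ha ha inf_le_left] at e2
  simp only [map_add] at e1 e2
  rw [LHom.bump_rs_comp] at e2
  refine mem_of_eq ?_ (add_mem e1 e2)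
  abel

lemma d_eta_mem {E : CohesiveFamily 𝒜 U} {Q : CohesiveModule (𝒜.obj ⊤)} {c : ι}
    {l : LHom (restrFamily U Q) E (U c) le_rfl le_rfl 0} {δ : DGMod.Hom Q.toDGMod Q.toDGMod 1}
    (hl : LHom.d (zero_add 1) l - LHom.comp (zero_add 1) l (canon le_rfl le_rfl δ) ∈ LHom.fil 1)
    {W : Opens X} {a : ι} (ha : W ≤ U a) (hc : W ≤ U c) :
    LHom.d (zero_add 1) (eta l ha hc) - LHom.comp (zero_add 1) (eta l ha hc) (canon ha ha δ) ∈
      LHom.fil 1 := by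
  have h1 : LHom.d (zero_add 1) (eta l ha hc) -
      LHom.comp (zero_add 1) (eta l ha hc) (canon ha ha δ) =
      LHom.comp (add_zero 1) (LHom.rs hc
        (LHom.d (zero_add 1) l - LHom.comp (zero_add 1) l (canon le_rfl le_rfl δ)))
        (canon ha hc (DGMod.idHom Q.toDGMod)) := by
    rw [eta, LHom.d_comp (zero_add 0) (zero_add 1) (zero_add 1) (zero_add 1) (by omega) (by omega), canon_d,
      DGMod.d_id, map_zero, map_zero, smul_zero, add_zero,
      map_sub, map_sub, LinearMap.sub_apply, LHom.rs_d, LHom.rs_comp, canon_rs,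
      LHom.comp_assoc (zero_add 0) (zero_add 1) (zero_add 1) (zero_add 1),
      LHom.comp_assoc (zero_add 1) (add_zero 1) (add_zero 1) (zero_add 1), canon_comp_canon_id,
      canon_id_comp_canon]
  rw [h1]
  have h2 := LHom.comp_mem_fil (add_zero 1) (LHom.rs_mem_fil hc hl)
    (LHom.mem_fil_zero (canon ha hc (DGMod.idHom Q.toDGMod)))
  rw [add_zero (1 : ℕ)] at h2
  exact h2

lemma d_bump_eta {E F : CohesiveFamily 𝒜 U} {Q : CohesiveModule (𝒜.obj ⊤)} (S : SoftCover 𝒜 U) {c : ι}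
    {l : LHom (restrFamily U Q) E (U c) le_rfl le_rfl 0} {δ : DGMod.Hom Q.toDGMod Q.toDGMod 1}
    (hl : LHom.d (zero_add 1) l - LHom.comp (zero_add 1) l (canon le_rfl le_rfl δ) ∈ LHom.fil 1)
    {V : Opens X} {i a : ι} (hi : V ≤ U i) (ha : V ≤ U a) {n m n' m' : ℤ} {k : ℕ}
    (h : n + 0 = m) (hn : n + 1 = n') (hm : m + 1 = m') (h' : n' + 0 = m')
    {y : LHom E F (V ⊓ U c) inf_le_right (inf_le_left.trans hi) n} (hy : y ∈ LHom.fil k) :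
    LHom.d hm (LHom.bump S c (LHom.comp h y (eta l (inf_le_left.trans ha) inf_le_right)) :
        LHom (restrFamily U Q) F V ha hi m) -
      LHom.bump S c (LHom.comp h' (LHom.d hn y) (eta l (inf_le_left.trans ha) inf_le_right)) -
      n.negOnePow • LHom.comp hm (LHom.bump S c (LHom.comp h y
        (eta l (inf_le_left.trans ha) inf_le_right)) : LHom (restrFamily U Q) F V ha hi m)
          (canon ha ha δ) ∈ LHom.fil (k + 1) := by
  have e1 := LHom.d_bump S c (hi := ha) (hj := hi) hm (LHom.comp_mem_fil h hy
    (LHom.mem_fil_zero (eta l (inf_le_left.trans ha) inf_le_right)))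
  have e2 := LHom.bump_mem_fil S c (hi := ha) (hj := hi) (LHom.comp_mem_fil (by omega : n + 1 = m') hy
    (d_eta_mem hl (inf_le_left.trans ha) inf_le_right))
  rw [add_zero] at e1
  rw [LHom.d_comp h hn (zero_add 1) hm h' (by omega : n + 1 = m')] at e1
  rw [map_sub, ← LHom.comp_assoc h (zero_add 1) hm _, ← canon_rs ha ha inf_le_left] at e2
  simp only [map_add, map_sub, Units.smul_def, map_zsmul] at e1 e2
  rw [LHom.bump_comp_rs] at e2
  refine mem_of_eq ?_ (add_mem e1 (zsmul_mem e2 n.negOnePow))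
  simp only [smul_sub, Units.smul_def]
  abel

namespace CechHom

variable {E F G : CohesiveFamily 𝒜 U} {Q : CohesiveModule (𝒜.obj ⊤)} (S : SoftCover 𝒜 U) (c : ι)

def fil (k : ℕ) {n : ℤ} : AddSubgroup (CechHom E F n) where
  carrier := {u | ∀ p a b s, u p a b s ∈ LHom.fil k}
  zero_mem' _ _ _ _ := zero_mem _
  add_mem' hu hv p a b s := add_mem (hu p a b s) (hv p a b s)
  neg_mem' hu p a b s := neg_mem (hu p a b s)

lemma cup_mem_fil {k k' : ℕ} {n₁ n₂ : ℤ} {u : CechHom F G n₁} {v : CechHom E F n₂} (hu : u ∈ fil k)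
    (hv : v ∈ fil k') {p r : ℕ} {a b c : ι} (s₁ : Simplex ι p a c) (s₂ : Simplex ι r c b)
    {V : Opens X} (h₁ : V ≤ supp U s₁) (h₂ : V ≤ supp U s₂) {m : ℤ}
    (hm : n₁ - p + (n₂ - r) = m) : cup u v s₁ s₂ h₁ h₂ hm ∈ LHom.fil (k + k') :=
  LHom.comp_mem_fil hm (LHom.rs_mem_fil h₁ (hu _ _ _ _)) (LHom.rs_mem_fil h₂ (hv _ _ _ _))

lemma mul_mem_fil {k k' : ℕ} {n₁ n₂ n : ℤ} (h : n₁ + n₂ = n) {u : CechHom F G n₁} {v : CechHom E F n₂}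
    (hu : u ∈ fil k) (hv : v ∈ fil k') : mul h u v ∈ fil (k + k') := fun p a b s =>
  sum_mem fun x _ => zsmul_mem (cup_mem_fil hu hv _ _ _ _ _) _

lemma d_mem_fil {k : ℕ} {n m : ℤ} (h : n + 1 = m) {u : CechHom E F n} (hu : u ∈ fil k) :
    d h u ∈ fil k := by
  refine add_mem (fun p a b s => zsmul_mem (LHom.d_mem_fil _ (hu _ _ _ _)) _) (fun p a b s => ?_)
  cases p with
  | zero => exact zero_mem _
  | succ p =>
    exact sum_mem fun x _ => zsmul_mem (LHom.cast_mem_fil _ (LHom.rs_mem_fil _ (hu _ _ _ _))) _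

lemma mapCochain_mul {R : CohesiveModule (𝒜.obj ⊤)} {m n k : ℤ} (h : m + n = k)
    (φ : DGMod.Hom Q.toDGMod R.toDGMod m) (v : CechHom E (restrFamily U Q) n) (p : ℕ) (a b : ι)
    (s : Simplex ι p a b) : mul h (mapCochain U φ) v p a b s = (m * p).negOnePow •
      LHom.comp (by omega) (canon (supp_le_first s) (supp_le_first s) φ) (v p a b s) := by
  rw [mul_apply_eq h (p := 0) (r := p) (mapCochain_ne φ) (zero_add p)]
  obtain ⟨s, rfl, rfl⟩ := s
  simp only [cup, mapCochain_zero, LHom.rs_cast, canon_rs, LHom.comp_cast_left, Nat.cast_zero, sub_zero]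
  refine congrArg₂ _ rfl (congrArg (LHom.comp _ _) ?_)
  refine (rs_congr v (s' := ⟨s, rfl, rfl⟩) (funext fun k => ?_) _ le_rfl).trans (LHom.rs_self _ _)
  exact congrArg s (Fin.ext (zero_add _) : (⟨0 + k, by omega⟩ : Fin (p + 1)) = k)

lemma mul_mapCochain {R : CohesiveModule (𝒜.obj ⊤)} {m n k : ℤ} (h : m + n = k)
    (u : CechHom (restrFamily U R) E m) (φ : DGMod.Hom Q.toDGMod R.toDGMod n) (p : ℕ) (a b : ι)
    (s : Simplex ι p a b) : mul h u (mapCochain U φ) p a b s =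
      LHom.comp (by omega) (u p a b s) (canon (supp_le_last s) (supp_le_last s) φ) := by
  have h0 : mul h u (mapCochain U φ) p a b s = cup u (mapCochain U φ) (s.front p 0 rfl) (s.back p 0 rfl)
      (supp_le_front _ _ _ _) (supp_le_back _ _ _ _) (by push_cast; omega) := by
    rw [mul_apply, sum_eq_single ⟨(p, 0), by simp⟩]
    · simp
    · rintro ⟨⟨i, j⟩, hx⟩ - hne
      have e : i + j = p := by simpa using hx
      have hj : j ≠ 0 := by
        rintro rfl
        obtain rfl : i = p := by omega
        exact hne rfl
      simp only [cup, mapCochain_ne φ j hj, map_zero, smul_zero]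
    · exact fun h => absurd (mem_univ _) h
  rw [h0]
  obtain ⟨s, rfl, rfl⟩ := s
  simp only [cup, mapCochain_zero, LHom.rs_cast, canon_rs, LHom.comp_cast_right]
  exact congrArg (fun x => LHom.comp _ x _) ((rs_congr u (s' := ⟨s, rfl, rfl⟩) rfl _ le_rfl).trans
    (LHom.rs_self _ _))

section first

variable (l : LHom F (restrFamily U Q) (U c) le_rfl le_rfl 0)

/-- The contraction `u ↦ (ρ_c λ_c u_{c i₀ … i_p})` with the first vertex. -/
def first {n' n : ℤ} (h : n' + 1 = n) (u : CechHom E F n) :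
    CechHom E (restrFamily U Q) n' := fun p _ b s =>
  LHom.bump S c (LHom.comp (by push_cast; omega)
    (lam l inf_le_right (inf_le_left.trans (supp_le_first s)))
    (LHom.rs (inf_le_cons s c) (u (p + 1) c b (s.cons c))))

lemma first_apply {n' n : ℤ} (h : n' + 1 = n) (u : CechHom E F n) (p : ℕ) (a b : ι)
    (s : Simplex ι p a b) : first S c l h u p a b s = LHom.bump S c (LHom.comp (by push_cast; omega)
      (lam l inf_le_right (inf_le_left.trans (supp_le_first s)))
      (LHom.rs (inf_le_cons s c) (u (p + 1) c b (s.cons c)))) := rfl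

lemma first_add {n' n : ℤ} (h : n' + 1 = n) (u v : CechHom E F n) :
    first S c l h (u + v) = first S c l h u + first S c l h v := ext fun p a b s => by
  simp only [first_apply, add_apply, map_add]

lemma canon_comp_bump {V : Opens X} {i a b : ι} (hi : V ≤ U i) (ha : V ≤ U a)
    (hb : V ≤ U b) {z n m m' : ℤ} (h : 0 + n = m) (hz : 0 = z) (hm : z + m = m') (h' : 0 + n = m')
    (y : LHom E F (V ⊓ U c) (inf_le_left.trans hi) inf_le_right n) :
    LHom.comp hm (LHom.cast hz (canon ha hb (DGMod.idHom Q.toDGMod)))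
      (LHom.bump S c (LHom.comp h (lam l inf_le_right (inf_le_left.trans ha)) y) :
        LHom E (restrFamily U Q) V hi ha m) =
      LHom.bump S c (LHom.comp h' (lam l inf_le_right (inf_le_left.trans hb)) y) := by
  subst hz
  rw [LHom.cast_rfl, ← LHom.bump_rs_comp, canon_rs, ← LHom.comp_assoc (zero_add 0) h h' hm,
    canon_comp_lam]

lemma first_delta {n' n m : ℤ} (h : n' + 1 = n) (hm : n + 1 = m) (h' : 1 + n' = n)
    (u : CechHom E F n) : first S c l hm (delta hm u) + delta h (first S c l h u) +
      mul h' (twistCochain U Q) (first S c l h u) = 0 := by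
  refine ext fun p a b s => ?_
  rw [add_apply, add_apply, zero_apply]
  cases p with
  | zero =>
    have h0 : mul h' (twistCochain U Q) (first S c l h u) 0 a b s = 0 := by
      rw [mul_apply]
      refine sum_eq_zero ?_
      rintro ⟨⟨i, j⟩, hx⟩ -
      obtain rfl : i = 0 := by have : i + j = 0 := by simpa using hx
                               omega
      simp only [cup, twistCochain_ne 0 zero_ne_one, map_zero, LinearMap.zero_apply, smul_zero]
    rw [delta_zero, h0, first_apply, delta_succ, Finset.univ_eq_empty, Finset.sum_empty, map_zero,
      map_zero, map_zero, add_zero, add_zero]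
  | succ p =>
    rw [mul_apply_eq h' (p := 1) (r := p) twistCochain_ne (by omega), first_apply, delta_succ, delta_succ,
      Fin.sum_univ_succ]
    simp only [map_add, map_sum, Units.smul_def, map_zsmul, cup, twistCochain_one, first_apply, LHom.rs_cast,
      LHom.rs_bump, LHom.rs_comp, LHom.rs_rs, rs_lam, canon_rs, LHom.comp_cast_right]
    have e0 := rs_congr u (Simplex.cons_face_zero s c)
      ((inf_le_cons s c).trans (supp_le_face _ 0))
      ((inf_le_inf_right (U c) (supp_le_back s 1 p (by omega))).trans (inf_le_cons _ c))
    have e1 := fun k => rs_congr u (Simplex.cons_face_succ s c k)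
      ((inf_le_cons s c).trans (supp_le_face _ k.succ))
      ((inf_le_inf_right (U c) (supp_le_face s k)).trans (inf_le_cons _ c))
    rw [canon_comp_bump S c l _ _ _ _ _ _ (by push_cast; omega), e0]
    simp only [e1, ← LHom.bump_cast, LHom.cast_comp]
    rw [add_right_comm, add_assoc, add_add_add_comm, ← Finset.sum_add_distrib, Finset.sum_eq_zero, add_zero]
    · simp
    · intro k _
      rw [← add_smul]
      simp [Int.negOnePow_succ]

lemma first_mul {n₁' n₁ n₂ n' n : ℤ} (h₁ : n₁' + 1 = n₁) (hn : n' + 1 = n) (h : n₁ + n₂ = n)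
    (h' : n₁' + n₂ = n') (u : CechHom G F n₁) (v : CechHom E G n₂) (p : ℕ) (a b : ι)
    (s : Simplex ι p a b) : first S c l hn (mul h u v) p a b s =
      mul h' (first S c l h₁ u) v p a b s + (n₁ * (p + 1)).negOnePow •
        LHom.bump S c (LHom.comp (by push_cast; omega)
          (lam l inf_le_right (inf_le_left.trans (supp_le_first s)))
          (cup u v (Simplex.pt c) (s.cons c) (le_pt inf_le_right) (inf_le_cons s c) 
            (k := n - (p + 1 : ℕ)) (by push_cast; omega))) := by
  rw [first_apply, mul_apply, mul_apply]
  simp only [map_sum, Units.smul_def, map_zsmul]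
  refine (sum_antidiag_succ
    (M := LHom E (restrFamily U Q) (supp U s) (supp_le_last s) (supp_le_first s) (n' - p)) p
    (fun q r hq => (((n₁ - q) * r).negOnePow : ℤ) • LHom.bump S c (LHom.comp (by push_cast; omega)
      (lam l inf_le_right (inf_le_left.trans (supp_le_first s))) (LHom.rs (inf_le_cons s c)
        (cup u v ((s.cons c).front q r hq) ((s.cons c).back q r hq) (supp_le_front _ _ _ _)
          (supp_le_back _ _ _ _) (k := n - (p + 1 : ℕ)) (by omega)))))).trans ?_
  rw [add_comm]
  refine congrArg₂ _ (sum_congr rfl ?_) (congrArg₂ _ ?_ ?_)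
  · rintro ⟨⟨q, r⟩, hx⟩ -
    have e : q + r = p := by simpa using hx
    refine congrArg₂ _ (by subst h₁; push_cast; congr 3; ring) ?_
    dsimp only [cup]
    rw [first_apply, LHom.rs_bump, ← LHom.bump_comp_rs]
    simp only [LHom.rs_comp, LHom.rs_rs, rs_lam]
    rw [LHom.comp_assoc (bc := n - (p + 1 : ℕ)) _ (by push_cast; omega) _ (by push_cast; omega)]
    refine congrArg (LHom.bump S c) (congrArg (LHom.comp _ (lam l _ _)) ?_)
    exact cup_congr u v rfl (s.cons_front_succ c e (by omega)) (s.cons_back_succ c e (by omega)) _ _ _ _ _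
  · push_cast
    congr 3
    ring
  · rw [cup_rs]
    refine congrArg (LHom.bump S c) (congrArg (LHom.comp _ (lam l _ _)) ?_)
    exact cup_congr u v rfl (s.cons_front_zero c) (s.cons_back_zero c) _ _ _ _ _

lemma first_dInt {δ : DGMod.Hom Q.toDGMod Q.toDGMod 1}
    (hl : LHom.d (zero_add 1) l + LHom.comp (add_zero 1) (canon le_rfl le_rfl δ) l ∈ LHom.fil 1)
    {n' n m : ℤ} (h : n' + 1 = n) (hm : n + 1 = m) (h' : 1 + n' = n) {k : ℕ} {u : CechHom E F n}
    (hu : u ∈ fil k) : first S c l hm (dInt hm u) + dInt h (first S c l h u) +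
      mul h' (mapCochain U δ) (first S c l h u) ∈ fil (k + 1) := by
  intro p a b s
  rw [add_apply, add_apply, mapCochain_mul, dInt_apply, first_apply, dInt_apply]
  simp only [map_zsmul, Units.smul_def]
  have e := zsmul_mem (d_bump_lam S hl (supp_le_last s) (supp_le_first s) (m := n' - p) (m' := n - p)
    (n' := m - (p + 1 : ℕ)) (by push_cast; omega) (by omega) (by omega) (by push_cast; omega) (by omega)
    (LHom.rs_mem_fil (inf_le_cons s c) (hu _ _ _ (s.cons c)))) ((p : ℤ).negOnePow : ℤ)
  rw [LHom.rs_d]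
  refine mem_of_eq ?_ e
  simp only [smul_add, smul_sub, one_mul, Nat.cast_add, Nat.cast_one, Int.negOnePow_succ, Units.val_neg,
    neg_smul, sub_eq_add_neg, smul_neg]
  refine congrArg₂ _ ?_ rfl
  rw [add_comm]
  rfl

end first

section last

variable (l : LHom (restrFamily U Q) E (U c) le_rfl le_rfl 0)

/-- The contraction `u ↦ ((-1)^p ρ_c u_{i₀ … i_p c} η_c)` with the last vertex. -/
def last {n' n : ℤ} (h : n' + 1 = n) (u : CechHom E F n) :
    CechHom (restrFamily U Q) F n' := fun p a b s =>
  (p : ℤ).negOnePow • LHom.bump S c (LHom.comp (by push_cast; omega)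
    (LHom.rs (inf_le_snoc s c) (u (p + 1) a c (s.snoc c)))
    (eta l (inf_le_left.trans (supp_le_last s)) inf_le_right))

lemma last_apply {n' n : ℤ} (h : n' + 1 = n) (u : CechHom E F n) (p : ℕ) (a b : ι)
    (s : Simplex ι p a b) : last S c l h u p a b s =
      (p : ℤ).negOnePow • LHom.bump S c (LHom.comp (by push_cast; omega)
        (LHom.rs (inf_le_snoc s c) (u (p + 1) a c (s.snoc c)))
        (eta l (inf_le_left.trans (supp_le_last s)) inf_le_right)) := rfl

lemma last_add {n' n : ℤ} (h : n' + 1 = n) (u v : CechHom E F n) :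
    last S c l h (u + v) = last S c l h u + last S c l h v := ext fun p a b s => by
  simp only [last_apply, add_apply, map_add, LinearMap.add_apply, smul_add]

lemma bump_comp_canon {V : Opens X} {i a b : ι} (hi : V ≤ U i) (ha : V ≤ U a)
    (hb : V ≤ U b) {z n m m' : ℤ} (h : n + 0 = m) (hz : 0 = z) (hm : m + z = m') (h' : n + 0 = m')
    (y : LHom E F (V ⊓ U c) inf_le_right (inf_le_left.trans hi) n) :
    LHom.comp hm (LHom.bump S c (LHom.comp h y (eta l (inf_le_left.trans ha) inf_le_right)) :
        LHom (restrFamily U Q) F V ha hi m)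
      (LHom.cast hz (canon hb ha (DGMod.idHom Q.toDGMod))) =
      LHom.bump S c (LHom.comp h' y (eta l (inf_le_left.trans hb) inf_le_right)) := by
  subst hz
  rw [LHom.cast_rfl, ← LHom.bump_comp_rs, canon_rs, LHom.comp_assoc h (zero_add 0) hm h',
    eta_comp_canon]

lemma last_delta {n' n m : ℤ} (h : n' + 1 = n) (hm : n + 1 = m) (u : CechHom E F n) :
    last S c l hm (delta hm u) + delta h (last S c l h u) =
      n'.negOnePow • mul h (last S c l h u) (twistCochain U Q) := by
  refine ext fun p a b s => ?_
  rw [add_apply, Units.smul_def, zsmul_apply]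
  cases p with
  | zero =>
    have h0 : mul h (last S c l h u) (twistCochain U Q) 0 a b s = 0 := by
      rw [mul_apply]
      refine sum_eq_zero ?_
      rintro ⟨⟨i, j⟩, hx⟩ -
      obtain rfl : j = 0 := by have : i + j = 0 := by simpa using hx
                               omega
      simp only [cup, twistCochain_ne 0 zero_ne_one, map_zero, smul_zero]
    rw [delta_zero, h0, last_apply, delta_succ, Finset.univ_eq_empty, Finset.sum_empty, map_zero,
      map_zero, LinearMap.zero_apply, map_zero, add_zero, smul_zero, smul_zero]
  | succ p =>
    have h0 : mul h (last S c l h u) (twistCochain U Q) (p + 1) a b s = (n' - p).negOnePow •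
        cup (last S c l h u) (twistCochain U Q) (s.front p 1 rfl) (s.back p 1 rfl)
          (supp_le_front _ _ _ _) (supp_le_back _ _ _ _) (by push_cast; omega) := by
      rw [mul_apply, sum_eq_single ⟨(p, 1), by simp⟩]
      · simp
      · rintro ⟨⟨i, j⟩, hx⟩ - hne
        have e : i + j = p + 1 := by simpa using hx
        have hj : j ≠ 1 := by
          rintro rfl
          obtain rfl : i = p := by omega
          exact hne rfl
        simp only [cup, twistCochain_ne j hj, map_zero, smul_zero]
      · exact fun h => absurd (mem_univ _) h
    rw [h0, last_apply, delta_succ, delta_succ, Fin.sum_univ_castSucc]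
    simp only [map_add, map_sum, Units.smul_def, map_zsmul, cup, twistCochain_one, last_apply, LHom.rs_cast,
      LHom.rs_bump, LHom.rs_comp, LHom.rs_rs, rs_eta, canon_rs, LHom.comp_cast_left, smul_add, smul_sum,
      LinearMap.add_apply, LinearMap.sum_apply, LinearMap.smul_apply]
    have e0 := rs_congr u (Simplex.snoc_face_last s c)
      ((inf_le_snoc s c).trans (supp_le_face _ (Fin.last p)))
      ((inf_le_inf_right (U c) (supp_le_front s p 1 rfl)).trans (inf_le_snoc _ c))
    have e1 := fun k => rs_congr u (Simplex.snoc_face_castSucc s c k)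
      ((inf_le_snoc s c).trans (supp_le_face _ k.castSucc))
      ((inf_le_inf_right (U c) (supp_le_face s k)).trans (inf_le_snoc _ c))
    rw [bump_comp_canon S c l _ _ _ _ _ _ (by push_cast; omega), e0]
    simp only [e1, ← LHom.bump_cast, LHom.cast_comp]
    rw [add_right_comm, ← Finset.sum_add_distrib, Finset.sum_eq_zero, zero_add]
    · simp only [smul_smul]
      refine congrArg₂ _ ?_ rfl
      simp only [← Units.val_mul, ← Int.negOnePow_add]
      refine congrArg _ ((Int.negOnePow_eq_iff _ _).2 ⟨p + 1 - n', ?_⟩)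
      simp
      ring
    · intro k _
      simp only [smul_smul]
      rw [← add_smul]
      simp [Int.negOnePow_succ, mul_comm]

lemma last_mul {n₂' n₁ n₂ n' n : ℤ} (h₂ : n₂' + 1 = n₂) (hn : n' + 1 = n) (h : n₁ + n₂ = n)
    (h' : n₁ + n₂' = n') (u : CechHom F G n₁) (v : CechHom E F n₂) (p : ℕ) (a b : ι)
    (s : Simplex ι p a b) : last S c l hn (mul h u v) p a b s =
      n₁.negOnePow • mul h' u (last S c l h₂ v) p a b s + (p : ℤ).negOnePow •
        LHom.bump S c (LHom.comp (by push_cast; omega)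
          (cup u v (s.snoc c) (Simplex.pt c) (inf_le_snoc s c) (le_pt inf_le_right)
            (k := n - (p + 1 : ℕ)) (by push_cast; omega))
          (eta l (inf_le_left.trans (supp_le_last s)) inf_le_right)) := by
  rw [last_apply, mul_apply, mul_apply]
  simp only [map_sum, Units.smul_def, map_zsmul, LinearMap.sum_apply, LinearMap.smul_apply, smul_sum]
  refine (sum_antidiag_succ'
    (M := LHom (restrFamily U Q) G (supp U s) (supp_le_last s) (supp_le_first s) (n' - p)) p
    (fun q r hq => ((p : ℤ).negOnePow : ℤ) • (((n₁ - q) * r).negOnePow : ℤ) • LHom.bump S c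
      (LHom.comp (by push_cast; omega) (LHom.rs (inf_le_snoc s c)
        (cup u v ((s.snoc c).front q r hq) ((s.snoc c).back q r hq) (supp_le_front _ _ _ _)
          (supp_le_back _ _ _ _) (k := n - (p + 1 : ℕ)) (by omega)))
        (eta l (inf_le_left.trans (supp_le_last s)) inf_le_right)))).trans ?_
  rw [add_comm]
  refine congrArg₂ _ (sum_congr rfl ?_) (congrArg₂ _ rfl ?_)
  · rintro ⟨⟨q, r⟩, hx⟩ -
    have e : q + r = p := by simpa using hx
    dsimp only [cup]
    rw [last_apply, Units.smul_def]
    simp only [map_zsmul, LinearMap.smul_apply]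
    rw [LHom.rs_bump, ← LHom.bump_rs_comp]
    simp only [LHom.rs_comp, LHom.rs_rs, rs_eta, smul_smul]
    refine congrArg₂ _ ?_ ?_
    · simp only [← Units.val_mul, ← Int.negOnePow_add]
      refine congrArg _ ((Int.negOnePow_eq_iff _ _).2 ⟨0, ?_⟩)
      subst e
      push_cast
      ring
    rw [← LHom.comp_assoc (ab := n - (p + 1 : ℕ)) (by push_cast; omega) _ (by push_cast; omega)]
    refine congrArg (LHom.bump S c) (congrArg (fun x => LHom.comp _ x (eta l _ _)) ?_)
    exact cup_congr u v (s.snoc_castSucc c e) (s.snoc_front c e (by omega)) (s.snoc_back c e (by omega)) _ _ _ _ _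
  · rw [cup_rs]
    simp only [Nat.cast_zero, mul_zero, Int.negOnePow_zero, Units.val_one, one_smul]
    refine congrArg (LHom.bump S c) (congrArg (fun x => LHom.comp _ x (eta l _ _)) ?_)
    exact cup_congr u v (s.snoc_last c) (s.snoc_front_last c) (s.snoc_back_last c) _ _ _ _ _

lemma last_dInt {δ : DGMod.Hom Q.toDGMod Q.toDGMod 1}
    (hl : LHom.d (zero_add 1) l - LHom.comp (zero_add 1) l (canon le_rfl le_rfl δ) ∈ LHom.fil 1)
    {n' n m : ℤ} (h : n' + 1 = n) (hm : n + 1 = m) {k : ℕ} {u : CechHom E F n}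
    (hu : u ∈ fil k) : last S c l hm (dInt hm u) + dInt h (last S c l h u) -
      n'.negOnePow • mul h (last S c l h u) (mapCochain U δ) ∈ fil (k + 1) := by
  intro p a b s
  have h0 : (last S c l hm (dInt hm u) + dInt h (last S c l h u) -
      n'.negOnePow • mul h (last S c l h u) (mapCochain U δ)) p a b s =
      last S c l hm (dInt hm u) p a b s + dInt h (last S c l h u) p a b s -
      n'.negOnePow • mul h (last S c l h u) (mapCochain U δ) p a b s := rfl
  rw [h0, mul_mapCochain, last_apply, last_apply, dInt_apply, dInt_apply, last_apply]
  simp only [map_zsmul, Units.smul_def, LinearMap.smul_apply]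
  have e := d_bump_eta S hl (supp_le_first s) (supp_le_last s) (m := n' - p) (m' := n - p)
    (n' := m - (p + 1 : ℕ)) (by push_cast; omega) (by omega) (by omega) (by push_cast; omega)
    (LHom.rs_mem_fil (inf_le_snoc s c) (hu _ _ _ (s.snoc c)))
  refine mem_of_eq ?_ e
  rw [LHom.rs_d]
  simp only [smul_smul, Int.units_coe_mul_self, one_smul, Nat.cast_add, Nat.cast_one, Int.negOnePow_succ,
    Units.val_neg, mul_neg, neg_smul, smul_neg]
  rw [neg_add_eq_sub, Units.smul_def]
  refine congrArg₂ _ rfl (congrArg₂ _ ?_ rfl)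
  rw [← Units.val_mul, ← Int.negOnePow_add]
  refine congrArg _ ((Int.negOnePow_eq_iff _ _).2 ⟨p, ?_⟩)
  omega

end last

end CechHom

end Contraction

/-! ### Extension of morphisms to the whole space -/

namespace CohesiveModule

section fil

variable {A : DGAlg.{u}} {Q R S : CohesiveModule A}

lemma conn_eq_connExt (x : ScalarExt (Hom.id A) Q.E) : Q.conn x = Q.connExt (Hom.id A) x := by
  have h := Q.connExt_push_id (Hom.id A) x
  rw [ScalarExt.push_id _ _ (fun _ => rfl), ScalarExt.push_id _ _ (fun _ => rfl)] at h
  exact h.symm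

def homFil (k : ℕ) {n : ℤ} : AddSubgroup (DGMod.Hom Q.toDGMod R.toDGMod n) :=
  (ScalarExt.homFil (Hom.id A) (Hom.id A) Q.gr R.gr k n).comap
    (DGMod.Hom Q.toDGMod R.toDGMod n).subtype.toAddMonoidHom

lemma mem_homFil_zero {n : ℤ} (x : DGMod.Hom Q.toDGMod R.toDGMod n) : x ∈ homFil 0 :=
  ScalarExt.mem_homFil_zero.2 x.2

lemma homFil_anti {p q : ℕ} (h : p ≤ q) {n : ℤ} {x : DGMod.Hom Q.toDGMod R.toDGMod n}
    (hx : x ∈ homFil q) : x ∈ homFil p := ScalarExt.homFil_anti h hx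

lemma comp_mem_homFil {p q : ℕ} {m n k : ℤ} (h : m + n = k) {x : DGMod.Hom R.toDGMod S.toDGMod m}
    {y : DGMod.Hom Q.toDGMod R.toDGMod n} (hx : x ∈ homFil p) (hy : y ∈ homFil q) :
    DGMod.comp h x y ∈ homFil (p + q) := ScalarExt.homFil_comp hx hy h

lemma d_mem_homFil {p : ℕ} {n m : ℤ} (h : n + 1 = m) {x : DGMod.Hom Q.toDGMod R.toDGMod n}
    (hx : x ∈ homFil p) : DGMod.d h x ∈ homFil p := fun q e he => by
  refine sub_mem ?_ ?_
  · have h1 := R.connExt_mem_filGr (Hom.id A) (hx q e he) (n := q + m) (by omega)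
    rw [← conn_eq_connExt] at h1
    exact h1
  · have h1 : Q.connExt (Hom.id A) (ScalarExt.mk _ 1 e) ∈ ScalarExt.filGr (Hom.id A) Q.gr 0
        (q + 1) := Q.connExt_mem_filGr _ (ScalarExt.mk_mem_filGr A.one_mem he (by simp) le_rfl) rfl
    rw [← conn_eq_connExt] at h1
    exact zsmul_mem (ScalarExt.homFil_apply hx h1 le_rfl (by omega)) _

lemma homFil_eq_zero {p : ℕ} (hA : ∀ j, p ≤ j → ∀ b ∈ A.gr j, b = 0) {n : ℤ}
    {x : DGMod.Hom Q.toDGMod R.toDGMod n} (hx : x ∈ homFil p) : x = 0 :=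
  Subtype.ext (ScalarExt.homFil_eq_zero Q.internal hA hx)

def zid (Q : CohesiveModule A) (z : A.Z) : DGMod.Hom Q.toDGMod Q.toDGMod 0 :=
  ⟨ScalarExt.zmul (Hom.id A) Q.E z, ScalarExt.mem_homFil_zero.1 (ScalarExt.zmul_mem Q.gr z)⟩

lemma zid_comp_eq {z : A.Z} {n m : ℤ} (h : 0 + n = m) (h' : n + 0 = m)
    (x : DGMod.Hom Q.toDGMod R.toDGMod n) : DGMod.comp h (zid R z) x = DGMod.comp h' x (zid Q z) :=
  Subtype.ext (ScalarExt.zmul_comm z x.1)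

lemma d_zid_mem (z : A.Z) {m : ℤ} (h : 0 + 1 = m) : DGMod.d h (zid Q z) ∈ homFil 1 := by
  subst h
  intro q e he
  have h1 := Q.leibniz (algebraMap A.Z A.A z)
    (ScalarExt.mk_mem (Hom.id A) Q.gr A.one_mem he (zero_add q))
  have h2 : (DGMod.d (m := 0 + 1) rfl (zid Q z)).1 (ScalarExt.mk (Hom.id A) 1 e) = q.negOnePow •
      (ScalarExt.mk (Hom.id A) 1 e <• A.d (algebraMap A.Z A.A z)) := by
    change Q.conn (ScalarExt.mk (Hom.id A) 1 e <• algebraMap A.Z A.A z) -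
      (0 : ℤ).negOnePow • (Q.conn (ScalarExt.mk (Hom.id A) 1 e) <• algebraMap A.Z A.A z) = _
    rw [h1, Int.negOnePow_zero, one_smul, add_sub_cancel_left]
  have h3 : (DGMod.d (m := 0 + 1) rfl (zid Q z)).1 (ScalarExt.mk (Hom.id A) 1 e) ∈
      ScalarExt.filGr (Hom.id A) Q.gr 1 (q + (0 + 1)) := by
    refine (congrArg (· ∈ ScalarExt.filGr (Hom.id A) Q.gr 1 (q + (0 + 1))) h2).mpr ?_
    rw [ScalarExt.mk_mul, one_mul]
    exact zsmul_mem (ScalarExt.mk_mem_filGr (A.d_mem ((A.mem_gr_zero _).2 ⟨z, rfl⟩)) he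
      (by push_cast; ring) le_rfl) _
  exact h3

lemma zid_one_comp {n : ℤ} (h : 0 + n = n) (x : DGMod.Hom Q.toDGMod R.toDGMod n) :
    DGMod.comp h (zid R 1) x = x :=
  Subtype.ext (LinearMap.ext fun _ => LHom.zmul_one _)

lemma zid_add (z z' : A.Z) : zid Q (z + z') = zid Q z + zid Q z' :=
  Subtype.ext (LinearMap.ext fun (x : ScalarExt (Hom.id A) Q.E) =>
    show x <• algebraMap A.Z A.A (z + z') = x <• algebraMap A.Z A.A z + x <• algebraMap A.Z A.A z' by
      rw [map_add, MulOpposite.op_add, add_smul])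

def zidHom (Q : CohesiveModule A) : A.Z →+ DGMod.Hom Q.toDGMod Q.toDGMod 0 :=
  AddMonoidHom.mk' (zid Q) zid_add

end fil

end CohesiveModule

/-- The filtration of the category of cohesive modules by form degree. -/
def cohesiveFilt (A : DGAlg.{u}) : (cohesiveCat A).Filt where
  fil k := CohesiveModule.homFil k
  zero f := CohesiveModule.mem_homFil_zero f
  anti h hf := CohesiveModule.homFil_anti h hf
  d_mem h hf := CohesiveModule.d_mem_homFil h hf
  comp_mem h _ _ hg hf := CohesiveModule.comp_mem_homFil h hg hf

section Global

variable {X : Type v} [TopologicalSpace X] {𝒜 : DGAlgPresheaf.{u} X} {ι : Type w}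
  {U : ι → Opens X} {Q R T : CohesiveModule (𝒜.obj ⊤)} {V : Opens X}
  {i j k : ι}

/-- The morphism of the base changes to `V` given by a morphism `Q|_{U_i} → R|_{U_j}` on `V`. -/
def uncanon (hi : V ≤ U i) (hj : V ≤ U j) {n : ℤ}
    (y : LHom (restrFamily U Q) (restrFamily U R) V hi hj n) :
    DGMod.Hom (Q.extend (𝒜.res (le_top : V ≤ ⊤))) (R.extend (𝒜.res (le_top : V ≤ ⊤))) n :=
  DGMod.comp (zero_add n) (R.assocHom (𝒜.res hj) (𝒜.res_res hj le_top (le_top : V ≤ ⊤)))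
    (DGMod.comp (add_zero n) y (Q.assocHomInv (𝒜.res hi) (𝒜.res_res hi le_top (le_top : V ≤ ⊤))))

lemma canon_eq_iff (hi : V ≤ U i) (hj : V ≤ U j) {n : ℤ} (φ : DGMod.Hom Q.toDGMod R.toDGMod n)
    (y : LHom (restrFamily U Q) (restrFamily U R) V hi hj n) : canon hi hj φ = y ↔
      CohesiveModule.extendHom Q (𝒜.res (le_top : V ≤ ⊤)) φ = uncanon hi hj y := by
  constructor
  · rintro rfl
    refine Subtype.ext (LinearMap.ext fun x => ?_)
    have h1 := Q.assocTo_assocInv (𝒜.res hi) (𝒜.res_res hi le_top (le_top : V ≤ ⊤)) x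
    have h2 := R.assocTo_assocInv (𝒜.res hj) (𝒜.res_res hj le_top (le_top : V ≤ ⊤))
    refine Eq.trans ?_ (h2 _).symm
    exact congrArg (CohesiveModule.extendHom Q (𝒜.res (le_top : V ≤ ⊤)) φ).1 h1.symm
  · intro h
    refine Subtype.ext (LinearMap.ext fun x => ?_)
    have h1 := Q.assocInv_assocTo (𝒜.res hi) (𝒜.res_res hi le_top (le_top : V ≤ ⊤)) x
    have h2 := R.assocInv_assocTo (𝒜.res hj) (𝒜.res_res hj le_top (le_top : V ≤ ⊤))
    refine (congrArg (fun z => R.assocInv (𝒜.res hj) (𝒜.res_res hj le_top (le_top : V ≤ ⊤))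
      (z.1 (Q.assocTo (𝒜.res hi) (𝒜.res_res hi le_top (le_top : V ≤ ⊤)) x))) h).trans ?_
    refine (h2 _).trans ?_
    exact congrArg y.1 h1

lemma canon_mem_fil (hi : V ≤ U i) (hj : V ≤ U j) {p : ℕ} {n : ℤ}
    {φ : DGMod.Hom Q.toDGMod R.toDGMod n} (hφ : φ ∈ CohesiveModule.homFil p) :
    canon hi hj φ ∈ LHom.fil p := by
  have h1 : (CohesiveModule.extendHom Q (𝒜.res (le_top : V ≤ ⊤)) φ).1 ∈
      ScalarExt.homFil (𝒜.res (le_top : V ≤ ⊤)) (𝒜.res (le_top : V ≤ ⊤)) Q.gr R.gr p n :=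
    ScalarExt.homFil_restr (f := Hom.id _) (g := Hom.id _) _ (CohesiveModule.id_push _)
      (CohesiveModule.id_push _) hφ
  have h2 := ScalarExt.mem_homFil_zero.2
    (Q.assocHom (𝒜.res hi) (𝒜.res_res hi le_top (le_top : V ≤ ⊤))).2
  have h3 := ScalarExt.mem_homFil_zero.2
    (R.assocHomInv (𝒜.res hj) (𝒜.res_res hj le_top (le_top : V ≤ ⊤))).2
  have h4 := ScalarExt.homFil_comp h3 (ScalarExt.homFil_comp h1 h2 (add_zero n)) (zero_add n)
  rw [zero_add, add_zero] at h4
  exact h4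

lemma exists_canon (S : SoftCover 𝒜 U) (hi : V ≤ U i) (hj : V ≤ U j) {p : ℕ} {n : ℤ}
    {y : LHom (restrFamily U Q) (restrFamily U R) V hi hj n} (hy : y ∈ LHom.fil p) :
    ∃ φ : DGMod.Hom Q.toDGMod R.toDGMod n, φ ∈ CohesiveModule.homFil p ∧ canon hi hj φ = y := by
  have h2 := ScalarExt.mem_homFil_zero.2
    (Q.assocHomInv (𝒜.res hi) (𝒜.res_res hi le_top (le_top : V ≤ ⊤))).2
  have h3 := ScalarExt.mem_homFil_zero.2
    (R.assocHom (𝒜.res hj) (𝒜.res_res hj le_top (le_top : V ≤ ⊤))).2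
  have h4 := ScalarExt.homFil_comp h3 (ScalarExt.homFil_comp hy h2 (add_zero n)) (zero_add n)
  rw [zero_add, add_zero] at h4
  obtain ⟨ψ, h5, h6⟩ := ScalarExt.exists_restr (f := Hom.id _) (g := Hom.id _) (E := Q) (F := R)
    (𝒜.res (le_top : V ≤ ⊤)) (CohesiveModule.id_push _)
    (CohesiveModule.id_push _) (S.surj le_top) h4
  refine ⟨⟨ψ, ScalarExt.mem_homFil_zero.1 (ScalarExt.homFil_anti (Nat.zero_le _) h5)⟩, h5, ?_⟩
  rw [canon_eq_iff]
  exact Subtype.ext h6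

lemma ScalarExt.restr_zmul {A B : DGAlg.{u}} {M : Type u} [AddCommGroup M] [Module A.Z M] (f : Hom A B)
    (hf : ∀ a, f.toFun ((Hom.id A).toFun a) = f.toFun a) (z : A.Z) :
    ScalarExt.restr f hf hf (ScalarExt.zmul (Hom.id A) M z) = ScalarExt.zmul f M (f.zero z) := by
  refine ScalarExt.hom_ext _ fun e => ?_
  rw [ScalarExt.restr_mk, MulOpposite.op_one, one_smul, ScalarExt.zmul_apply, ScalarExt.zmul_apply,
    ScalarExt.push_smul, ScalarExt.push_mk, map_one, f.algebraMap_zero]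

lemma canon_zid (hi : V ≤ U i) (z : (𝒜.obj ⊤).Z) :
    canon hi hi (CohesiveModule.zid Q z) =
      LHom.zid (restrFamily U Q) hi ((𝒜.res (le_top : V ≤ ⊤)).zero z) := by
  rw [canon_eq_iff]
  refine Subtype.ext ((ScalarExt.restr_zmul _ (CohesiveModule.id_push _) z).trans
    (LinearMap.ext fun x => ?_))
  have h1 := Q.assocTo_assocInv (𝒜.res hi) (𝒜.res_res hi le_top (le_top : V ≤ ⊤)) x
  refine Eq.trans (congrArg (ScalarExt.zmul _ Q.E ((𝒜.res (le_top : V ≤ ⊤)).zero z)) h1.symm) ?_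
  exact (map_smul (Q.assocTo (𝒜.res hi) (𝒜.res_res hi le_top (le_top : V ≤ ⊤))) _ _).symm

section gmul

variable (S : SoftCover 𝒜 U) (c : ι)

/-- Multiplication of a morphism by a member of the partition of unity. -/
def gmul {n : ℤ} : DGMod.Hom Q.toDGMod R.toDGMod n →+ DGMod.Hom Q.toDGMod R.toDGMod n :=
  (DGMod.comp (zero_add n) (CohesiveModule.zid R (S.ρ c))).toAddMonoidHom

lemma gmul_apply {n : ℤ} (x : DGMod.Hom Q.toDGMod R.toDGMod n) :
    gmul S c x = DGMod.comp (zero_add n) (CohesiveModule.zid R (S.ρ c)) x := rfl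

lemma canon_gmul (hi : V ≤ U i) (hj : V ≤ U j) {n : ℤ} (x : DGMod.Hom Q.toDGMod R.toDGMod n) :
    canon hi hj (gmul S c x) = LHom.rmul S c (canon hi hj x) := by
  rw [gmul_apply, ← canon_comp hi hj hj, canon_zid, LHom.rmul_apply]

lemma gmul_comp {m n k : ℤ} (h : m + n = k) (x : DGMod.Hom R.toDGMod T.toDGMod m)
    (y : DGMod.Hom Q.toDGMod R.toDGMod n) : gmul S c (DGMod.comp h x y) = DGMod.comp h (gmul S c x) y := rfl

lemma comp_gmul {m n k : ℤ} (h : m + n = k) (x : DGMod.Hom R.toDGMod T.toDGMod m)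
    (y : DGMod.Hom Q.toDGMod R.toDGMod n) : DGMod.comp h x (gmul S c y) = DGMod.comp h (gmul S c x) y := by
  rw [gmul_apply, gmul_apply, CohesiveModule.zid_comp_eq _ (add_zero m)]
  rfl

lemma gmul_mem {p : ℕ} {n : ℤ} {x : DGMod.Hom Q.toDGMod R.toDGMod n} (hx : x ∈ CohesiveModule.homFil p) :
    gmul S c x ∈ CohesiveModule.homFil p := by
  have := CohesiveModule.comp_mem_homFil (zero_add n)
    (CohesiveModule.mem_homFil_zero (CohesiveModule.zid R (S.ρ c))) hx
  rw [zero_add] at this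
  exact this

lemma d_gmul {p : ℕ} {n m : ℤ} (h : n + 1 = m) {x : DGMod.Hom Q.toDGMod R.toDGMod n}
    (hx : x ∈ CohesiveModule.homFil p) :
    DGMod.d h (gmul S c x) - gmul S c (DGMod.d h x) ∈ CohesiveModule.homFil (p + 1) := by
  rw [gmul_apply, DGMod.d_comp (zero_add n) (zero_add 1) h h (by omega) (zero_add m),
    Int.negOnePow_zero, one_smul, gmul_apply, add_sub_cancel_right, add_comm p]
  exact CohesiveModule.comp_mem_homFil _ (CohesiveModule.d_zid_mem _ _) hx

lemma sum_gmul {n : ℤ} (x : DGMod.Hom Q.toDGMod R.toDGMod n) : ∑ c ∈ S.J, gmul S c x = x := by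
  have h1 : ∑ c ∈ S.J, CohesiveModule.zid R (S.ρ c) = CohesiveModule.zid R 1 := by
    rw [← S.sum_ρ]
    exact (map_sum (CohesiveModule.zidHom R) S.ρ S.J).symm
  have h2 : ∑ c ∈ S.J, gmul S c x =
      DGMod.comp (zero_add n) (∑ c ∈ S.J, CohesiveModule.zid R (S.ρ c)) x := by
    rw [map_sum, LinearMap.sum_apply]
    rfl
  rw [h2, h1, CohesiveModule.zid_one_comp]

lemma ScalarExt.zmul_comp_eq_zero_id {A B : DGAlg.{u}} {Q R : CohesiveModule A} (f : Hom A B)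
    (hf : ∀ a, f.toFun ((Hom.id A).toFun a) = f.toFun a) {z : A.Z}
    (hz : ∀ b, f.toFun b = 0 → algebraMap A.Z A.A z * b = 0)
    {φ : ScalarExt (Hom.id A) Q.E →ₗ[(A.A)ᵐᵒᵖ] ScalarExt (Hom.id A) R.E}
    (hφ : ScalarExt.restr f hf hf φ = 0) : ScalarExt.zmul (Hom.id A) R.E z ∘ₗ φ = 0 :=
  ScalarExt.zmul_comp_eq_zero f hf hf hz hφ

lemma gmul_eq_zero {n : ℤ} {x : DGMod.Hom Q.toDGMod R.toDGMod n}
    (hx : canon (le_refl (U c)) (le_refl (U c)) x = 0) : gmul S c x = 0 := by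
  refine Subtype.ext (ScalarExt.zmul_comp_eq_zero_id (𝒜.res (le_top : U c ≤ ⊤))
    (CohesiveModule.id_push _) (fun b hb => ?_) ?_)
  · have h1 := S.mul_eq_zero c (le_top : U c ≤ ⊤) inf_le_right b hb
    rw [(𝒜.res le_top).algebraMap_zero, 𝒜.res_id] at h1
    exact h1
  · rw [canon_eq_iff] at hx
    refine (congrArg Subtype.val hx).trans ?_
    simp only [uncanon]
    refine LinearMap.ext fun x => ?_
    exact map_zero (R.assocTo (𝒜.res (le_refl (U c))) (𝒜.res_res le_rfl le_top (le_top : U c ≤ ⊤)))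

/-- The extension by zero of the product of a morphism on `U_c` with `ρ_c`. -/
def gex {n : ℤ} :
    LHom (restrFamily U Q) (restrFamily U R) (U c) (le_refl (U c)) (le_refl (U c)) n →+
      DGMod.Hom Q.toDGMod R.toDGMod n :=
  extendAlong (canon (le_refl (U c)) (le_refl (U c))).toAddMonoidHom
    (fun y => by
      obtain ⟨x, -, hx⟩ := exists_canon S _ _ (LHom.mem_fil_zero y)
      exact ⟨x, hx⟩)
    (gmul S c) (fun x hx => gmul_eq_zero S c hx)

lemma gex_canon {n : ℤ} (x : DGMod.Hom Q.toDGMod R.toDGMod n) :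
    gex S c (canon (le_refl (U c)) (le_refl (U c)) x) = gmul S c x :=
  extendAlong_apply _ _ _ _ x

lemma gex_mem {p : ℕ} {n : ℤ} {y : LHom (restrFamily U Q) (restrFamily U R) (U c) le_rfl le_rfl n}
    (hy : y ∈ LHom.fil p) : gex S c y ∈ CohesiveModule.homFil p := by
  obtain ⟨x, hx, rfl⟩ := exists_canon S _ _ hy
  rw [gex_canon]
  exact gmul_mem S c hx

lemma d_gex {p : ℕ} {n m : ℤ} (h : n + 1 = m)
    {y : LHom (restrFamily U Q) (restrFamily U R) (U c) le_rfl le_rfl n} (hy : y ∈ LHom.fil p) :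
    DGMod.d h (gex S c y) - gex S c (LHom.d h y) ∈ CohesiveModule.homFil (p + 1) := by
  obtain ⟨x, hx, rfl⟩ := exists_canon S _ _ hy
  rw [canon_d, gex_canon, gex_canon]
  exact d_gmul S c h hx

lemma gex_comp_canon {m n k : ℤ} (h : m + n = k)
    (y : LHom (restrFamily U R) (restrFamily U T) (U c) le_rfl le_rfl m)
    (x : DGMod.Hom Q.toDGMod R.toDGMod n) :
    gex S c (LHom.comp h y (canon le_rfl le_rfl x)) = DGMod.comp h (gex S c y) x := by
  obtain ⟨y, -, rfl⟩ := exists_canon S _ _ (LHom.mem_fil_zero y)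
  rw [canon_comp, gex_canon, gex_canon, gmul_comp]

lemma gex_canon_comp {m n k : ℤ} (h : m + n = k) (x : DGMod.Hom R.toDGMod T.toDGMod m)
    (y : LHom (restrFamily U Q) (restrFamily U R) (U c) le_rfl le_rfl n) :
    gex S c (LHom.comp h (canon le_rfl le_rfl x) y) = DGMod.comp h x (gex S c y) := by
  obtain ⟨y, -, rfl⟩ := exists_canon S _ _ (LHom.mem_fil_zero y)
  rw [canon_comp, gex_canon, gex_canon, gmul_comp, comp_gmul]

lemma canon_gex (hi : V ≤ U i) (hj : V ≤ U j) {n : ℤ}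
    (y : LHom (restrFamily U Q) (restrFamily U R) (U c) le_rfl le_rfl n) :
    canon hi hj (gex S c y) = LHom.bump S c (LHom.comp (zero_add n)
      (canon (inf_le_right : V ⊓ U c ≤ U c) (inf_le_left.trans hj) (DGMod.idHom R.toDGMod))
      (LHom.comp (add_zero n) (LHom.rs inf_le_right y)
        (canon (inf_le_left.trans hi) (inf_le_right : V ⊓ U c ≤ U c) (DGMod.idHom Q.toDGMod)))) := by
  obtain ⟨y, -, rfl⟩ := exists_canon S _ _ (LHom.mem_fil_zero y)
  rw [gex_canon, canon_gmul, canon_rs, canon_comp_canon_id, canon_id_comp_canon, ← LHom.bump_rs, canon_rs]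

end gmul

end Global

/-! ### The twisting functor is a homotopy equivalence on morphisms -/

section Transfer

open Finset

variable {X : Type v} [TopologicalSpace X] {𝒜 : DGAlgPresheaf.{u} X} {ι : Type w}
  {U : ι → Opens X} {Q R T : CohesiveModule (𝒜.obj ⊤)}

lemma twCat_d {M N : TwistedComplex 𝒜 U} {n m : ℤ} (h : n + 1 = m) (h' : 1 + n = m)
    (x : CechHom M.E N.E n) : (twCat 𝒜 U).d (X := M) (Y := N) h x =
      CechHom.dInt h x + CechHom.delta h x + CechHom.mul h' N.a x -
        (n.negOnePow : ℤ) • CechHom.mul h x M.a := rfl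

variable (𝒜 U) in
/-- The filtration of the category of twisted complexes by form degree. -/
def twFilt : (twCat 𝒜 U).Filt where
  fil k := CechHom.fil k
  zero f p a b s := LHom.mem_fil_zero _
  anti h hf p a b s := LHom.fil_anti h (hf p a b s)
  d_mem {M N n m k f} h hf := by
    refine mem_of_eq (twCat_d (M := M) (N := N) h (by omega) f) ?_
    have h1 := CechHom.mul_mem_fil (k := 0) (u := N.a) (by omega : 1 + n = m)
      (fun p a b s => LHom.mem_fil_zero _) hf
    have h2 := CechHom.mul_mem_fil (k' := 0) (v := M.a) h hf (fun p a b s => LHom.mem_fil_zero _)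
    rw [zero_add] at h1
    exact (CechHom.fil k : AddSubgroup (CechHom M.E N.E m)).sub_mem
      ((CechHom.fil k).add_mem (CechHom.d_mem_fil h hf) h1) ((CechHom.fil k).zsmul_mem h2 _)
  comp_mem h _ _ hg hf := CechHom.mul_mem_fil h hg hf

lemma twFilt_isFinite (S : SoftCover 𝒜 U) : (twFilt 𝒜 U).IsFinite :=
  ⟨S.N + 1, fun hf => CechHom.ext fun p a b s => LHom.fil_eq_zero S (Nat.lt_succ_self _) (hf p a b s)⟩

lemma cohesiveFilt_isFinite (S : SoftCover 𝒜 U) : (cohesiveFilt (𝒜.obj ⊤)).IsFinite :=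
  ⟨S.N + 1, fun hf => CohesiveModule.homFil_eq_zero (fun j hj => S.gr_eq_zero ⊤ j hj) hf⟩

variable (S : SoftCover 𝒜 U)

namespace CechHom

def firstHom {E F : CohesiveFamily 𝒜 U} (c : ι)
    (l : LHom F (restrFamily U Q) (U c) le_rfl le_rfl 0) {n' n : ℤ} (h : n' + 1 = n) :
    CechHom E F n →+ CechHom E (restrFamily U Q) n' :=
  AddMonoidHom.mk' (first S c l h) (first_add S c l h)

def atPt {E F : CohesiveFamily 𝒜 U} (c : ι) {n : ℤ} :
    CechHom E F n →+ LHom E F (U c) le_rfl le_rfl n :=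
  AddMonoidHom.mk' (fun u => LHom.cast (by simp) (LHom.rs (le_pt le_rfl) (u 0 c c (Simplex.pt c))))
    (fun u v => by rw [add_apply, map_add, map_add])

lemma atPt_apply {E F : CohesiveFamily 𝒜 U} (c : ι) {n : ℤ} (u : CechHom E F n) :
    atPt c u = LHom.cast (by simp) (LHom.rs (le_pt le_rfl) (u 0 c c (Simplex.pt c))) := rfl

def glue {n : ℤ} : CechHom (restrFamily U Q) (restrFamily U R) n →+
    DGMod.Hom Q.toDGMod R.toDGMod n := ∑ c ∈ S.J, (gex S c).comp (atPt c)

lemma glue_apply {n : ℤ} (u : CechHom (restrFamily U Q) (restrFamily U R) n) :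
    glue S u = ∑ c ∈ S.J, gex S c (atPt c u) := by
  simp [glue]

def idAt (U : ι → Opens X) (Q : CohesiveModule (𝒜.obj ⊤)) (c : ι) :
    LHom (restrFamily U Q) (restrFamily U Q) (U c) le_rfl le_rfl 0 :=
  canon le_rfl le_rfl (DGMod.idHom Q.toDGMod)

lemma lam_idAt {c a : ι} {W : Opens X} (hc : W ≤ U c) (ha : W ≤ U a) :
    lam (idAt U Q c) hc ha = canon hc ha (DGMod.idHom Q.toDGMod) := by
  rw [lam, idAt, canon_rs, canon_id_comp]

def htp {E : CohesiveFamily 𝒜 U} {n' n : ℤ} (h : n' + 1 = n) :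
    CechHom E (restrFamily U Q) n →+ CechHom E (restrFamily U Q) n' :=
  ∑ c ∈ S.J, firstHom S c (idAt U Q c) h

lemma htp_apply {E : CohesiveFamily 𝒜 U} {n' n : ℤ} (h : n' + 1 = n)
    (u : CechHom E (restrFamily U Q) n) : htp S h u = ∑ c ∈ S.J, first S c (idAt U Q c) h u := by
  simp [htp, firstHom]

lemma sum_eval {E F : CohesiveFamily 𝒜 U} {n : ℤ} {κ : Type*} (s : Finset κ) (u : κ → CechHom E F n)
    (p : ℕ) (a b : ι) (t : Simplex ι p a b) : (∑ c ∈ s, u c) p a b t = ∑ c ∈ s, u c p a b t :=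
  map_sum (AddMonoidHom.mk' (fun u : CechHom E F n => u p a b t) fun _ _ => rfl) u s

lemma first_mem_fil {E F : CohesiveFamily 𝒜 U} (c : ι)
    (l : LHom F (restrFamily U Q) (U c) le_rfl le_rfl 0) {n' n : ℤ} (h : n' + 1 = n) {k : ℕ}
    {u : CechHom E F n} (hu : u ∈ fil k) : first S c l h u ∈ fil k := fun p a b s => by
  have h1 := LHom.comp_mem_fil (by push_cast; omega : 0 + (n - (p + 1 : ℕ)) = n' - p)
    (LHom.mem_fil_zero (lam l (inf_le_right : supp U s ⊓ U c ≤ U c) (inf_le_left.trans (supp_le_first s))))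
    (LHom.rs_mem_fil (inf_le_cons s c) (hu _ _ _ (s.cons c)))
  rw [zero_add] at h1
  exact LHom.bump_mem_fil S c h1

lemma glue_map {n : ℤ} (φ : DGMod.Hom Q.toDGMod R.toDGMod n) : glue S (mapCochain U φ) = φ := by
  rw [glue_apply]
  refine (sum_congr rfl fun c _ => ?_).trans (sum_gmul S φ)
  rw [atPt_apply, mapCochain_zero, LHom.rs_cast, LHom.cast_cast, canon_rs, LHom.cast_rfl, gex_canon]

lemma htp_map {n' n : ℤ} (h : n' + 1 = n) (φ : DGMod.Hom Q.toDGMod R.toDGMod n) :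
    htp S h (mapCochain U φ) = 0 := by
  rw [htp_apply]
  refine sum_eq_zero fun c _ => ext fun p a b s => ?_
  rw [first_apply, mapCochain_ne φ _ (Nat.succ_ne_zero p), map_zero, map_zero, map_zero, zero_apply]

lemma atPt_map_mul {E : CohesiveFamily 𝒜 U} {m n k : ℤ} (h : m + n = k) (c : ι)
    (φ : DGMod.Hom Q.toDGMod R.toDGMod m) (u : CechHom E (restrFamily U Q) n) :
    atPt c (mul h (mapCochain U φ) u) = LHom.comp h (canon le_rfl le_rfl φ) (atPt c u) := by
  rw [atPt_apply, mapCochain_mul, atPt_apply]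
  simp only [Nat.cast_zero, mul_zero, Int.negOnePow_zero, one_smul]
  rw [LHom.rs_comp, LHom.cast_comp, canon_rs, LHom.comp_cast_right]

lemma atPt_mul_map {E : CohesiveFamily 𝒜 U} {m n k : ℤ} (h : m + n = k) (c : ι)
    (u : CechHom (restrFamily U R) E m) (φ : DGMod.Hom Q.toDGMod R.toDGMod n) :
    atPt c (mul h u (mapCochain U φ)) = LHom.comp h (atPt c u) (canon le_rfl le_rfl φ) := by
  rw [atPt_apply, mul_mapCochain, atPt_apply, LHom.rs_comp, LHom.cast_comp, canon_rs, LHom.comp_cast_left]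

lemma htp_map_mul {E : CohesiveFamily 𝒜 U} {m n k n' k' : ℤ} (h : m + n = k) (hn : n' + 1 = n)
    (hk : k' + 1 = k) (h' : m + n' = k') (φ : DGMod.Hom Q.toDGMod R.toDGMod m)
    (u : CechHom E (restrFamily U Q) n) :
    htp S hk (mul h (mapCochain U φ) u) = (m.negOnePow : ℤ) • mul h' (mapCochain U φ) (htp S hn u) := by
  rw [htp_apply, htp_apply, ← comp_apply h', map_sum, smul_sum]
  refine sum_congr rfl fun c _ => ext fun p a b s => ?_
  rw [zsmul_apply, comp_apply, mapCochain_mul, first_apply, mapCochain_mul, first_apply, Units.smul_def]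
  simp only [map_zsmul, Units.smul_def, smul_smul]
  refine congrArg₂ _ ?_ ?_
  · rw [← Units.val_mul, ← Int.negOnePow_add]
    congr 2
    push_cast
    ring
  · rw [← LHom.bump_rs_comp, LHom.rs_comp, canon_rs, canon_rs, lam_idAt, lam_idAt,
      ← LHom.comp_assoc (zero_add m) _ (by push_cast; omega) _,
      ← LHom.comp_assoc (add_zero m) _ (by push_cast; omega) _, canon_id_comp_canon, canon_comp_canon_id]

lemma htp_mul_map {m n k m' k' : ℤ} (h : m + n = k) (hm : m' + 1 = m)
    (hk : k' + 1 = k) (h' : m' + n = k') (u : CechHom (restrFamily U R) (restrFamily U T) m)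
    (φ : DGMod.Hom Q.toDGMod R.toDGMod n) :
    htp S hk (mul h u (mapCochain U φ)) = mul h' (htp S hm u) (mapCochain U φ) := by
  rw [htp_apply, htp_apply, ← comp_apply h', map_sum, LinearMap.sum_apply]
  refine sum_congr rfl fun c _ => ext fun p a b s => ?_
  rw [comp_apply, mul_mapCochain, first_apply, mul_mapCochain, first_apply, ← LHom.bump_comp_rs,
    LHom.rs_comp, canon_rs, canon_rs]
  rfl

lemma htp_twist (h : 0 + 1 = 1) : htp S h (twistCochain U Q) = id (restrFamily U Q) := by
  rw [← mapCochain_id, htp_apply]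
  refine ext fun p a b s => ?_
  rw [sum_eval]
  cases p with
  | zero =>
    rw [mapCochain_zero]
    refine (sum_congr rfl fun c _ => ?_).trans (LHom.sum_rmul S _)
    rw [first_apply, lam_idAt, twistCochain_one, LHom.rs_cast, canon_rs, LHom.comp_cast_right,
      ← LHom.bump_rs, LHom.rs_cast, canon_rs]
    refine congrArg (LHom.bump S c) ?_
    rw [← canon_id_comp (inf_le_left.trans (supp_le_last s)) (inf_le_right : supp U s ⊓ U c ≤ U c)
      (inf_le_left.trans (supp_le_first s)), LHom.cast_comp]
  | succ p =>
    rw [mapCochain_ne _ _ (Nat.succ_ne_zero p)]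
    refine sum_eq_zero fun c _ => ?_
    rw [first_apply, twistCochain_ne _ (by omega), map_zero, map_zero, map_zero]

lemma sum_first_mul_twist {n' n m : ℤ} (h : n' + 1 = n) (hm : n + 1 = m)
    (u : CechHom (restrFamily U Q) (restrFamily U R) n) :
    htp S hm (mul hm u (twistCochain U Q)) = mul h (htp S h u) (twistCochain U Q) +
      (n.negOnePow : ℤ) • mapCochain U (glue S u) := by
  rw [htp_apply, htp_apply, ← comp_apply h, map_sum, LinearMap.sum_apply, glue_apply, map_sum, smul_sum,
    ← sum_add_distrib]
  refine sum_congr rfl fun c _ => ext fun p a b s => ?_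
  rw [add_apply, zsmul_apply, comp_apply, first_mul S c (idAt U R c) h hm hm h]
  refine congrArg _ ?_
  cases p with
  | zero =>
    rw [mapCochain_zero, canon_gex, atPt_apply, cup, twistCochain_one, lam_idAt]
    simp only [Nat.cast_zero, zero_add, mul_one, LHom.rs_cast, LHom.rs_rs, canon_rs, Units.smul_def]
    refine congrArg _ ?_
    rw [← LHom.bump_cast, LHom.comp_cast_left, LHom.comp_cast_right, LHom.cast_comp]
    refine congrArg (LHom.bump S c) ?_
    rw [← LHom.comp_assoc (ab := n - (0 : ℕ)) (zero_add _) _ (by push_cast; omega),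
      ← LHom.comp_assoc (ab := n - (0 : ℕ)) (zero_add _) _ (by push_cast; omega)]
  | succ p =>
    rw [mapCochain_ne _ _ (Nat.succ_ne_zero p), cup, twistCochain_ne _ (by omega), map_zero, map_zero,
      map_zero, map_zero, smul_zero, smul_zero]

lemma htp_twist_mul {E : CohesiveFamily 𝒜 U} {n m : ℤ} (hm : n + 1 = m) (h' : 1 + n = m)
    (u : CechHom E (restrFamily U Q) n) : htp S hm (mul h' (twistCochain U Q) u) = u := by
  have h0 : ∀ c, first S c (idAt U Q c) hm (mul h' (twistCochain U Q) u) =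
      mul (zero_add n) (first S c (idAt U Q c) (zero_add 1) (twistCochain U Q)) u := fun c =>
    ext fun p a b s => by
      rw [first_mul S c (idAt U Q c) (zero_add 1) hm h' (zero_add n), cup, twistCochain_ne 0 zero_ne_one,
        map_zero, map_zero, LinearMap.zero_apply, map_zero, map_zero, smul_zero, add_zero]
  rw [htp_apply]
  simp only [h0]
  simp only [← comp_apply]
  rw [← LinearMap.sum_apply, ← map_sum, ← htp_apply, htp_twist, id_comp]

lemma d_idAt (c : ι) : LHom.d (zero_add 1) (idAt U Q c) + LHom.comp (add_zero 1)
    (canon le_rfl le_rfl (0 : DGMod.Hom Q.toDGMod Q.toDGMod 1)) (idAt U Q c) ∈ LHom.fil 1 := by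
  rw [idAt, canon_d, DGMod.d_id, map_zero, map_zero, zero_add]
  exact zero_mem _

lemma htp_dInt {E : CohesiveFamily 𝒜 U} {n' n m : ℤ} (h : n' + 1 = n) (hm : n + 1 = m) {k : ℕ}
    {u : CechHom E (restrFamily U Q) n} (hu : u ∈ fil k) :
    htp S hm (dInt hm u) + dInt h (htp S h u) ∈ fil (k + 1) := by
  have h1 : dInt h (htp S h u) = ∑ c ∈ S.J, dInt h (first S c (idAt U Q c) h u) := by
    rw [htp_apply]
    refine ext fun p a b s => ?_
    simp only [dInt_apply, sum_eval, map_sum, smul_sum]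
  rw [h1, htp_apply, ← sum_add_distrib]
  refine sum_mem fun c _ => ?_
  have h2 := first_dInt S c (idAt U Q c) (d_idAt c) h hm (by omega) hu
  rw [map_zero, ← comp_apply, map_zero, LinearMap.zero_apply, add_zero] at h2
  exact h2

lemma htp_delta {E : CohesiveFamily 𝒜 U} {n' n m : ℤ} (h : n' + 1 = n) (hm : n + 1 = m) (h' : 1 + n' = n)
    (u : CechHom E (restrFamily U Q) n) :
    htp S hm (delta hm u) + delta h (htp S h u) + mul h' (twistCochain U Q) (htp S h u) = 0 := by
  have h1 : delta h (htp S h u) = ∑ c ∈ S.J, delta h (first S c (idAt U Q c) h u) := by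
    rw [htp_apply]
    refine ext fun p a b s => ?_
    rw [sum_eval]
    cases p with
    | zero => simp only [delta_zero, sum_const_zero]
    | succ p =>
      simp only [delta_succ, sum_eval, map_sum, smul_sum]
      exact sum_comm
  rw [h1, htp_apply, htp_apply, ← comp_apply h', map_sum, ← sum_add_distrib, ← sum_add_distrib]
  exact sum_eq_zero fun c _ => first_delta S c _ h hm h' u

lemma glue_map_mul {m n k : ℤ} (h : m + n = k) (φ : DGMod.Hom R.toDGMod T.toDGMod m)
    (u : CechHom (restrFamily U Q) (restrFamily U R) n) :
    glue S (mul h (mapCochain U φ) u) = DGMod.comp h φ (glue S u) := by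
  rw [glue_apply, glue_apply, map_sum]
  refine sum_congr rfl fun c _ => ?_
  rw [atPt_map_mul, gex_canon_comp]

lemma glue_mul_map {m n k : ℤ} (h : m + n = k) (u : CechHom (restrFamily U R) (restrFamily U T) m)
    (φ : DGMod.Hom Q.toDGMod R.toDGMod n) :
    glue S (mul h u (mapCochain U φ)) = DGMod.comp h (glue S u) φ := by
  rw [glue_apply, glue_apply, map_sum, LinearMap.sum_apply]
  refine sum_congr rfl fun c _ => ?_
  rw [atPt_mul_map, gex_comp_canon]

lemma map_mem_fil {n : ℤ} {k : ℕ} {φ : DGMod.Hom Q.toDGMod R.toDGMod n}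
    (hφ : φ ∈ CohesiveModule.homFil k) : mapCochain U φ ∈ fil k := fun p a b s => by
  cases p with
  | zero => exact LHom.cast_mem_fil _ (canon_mem_fil _ _ hφ)
  | succ p => exact zero_mem _

lemma atPt_mem_fil {E F : CohesiveFamily 𝒜 U} {n : ℤ} {k : ℕ} {u : CechHom E F n} (hu : u ∈ fil k)
    (c : ι) : atPt c u ∈ LHom.fil k := LHom.cast_mem_fil _ (LHom.rs_mem_fil _ (hu _ _ _ _))

lemma glue_mem_fil {n : ℤ} {k : ℕ} {u : CechHom (restrFamily U Q) (restrFamily U R) n} (hu : u ∈ fil k) :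
    glue S u ∈ CohesiveModule.homFil k := by
  rw [glue_apply]
  exact sum_mem fun c _ => gex_mem S c (atPt_mem_fil hu c)

lemma htp_mem_fil {E : CohesiveFamily 𝒜 U} {n' n : ℤ} (h : n' + 1 = n) {k : ℕ}
    {u : CechHom E (restrFamily U Q) n} (hu : u ∈ fil k) : htp S h u ∈ fil k := by
  rw [htp_apply]
  exact sum_mem fun c _ => first_mem_fil S c _ h hu

lemma mul_zero_left {E F G : CohesiveFamily 𝒜 U} {m n k : ℤ} (h : m + n = k) {u : CechHom F G m}
    (hu : ∀ a b s, u 0 a b s = 0) (v : CechHom E F n) (a b : ι) (s : Simplex ι 0 a b) :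
    mul h u v 0 a b s = 0 := by
  rw [mul_apply]
  refine sum_eq_zero ?_
  rintro ⟨⟨i, j⟩, hx⟩ -
  obtain rfl : i = 0 := by have : i + j = 0 := by simpa using hx
                           omega
  simp only [cup, hu, map_zero, LinearMap.zero_apply, smul_zero]

lemma mul_zero_right {E F G : CohesiveFamily 𝒜 U} {m n k : ℤ} (h : m + n = k) (u : CechHom F G m)
    {v : CechHom E F n} (hv : ∀ a b s, v 0 a b s = 0) (a b : ι) (s : Simplex ι 0 a b) :
    mul h u v 0 a b s = 0 := by
  rw [mul_apply]
  refine sum_eq_zero ?_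
  rintro ⟨⟨i, j⟩, hx⟩ -
  obtain rfl : j = 0 := by have : i + j = 0 := by simpa using hx
                           omega
  simp only [cup, hv, map_zero, smul_zero]

lemma atPt_twCat_d {M N : TwistedComplex 𝒜 U} {n m : ℤ} (h : n + 1 = m) (h' : 1 + n = m)
    (u : CechHom M.E N.E n) (c : ι) : atPt c (dInt h u + delta h u + mul h' N.a u -
        (n.negOnePow : ℤ) • mul h u M.a) = LHom.d h (atPt c u) := by
  rw [map_sub, map_add, map_add, map_zsmul, atPt_apply, atPt_apply, atPt_apply, atPt_apply, atPt_apply,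
    delta_zero, mul_zero_left h' N.a_zero, mul_zero_right h u M.a_zero, dInt_apply]
  simp only [map_zero, add_zero, smul_zero, sub_zero, Nat.cast_zero, Int.negOnePow_zero, one_smul]
  rw [LHom.rs_d, LHom.cast_d, LHom.d_cast]

lemma d_glue {n m : ℤ} (h : n + 1 = m) (h' : 1 + n = m) {k : ℕ}
    {u : CechHom (restrFamily U Q) (restrFamily U R) n} (hu : u ∈ fil k) :
    DGMod.d h (glue S u) - glue S (dInt h u + delta h u + mul h' (twistCochain U R) u -
        (n.negOnePow : ℤ) • mul h u (twistCochain U Q)) ∈ CohesiveModule.homFil (k + 1) := by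
  rw [glue_apply, glue_apply, map_sum, ← sum_sub_distrib]
  refine sum_mem fun c _ => ?_
  have h1 := atPt_twCat_d (M := Q.toTwisted U) (N := R.toTwisted U) h h' u c
  refine mem_of_eq (congrArg (fun y => DGMod.d h (gex S c (atPt c u)) - gex S c y) h1) ?_
  exact d_gex S c h (atPt_mem_fil hu c)

lemma htp_homotopy {l n m : ℤ} (hl : l + 1 = n) (hl' : 1 + l = n) (hm : n + 1 = m) (hm' : 1 + n = m)
    {k : ℕ} {u : CechHom (restrFamily U Q) (restrFamily U R) n} (hu : u ∈ fil k) :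
    u - mapCochain U (glue S u) - (dInt hl (htp S hl u) + delta hl (htp S hl u) +
      mul hl' (twistCochain U R) (htp S hl u) - (l.negOnePow : ℤ) • mul hl (htp S hl u) (twistCochain U Q)) -
      htp S hm (dInt hm u + delta hm u + mul hm' (twistCochain U R) u -
        (n.negOnePow : ℤ) • mul hm u (twistCochain U Q)) ∈ fil (k + 1) := by
  have h1 := neg_mem (htp_dInt S hl hm hu)
  have h2 := htp_delta S hl hm hl' u
  refine mem_of_eq ?_ h1
  rw [map_sub, map_add, map_add, map_zsmul, htp_twist_mul, sum_first_mul_twist S hl hm, smul_add, smul_smul,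
    ← Units.val_mul, Int.units_mul_self, Units.val_one, one_smul, ← sub_eq_zero]
  have h3 : n.negOnePow = -l.negOnePow := by rw [← hl, Int.negOnePow_succ]
  rw [h3, Units.val_neg, neg_smul]
  refine Eq.trans ?_ (neg_eq_zero.2 h2)
  abel

end CechHom

variable (𝒜 U) in
/-- The partition of unity provides a retraction of the twisting functor. -/
def twistingTransfer : DGCat.FilTransfer (twistingFunctor 𝒜 U)
    (cohesiveFilt (𝒜.obj ⊤)) (twFilt 𝒜 U) where
  ε := CechHom.glue S
  K h := CechHom.htp S h
  ε_map f := CechHom.glue_map S f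
  K_map h f := CechHom.htp_map S h f
  ε_left h a x := CechHom.glue_map_mul S h a x
  ε_right h x a := CechHom.glue_mul_map S h x a
  K_left h hn hk h' a x := CechHom.htp_map_mul S h hn hk h' a x
  K_right h hm hk h' x a := CechHom.htp_mul_map S h hm hk h' x a
  map_fil hf := CechHom.map_mem_fil hf
  ε_fil hx := CechHom.glue_mem_fil S hx
  K_fil h _ _ hx := CechHom.htp_mem_fil S h hx
  d_ε h _ _ hx := CechHom.d_glue S h (by omega) hx
  htpy hl hm _ _ hx := CechHom.htp_homotopy S hl (by omega) hm (by omega) hx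

end Transfer

/-! ### Free cohesive modules -/

lemma isInternal_of_grProj {R M : Type*} [CommRing R] [AddCommGroup M] [Module R M]
    {gr : ℤ → Submodule R M} (π : ℤ → M →ₗ[R] M) (D : Finset ℤ) (h1 : ∀ n v, π n v ∈ gr n)
    (h2 : ∀ n, ∀ v ∈ gr n, π n v = v) (h3 : ∀ n m, n ≠ m → ∀ v ∈ gr m, π n v = 0)
    (h4 : ∀ v, ∑ n ∈ D, π n v = v) : DirectSum.IsInternal gr := by
  rw [DirectSum.isInternal_submodule_iff_iSupIndep_and_iSup_eq_top]
  refine ⟨?_, ?_⟩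
  · rw [iSupIndep_def]
    intro i
    rw [Submodule.disjoint_def]
    intro x hx hx'
    have h5 : ⨆ j, ⨆ (_ : j ≠ i), gr j ≤ LinearMap.ker (π i) :=
      iSup₂_le fun j hj v hv => h3 i j hj.symm v hv
    rw [← h2 i x hx]
    exact h5 hx'
  · rw [eq_top_iff]
    rintro x -
    rw [← h4 x]
    exact sum_mem fun n _ => Submodule.mem_iSup_of_mem n (h1 n x)

section piProj

variable {R : Type*} [CommRing R] {κ : Type*} (deg : κ → ℤ)

def piProj (n : ℤ) : (κ → R) →ₗ[R] (κ → R) :=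
  LinearMap.pi fun x => if deg x = n then LinearMap.proj x else 0

lemma piProj_apply (n : ℤ) (v : κ → R) (x : κ) : piProj deg n v x = if deg x = n then v x else 0 := by
  simp only [piProj, LinearMap.pi_apply]
  split_ifs <;> rfl

lemma piProj_mem (n : ℤ) (v : κ → R) : piProj deg n v ∈ piGr R deg n := fun x hx => by
  rw [piProj_apply, if_neg hx]

lemma piProj_eq {n : ℤ} {v : κ → R} (hv : v ∈ piGr R deg n) : piProj deg n v = v := by
  ext x
  rw [piProj_apply]
  split_ifs with h
  · rfl
  · exact (hv x h).symm

lemma piProj_ne {n m : ℤ} (h : n ≠ m) {v : κ → R} (hv : v ∈ piGr R deg m) : piProj deg n v = 0 := by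
  ext x
  rw [piProj_apply]
  split_ifs with h'
  · exact hv x fun h'' => h (h'.symm.trans h'')
  · rfl

lemma sum_piProj [Fintype κ] (v : κ → R) : ∑ n ∈ Finset.univ.image deg, piProj deg n v = v := by
  ext x
  simp [Finset.sum_apply, piProj_apply]

lemma piGr_isInternal [Fintype κ] : DirectSum.IsInternal (piGr R deg) :=
  isInternal_of_grProj (piProj deg) (Finset.univ.image deg) (piProj_mem deg) (fun n v => piProj_eq deg)
    (fun n m h v => piProj_ne deg h) (sum_piProj deg)

lemma IsDeg.piProj_comm [Fintype κ] {p : (κ → R) →ₗ[R] (κ → R)} (hp : IsDeg (piGr R deg) (piGr R deg) 0 p)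
    (n : ℤ) (v : κ → R) : piProj deg n (p v) = p (piProj deg n v) := by
  conv_lhs => rw [← sum_piProj deg v, map_sum, map_sum]
  by_cases h : n ∈ Finset.univ.image deg
  · rw [Finset.sum_eq_single n]
    · exact piProj_eq deg (hp (add_zero n) (piProj_mem deg n v))
    · intro m _ hm
      exact piProj_ne deg hm.symm (hp (add_zero m) (piProj_mem deg m v))
    · exact fun h' => absurd h h'
  · rw [Finset.sum_eq_zero]
    · have h1 : piProj deg n v = 0 := by
        ext x
        rw [piProj_apply, if_neg fun hx => h (Finset.mem_image.2 ⟨x, Finset.mem_univ _, hx⟩)]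
        rfl
      rw [h1, map_zero]
    · intro m hm
      exact piProj_ne deg (fun h' => h (by rw [h']; exact hm)) (hp (add_zero m) (piProj_mem deg m v))

lemma range_isInternal [Fintype κ] {p : (κ → R) →ₗ[R] (κ → R)}
    (hp : IsDeg (piGr R deg) (piGr R deg) 0 p) :
    DirectSum.IsInternal fun n => (piGr R deg n).comap (LinearMap.range p).subtype := by
  refine isInternal_of_grProj (fun n => (piProj deg n).restrict (p := LinearMap.range p)
    (q := LinearMap.range p) ?_) (Finset.univ.image deg) (fun n v => piProj_mem deg n v.1)
    (fun n v hv => Subtype.ext (piProj_eq (v := v.1) deg hv))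
    (fun n m h v hv => Subtype.ext (piProj_ne (v := v.1) deg h hv))
    fun v => Subtype.ext ?_
  · rintro _ ⟨v, rfl⟩
    exact ⟨piProj deg n v, (hp.piProj_comm deg n v).symm⟩
  · rw [AddSubmonoidClass.coe_finsetSum]
    exact sum_piProj deg (v : κ → R)

end piProj

namespace ScalarExt

variable {A B : DGAlg.{u}} {M N L : Type u} [AddCommGroup M] [Module A.Z M] [AddCommGroup N]
  [Module A.Z N] [AddCommGroup L] [Module A.Z L] (f : Hom A B)

def extL (g : M →ₗ[A.Z] N) : ScalarExt f M →ₗ[(B.A)ᵐᵒᵖ] ScalarExt f N :=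
  lift f (AddMonoidHom.mk' (fun e => mk f 1 (g e)) fun e e' => by rw [map_add, mk_add]) fun z e => by
    change mk f 1 (g (z • e)) = _
    rw [map_smul, mk_smul, mul_one]
    exact (mk_mul f 1 _ (g e)).symm ▸ by rw [one_mul]

variable {f}

lemma extL_mk (g : M →ₗ[A.Z] N) (b : B.A) (e : M) : extL f g (mk f b e) = mk f b (g e) := by
  rw [mk_eq f b e, map_smul, mk_eq f b (g e)]
  congr 1
  exact (lift_mk f _ _ 1 e).trans (by rw [MulOpposite.op_one, one_smul]; rfl)

lemma extL_comp (h : N →ₗ[A.Z] L) (g : M →ₗ[A.Z] N) (x : ScalarExt f M) :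
    extL f h (extL f g x) = extL f (h ∘ₗ g) x := by
  induction x using ScalarExt.induction with
  | h0 => simp
  | hm b e => rw [extL_mk, extL_mk, extL_mk]; rfl
  | ha x y hx hy => simp only [map_add, hx, hy]

lemma extL_id (x : ScalarExt f M) : extL f (LinearMap.id : M →ₗ[A.Z] M) x = x := by
  induction x using ScalarExt.induction with
  | h0 => simp
  | hm b e => rw [extL_mk]; rfl
  | ha x y hx hy => simp only [map_add, hx, hy]

lemma extL_add (g h : M →ₗ[A.Z] N) (x : ScalarExt f M) : extL f (g + h) x = extL f g x + extL f h x := by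
  induction x using ScalarExt.induction with
  | h0 => simp
  | hm b e => rw [extL_mk, extL_mk, extL_mk, LinearMap.add_apply, mk_add]
  | ha x y hx hy => simp only [map_add, hx, hy]; abel

lemma extL_zero (x : ScalarExt f M) : extL f (0 : M →ₗ[A.Z] N) x = 0 := by
  have h := extL_add (f := f) (0 : M →ₗ[A.Z] N) 0 x
  rw [add_zero] at h
  simpa using h

lemma coord_extL (l : N →ₗ[A.Z] A.Z) (g : M →ₗ[A.Z] N) (x : ScalarExt f M) :
    coord f l (extL f g x) = coord f (l ∘ₗ g) x := by
  induction x using ScalarExt.induction with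
  | h0 => simp
  | hm b e => rw [extL_mk, coord_mk, coord_mk]; rfl
  | ha x y hx hy => simp only [map_add, hx, hy]

lemma coord_smul (l : M →ₗ[A.Z] A.Z) (x : ScalarExt f M) (b : B.A) :
    coord f l (x <• b) = coord f l x * b := map_smul _ _ _

lemma coord_zero (x : ScalarExt f M) : coord f (0 : M →ₗ[A.Z] A.Z) x = 0 := by
  induction x using ScalarExt.induction with
  | h0 => simp
  | hm b e => rw [coord_mk]; simp
  | ha x y hx hy => simp only [map_add, hx, hy, add_zero]

lemma extL_mem_homFil {𝓜 : ℤ → Submodule A.Z M} {𝓝 : ℤ → Submodule A.Z N} {n : ℤ} {g : M →ₗ[A.Z] N}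
    (hg : IsDeg 𝓜 𝓝 n g) : extL f g ∈ homFil f f 𝓜 𝓝 0 n := fun m e he => by
  rw [extL_mk]
  exact mk_mem_filGr B.one_mem (hg rfl he) (by simp) le_rfl

section pi

variable {κ : Type}

variable (A) in
def piForm (y : κ) : (κ → A.Z) →ₗ[A.Z] A.Z := LinearMap.proj y

lemma piForm_apply (y : κ) (e : κ → A.Z) : piForm A y e = e y := rfl

variable [Fintype κ] [DecidableEq κ]

lemma eq_sum_coord_pi (x : ScalarExt f (κ → A.Z)) :
    x = ∑ y, mk f (coord f (piForm A y) x) (Pi.single y 1) := by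
  induction x using ScalarExt.induction with
  | h0 => simp [zero_mk]
  | ha x y hx hy =>
    conv_lhs => rw [hx, hy]
    simp only [map_add, add_mk, Finset.sum_add_distrib]
  | hm b e =>
    have he : e = ∑ y, e y • (Pi.single y 1 : κ → A.Z) := by
      ext z
      simp [Finset.sum_apply, Pi.single_apply]
    conv_lhs => rw [he]
    refine (map_sum (AddMonoidHom.mk' (mk f b) (mk_add f b)) _ _).trans
      (Finset.sum_congr rfl fun y _ => ?_)
    exact mk_smul f b (e y) (Pi.single y 1)

lemma ext_pi {x x' : ScalarExt f (κ → A.Z)}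
    (h : ∀ y, coord f (piForm A y) x = coord f (piForm A y) x') : x = x' := by
  rw [eq_sum_coord_pi x, eq_sum_coord_pi x']
  exact Finset.sum_congr rfl fun y _ => by rw [h]

lemma coord_single (y z : κ) (b : B.A) :
    coord f (piForm A z) (mk f b (Pi.single y 1)) = if z = y then b else 0 := by
  rw [coord_mk, piForm_apply, Pi.single_apply]
  split_ifs <;> simp

lemma coord_mem {deg : κ → ℤ} {n : ℤ} {x : ScalarExt f (κ → A.Z)} (hx : x ∈ gr f (piGr A.Z deg) n)
    (y : κ) : (∀ j : ℕ, (j : ℤ) + deg y = n → coord f (piForm A y) x ∈ B.gr j) ∧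
      ((∀ j : ℕ, (j : ℤ) + deg y ≠ n) → coord f (piForm A y) x = 0) := by
  refine gr_induction f (P := fun x => (∀ j : ℕ, (j : ℤ) + deg y = n →
    coord f (piForm A y) x ∈ B.gr j) ∧ ((∀ j : ℕ, (j : ℤ) + deg y ≠ n) →
    coord f (piForm A y) x = 0)) hx ?_ ?_ ?_
  · exact ⟨fun j _ => by rw [map_zero]; exact zero_mem _, fun _ => map_zero _⟩
  · intro j m b e hb he h
    by_cases hy : deg y = m
    · refine ⟨fun i hi => ?_, fun h' => absurd h (hy ▸ h' j)⟩
      obtain rfl : i = j := by omega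
      rw [coord_mk]
      have := B.mul_mem ((B.mem_gr_zero _).2 ⟨f.zero (piForm A y e), rfl⟩) hb
      rwa [zero_add] at this
    · have h0 : coord f (piForm A y) (mk f b e) = 0 := by
        rw [coord_mk, piForm_apply, he y hy, map_zero, map_zero, zero_mul]
      rw [h0]
      exact ⟨fun _ _ => zero_mem _, fun _ => rfl⟩
  · intro x x' hx hx'
    rw [map_add]
    exact ⟨fun j hj => add_mem (hx.1 j hj) (hx'.1 j hj), fun h => by rw [hx.2 h, hx'.2 h, add_zero]⟩

end pi

end ScalarExt

lemma DGCat.tof_sum {C : DGCat.{u, v}} {X Y : C.Obj} {n : ℤ} {σ : Type*} (s : Finset σ)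
    (f : σ → C.Hom X Y n) : tof (∑ x ∈ s, f x) = ∑ x ∈ s, tof (f x) := map_sum _ _ _

namespace CohesiveModule

open ScalarExt

variable {A : DGAlg.{u}}

/-- The morphism given by a linear map of the underlying graded modules. -/
def mapHom {Q R : CohesiveModule A} {n : ℤ} (g : Q.E →ₗ[A.Z] R.E) (hg : IsDeg Q.gr R.gr n g) :
    DGMod.Hom Q.toDGMod R.toDGMod n :=
  ⟨extL (Hom.id A) g, ScalarExt.mem_homFil_zero.1 (extL_mem_homFil hg)⟩

section free

variable {κ : Type} [Fintype κ] [DecidableEq κ] (deg : κ → ℤ)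

variable (A) in
def freeConn : ScalarExt (Hom.id A) (κ → A.Z) →ₗ[ℂ] ScalarExt (Hom.id A) (κ → A.Z) where
  toFun x := ∑ y, ScalarExt.mk (Hom.id A) ((deg y).negOnePow • A.d (coord (Hom.id A) (piForm A y) x))
    (Pi.single y 1)
  map_add' x x' := by simp only [map_add, smul_add, add_mk, Finset.sum_add_distrib]
  map_smul' c x := by
    rw [RingHom.id_apply, Finset.smul_sum]
    refine Finset.sum_congr rfl fun y _ => ?_
    have h : coord (Hom.id A) (piForm A y) (c • x) =
        c • coord (Hom.id A) (piForm A y) x := by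
      have h1 : ∀ x : ScalarExt (Hom.id A) (κ → A.Z), c • x = x <• (c • (1 : A.A)) := fun x => by
        rw [MulOpposite.op_smul, smul_assoc, MulOpposite.op_one, one_smul]
      rw [h1, map_smul]
      change coord (Hom.id A) (piForm A y) x * (c • (1 : A.A)) = _
      rw [mul_smul_comm, mul_one]
    rw [h, map_smul, csmul_mk]
    congr 1
    simp only [Units.smul_def]
    exact smul_comm _ _ _

lemma coord_freeConn (x : ScalarExt (Hom.id A) (κ → A.Z)) (y : κ) :
    coord (Hom.id A) (piForm A y) (freeConn A deg x) =
      (deg y).negOnePow • A.d (coord (Hom.id A) (piForm A y) x) := by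
  refine (map_sum (coord (Hom.id A) (piForm A y)) _ _).trans ?_
  simp [coord_single]

variable (A) in
/-- The free cohesive module with generators in the given degrees. -/
def free : CohesiveModule A where
  E := κ → A.Z
  gr := piGr A.Z deg
  internal := piGr_isInternal deg
  finite := inferInstance
  projective := inferInstance
  conn := freeConn A deg
  conn_mem {k x} hx := by
    refine sum_mem fun y _ => ?_
    by_cases h : ∃ j : ℕ, (j : ℤ) + deg y = k
    · obtain ⟨j, hj⟩ := h
      refine ScalarExt.mk_mem _ _ (j := j + 1) (n := deg y) ?_ (single_mem_piGr deg y 1) (by push_cast; omega)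
      rw [Units.smul_def]
      exact zsmul_mem (A.d_mem ((coord_mem hx y).1 j hj)) _
    · rw [(coord_mem hx y).2 fun j hj => h ⟨j, hj⟩, map_zero, smul_zero, zero_mk]
      exact zero_mem _
  leibniz {k x} a hx := by
    refine ext_pi fun y => ?_
    rw [coord_freeConn, map_add, Units.smul_def, Units.smul_def, map_zsmul, coord_smul, coord_smul,
      coord_smul, coord_freeConn]
    by_cases h : ∃ j : ℕ, (j : ℤ) + deg y = k
    · obtain ⟨j, rfl⟩ := h
      rw [A.d_mul a ((coord_mem hx y).1 j rfl), smul_add, smul_smul, Int.negOnePow_add, Units.val_mul,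
        negOnePow_natCast, mul_comm, Units.smul_def, smul_mul_assoc]
    · rw [(coord_mem hx y).2 fun j hj => h ⟨j, hj⟩]
      simp
  conn_conn x := by
    refine ext_pi fun y => ?_
    rw [coord_freeConn, coord_freeConn, Units.smul_def, Units.smul_def, map_zsmul, A.d_d, smul_zero,
      smul_zero, map_zero]

variable (A) in
abbrev unit : CohesiveModule A := free A fun _ : Unit => 0

variable (A) in
def inclL (x : κ) : (Unit → A.Z) →ₗ[A.Z] (κ → A.Z) :=
  LinearMap.single A.Z (fun _ => A.Z) x ∘ₗ LinearMap.proj ()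

variable (A) in
def projL (x : κ) : (κ → A.Z) →ₗ[A.Z] (Unit → A.Z) := LinearMap.pi fun _ => LinearMap.proj x

lemma inclL_deg (x : κ) : IsDeg (unit A).gr (free A deg).gr (deg x) (inclL A x) := fun n m h v hv y hy => by
  change (Pi.single x (v ()) : κ → A.Z) y = 0
  rw [Pi.single_apply]
  split_ifs with h'
  · subst h'
    exact hv () (by dsimp only; omega)
  · rfl

lemma projL_deg (x : κ) : IsDeg (free A deg).gr (unit A).gr (-deg x) (projL A x) := fun n m h v hv y hy =>
  hv x (by dsimp only at hy; omega)

lemma piForm_inclL (x y : κ) : piForm A y ∘ₗ inclL A x = if y = x then piForm A () else 0 := by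
  refine LinearMap.ext fun v => ?_
  change (Pi.single x (v ()) : κ → A.Z) y = _
  rw [Pi.single_apply]
  split_ifs <;> rfl

def incl (x : κ) : DGMod.Hom (unit A).toDGMod (free A deg).toDGMod (deg x) :=
  mapHom (inclL A x) (inclL_deg deg x)

def prj (x : κ) : DGMod.Hom (free A deg).toDGMod (unit A).toDGMod (-deg x) :=
  mapHom (projL A x) (projL_deg deg x)

lemma d_incl (x : κ) {m : ℤ} (h : deg x + 1 = m) : DGMod.d h (incl (A := A) deg x) = 0 := by
  refine Subtype.ext (LinearMap.ext fun (v : ScalarExt (Hom.id A) (Unit → A.Z)) =>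
    ext_pi (κ := κ) fun y => ?_)
  change coord (Hom.id A) (piForm A y) (freeConn A deg (extL (Hom.id A) (inclL A x) v) -
    (deg x).negOnePow • extL (Hom.id A) (inclL A x) (freeConn A (fun _ : Unit => 0) v)) = coord _ _ 0
  rw [map_sub, coord_freeConn, Units.smul_def, Units.smul_def, map_zsmul, coord_extL, coord_extL,
    piForm_inclL, map_zero]
  split_ifs with h
  · subst h
    rw [coord_freeConn, Int.negOnePow_zero, one_smul, sub_self]
  · simp [coord_zero]

lemma d_prj (x : κ) {m : ℤ} (h : -deg x + 1 = m) : DGMod.d h (prj (A := A) deg x) = 0 := by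
  refine Subtype.ext (LinearMap.ext fun (v : ScalarExt (Hom.id A) (κ → A.Z)) =>
    ext_pi (κ := Unit) fun y => ?_)
  change coord (Hom.id A) (piForm A ()) (freeConn A (fun _ : Unit => 0) (extL (Hom.id A) (projL A x) v) -
    (-deg x).negOnePow • extL (Hom.id A) (projL A x) (freeConn A deg v)) = coord _ _ 0
  have h1 : piForm A () ∘ₗ projL A x = piForm A x := rfl
  rw [map_sub, coord_freeConn, Units.smul_def, Units.smul_def, map_zsmul, coord_extL, coord_extL, h1,
    coord_freeConn, Units.smul_def, smul_smul, Int.negOnePow_zero, Units.val_one, one_smul,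
    Int.negOnePow_neg, ← Units.val_mul, Int.units_mul_self, Units.val_one, one_smul, sub_self, map_zero]

lemma prj_incl_self (x : κ) (h : -deg x + deg x = 0) :
    DGMod.comp h (prj (A := A) deg x) (incl deg x) = DGMod.idHom (unit A).toDGMod := by
  refine Subtype.ext (LinearMap.ext fun v => (extL_comp (projL A x) (inclL A x) v).trans ?_)
  have : projL A x ∘ₗ inclL A x = LinearMap.id := by
    refine LinearMap.ext fun v => ?_
    ext u
    change (Pi.single x (v ()) : κ → A.Z) x = v u
    rw [Pi.single_eq_same]
  rw [this]
  exact extL_id (M := Unit → A.Z) v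

lemma prj_incl_ne {x y : κ} (hxy : x ≠ y) {m : ℤ} (h : -deg x + deg y = m) :
    DGMod.comp h (prj (A := A) deg x) (incl deg y) = 0 := by
  refine Subtype.ext (LinearMap.ext fun v => (extL_comp (projL A x) (inclL A y) v).trans ?_)
  have : projL A x ∘ₗ inclL A y = 0 := by
    refine LinearMap.ext fun v => ?_
    ext u
    change (Pi.single y (v ()) : κ → A.Z) x = 0
    rw [Pi.single_eq_of_ne hxy]
  rw [this]
  exact extL_zero v

lemma sum_extL_inclL (v : ScalarExt (Hom.id A) (κ → A.Z)) :
    ∑ x, extL (Hom.id A) (inclL A x) (extL (Hom.id A) (projL A x) v) = v := by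
  refine ext_pi fun y => ?_
  rw [map_sum]
  refine (Finset.sum_congr rfl fun x _ => ?_).trans (Finset.sum_ite_eq Finset.univ y
    fun _ => coord (Hom.id A) (piForm A y) v) |>.trans (if_pos (Finset.mem_univ y))
  rw [coord_extL, piForm_inclL]
  split_ifs with h
  · subst h
    rw [coord_extL]
    rfl
  · rw [coord_zero]

lemma sum_incl_prj (h : ∀ x, deg x + -deg x = 0) :
    ∑ x, DGMod.comp (h x) (incl (A := A) deg x) (prj deg x) = DGMod.idHom (free A deg).toDGMod := by
  refine Subtype.ext (LinearMap.ext fun v => ?_)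
  rw [AddSubmonoidClass.coe_finsetSum, LinearMap.sum_apply]
  exact sum_extL_inclL v

end free

section tot

open DGCat

variable (A)

def unitObj : (cohesiveCat A).tot.UnitObj A.Z where
  one := unit A
  z := AddMonoidHom.mk' (fun a => tof (C := cohesiveCat A) (zid (unit A) a)) fun a b =>
    (congrArg (tof (C := cohesiveCat A)) (zid_add a b)).trans (tof_add _ _)
  z_one := congrArg (tof (C := cohesiveCat A)) (show zid (unit A) 1 = DGMod.idHom (unit A).toDGMod from
    Subtype.ext (LinearMap.ext fun _ => LHom.zmul_one _))
  z_mul a b := by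
    refine Eq.trans ?_ (tcomp_tof (C := cohesiveCat A) (zero_add 0) (zid (unit A) a) (zid (unit A) b)).symm
    refine congrArg (tof (C := cohesiveCat A)) (Subtype.ext (LinearMap.ext fun x => ?_))
    change x <• algebraMap A.Z A.A (a * b) = (x <• algebraMap A.Z A.A b) <• algebraMap A.Z A.A a
    rw [smul_smul, ← MulOpposite.op_mul, mul_comm a b, map_mul]
  z_gr a := tof_mem_gr (C := cohesiveCat A) (zid (unit A) a)

/-- Free cohesive modules are sums of shifts of the unit object. -/
def freeOn {κ : Type} [Fintype κ] [DecidableEq κ] (deg : κ → ℤ) :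
    TotCat.FreeOn (unitObj A) deg (free A deg : (cohesiveCat A).tot.Obj) where
  e x := tof (C := cohesiveCat A) (X := unit A) (incl deg x)
  l x := tof (C := cohesiveCat A) (Y := unit A) (prj deg x)
  e_gr x := tof_mem_gr (C := cohesiveCat A) (incl deg x)
  l_gr x := tof_mem_gr (C := cohesiveCat A) (prj deg x)
  l_e x y := by
    refine (tcomp_tof (C := cohesiveCat A) rfl (prj deg x) (incl deg y)).trans ?_
    split_ifs with h
    · subst h
      refine (tcomp_tof (C := cohesiveCat A) rfl (prj deg x) (incl deg x)).symm.trans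
        ((tcomp_tof (C := cohesiveCat A) (neg_add_cancel (deg x)) (prj deg x) (incl deg x)).trans ?_)
      exact congrArg (tof (C := cohesiveCat A)) (prj_incl_self deg x (neg_add_cancel (deg x)))
    · exact (congrArg (tof (C := cohesiveCat A)) (prj_incl_ne deg h rfl)).trans tof_zero
  sum_e_l := by
    refine (Finset.sum_congr rfl fun x _ => tcomp_tof (C := cohesiveCat A) (add_neg_cancel (deg x))
      (incl deg x) (prj deg x)).trans ?_
    refine (tof_sum (C := cohesiveCat A) Finset.univ fun x =>
      DGMod.comp (add_neg_cancel (deg x)) (incl (A := A) deg x) (prj deg x)).symm.trans ?_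
    exact congrArg (tof (C := cohesiveCat A)) (sum_incl_prj deg fun x => add_neg_cancel (deg x))
  D_e x := (tD_tof (C := cohesiveCat A) rfl (incl deg x)).trans
    ((congrArg (tof (C := cohesiveCat A)) (d_incl deg x rfl)).trans tof_zero)
  D_l x := (tD_tof (C := cohesiveCat A) rfl (prj deg x)).trans
    ((congrArg (tof (C := cohesiveCat A)) (d_prj deg x rfl)).trans tof_zero)

end tot

end CohesiveModule

/-! ### Matrices, reduction and splitting of idempotents -/

namespace ScalarExt

variable {A B : DGAlg.{u}} {M N : Type u} [AddCommGroup M] [Module A.Z M] [AddCommGroup N]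
  [Module A.Z N] {f : Hom A B}

lemma extL_sum {σ : Type*} (s : Finset σ) (g : σ → M →ₗ[A.Z] N) (x : ScalarExt f M) :
    extL f (∑ a ∈ s, g a) x = ∑ a ∈ s, extL f (g a) x :=
  map_sum (AddMonoidHom.mk' (fun g : M →ₗ[A.Z] N => extL f g x) fun g h => extL_add g h x) _ _

lemma zmul_eq_extL (z : A.Z) (x : ScalarExt f M) :
    zmul f M (f.zero z) x = extL f (z • LinearMap.id : M →ₗ[A.Z] M) x := by
  induction x using ScalarExt.induction with
  | h0 => simp
  | hm b e =>
    rw [extL_mk, zmul_apply, mk_mul, ← Algebra.commutes]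
    exact (mk_smul f b z e).symm
  | ha x y hx hy => simp only [map_add, hx, hy]

lemma mem_filGr_one {n : ℤ} (hn : n ≠ 0) {x : ScalarExt f (Unit → A.Z)}
    (hx : x ∈ gr f (piGr A.Z fun _ : Unit => 0) n) : x ∈ filGr f (piGr A.Z fun _ : Unit => 0) 1 n :=
  gr_induction f (P := fun x => x ∈ filGr f (piGr A.Z fun _ : Unit => 0) 1 n) hx (zero_mem _)
    (fun j m b e hb he h => by
      by_cases hm : m = 0
      · exact mk_mem_filGr hb he h (by omega)
      · have : e = 0 := funext fun u => he u (Ne.symm hm)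
        rw [this, mk_zero]
        exact zero_mem _)
    fun _ _ => add_mem

lemma filGr_one_eq_zero {x : ScalarExt f (Unit → A.Z)}
    (hx : x ∈ filGr f (piGr A.Z fun _ : Unit => 0) 1 0) : x = 0 :=
  filGr_induction (P := fun x => x = 0) hx rfl
    (fun j m b e hb he h hj => by
      have : e = 0 := funext fun u => he u (by dsimp only; omega)
      rw [this, mk_zero])
    fun x y hx hy => by rw [hx, hy, add_zero]

end ScalarExt

lemma DGCat.curv_tof {C : DGCat.{u, v}} {F : C.Obj} (p : C.Hom F F 0) (t : C.Hom F F 1) :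
    C.tot.curv (tof p) (tof t) = tof (C.comp (zero_add 2) p (C.comp one_add_one_eq_two
      (C.d (zero_add 1) p) (C.comp (add_zero 1) (C.d (zero_add 1) p) p)) +
      C.comp (zero_add 2) p (C.comp (add_zero 2) (C.d one_add_one_eq_two t) p) +
      C.comp one_add_one_eq_two t t) := by
  change tcomp (tof p) (tcomp (tD (tof p)) (tcomp (tD (tof p)) (tof p))) +
    tcomp (tof p) (tcomp (tD (tof t)) (tof p)) + tcomp (tof t) (tof t) = _
  rw [tD_tof (zero_add 1), tD_tof one_add_one_eq_two, tcomp_tof (add_zero 1), tcomp_tof one_add_one_eq_two,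
    tcomp_tof (zero_add 2), tcomp_tof (add_zero 2), tcomp_tof (zero_add 2), tcomp_tof one_add_one_eq_two,
    tof_add, tof_add]

namespace CohesiveModule

open ScalarExt DGCat

variable {A : DGAlg.{u}}

section mat

variable {κ κ' : Type} [Fintype κ] [DecidableEq κ] [Fintype κ'] [DecidableEq κ'] {deg : κ → ℤ} {deg' : κ' → ℤ}

def freeMap {n : ℤ} (f : (κ → A.Z) →ₗ[A.Z] (κ' → A.Z)) (hf : IsDeg (piGr A.Z deg) (piGr A.Z deg') n f) :
    DGMod.Hom (free A deg).toDGMod (free A deg').toDGMod n :=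
  mapHom (Q := free A deg) (R := free A deg') f hf

lemma incl_comp_zid (x : κ) (c : A.Z) {n : ℤ} (h : deg x + 0 = n)
    (hc : IsDeg (unit A).gr (free A deg).gr n (c • inclL A x)) :
    DGMod.comp h (incl deg x) (zid (unit A) c) = mapHom (c • inclL A x) hc := by
  refine Subtype.ext (LinearMap.ext fun (v : ScalarExt (Hom.id A) (Unit → A.Z)) => ?_)
  change extL (Hom.id A) (inclL A x) (zmul (Hom.id A) (Unit → A.Z) ((Hom.id A).zero c) v) =
    extL (Hom.id A) (c • inclL A x) v
  rw [zmul_eq_extL, extL_comp, LinearMap.comp_smul, LinearMap.comp_id]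

lemma e_comp_z (x : κ) (c : A.Z) {n : ℤ} (hn : c ≠ 0 → deg x = n)
    (hc : IsDeg (unit A).gr (free A deg).gr n (c • inclL A x)) :
    (cohesiveCat A).tot.comp ((freeOn A deg).e x) ((unitObj A).z c) =
      tof (C := cohesiveCat A) (X := unit A) (Y := free A deg) (mapHom (c • inclL A x) hc) := by
  by_cases h : c = 0
  · subst h
    refine (congrArg _ (map_zero _)).trans ((map_zero _).trans (Eq.trans ?_ (congrArg
      (tof (C := cohesiveCat A)) (show (0 : DGMod.Hom (unit A).toDGMod (free A deg).toDGMod n) = _ from ?_))))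
    · exact tof_zero.symm
    · refine Subtype.ext (LinearMap.ext fun (v : ScalarExt (Hom.id A) (Unit → A.Z)) => ?_)
      change 0 = extL (Hom.id A) ((0 : A.Z) • inclL A x) v
      rw [zero_smul, extL_zero]
  · have h' : deg x + 0 = n := by rw [add_zero]; exact hn h
    exact (tcomp_tof (C := cohesiveCat A) h' (incl deg x) (zid (unit A) c)).trans
      (congrArg (tof (C := cohesiveCat A)) (incl_comp_zid x c h' hc))

lemma sum_smul_inclL (f : (κ → A.Z) →ₗ[A.Z] (κ' → A.Z)) (y : κ) :
    ∑ x, f (Pi.single y 1) x • inclL A x = f ∘ₗ inclL A y := by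
  refine LinearMap.ext fun w => ?_
  rw [LinearMap.sum_apply, LinearMap.comp_apply]
  have hw : inclL A y w = w () • (Pi.single y 1 : κ → A.Z) := by
    ext z
    change (Pi.single y (w ()) : κ → A.Z) z = w () * (Pi.single y 1 : κ → A.Z) z
    simp [Pi.single_apply]
  rw [hw, map_smul]
  ext z
  rw [Finset.sum_apply]
  change ∑ x, f (Pi.single y 1) x * (Pi.single x (w ()) : κ' → A.Z) z = w () * f (Pi.single y 1) z
  simp [Pi.single_apply, mul_comm]

lemma sum_mapHom_inclL {f : (κ → A.Z) →ₗ[A.Z] (κ' → A.Z)} {n m : ℤ}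
    (hf : IsDeg (piGr A.Z deg) (piGr A.Z deg') n f) (y : κ) (h : n + deg y = m)
    (hd : ∀ x, IsDeg (unit A).gr (free A deg').gr m (f (Pi.single y 1) x • inclL A x)) :
    ∑ x, mapHom (Q := unit A) (R := free A deg') (f (Pi.single y 1) x • inclL A x) (hd x) =
      DGMod.comp h (freeMap f hf) (incl deg y) := by
  refine Subtype.ext (LinearMap.ext fun v => ?_)
  rw [AddSubmonoidClass.coe_finsetSum, LinearMap.sum_apply]
  refine (extL_sum (f := Hom.id A) Finset.univ (fun x => f (Pi.single y 1) x • inclL A x) v).symm.trans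
    (Eq.trans ?_ (extL_comp (f := Hom.id A) f (inclL A y) v).symm)
  exact congrArg (fun g => extL (Hom.id A) g v) (sum_smul_inclL f y)

set_option maxHeartbeats 1000000 in
lemma freeOn_mat {f : (κ → A.Z) →ₗ[A.Z] (κ' → A.Z)} {n : ℤ}
    (hf : IsDeg (piGr A.Z deg) (piGr A.Z deg') n f) :
    (freeOn A deg).mat (freeOn A deg') f =
      tof (C := cohesiveCat A) (X := free A deg) (Y := free A deg') (freeMap f hf) := by
  refine (freeOn A deg).hom_ext fun y => (TotCat.FreeOn.mat_e _ _ f y).trans ?_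
  have hz : ∀ x, deg' x ≠ n + deg y → f (Pi.single y 1) x = 0 := fun x hx =>
    hf rfl (single_mem_piGr deg y 1) x fun h => hx (h.trans (add_comm _ _))
  have hd : ∀ x, IsDeg (unit A).gr (free A deg').gr (n + deg y) (f (Pi.single y 1) x • inclL A x) :=
    fun x a b hab v hv z hz' => by
      by_cases hx : deg' x = n + deg y
      · exact Submodule.smul_mem (piGr A.Z deg' b) _ (inclL_deg deg' x (by omega) hv) z hz'
      · rw [hz x hx, zero_smul]
        rfl
  refine (Finset.sum_congr rfl fun x _ => e_comp_z x _ (fun h => by_contra fun h' => h (hz x h'))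
    (hd x)).trans ?_
  refine (tof_sum (C := cohesiveCat A) Finset.univ
    fun x => mapHom (Q := unit A) (R := free A deg') (f (Pi.single y 1) x • inclL A x) (hd x)).symm.trans
      (Eq.trans ?_ (tcomp_tof (C := cohesiveCat A) rfl (freeMap f hf) (incl deg y)).symm)
  exact congrArg (tof (C := cohesiveCat A)) (sum_mapHom_inclL hf y rfl hd)

end mat

section red

lemma exists_coeff (φ : DGMod.Hom (unit A).toDGMod (unit A).toDGMod 0) : ∃ z : A.Z, φ = zid (unit A) z := by
  have h1 : (φ.1 (ScalarExt.mk (Hom.id A) 1 (1 : Unit → A.Z)) : ScalarExt (Hom.id A) (Unit → A.Z)) ∈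
      ScalarExt.gr (Hom.id A) (piGr A.Z fun _ : Unit => 0) 0 := by
    refine φ.2 0 _ (ScalarExt.mk_mem _ _ (j := 0) (n := 0) A.one_mem ?_ (by simp))
    exact fun x hx => absurd rfl hx
  obtain ⟨z, hz⟩ := (A.mem_gr_zero _).1 ((coord_mem h1 ()).1 0 (by simp))
  refine ⟨z, Subtype.ext (ScalarExt.hom_ext _ fun (e : Unit → A.Z) => ?_)⟩
  have he : e = e () • (1 : Unit → A.Z) := by
    ext u
    simp
  have h2 : φ.1 (ScalarExt.mk (Hom.id A) 1 (1 : Unit → A.Z)) =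
      zmul (Hom.id A) (Unit → A.Z) z (ScalarExt.mk (Hom.id A) 1 1) := by
    refine ext_pi (κ := Unit) fun u => ?_
    refine hz.symm.trans ?_
    rw [zmul_apply, mk_mul, coord_mk, one_mul]
    simp [piForm_apply]
  have h3 : ScalarExt.mk (Hom.id A) 1 e = ScalarExt.mk (Hom.id A) 1 (1 : Unit → A.Z) <•
      algebraMap A.Z A.A (e ()) := by
    rw [mk_mul]
    conv_lhs => rw [he]
    rw [mk_smul, mul_one, one_mul]
    rfl
  refine (congrArg φ.1 h3).trans ((map_smul φ.1 _ _).trans ?_)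
  refine Eq.trans ?_ (congrArg (zmul (Hom.id A) (Unit → A.Z) z) h3).symm
  rw [map_smul]
  exact congrArg (fun y : ScalarExt (Hom.id A) (Unit → A.Z) => y <• algebraMap A.Z A.A (e ())) h2

lemma zid_injective {z z' : A.Z} (h : zid (unit A) z = zid (unit A) z') : z = z' := by
  have h1 := congrArg (fun φ : DGMod.Hom (unit A).toDGMod (unit A).toDGMod 0 =>
    coord (Hom.id A) (piForm A ()) (φ.1 (ScalarExt.mk (Hom.id A) 1 (1 : Unit → A.Z)))) h
  refine A.zero_injective ?_
  have h2 : ∀ z : A.Z, coord (Hom.id A) (piForm A ()) (zmul (Hom.id A) (Unit → A.Z) z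
      (ScalarExt.mk (Hom.id A) 1 1)) = algebraMap A.Z A.A z := fun z => by
    rw [zmul_apply, mk_mul, coord_mk, one_mul]
    simp [piForm_apply]
  exact (h2 z).symm.trans (h1.trans (h2 z'))

/-- The coefficient of an endomorphism of the unit object of degree zero. -/
def coeff : DGMod.Hom (unit A).toDGMod (unit A).toDGMod 0 →+ A.Z :=
  AddMonoidHom.mk' (fun φ => (exists_coeff φ).choose) fun φ ψ => zid_injective <| by
    rw [zid_add, ← (exists_coeff φ).choose_spec, ← (exists_coeff ψ).choose_spec,
      ← (exists_coeff (φ + ψ)).choose_spec]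

lemma zid_coeff (φ : DGMod.Hom (unit A).toDGMod (unit A).toDGMod 0) : zid (unit A) (coeff φ) = φ :=
  (exists_coeff φ).choose_spec.symm

lemma coeff_zid (z : A.Z) : coeff (zid (unit A) z) = z := zid_injective (zid_coeff _)

lemma mem_homFil_one {n : ℤ} (hn : n ≠ 0) (φ : DGMod.Hom (unit A).toDGMod (unit A).toDGMod n) :
    φ ∈ homFil 1 := fun m e he => by
  by_cases hm : m = 0
  · refine mem_filGr_one (by omega) (φ.2 m _ (ScalarExt.mk_mem _ _ A.one_mem he (by simp)))
  · have : e = 0 := funext fun u => he u (Ne.symm hm)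
    subst this
    have h1 : φ.1 (ScalarExt.mk (Hom.id A) 1 (0 : Unit → A.Z)) = 0 :=
      (congrArg φ.1 (ScalarExt.mk_zero _ _)).trans (map_zero φ.1)
    have h2 : φ.1 (ScalarExt.mk (Hom.id A) 1 (0 : Unit → A.Z)) ∈
        filGr (Hom.id A) (piGr A.Z fun _ : Unit => 0) 1 (m + n) := by
      rw [h1]
      exact zero_mem _
    exact h2

lemma eq_zero_of_mem_homFil_one {φ : DGMod.Hom (unit A).toDGMod (unit A).toDGMod 0} (hφ : φ ∈ homFil 1) :
    φ = 0 := by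
  refine Subtype.ext (ScalarExt.hom_ext _ fun e => ?_)
  have he : e ∈ (unit A).gr 0 := fun x hx => absurd rfl hx
  exact filGr_one_eq_zero (hφ 0 e he)

variable (A) in
def unitReduced : (unitObj A).Reduced (cohesiveFilt A).tot where
  red := coeff.comp (AddMonoidHom.mk'
    (fun x : (cohesiveCat A).THom (unit A) (unit A) => (x 0 : DGMod.Hom (unit A).toDGMod (unit A).toDGMod 0))
    fun x y => rfl)
  red_z r := (congrArg coeff (tof_apply (C := cohesiveCat A) (zid (unit A) r))).trans (coeff_zid r)
  z_red x := fun n => by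
    by_cases hn : n = 0
    · subst hn
      refine mem_of_eq (y := 0) ?_ (zero_mem _)
      refine sub_eq_zero.2 ?_
      exact (tof_apply (C := cohesiveCat A) (zid (unit A) _)).trans (zid_coeff _)
    · exact mem_homFil_one hn _
  red_fil x hx := (congrArg coeff (eq_zero_of_mem_homFil_one (hx 0))).trans (map_zero _)
  one_gr := by
    rintro n _ hn ⟨f, rfl⟩
    exact tof_mem_tfil.2 (mem_homFil_one hn f)

end red

section split

variable {κ : Type} [Fintype κ] [DecidableEq κ] (deg : κ → ℤ) (p : (κ → A.Z) →ₗ[A.Z] (κ → A.Z))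

def imIncl : ScalarExt (Hom.id A) (LinearMap.range p) →ₗ[(A.A)ᵐᵒᵖ] ScalarExt (Hom.id A) (κ → A.Z) :=
  extL (Hom.id A) (LinearMap.range p).subtype

def imProj : ScalarExt (Hom.id A) (κ → A.Z) →ₗ[(A.A)ᵐᵒᵖ] ScalarExt (Hom.id A) (LinearMap.range p) :=
  extL (Hom.id A) p.rangeRestrict

variable {p}

lemma rangeRestrict_comp_subtype (hpp : ∀ x, p (p x) = p x) :
    p.rangeRestrict ∘ₗ (LinearMap.range p).subtype = LinearMap.id := by
  refine LinearMap.ext ?_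
  rintro ⟨_, x, rfl⟩
  exact Subtype.ext (hpp x)

lemma imProj_imIncl (hpp : ∀ x, p (p x) = p x) (x : ScalarExt (Hom.id A) (LinearMap.range p)) :
    imProj p (imIncl p x) = x := by
  rw [imProj, imIncl, extL_comp, rangeRestrict_comp_subtype hpp, extL_id]

lemma imIncl_imProj (x : ScalarExt (Hom.id A) (κ → A.Z)) : imIncl p (imProj p x) = extL (Hom.id A) p x := by
  rw [imProj, imIncl, extL_comp]
  rfl

lemma extL_imIncl (hpp : ∀ x, p (p x) = p x) (x : ScalarExt (Hom.id A) (LinearMap.range p)) :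
    extL (Hom.id A) p (imIncl p x) = imIncl p x := by
  rw [← imIncl_imProj, imProj_imIncl hpp]

lemma extL_csmul {A B : DGAlg.{u}} {M N : Type u} [AddCommGroup M] [Module A.Z M] [AddCommGroup N]
    [Module A.Z N] {f : Hom A B} (φ : ScalarExt f M →ₗ[(B.A)ᵐᵒᵖ] ScalarExt f N) (c : ℂ) (x : ScalarExt f M) :
    φ (c • x) = c • φ x := by
  have h1 : ∀ {M : Type u} [AddCommGroup M] [Module A.Z M] (x : ScalarExt f M),
      c • x = x <• (c • (1 : B.A)) := fun x => by
    rw [MulOpposite.op_smul, smul_assoc, MulOpposite.op_one, one_smul]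
  rw [h1, h1, map_smul]

/-- A perturbation of the trivial connection, compressed to the image of an idempotent. -/
def splitConn (p : (κ → A.Z) →ₗ[A.Z] (κ → A.Z))
    (T : ScalarExt (Hom.id A) (κ → A.Z) →ₗ[(A.A)ᵐᵒᵖ] ScalarExt (Hom.id A) (κ → A.Z)) :
    ScalarExt (Hom.id A) (LinearMap.range p) →ₗ[ℂ] ScalarExt (Hom.id A) (LinearMap.range p) where
  toFun x := imProj p (freeConn A deg (imIncl p x) + T (imIncl p x))
  map_add' x y := by
    simp only [map_add]
    abel
  map_smul' c x := by
    rw [RingHom.id_apply, extL_csmul, map_smul, extL_csmul, ← smul_add, extL_csmul]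

lemma splitConn_apply (T : ScalarExt (Hom.id A) (κ → A.Z) →ₗ[(A.A)ᵐᵒᵖ] ScalarExt (Hom.id A) (κ → A.Z))
    (x : ScalarExt (Hom.id A) (LinearMap.range p)) :
    splitConn deg p T x = imProj p (freeConn A deg (imIncl p x) + T (imIncl p x)) := rfl

variable {deg} (hp : IsDeg (piGr A.Z deg) (piGr A.Z deg) 0 p)

lemma imIncl_mem {n : ℤ} {x : ScalarExt (Hom.id A) (LinearMap.range p)}
    (hx : x ∈ ScalarExt.gr (Hom.id A) (fun n => (piGr A.Z deg n).comap (LinearMap.range p).subtype) n) :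
    imIncl p x ∈ ScalarExt.gr (Hom.id A) (piGr A.Z deg) n := by
  have h := ScalarExt.mem_homFil_zero.1 (extL_mem_homFil (f := Hom.id A) (𝓜 := fun n =>
    (piGr A.Z deg n).comap (LinearMap.range p).subtype) (𝓝 := piGr A.Z deg) (n := 0)
    (g := (LinearMap.range p).subtype) (fun a b h x hx => by rw [← h, add_zero]; exact hx)) n x hx
  rwa [add_zero] at h

lemma imProj_mem (hp : IsDeg (piGr A.Z deg) (piGr A.Z deg) 0 p) {n : ℤ} {x : ScalarExt (Hom.id A) (κ → A.Z)}
    (hx : x ∈ ScalarExt.gr (Hom.id A) (piGr A.Z deg) n) : imProj p x ∈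
      ScalarExt.gr (Hom.id A) (fun n => (piGr A.Z deg n).comap (LinearMap.range p).subtype) n := by
  have h := ScalarExt.mem_homFil_zero.1 (extL_mem_homFil (f := Hom.id A) (𝓝 := fun n =>
    (piGr A.Z deg n).comap (LinearMap.range p).subtype) (𝓜 := piGr A.Z deg) (n := 0)
    (g := p.rangeRestrict) (fun a b h x hx => hp h hx)) n x hx
  rwa [add_zero] at h

/-- The image of an idempotent with a flat perturbation of the trivial connection. -/
def splitModule (hp : IsDeg (piGr A.Z deg) (piGr A.Z deg) 0 p) (hpp : ∀ x, p (p x) = p x)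
    (t : DGMod.Hom (free A deg).toDGMod (free A deg).toDGMod 1)
    (T : ScalarExt (Hom.id A) (κ → A.Z) →ₗ[(A.A)ᵐᵒᵖ] ScalarExt (Hom.id A) (κ → A.Z)) (hT : T = t.1)
    (hPT : ∀ x, extL (Hom.id A) p (T x) = T x) (hTP : ∀ x, T (extL (Hom.id A) p x) = T x)
    (hcurv : ∀ v, extL (Hom.id A) p v = v →
      extL (Hom.id A) p (freeConn A deg (extL (Hom.id A) p (freeConn A deg v))) +
        extL (Hom.id A) p (freeConn A deg (T v)) + T (freeConn A deg v) + T (T v) = 0) :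
    CohesiveModule A where
  E := LinearMap.range p
  gr n := (piGr A.Z deg n).comap (LinearMap.range p).subtype
  internal := range_isInternal deg hp
  finite := inferInstance
  projective := Module.Projective.of_split (LinearMap.range p).subtype p.rangeRestrict
    (rangeRestrict_comp_subtype hpp)
  conn := splitConn deg p T
  conn_mem {k x} hx := by
    refine imProj_mem hp (add_mem ((free A deg).conn_mem (imIncl_mem hx)) ?_)
    rw [hT]
    exact t.2 k _ (imIncl_mem hx)
  leibniz {k x} a hx := by
    have h1 : freeConn A deg (imIncl p x <• a) = freeConn A deg (imIncl p x) <• a +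
        k.negOnePow • (imIncl p x <• A.d a) := (free A deg).leibniz a (imIncl_mem hx)
    rw [splitConn_apply, splitConn_apply, map_smul (imIncl p), h1, ← map_smul (imIncl p), map_smul (imIncl p),
      map_smul T, map_add, map_add, map_add, Units.smul_def, Units.smul_def, map_zsmul, ← map_smul (imIncl p),
      imProj_imIncl hpp, map_smul (imProj p), map_smul (imProj p), smul_add]
    abel
  conn_conn x := by
    have h0 : ∀ y, imIncl p y = 0 → y = 0 := fun y hy => by rw [← imProj_imIncl hpp y, hy, map_zero]
    refine h0 _ ?_
    rw [splitConn_apply, splitConn_apply]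
    simp only [imIncl_imProj, map_add, hPT, hTP]
    rw [← hcurv _ (extL_imIncl hpp x)]
    abel

lemma split_aux (hp : IsDeg (piGr A.Z deg) (piGr A.Z deg) 0 p) (hpp : ∀ x, p (p x) = p x)
    (t : DGMod.Hom (free A deg).toDGMod (free A deg).toDGMod 1)
    (hpt : DGMod.comp (zero_add 1) (freeMap p hp) t = t) (htp : DGMod.comp (add_zero 1) t (freeMap p hp) = t)
    (hcurv : DGMod.comp (zero_add 2) (freeMap p hp) (DGMod.comp (one_add_one_eq_two)
        (DGMod.d (zero_add 1) (freeMap p hp)) (DGMod.comp (add_zero 1) (DGMod.d (zero_add 1) (freeMap p hp))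
          (freeMap p hp))) +
      DGMod.comp (zero_add 2) (freeMap p hp) (DGMod.comp (add_zero 2) (DGMod.d (one_add_one_eq_two) t)
        (freeMap p hp)) + DGMod.comp (one_add_one_eq_two) t t = 0) :
    ∃ (Q : CohesiveModule A) (i : DGMod.Hom Q.toDGMod (free A deg).toDGMod 0)
      (r : DGMod.Hom (free A deg).toDGMod Q.toDGMod 0),
      DGMod.comp (zero_add 0) r i = DGMod.idHom Q.toDGMod ∧ DGMod.comp (zero_add 0) i r = freeMap p hp ∧
        DGMod.comp (zero_add 1) (freeMap p hp) (DGMod.d (zero_add 1) i) = -DGMod.comp (add_zero 1) t i := by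
  obtain ⟨T, hT⟩ : ∃ T : ScalarExt (Hom.id A) (κ → A.Z) →ₗ[(A.A)ᵐᵒᵖ] ScalarExt (Hom.id A) (κ → A.Z),
    T = t.1 := ⟨t.1, rfl⟩
  have hPT : ∀ x, extL (Hom.id A) p (T x) = T x := fun x => by
    rw [hT]
    exact congrArg (fun φ => φ.1 x) hpt
  have hTP : ∀ x, T (extL (Hom.id A) p x) = T x := fun x => by
    rw [hT]
    exact congrArg (fun φ => φ.1 x) htp
  have hNN : ∀ x, freeConn A deg (freeConn A deg x) = 0 := (free A deg).conn_conn
  have hPP : ∀ x, extL (Hom.id A) p (extL (Hom.id A) p x) = extL (Hom.id A) p x := fun x => by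
    rw [extL_comp]
    congr 2
    exact LinearMap.ext hpp
  have hc : ∀ v, extL (Hom.id A) p v = v →
      extL (Hom.id A) p (freeConn A deg (extL (Hom.id A) p (freeConn A deg v))) +
        extL (Hom.id A) p (freeConn A deg (T v)) + T (freeConn A deg v) + T (T v) = 0 := fun v hv => by
    have h1 : extL (Hom.id A) p (freeConn A deg (extL (Hom.id A) p (freeConn A deg (extL (Hom.id A) p
        (extL (Hom.id A) p v)) - (0 : ℤ).negOnePow • extL (Hom.id A) p (freeConn A deg (extL (Hom.id A) p v)))) -
        (0 : ℤ).negOnePow • extL (Hom.id A) p (freeConn A deg (freeConn A deg (extL (Hom.id A) p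
        (extL (Hom.id A) p v)) - (0 : ℤ).negOnePow • extL (Hom.id A) p (freeConn A deg (extL (Hom.id A) p v))))) +
        extL (Hom.id A) p (freeConn A deg (T (extL (Hom.id A) p v)) -
          (1 : ℤ).negOnePow • T (freeConn A deg (extL (Hom.id A) p v))) + T (T v) = 0 := by
      rw [hT]
      exact congrArg (fun φ => φ.1 v) hcurv
    rw [hv, hv, Int.negOnePow_zero, Int.negOnePow_one] at h1
    simp only [Units.smul_def, Units.val_one, Units.val_neg, neg_smul, one_smul, sub_neg_eq_add, map_sub,
      map_add, hNN, hPP, hPT, zero_sub, sub_self, map_zero, sub_zero, map_neg, neg_neg] at h1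
    rw [← h1]
    abel
  refine ⟨splitModule hp hpp t T hT hPT hTP hc, ⟨imIncl p, fun k x hx => ?_⟩, ⟨imProj p, fun k x hx => ?_⟩,
    Subtype.ext (LinearMap.ext fun x => imProj_imIncl hpp x),
    Subtype.ext (LinearMap.ext fun x => imIncl_imProj x), Subtype.ext (LinearMap.ext
      fun (x : ScalarExt (Hom.id A) (LinearMap.range p)) => ?_)⟩
  · rw [add_zero]
    exact imIncl_mem hx
  · rw [add_zero]
    exact imProj_mem hp hx
  · change extL (Hom.id A) p (freeConn A deg (imIncl p x) - (0 : ℤ).negOnePow • imIncl p (splitConn deg p T x)) =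
      -t.1 (imIncl p x)
    rw [← hT]
    change _ = -T (imIncl p x)
    rw [splitConn_apply, imIncl_imProj, Int.negOnePow_zero, one_smul, map_sub, hPP, map_add, hPT]
    abel

end split

set_option maxHeartbeats 1000000 in
lemma exists_split {κ : Type} [Fintype κ] [DecidableEq κ] (deg : κ → ℤ)
    (p : (κ → A.Z) →ₗ[A.Z] (κ → A.Z)) (θ : (cohesiveCat A).tot.Hom (free A deg) (free A deg))
    (hp : IsDeg (piGr A.Z deg) (piGr A.Z deg) 0 p) (hpp : ∀ x, p (p x) = p x)
    (hθ : θ ∈ (cohesiveCat A).tot.gr 1) (hpθ : (freeOn A deg).mat (freeOn A deg) p ⊚ θ = θ)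
    (hθp : θ ⊚ (freeOn A deg).mat (freeOn A deg) p = θ)
    (hcurv : (cohesiveCat A).tot.curv ((freeOn A deg).mat (freeOn A deg) p) θ = 0) :
    ∃ (Q : (cohesiveCat A).tot.Obj) (i : (cohesiveCat A).tot.Hom Q (free A deg))
      (r : (cohesiveCat A).tot.Hom (free A deg) Q), i ∈ (cohesiveCat A).tot.gr 0 ∧
      r ∈ (cohesiveCat A).tot.gr 0 ∧ r ⊚ i = (cohesiveCat A).tot.id Q ∧
      i ⊚ r = (freeOn A deg).mat (freeOn A deg) p ∧
      (freeOn A deg).mat (freeOn A deg) p ⊚ (cohesiveCat A).tot.D i = -(θ ⊚ i) := by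
  obtain ⟨t, rfl⟩ := hθ
  have hm := freeOn_mat (A := A) (deg := deg) (deg' := deg) (f := p) hp
  generalize (freeOn A deg).mat (freeOn A deg) p = P at *
  subst hm
  have hpθ' := (tcomp_tof (C := cohesiveCat A) (zero_add 1) (freeMap p hp) t).symm.trans hpθ
  have hθp' := (tcomp_tof (C := cohesiveCat A) (add_zero 1) t (freeMap p hp)).symm.trans hθp
  have hc := ((curv_tof (C := cohesiveCat A) (freeMap p hp) t).symm.trans hcurv).trans
    (tof_zero (C := cohesiveCat A) (X := free A deg) (Y := free A deg) (n := 2)).symm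
  obtain ⟨Q, i, r, h1, h2, h3⟩ := split_aux hp hpp t (tof_injective hpθ') (tof_injective hθp')
    (tof_injective hc)
  refine ⟨Q, tof (C := cohesiveCat A) (X := Q) (Y := free A deg) i,
    tof (C := cohesiveCat A) (X := free A deg) (Y := Q) r, ⟨i, rfl⟩, ⟨r, rfl⟩, ?_, ?_, ?_⟩
  · exact (tcomp_tof (C := cohesiveCat A) (zero_add 0) r i).trans (congrArg (tof (C := cohesiveCat A)) h1)
  · exact (tcomp_tof (C := cohesiveCat A) (zero_add 0) i r).trans (congrArg (tof (C := cohesiveCat A)) h2)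
  · refine (congrArg (tcomp _) (tD_tof (C := cohesiveCat A) (zero_add 1) i)).trans
      ((tcomp_tof (C := cohesiveCat A) (zero_add 1) (freeMap p hp) _).trans
      ((congrArg (tof (C := cohesiveCat A)) h3).trans ((tof_neg _).trans (congrArg Neg.neg ?_))))
    exact (tcomp_tof (C := cohesiveCat A) (add_zero 1) t i).symm

end CohesiveModule

/-! ### The degree zero part of a connection -/

namespace DGAlg

variable (A : DGAlg.{u})

@[elab_as_elim]
lemma gr_induction {P : A.A → Prop} (a : A.A) (hm : ∀ n a, a ∈ A.gr n → P a)
    (ha : ∀ x y, P x → P y → P (x + y)) : P a := by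
  have hx : a ∈ ⨆ k, A.gr k := by rw [A.internal.submodule_iSup_eq_top]; trivial
  exact Submodule.iSup_induction A.gr (motive := P) hx hm (hm 0 0 (zero_mem _)) ha

def projZero : A.A →ₗ[ℂ] A.gr 0 :=
  DirectSum.component ℂ ℕ (fun n => A.gr n) 0 ∘ₗ
    (LinearEquiv.ofBijective (DirectSum.coeLinearMap A.gr) A.internal).symm.toLinearMap

lemma symm_apply {n : ℕ} {a : A.A} (ha : a ∈ A.gr n) :
    (LinearEquiv.ofBijective (DirectSum.coeLinearMap A.gr) A.internal).symm a =
      DirectSum.lof ℂ ℕ (fun n => A.gr n) n ⟨a, ha⟩ := by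
  rw [LinearEquiv.symm_apply_eq]
  exact (DirectSum.coeLinearMap_lof A.gr n ⟨a, ha⟩).symm

def grZero : A.A →+ A.Z :=
  AddMonoidHom.mk' (fun a => ((A.mem_gr_zero _).1 (A.projZero a).2).choose) fun a b =>
    A.zero_injective <| by
      rw [map_add (algebraMap A.Z A.A), ((A.mem_gr_zero _).1 (A.projZero a).2).choose_spec,
        ((A.mem_gr_zero _).1 (A.projZero b).2).choose_spec,
        ((A.mem_gr_zero _).1 (A.projZero (a + b)).2).choose_spec, map_add A.projZero]
      rfl

lemma algebraMap_grZero (a : A.A) : algebraMap A.Z A.A (A.grZero a) = A.projZero a :=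
  ((A.mem_gr_zero _).1 (A.projZero a).2).choose_spec

lemma grZero_algebraMap (z : A.Z) : A.grZero (algebraMap A.Z A.A z) = z := by
  refine A.zero_injective ?_
  have h : algebraMap A.Z A.A z ∈ A.gr 0 := (A.mem_gr_zero _).2 ⟨z, rfl⟩
  rw [algebraMap_grZero, projZero, LinearMap.comp_apply, LinearEquiv.coe_coe, A.symm_apply h,
    DirectSum.component.lof_self]

lemma grZero_of_pos {n : ℕ} (hn : n ≠ 0) {a : A.A} (ha : a ∈ A.gr n) : A.grZero a = 0 := by
  refine A.zero_injective ?_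
  rw [algebraMap_grZero, projZero, LinearMap.comp_apply, LinearEquiv.coe_coe, A.symm_apply ha,
    DirectSum.component.of, dif_neg hn, map_zero]
  rfl

lemma grZero_mul (z : A.Z) (a : A.A) : A.grZero (algebraMap A.Z A.A z * a) = z * A.grZero a := by
  induction a using A.gr_induction with
  | ha x y hx hy => rw [mul_add, map_add, map_add, mul_add, hx, hy]
  | hm n a ha =>
    by_cases hn : n = 0
    · subst hn
      obtain ⟨w, rfl⟩ := (A.mem_gr_zero a).1 ha
      rw [← map_mul, grZero_algebraMap, grZero_algebraMap]
    · have h := A.mul_mem ((A.mem_gr_zero _).2 ⟨z, rfl⟩) ha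
      rw [zero_add] at h
      rw [A.grZero_of_pos hn h, A.grZero_of_pos hn ha, mul_zero]

end DGAlg

namespace ScalarExt

variable {A : DGAlg.{u}} {M : Type u} [AddCommGroup M] [Module A.Z M] {𝓜 : ℤ → Submodule A.Z M}

variable (M) in
def redZero : ScalarExt (Hom.id A) M →+ M :=
  TensorProduct.liftAddHom (R := A.Z) (M := Pull (Hom.id A)) (N := M)
    (AddMonoidHom.mk' (fun b : Pull (Hom.id A) => AddMonoidHom.mk'
        (fun e => A.grZero (show A.A from b) • e) fun e e' => smul_add _ _ _)
      fun b b' => by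
        ext e
        change A.grZero ((show A.A from b) + (show A.A from b')) • e = _
        rw [map_add, add_smul]
        rfl)
    fun z b e => by
      change A.grZero (algebraMap A.Z A.A z * (show A.A from b)) • e = A.grZero (show A.A from b) • z • e
      rw [A.grZero_mul, smul_smul, mul_comm]

lemma redZero_mk (a : A.A) (e : M) : redZero M (mk (Hom.id A) a e) = A.grZero a • e := rfl

lemma redZero_smul (z : A.Z) (x : ScalarExt (Hom.id A) M) :
    redZero M (x <• algebraMap A.Z A.A z) = z • redZero M x := by
  induction x using ScalarExt.induction with
  | h0 => simp
  | hm b e =>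
    rw [mk_mul, redZero_mk, redZero_mk, ← Algebra.commutes, A.grZero_mul, smul_smul]
  | ha x y hx hy => simp only [smul_add, map_add, hx, hy]

lemma redZero_filGr {m : ℤ} {x : ScalarExt (Hom.id A) M} (hx : x ∈ filGr (Hom.id A) 𝓜 1 m) :
    redZero M x = 0 :=
  filGr_induction (P := fun x => redZero M x = 0) hx (map_zero _)
    (fun j n b e hb _ _ hj => by rw [redZero_mk, A.grZero_of_pos (by omega) hb, zero_smul])
    fun x y hx hy => by rw [map_add, hx, hy, add_zero]

lemma redZero_mem {m : ℤ} {x : ScalarExt (Hom.id A) M} (hx : x ∈ gr (Hom.id A) 𝓜 m) :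
    redZero M x ∈ 𝓜 m ∧ x - mk (Hom.id A) 1 (redZero M x) ∈ filGr (Hom.id A) 𝓜 1 m := by
  refine gr_induction (Hom.id A) (P := fun x => redZero M x ∈ 𝓜 m ∧
    x - mk (Hom.id A) 1 (redZero M x) ∈ filGr (Hom.id A) 𝓜 1 m) hx ?_ ?_ ?_
  · rw [map_zero, mk_zero, sub_zero]
    exact ⟨zero_mem _, zero_mem _⟩
  · intro j n b e hb he h
    rw [redZero_mk]
    by_cases hj : j = 0
    · subst hj
      obtain ⟨z, rfl⟩ := (A.mem_gr_zero b).1 hb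
      obtain rfl : n = m := by simpa using h
      rw [A.grZero_algebraMap, mk_smul, mul_one]
      refine ⟨Submodule.smul_mem _ _ he, ?_⟩
      have h0 : mk (Hom.id A) (algebraMap A.Z A.A z) e -
          mk (Hom.id A) (algebraMap A.Z A.A ((Hom.id A).zero z)) e = 0 := sub_self _
      rw [h0]
      exact zero_mem _
    · rw [A.grZero_of_pos hj hb, zero_smul, mk_zero, sub_zero]
      exact ⟨zero_mem _, mk_mem_filGr hb he h (by omega)⟩
  · rintro x y ⟨hx, hx'⟩ ⟨hy, hy'⟩
    rw [map_add, mk_add, add_sub_add_comm]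
    exact ⟨add_mem hx hy, add_mem hx' hy'⟩

end ScalarExt

namespace CohesiveModule

open ScalarExt

variable {A : DGAlg.{u}} (E : CohesiveModule A)

def D₀ : E.E →ₗ[A.Z] E.E where
  toFun e := redZero E.E (E.conn₁ e)
  map_add' e e' := by rw [conn₁_add, map_add]
  map_smul' z e := by
    rw [conn₁_smul, map_add, redZero_smul, redZero_mk, A.grZero_of_pos one_ne_zero
      (A.d_mem ((A.mem_gr_zero _).2 ⟨z, rfl⟩)), zero_smul, add_zero]
    rfl

lemma D₀_mem {n : ℤ} {e : E.E} (he : e ∈ E.gr n) : E.D₀ e ∈ E.gr (n + 1) :=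
  (redZero_mem (E.conn₁_mem he)).1

lemma conn₁_sub_mem {n : ℤ} {e : E.E} (he : e ∈ E.gr n) :
    E.conn₁ e - ScalarExt.mk (Hom.id A) 1 (E.D₀ e) ∈ filGr (Hom.id A) E.gr 1 (n + 1) :=
  (redZero_mem (E.conn₁_mem he)).2

lemma D₀_D₀ (e : E.E) : E.D₀ (E.D₀ e) = 0 := by
  induction e using E.gr_induction with
  | ha x y hx hy => rw [map_add, map_add, hx, hy, add_zero]
  | hm n e he =>
    have h1 := redZero_filGr (E.connExt_mem_filGr (Hom.id A) (E.conn₁_sub_mem he) rfl)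
    rw [← conn_eq_connExt, map_sub, conn₁, E.conn_conn, zero_sub, map_neg, neg_eq_zero] at h1
    exact h1

lemma connExt_one_sub_mem {B : DGAlg.{u}} (f : Hom A B) {n m : ℤ} (h : n + 1 = m) {e : E.E}
    (he : e ∈ E.gr n) :
    E.connExt f (ScalarExt.mk f 1 e) - ScalarExt.mk f 1 (E.D₀ e) ∈ filGr f E.gr 1 m := by
  subst h
  have h1 := push_mem_filGr f (id_push f) (E.conn₁_sub_mem he)
  rw [map_sub, push_mk, map_one] at h1
  rwa [connExt_mk, d_one, zero_mk, add_zero, MulOpposite.op_one, one_smul]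

end CohesiveModule

/-! ### Comparison of a cohesive module with a free module -/

namespace ScalarExt

section rankOne

variable {A A' B : DGAlg.{u}} {M N : Type u} [AddCommGroup M] [Module A.Z M] [AddCommGroup N]
  [Module A'.Z N] (f : Hom A B) (g : Hom A' B)

/-- The morphism of rank one given by a linear form and a vector. -/
def rankOne (φ : M →ₗ[A.Z] A.Z) (w : N) : ScalarExt f M →ₗ[(B.A)ᵐᵒᵖ] ScalarExt g N where
  toFun x := mk g (coord f φ x) w
  map_add' x y := by rw [map_add, add_mk]
  map_smul' b x := by
    rw [map_smul]
    exact (mk_mul g (coord f φ x) b.unop w).symm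

variable {f g}

lemma rankOne_mk (φ : M →ₗ[A.Z] A.Z) (w : N) (e : M) :
    rankOne f g φ w (mk f 1 e) = mk g (algebraMap B.Z B.A (f.zero (φ e))) w := by
  change mk g (coord f φ (mk f 1 e)) w = _
  rw [coord_mk, mul_one]

lemma rankOne_mem {𝓜 : ℤ → Submodule A.Z M} {𝓝 : ℤ → Submodule A'.Z N} {φ : M →ₗ[A.Z] A.Z} {w : N} {d : ℤ}
    (hφ : ∀ m, ∀ v ∈ 𝓜 m, m ≠ d → φ v = 0) (hw : w ∈ 𝓝 d) : rankOne f g φ w ∈ homFil f g 𝓜 𝓝 0 0 :=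
  fun m e he => by
    rw [rankOne_mk]
    by_cases h : m = d
    · exact mk_mem_filGr ((B.mem_gr_zero _).2 ⟨_, rfl⟩) hw (by simp [h]) le_rfl
    · rw [hφ m e he h, map_zero, map_zero, zero_mk]
      exact zero_mem _

lemma mk_algebraMap_sum {σ : Type*} (s : Finset σ) (z : σ → B.Z) (w : N) :
    mk g (algebraMap B.Z B.A (∑ x ∈ s, z x)) w = ∑ x ∈ s, mk g (algebraMap B.Z B.A (z x)) w :=
  map_sum (AddMonoidHom.mk' (fun z : B.Z => mk g (algebraMap B.Z B.A z) w) fun z z' => by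
    rw [map_add, add_mk]) _ _

lemma mk_sum {σ : Type*} (s : Finset σ) (b : B.A) (w : σ → N) :
    mk g b (∑ x ∈ s, w x) = ∑ x ∈ s, mk g b (w x) :=
  map_sum (AddMonoidHom.mk' (fun w : N => mk g b w) fun z z' => mk_add g b z z') _ _

lemma mk_zero_smul (z : B.Z) (a : A'.Z) (w : N) : mk g (algebraMap B.Z B.A z) (a • w) =
    mk g (algebraMap B.Z B.A (g.zero a * z)) w := by
  rw [mk_smul, map_mul]

end rankOne

end ScalarExt

namespace CohesiveModule

open ScalarExt

variable {A B C : DGAlg.{u}}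

lemma connExt_sub_mem (E : CohesiveModule A) (f : Hom A B) {m m' : ℤ} (h : m + 1 = m')
    {x : ScalarExt f E.E} (hx : x ∈ ScalarExt.gr f E.gr m) :
    E.connExt f x - extL f E.D₀ x ∈ filGr f E.gr 1 m' := by
  subst h
  refine ScalarExt.gr_induction f (P := fun x => E.connExt f x - extL f E.D₀ x ∈ filGr f E.gr 1 (m + 1)) hx
    (by simp) (fun j n b e hb he hj => ?_) fun x y hx hy => ?_
  · have h1 := E.connExt_leibniz f b (ScalarExt.mk_mem f E.gr B.one_mem he (zero_add n))
    rw [mk_mul, one_mul] at h1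
    rw [extL_mk, h1, add_sub_right_comm, mk_eq f b (E.D₀ e), ← smul_sub]
    refine add_mem (smul_mem_filGr (E.connExt_one_sub_mem f rfl he) hb (by omega) (by omega)) ?_
    rw [mk_mul, one_mul]
    exact zsmul_mem (mk_mem_filGr (B.d_mem hb) he (by push_cast; omega) (by omega)) _
  · rw [map_add, map_add, add_sub_add_comm]
    exact add_mem hx hy

variable {κ : Type} [Fintype κ] [DecidableEq κ] {deg : κ → ℤ}

lemma free_D₀ : (free A deg).D₀ = 0 := by
  refine LinearMap.ext fun (v : κ → A.Z) => ?_
  have h1 : redZero (κ → A.Z) (freeConn A deg (ScalarExt.mk (Hom.id A) 1 v)) = 0 := by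
    refine (map_sum (redZero (κ → A.Z)) _ _).trans (Finset.sum_eq_zero fun y _ => ?_)
    rw [redZero_mk, Units.smul_def, map_zsmul, A.grZero_of_pos one_ne_zero, smul_zero, zero_smul]
    refine A.d_mem (i := 0) ?_
    rw [coord_mk, mul_one]
    exact (A.mem_gr_zero _).2 ⟨_, rfl⟩
  exact h1

section compare

variable {E : CohesiveModule B} (b : DualBasis E) (f : Hom B C) (g : Hom A C) (i : b.κ → κ)
  (r q : b.κ → A.Z) {t : b.κ → b.κ → A.Z} {δ : (κ → A.Z) →ₗ[A.Z] (κ → A.Z)}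

/-- The map to a free module given by a dual basis and weights. -/
def toFree : ScalarExt f E.E →ₗ[(C.A)ᵐᵒᵖ] ScalarExt g (κ → A.Z) :=
  ∑ x, rankOne f g (b.l x) (r x • (Pi.single (i x) 1 : κ → A.Z))

/-- The map from a free module given by a dual basis and weights. -/
def ofFree : ScalarExt g (κ → A.Z) →ₗ[(C.A)ᵐᵒᵖ] ScalarExt f E.E :=
  ∑ x, rankOne g f (q x • piForm A (i x)) (b.e x)

lemma toFree_mk (e : E.E) : toFree b f g i r (ScalarExt.mk f 1 e) =
    ∑ x, ScalarExt.mk g (algebraMap C.Z C.A (g.zero (r x) * f.zero (b.l x e))) (Pi.single (i x) 1 : κ → A.Z) := by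
  simp only [toFree, LinearMap.sum_apply, rankOne_mk, mk_zero_smul]

lemma ofFree_mk (v : κ → A.Z) : ofFree b f g i q (ScalarExt.mk g 1 v) =
    ∑ x, ScalarExt.mk f (algebraMap C.Z C.A (g.zero (q x * v (i x)))) (b.e x) := by
  simp only [ofFree, LinearMap.sum_apply, rankOne_mk]
  rfl

variable {i}

lemma toFree_mem (hi : ∀ x, deg (i x) = b.deg x) :
    toFree b f g i r ∈ ScalarExt.homFil f g E.gr (piGr A.Z deg) 0 0 := by
  refine sum_mem fun x _ => rankOne_mem (d := b.deg x) (fun m v hv h => b.l_eq_zero x hv h)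
    (Submodule.smul_mem _ _ fun y hy => ?_)
  rw [Pi.single_apply, if_neg]
  rintro rfl
  exact hy (hi x)

lemma ofFree_mem (hi : ∀ x, deg (i x) = b.deg x) :
    ofFree b f g i q ∈ ScalarExt.homFil g f (piGr A.Z deg) E.gr 0 0 := by
  refine sum_mem fun x _ => rankOne_mem (d := b.deg x) (fun m v hv h => ?_) (b.e_mem x)
  change q x * v (i x) = 0
  rw [hv (i x) (by rw [hi]; exact h.symm), mul_zero]

variable {f g r q}

lemma ofFree_toFree (hi : Function.Injective i) {s : A.Z} (hs : ∀ x, q x * r x = s) :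
    ofFree b f g i q ∘ₗ toFree b f g i r = zmul f E.E (g.zero s) := by
  refine hom_ext _ fun e => ?_
  rw [LinearMap.comp_apply, toFree_mk, map_sum, zmul_apply, mk_mul, one_mul]
  have h1 : ∀ x, ofFree b f g i q (ScalarExt.mk g (algebraMap C.Z C.A (g.zero (r x) * f.zero (b.l x e)))
      (Pi.single (i x) 1 : κ → A.Z)) = ScalarExt.mk f (algebraMap C.Z C.A (g.zero s)) (b.l x e • b.e x) := by
    intro x
    rw [mk_eq, map_smul, ofFree_mk, Finset.sum_eq_single x]
    · rw [Pi.single_eq_same, mul_one, mk_mul, ← map_mul, mk_zero_smul, ← mul_assoc, ← map_mul, hs, mul_comm]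
    · intro y _ hy
      rw [Pi.single_eq_of_ne fun h => hy (hi h), mul_zero, map_zero, map_zero, zero_mk]
    · exact fun h => absurd (Finset.mem_univ _) h
  simp only [h1]
  rw [← mk_sum, b.sum_l_e]

lemma extL_toFree (ht : ∀ x y, g.zero (t x y) = f.zero (b.l x (E.D₀ (b.e y))))
    (hδ : ∀ y, r y • δ (Pi.single (i y) 1) = ∑ x, (r x * t x y) • (Pi.single (i x) 1 : κ → A.Z))
    (e : E.E) : extL g δ (toFree b f g i r (ScalarExt.mk f 1 e)) =
      toFree b f g i r (ScalarExt.mk f 1 (E.D₀ e)) := by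
  rw [toFree_mk, toFree_mk, map_sum]
  have h1 : ∀ x, f.zero (b.l x (E.D₀ e)) = ∑ y, g.zero (t x y) * f.zero (b.l y e) := fun x => by
    conv_lhs => rw [← b.sum_l_e e]
    simp only [map_sum, map_smul, smul_eq_mul, map_mul, ht]
    exact Finset.sum_congr rfl fun y _ => mul_comm _ _
  simp only [h1, Finset.mul_sum, mk_algebraMap_sum]
  rw [Finset.sum_comm]
  refine Finset.sum_congr rfl fun y _ => ?_
  rw [extL_mk, ← mk_zero_smul, hδ, mk_sum]
  refine Finset.sum_congr rfl fun x _ => ?_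
  rw [mk_zero_smul, map_mul g.zero, mul_assoc]

lemma ofFree_extL (ht : ∀ x y, g.zero (t x y) = f.zero (b.l x (E.D₀ (b.e y))))
    (hδ : ∀ x v, q x * δ v (i x) = ∑ y, q y * t x y * v (i y)) (v : κ → A.Z) :
    ofFree b f g i q (ScalarExt.mk g 1 (δ v)) = extL f E.D₀ (ofFree b f g i q (ScalarExt.mk g 1 v)) := by
  rw [ofFree_mk, ofFree_mk, map_sum]
  simp only [hδ, map_sum g.zero, mk_algebraMap_sum]
  rw [Finset.sum_comm]
  refine Finset.sum_congr rfl fun y _ => ?_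
  rw [extL_mk]
  conv_rhs => rw [← b.sum_l_e (E.D₀ (b.e y)), mk_sum]
  refine Finset.sum_congr rfl fun x _ => ?_
  rw [mk_zero_smul, ← ht, ← map_mul]
  congr 3
  ring

def toFreeHom (r : b.κ → A.Z) (hi : ∀ x, deg (i x) = b.deg x) :
    DGMod.Hom (E.extend f) ((free A deg).extend g) 0 :=
  ⟨toFree b f g i r, ScalarExt.mem_homFil_zero.1 (toFree_mem b f g r hi)⟩

def ofFreeHom (q : b.κ → A.Z) (hi : ∀ x, deg (i x) = b.deg x) :
    DGMod.Hom ((free A deg).extend g) (E.extend f) 0 :=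
  ⟨ofFree b f g i q, ScalarExt.mem_homFil_zero.1 (ofFree_mem b f g q hi)⟩

lemma extendHom_freeMap {n : ℤ} (hδ : IsDeg (piGr A.Z deg) (piGr A.Z deg) n δ) :
    (extendHom (free A deg) g (freeMap δ hδ)).1 = extL g δ := by
  refine hom_ext g fun (e : κ → A.Z) => Eq.trans ?_ (extL_mk (f := g) δ 1 e).symm
  change ScalarExt.push g (id_push g) (extL (Hom.id A) δ (ScalarExt.mk (Hom.id A) 1 e)) <• (1 : C.A) = _
  rw [extL_mk, push_mk, map_one, MulOpposite.op_one, one_smul]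

variable (hi : ∀ x, deg (i x) = b.deg x) (hdeg : IsDeg (piGr A.Z deg) (piGr A.Z deg) 1 δ)

lemma d_toFreeHom (ht : ∀ x y, g.zero (t x y) = f.zero (b.l x (E.D₀ (b.e y))))
    (hδ : ∀ y, r y • δ (Pi.single (i y) 1) = ∑ x, (r x * t x y) • (Pi.single (i x) 1 : κ → A.Z)) :
    (DGMod.d (zero_add 1) (toFreeHom b r hi) + DGMod.comp (add_zero 1)
      (extendHom (free A deg) g (freeMap δ hdeg)) (toFreeHom (f := f) b r hi)).1 ∈
      ScalarExt.homFil f g E.gr (piGr A.Z deg) 1 1 := fun m e he => by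
  have h0 := toFree_mem b f g r hi m e he
  rw [add_zero] at h0
  have h1 := (free A deg).connExt_sub_mem g (rfl : m + 1 = m + 1) (mem_filGr_zero.1 h0)
  have h2 := ScalarExt.homFil_apply (toFree_mem b f g r hi) (E.connExt_one_sub_mem f rfl he)
    (Nat.le_refl 1) (add_zero (m + 1))
  rw [free_D₀] at h1
  have h1' := (congrArg (· ∈ filGr g (piGr A.Z deg) 1 (m + 1))
    ((congrArg _ (extL_zero (f := g) (N := κ → A.Z) (toFree b f g i r (ScalarExt.mk f 1 e)))).trans
      (sub_zero ((free A deg).connExt g (toFree b f g i r (ScalarExt.mk f 1 e)))))).mp h1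
  rw [map_sub, ← extL_toFree b ht hδ] at h2
  have h3 : (DGMod.d (zero_add 1) (toFreeHom b r hi) + DGMod.comp (add_zero 1)
      (extendHom (free A deg) g (freeMap δ hdeg)) (toFreeHom (f := f) b r hi)).1 (ScalarExt.mk f 1 e) =
      (show ScalarExt g (κ → A.Z) from (free A deg).connExt g (toFree b f g i r (ScalarExt.mk f 1 e))) -
        (toFree b f g i r (E.connExt f (ScalarExt.mk f 1 e)) -
          extL g δ (toFree b f g i r (ScalarExt.mk f 1 e))) := by
    change (show ScalarExt g (κ → A.Z) from (free A deg).connExt g (toFree b f g i r (ScalarExt.mk f 1 e))) -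
      (0 : ℤ).negOnePow • toFree b f g i r (E.connExt f (ScalarExt.mk f 1 e)) +
        (show ScalarExt g (κ → A.Z) →ₗ[(C.A)ᵐᵒᵖ] ScalarExt g (κ → A.Z) from
          (extendHom (free A deg) g (freeMap δ hdeg)).1) (toFree b f g i r (ScalarExt.mk f 1 e)) = _
    rw [extendHom_freeMap, Int.negOnePow_zero, one_smul]
    exact sub_add _ _ _
  exact (congrArg (· ∈ filGr g (piGr A.Z deg) 1 (m + 1)) h3).mpr (sub_mem h1' h2)

lemma d_ofFreeHom (ht : ∀ x y, g.zero (t x y) = f.zero (b.l x (E.D₀ (b.e y))))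
    (hδ : ∀ x v, q x * δ v (i x) = ∑ y, q y * t x y * v (i y)) :
    (DGMod.d (zero_add 1) (ofFreeHom b q hi) - DGMod.comp (zero_add 1) (ofFreeHom (f := f) b q hi)
      (extendHom (free A deg) g (freeMap δ hdeg))).1 ∈
      ScalarExt.homFil g f (piGr A.Z deg) E.gr 1 1 := fun m e he => by
  have h0 := ofFree_mem b f g q hi m e he
  rw [add_zero] at h0
  have h1 := E.connExt_sub_mem f (rfl : m + 1 = m + 1) (mem_filGr_zero.1 h0)
  have h2 := ScalarExt.homFil_apply (ofFree_mem b f g q hi) ((free A deg).connExt_one_sub_mem g rfl he)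
    (Nat.le_refl 1) (add_zero (m + 1))
  have h2' : ofFree b f g i q ((free A deg).connExt g (ScalarExt.mk g 1 e)) ∈ filGr f E.gr 1 (m + 1) := by
    rw [free_D₀] at h2
    refine (congrArg (fun x => ofFree b f g i q x ∈ filGr f E.gr 1 (m + 1)) ?_).mp h2
    refine (congrArg _ ?_).trans (sub_zero _)
    exact map_zero (AddMonoidHom.mk' (fun w : κ → A.Z => ScalarExt.mk g 1 w) fun w w' => mk_add g 1 w w')
  rw [← ofFree_extL b ht hδ] at h1
  have h3 : (DGMod.d (zero_add 1) (ofFreeHom b q hi) - DGMod.comp (zero_add 1) (ofFreeHom (f := f) b q hi)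
      (extendHom (free A deg) g (freeMap δ hdeg))).1 (ScalarExt.mk g 1 e) =
      E.connExt f (ofFree b f g i q (ScalarExt.mk g 1 e)) - ofFree b f g i q (ScalarExt.mk g 1 (δ e)) -
        ofFree b f g i q ((free A deg).connExt g (ScalarExt.mk g 1 e)) := by
    change E.connExt f (ofFree b f g i q (ScalarExt.mk g 1 e)) - (0 : ℤ).negOnePow •
      ofFree b f g i q ((free A deg).connExt g (ScalarExt.mk g 1 e)) -
        ofFree b f g i q ((extendHom (free A deg) g (freeMap δ hdeg)).1 (ScalarExt.mk g 1 e)) = _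
    rw [extendHom_freeMap, Int.negOnePow_zero, one_smul, sub_right_comm]
    exact congrArg (fun x => E.connExt f (ofFree b f g i q (ScalarExt.mk g 1 e)) - ofFree b f g i q x -
      ofFree b f g i q ((free A deg).connExt g (ScalarExt.mk g 1 e))) (extL_mk δ 1 e)
  exact (congrArg (· ∈ filGr f E.gr 1 (m + 1)) h3).mpr (sub_mem h1 h2')

end compare

end CohesiveModule

/-! ### Local comparison with a free module on the whole space -/

namespace CohesiveModule

section assoc

variable {A A' B B' C : DGAlg.{u}} {F : CohesiveModule A} {E : CohesiveModule A'} {p : Hom A B} {h : Hom B C}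
  {k : Hom A C} (hk : ∀ a, h.toFun (p.toFun a) = k.toFun a) {f : Hom A' C}

lemma canonHom_assocHomInv {n : ℤ} (hn : n + 0 = n) (ψ : DGMod.Hom F.toDGMod F.toDGMod n)
    (φ : DGMod.Hom (E.extend f) (F.extend k) 0) :
    DGMod.comp hn (canonHom h h hk hk ψ) (DGMod.comp (zero_add 0) (F.assocHomInv h hk) φ) =
      DGMod.comp (zero_add n) (F.assocHomInv h hk) (DGMod.comp hn (extendHom F k ψ) φ) :=
  Subtype.ext (LinearMap.ext fun x => congrArg (fun y => F.assocInv h hk ((extendHom F k ψ).1 y))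
    (F.assocTo_assocInv h hk _))

lemma assocHom_canonHom {n : ℤ} (hn : 0 + n = n) (ψ : DGMod.Hom F.toDGMod F.toDGMod n)
    (φ : DGMod.Hom (F.extend k) (E.extend f) 0) :
    DGMod.comp hn (DGMod.comp (zero_add 0) φ (F.assocHom h hk)) (canonHom h h hk hk ψ) =
      DGMod.comp (add_zero n) (DGMod.comp hn φ (extendHom F k ψ)) (F.assocHom h hk) :=
  Subtype.ext (LinearMap.ext fun x => congrArg φ.1 (F.assocTo_assocInv h hk _))

lemma d_assocHomInv_mem {ψ : DGMod.Hom F.toDGMod F.toDGMod 1} {φ : DGMod.Hom (E.extend f) (F.extend k) 0}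
    (hφ : (DGMod.d (zero_add 1) φ + DGMod.comp (add_zero 1) (extendHom F k ψ) φ).1 ∈
      ScalarExt.homFil f k E.gr F.gr 1 1) :
    (DGMod.d (zero_add 1) (DGMod.comp (zero_add 0) (F.assocHomInv h hk) φ) + DGMod.comp (add_zero 1)
      (canonHom h h hk hk ψ) (DGMod.comp (zero_add 0) (F.assocHomInv h hk) φ)).1 ∈
      ScalarExt.homFil f h E.gr (F.pullback p).gr 1 1 := by
  rw [canonHom_assocHomInv,
    DGMod.d_comp (zero_add 0) (zero_add 1) (zero_add 1) (zero_add 1) (add_zero 1) (zero_add 1),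
    d_assocHomInv, map_zero, LinearMap.zero_apply, zero_add, Int.negOnePow_zero, one_smul, ← map_add]
  have h1 : F.assocInv h hk ∈ ScalarExt.homFil k h F.gr (F.pullback p).gr 0 0 :=
    ScalarExt.mem_homFil_zero.2 (F.assocHomInv h hk).2
  exact fun m e he => ScalarExt.homFil_apply h1 (hφ m e he) le_rfl (add_zero _)

lemma d_assocHom_mem {ψ : DGMod.Hom F.toDGMod F.toDGMod 1} {φ : DGMod.Hom (F.extend k) (E.extend f) 0}
    (hφ : (DGMod.d (zero_add 1) φ - DGMod.comp (zero_add 1) φ (extendHom F k ψ)).1 ∈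
      ScalarExt.homFil k f F.gr E.gr 1 1) :
    (DGMod.d (zero_add 1) (DGMod.comp (zero_add 0) φ (F.assocHom h hk)) - DGMod.comp (zero_add 1)
      (DGMod.comp (zero_add 0) φ (F.assocHom h hk)) (canonHom h h hk hk ψ)).1 ∈
      ScalarExt.homFil h f (F.pullback p).gr E.gr 1 1 := by
  rw [assocHom_canonHom,
    DGMod.d_comp (zero_add 0) (zero_add 1) (zero_add 1) (zero_add 1) (add_zero 1) (zero_add 1),
    d_assocHom, map_zero, smul_zero, add_zero]
  have h1 : F.assocTo h hk ∈ ScalarExt.homFil h k (F.pullback p).gr F.gr 0 0 :=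
    ScalarExt.mem_homFil_zero.2 (F.assocHom h hk).2
  exact fun m e he => ScalarExt.homFil_apply hφ (h1 m e he) le_rfl (by omega)

end assoc

end CohesiveModule

section LocalFree

variable {X : Type v} [TopologicalSpace X] {𝒜 : DGAlgPresheaf.{u} X} {ι : Type w}
  {U : ι → Opens X}

open CohesiveModule

variable {κ : Type} [Fintype κ] [DecidableEq κ] {deg : κ → ℤ} {E : CohesiveFamily 𝒜 U} {c : ι}
  (b : DualBasis (E c)) {i : b.κ → κ} (hi : ∀ x, deg (i x) = b.deg x) (r : b.κ → (𝒜.obj ⊤).Z)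
  {t : b.κ → b.κ → (𝒜.obj ⊤).Z} {δ : (κ → (𝒜.obj ⊤).Z) →ₗ[(𝒜.obj ⊤).Z] (κ → (𝒜.obj ⊤).Z)}

/-- The morphism over `U_c` to the restriction of a free module. -/
def toLocal : LHom E (restrFamily U (free (𝒜.obj ⊤) deg)) (U c) le_rfl le_rfl 0 :=
  DGMod.comp (zero_add 0) ((free (𝒜.obj ⊤) deg).assocHomInv (𝒜.res le_rfl)
    (𝒜.res_res le_rfl le_top (le_top : U c ≤ ⊤))) (toFreeHom b r hi)

/-- The morphism over `U_c` from the restriction of a free module. -/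
def ofLocal : LHom (restrFamily U (free (𝒜.obj ⊤) deg)) E (U c) le_rfl le_rfl 0 :=
  DGMod.comp (zero_add 0) (ofFreeHom b r hi) ((free (𝒜.obj ⊤) deg).assocHom (𝒜.res le_rfl)
    (𝒜.res_res le_rfl le_top (le_top : U c ≤ ⊤)))

variable {r} {hi} (hdeg : IsDeg (piGr (𝒜.obj ⊤).Z deg) (piGr (𝒜.obj ⊤).Z deg) 1 δ)

lemma d_toLocal
    (ht : ∀ x y, (𝒜.res (le_top : U c ≤ ⊤)).zero (t x y) = (𝒜.res le_rfl).zero (b.l x ((E c).D₀ (b.e y))))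
    (hδ : ∀ y, r y • δ (Pi.single (i y) 1) = ∑ x, (r x * t x y) • (Pi.single (i x) 1 : κ → (𝒜.obj ⊤).Z)) :
    LHom.d (zero_add 1) (toLocal b hi r) + LHom.comp (add_zero 1)
      (canon le_rfl le_rfl (freeMap δ hdeg)) (toLocal b hi r) ∈ LHom.fil 1 := by
  exact d_assocHomInv_mem (𝒜.res_res le_rfl le_top (le_top : U c ≤ ⊤)) (d_toFreeHom b hi hdeg ht hδ)

lemma d_ofLocal
    (ht : ∀ x y, (𝒜.res (le_top : U c ≤ ⊤)).zero (t x y) = (𝒜.res le_rfl).zero (b.l x ((E c).D₀ (b.e y))))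
    (hδ : ∀ x v, r x * δ v (i x) = ∑ y, r y * t x y * v (i y)) :
    LHom.d (zero_add 1) (ofLocal b hi r) - LHom.comp (zero_add 1) (ofLocal b hi r)
      (canon le_rfl le_rfl (freeMap δ hdeg)) ∈ LHom.fil 1 := by
  exact d_assocHom_mem (𝒜.res_res le_rfl le_top (le_top : U c ≤ ⊤)) (d_ofFreeHom b hi hdeg ht hδ)

lemma ofLocal_toLocal {q : b.κ → (𝒜.obj ⊤).Z} (hinj : Function.Injective i) {s : (𝒜.obj ⊤).Z}
    (hs : ∀ x, q x * r x = s) : LHom.comp (zero_add 0) (ofLocal b hi q) (toLocal b hi r) =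
      LHom.zid E le_rfl ((𝒜.res le_top).zero s) :=
  Subtype.ext (LinearMap.ext fun x => (congrArg (fun y => (ofFreeHom b q hi).1 y)
    ((free (𝒜.obj ⊤) deg).assocTo_assocInv _ _ _)).trans
      (LinearMap.congr_fun (ofFree_toFree (g := 𝒜.res le_top) b hinj hs) x))

lemma eta_comp_lam {Q : CohesiveModule (𝒜.obj ⊤)} {l : LHom E (restrFamily U Q) (U c) le_rfl le_rfl 0}
    {η : LHom (restrFamily U Q) E (U c) le_rfl le_rfl 0} {s : (𝒜.obj ⊤).Z}
    (h : LHom.comp (zero_add 0) η l = LHom.zid E le_rfl ((𝒜.res le_top).zero s))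
    {W : Opens X} {a : ι} (hc : W ≤ U c) (ha : W ≤ U a) :
    LHom.comp (zero_add 0) (eta η ha hc) (lam l hc ha) = LHom.zid E hc ((𝒜.res le_top).zero s) := by
  rw [lam, ← LHom.comp_assoc (zero_add 0) (zero_add 0) (zero_add 0) (zero_add 0), eta_comp_canon, eta,
    canon_id _ _ rfl, show ∀ y : LHom (restrFamily U Q) E W hc hc 0,
      LHom.comp (zero_add 0) y (LHom.eqId (restrFamily U Q) hc hc rfl) = y from fun _ => rfl,
    ← LHom.rs_comp, h, LHom.rs_zid]
  congr 1
  refine (𝒜.obj W).zero_injective ?_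
  rw [(𝒜.res hc).algebraMap_zero, (𝒜.res _).algebraMap_zero, (𝒜.res _).algebraMap_zero, 𝒜.res_res]

lemma eta_comp_lam_ne {c' : ι} {Q : CohesiveModule (𝒜.obj ⊤)}
    {l : LHom E (restrFamily U Q) (U c) le_rfl le_rfl 0}
    {η : LHom (restrFamily U Q) E (U c') le_rfl le_rfl 0} (π : DGMod.Hom Q.toDGMod Q.toDGMod 0)
    (h : LHom.comp (zero_add 0) (canon le_rfl le_rfl π) l = l)
    (h' : LHom.comp (zero_add 0) η (canon le_rfl le_rfl π) = 0)
    {W : Opens X} {a : ι} (hc : W ≤ U c) (ha : W ≤ U a) (hc' : W ≤ U c') :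
    LHom.comp (zero_add 0) (eta η ha hc') (lam l hc ha) = 0 := by
  rw [lam, ← LHom.comp_assoc (zero_add 0) (zero_add 0) (zero_add 0) (zero_add 0), eta_comp_canon, eta,
    LHom.comp_assoc (zero_add 0) (zero_add 0) (zero_add 0) (zero_add 0), ← h, LHom.rs_comp, canon_rs,
    ← LHom.comp_assoc (zero_add 0) (zero_add 0) (zero_add 0) (zero_add 0) (canon _ _ _), canon_comp,
    show DGMod.comp (zero_add 0) (DGMod.idHom Q.toDGMod) π =
      DGMod.comp (zero_add 0) π (DGMod.idHom Q.toDGMod) from rfl,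
    ← canon_comp hc hc' hc',
    ← LHom.comp_assoc (zero_add 0) (zero_add 0) (zero_add 0) (zero_add 0),
    ← LHom.comp_assoc (zero_add 0) (zero_add 0) (zero_add 0) (zero_add 0), ← canon_rs le_rfl le_rfl hc',
    ← LHom.rs_comp, h', map_zero, map_zero, LinearMap.zero_apply]
  rfl

end LocalFree

/-! ### Local domination by a free module -/

section LocalDomination

variable {X : Type v} [TopologicalSpace X] {𝒜 : DGAlgPresheaf.{u} X} {ι : Type w}
  {U : ι → Opens X}

open CohesiveModule

def blockProj (R : Type u) [CommRing R] {n : ℕ} (K : Fin n → Type) (k : Fin n) :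
    ((Σ k, K k) → R) →ₗ[R] ((Σ k, K k) → R) :=
  LinearMap.pi fun q => if q.1 = k then LinearMap.proj q else 0

lemma blockProj_apply {R : Type u} [CommRing R] {n : ℕ} {K : Fin n → Type} (k : Fin n)
    (v : (Σ k, K k) → R) (q : Σ k, K k) : blockProj R K k v q = if q.1 = k then v q else 0 := by
  simp only [blockProj, LinearMap.pi_apply]
  split_ifs <;> rfl

lemma blockProj_deg {R : Type u} [CommRing R] {n : ℕ} {K : Fin n → Type} (k : Fin n)
    (deg : (Σ k, K k) → ℤ) : IsDeg (piGr R deg) (piGr R deg) 0 (blockProj R K k) := fun m m' h v hv q hq => by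
  rw [blockProj_apply, hv q (by omega), ite_self]

/-- The differential of a free module given by blocks of matrices with weights. -/
def blockDiff {R : Type u} [CommRing R] {n : ℕ} {K : Fin n → Type} [∀ k, Fintype (K k)] (ρ : Fin n → R)
    (t : ∀ k, K k → K k → R) : ((Σ k, K k) → R) →ₗ[R] ((Σ k, K k) → R) :=
  LinearMap.pi fun q => ∑ y, (ρ q.1 * t q.1 q.2 y) • LinearMap.proj (⟨q.1, y⟩ : Σ k, K k)

section blockDiff

variable {R : Type u} [CommRing R] {n : ℕ} {K : Fin n → Type} [∀ k, Fintype (K k)] {ρ : Fin n → R}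
  {t : ∀ k, K k → K k → R} {deg : ∀ k, K k → ℤ}

lemma blockDiff_apply (v : (Σ k, K k) → R) (k : Fin n) (x : K k) :
    blockDiff ρ t v ⟨k, x⟩ = ∑ y, ρ k * t k x y * v ⟨k, y⟩ := by
  simp only [blockDiff, LinearMap.pi_apply, LinearMap.sum_apply, LinearMap.smul_apply, LinearMap.proj_apply,
    smul_eq_mul]

lemma blockDiff_deg (ht : ∀ k x y, deg k x ≠ deg k y + 1 → t k x y = 0) :
    IsDeg (piGr R fun q : Σ k, K k => deg q.1 q.2) (piGr R fun q : Σ k, K k => deg q.1 q.2) 1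
      (blockDiff ρ t) := by
  rintro m m' h v hv ⟨k, x⟩ hq
  rw [blockDiff_apply]
  refine Finset.sum_eq_zero fun y _ => ?_
  by_cases hy : deg k y = m
  · rw [ht k x y (by dsimp only at hq; omega), mul_zero, zero_mul]
  · rw [hv ⟨k, y⟩ hy, mul_zero]

lemma blockDiff_blockDiff (ht : ∀ k x z, ρ k * ∑ y, t k x y * t k y z = 0) (v : (Σ k, K k) → R) :
    blockDiff ρ t (blockDiff ρ t v) = 0 := by
  ext ⟨k, x⟩
  simp only [blockDiff_apply, Finset.mul_sum]
  rw [Finset.sum_comm]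
  refine Finset.sum_eq_zero fun z _ => ?_
  have := congrArg (fun a => a * (ρ k * v ⟨k, z⟩)) (ht k x z)
  simp only [Finset.mul_sum, Finset.sum_mul, zero_mul] at this
  exact (Finset.sum_congr rfl fun y _ => by ring).trans this

lemma smul_blockDiff_single [∀ k, DecidableEq (K k)] {k : Fin n} {r : K k → R}
    (hr : ∀ x y, r y * (ρ k * t k x y) = r x * t k x y) (y : K k) :
    r y • blockDiff ρ t (Pi.single ⟨k, y⟩ 1) =
      ∑ x, (r x * t k x y) • (Pi.single ⟨k, x⟩ 1 : (Σ k, K k) → R) := by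
  ext ⟨k', x⟩
  simp only [Pi.smul_apply, blockDiff_apply, Finset.sum_apply, Pi.single_apply, smul_eq_mul, mul_ite, mul_one,
    mul_zero]
  by_cases hk : k' = k
  · subst hk
    simp [hr]
  · simp [hk]

lemma mul_blockDiff {k : Fin n} {q : K k → R} (hq : ∀ x y, q x * (ρ k * t k x y) = q y * t k x y) (x : K k)
    (v : (Σ k, K k) → R) : q x * blockDiff ρ t v ⟨k, x⟩ = ∑ y, q y * t k x y * v ⟨k, y⟩ := by
  rw [blockDiff_apply, Finset.mul_sum]
  exact Finset.sum_congr rfl fun y _ => by rw [← mul_assoc, hq]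

end blockDiff

lemma SoftCover.exists_lift (S : SoftCover 𝒜 U) (c : ι) (z : (𝒜.obj (U c)).Z) :
    ∃ s, (𝒜.res (le_top : U c ≤ ⊤)).zero s = z := by
  obtain ⟨b, hb, h⟩ := S.surj (le_top : U c ≤ ⊤) 0 _ (((𝒜.obj (U c)).mem_gr_zero _).2 ⟨z, rfl⟩)
  obtain ⟨s, rfl⟩ := ((𝒜.obj ⊤).mem_gr_zero _).1 hb
  exact ⟨s, (𝒜.obj (U c)).zero_injective (by rw [(𝒜.res _).algebraMap_zero, h])⟩

lemma SoftCover.ρ_mul (S : SoftCover 𝒜 U) (c : ι) {s : (𝒜.obj ⊤).Z}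
    (hs : (𝒜.res (le_top : U c ≤ ⊤)).zero s = 0) : S.ρ c * s = 0 := by
  refine (𝒜.obj ⊤).zero_injective ?_
  have h1 : (𝒜.res (le_top : (⊤ : Opens X) ≤ ⊤)).zero (S.ρ c) = S.ρ c :=
    (𝒜.obj ⊤).zero_injective (by rw [(𝒜.res _).algebraMap_zero, 𝒜.res_id])
  have h2 := S.mul_eq_zero c (le_top : U c ≤ ⊤) inf_le_right (algebraMap _ _ s)
    (by rw [← (𝒜.res _).algebraMap_zero, hs, map_zero])
  rw [map_mul, map_zero, ← h2, h1]

lemma exists_sum_mul_pow {R : Type u} [CommRing R] {n : ℕ} {ρ : Fin n → R} (h : ∑ k, ρ k = 1) (N : ℕ) :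
    ∃ c : Fin n → R, ∑ k, c k * ρ k ^ N = 1 := by
  have h1 : Ideal.span (Set.range ρ) = ⊤ := (Ideal.eq_top_iff_one _).2
    (h ▸ sum_mem fun k _ => Ideal.subset_span ⟨k, rfl⟩)
  have h2 := (Ideal.eq_top_iff_one _).1 (Ideal.span_pow_eq_top _ h1 N)
  rw [← Set.range_comp] at h2
  exact (Ideal.mem_span_range_iff_exists_fun).1 h2

lemma canon_comp_toLocal {κ : Type} [Fintype κ] [DecidableEq κ] {deg : κ → ℤ} {E : CohesiveFamily 𝒜 U} {c : ι}
    (b : DualBasis (E c)) {i : b.κ → κ} {hi : ∀ x, deg (i x) = b.deg x} {r : b.κ → (𝒜.obj ⊤).Z}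
    {π : (κ → (𝒜.obj ⊤).Z) →ₗ[(𝒜.obj ⊤).Z] (κ → (𝒜.obj ⊤).Z)}
    (hπ : IsDeg (piGr (𝒜.obj ⊤).Z deg) (piGr (𝒜.obj ⊤).Z deg) 0 π)
    (h : ∀ x, π (Pi.single (i x) 1) = Pi.single (i x) 1) :
    LHom.comp (zero_add 0) (canon le_rfl le_rfl (freeMap π hπ)) (toLocal b hi r) = toLocal b hi r := by
  have h1 : (extendHom (free (𝒜.obj ⊤) deg) (𝒜.res (le_top : U c ≤ ⊤)) (freeMap π hπ)).1 ∘ₗ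
      toFree b (𝒜.res le_rfl) (𝒜.res le_top) i r = toFree b (𝒜.res le_rfl) (𝒜.res le_top) i r := by
    rw [extendHom_freeMap]
    refine ScalarExt.hom_ext _ fun e => ?_
    change ScalarExt.extL _ π (toFree b _ _ i r (ScalarExt.mk _ 1 e)) = toFree b _ _ i r (ScalarExt.mk _ 1 e)
    rw [toFree_mk, map_sum]
    exact Finset.sum_congr rfl fun x _ => by rw [ScalarExt.extL_mk, h]
  exact (canonHom_assocHomInv (𝒜.res_res le_rfl le_top (le_top : U c ≤ ⊤)) (add_zero 0) (freeMap π hπ)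
    (toFreeHom (f := 𝒜.res le_rfl) b r hi)).trans (congrArg _ (Subtype.ext h1))

lemma ofLocal_comp_canon {κ : Type} [Fintype κ] [DecidableEq κ] {deg : κ → ℤ} {E : CohesiveFamily 𝒜 U} {c : ι}
    (b : DualBasis (E c)) {i : b.κ → κ} {hi : ∀ x, deg (i x) = b.deg x} {q : b.κ → (𝒜.obj ⊤).Z}
    {π : (κ → (𝒜.obj ⊤).Z) →ₗ[(𝒜.obj ⊤).Z] (κ → (𝒜.obj ⊤).Z)}
    (hπ : IsDeg (piGr (𝒜.obj ⊤).Z deg) (piGr (𝒜.obj ⊤).Z deg) 0 π) (h : ∀ v x, π v (i x) = 0) :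
    LHom.comp (zero_add 0) (ofLocal b hi q) (canon le_rfl le_rfl (freeMap π hπ)) = 0 := by
  have h1 : ofFree b (𝒜.res le_rfl) (𝒜.res le_top) i q ∘ₗ
      (extendHom (free (𝒜.obj ⊤) deg) (𝒜.res (le_top : U c ≤ ⊤)) (freeMap π hπ)).1 = 0 := by
    rw [extendHom_freeMap]
    refine ScalarExt.hom_ext _ fun (v : κ → (𝒜.obj ⊤).Z) => ?_
    change ofFree b _ _ i q (ScalarExt.extL _ π (ScalarExt.mk _ 1 v)) = 0
    rw [ScalarExt.extL_mk, ofFree_mk]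
    exact Finset.sum_eq_zero fun x _ => by rw [h, mul_zero, map_zero, map_zero, ScalarExt.zero_mk]
  refine (assocHom_canonHom (𝒜.res_res le_rfl le_top (le_top : U c ≤ ⊤)) (zero_add 0) (freeMap π hπ)
    (ofFreeHom (f := 𝒜.res le_rfl) b q hi)).trans (Subtype.ext (LinearMap.ext fun x => ?_))
  exact LinearMap.congr_fun h1 _

/-- A presentation of a family of cohesive modules on the `U_c` as a retract, locally and up to positive form
degree, of a free module with a differential on the whole space. -/
structure LocalDomination (S : SoftCover 𝒜 U) (E : CohesiveFamily 𝒜 U) where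
  n : ℕ
  idx : Fin n → ι
  κ : Type
  [fintype : Fintype κ]
  [decEq : DecidableEq κ]
  deg : κ → ℤ
  δ : (κ → (𝒜.obj ⊤).Z) →ₗ[(𝒜.obj ⊤).Z] (κ → (𝒜.obj ⊤).Z)
  δ_deg : IsDeg (piGr (𝒜.obj ⊤).Z deg) (piGr (𝒜.obj ⊤).Z deg) 1 δ
  l : ∀ k, LHom E (restrFamily U (free (𝒜.obj ⊤) deg)) (U (idx k)) le_rfl le_rfl 0
  η : ∀ k, LHom (restrFamily U (free (𝒜.obj ⊤) deg)) E (U (idx k)) le_rfl le_rfl 0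
  z : Fin n → (𝒜.obj ⊤).Z
  δ_δ : ∀ x, δ (δ x) = 0
  sum_z : ∑ k, z k * S.ρ (idx k) ^ 2 = 1
  d_l : ∀ k, LHom.d (zero_add 1) (l k) + LHom.comp (add_zero 1)
    (canon le_rfl le_rfl (freeMap δ δ_deg)) (l k) ∈ LHom.fil 1
  d_η : ∀ k, LHom.d (zero_add 1) (η k) - LHom.comp (zero_add 1) (η k)
    (canon le_rfl le_rfl (freeMap δ δ_deg)) ∈ LHom.fil 1
  η_l : ∀ k, LHom.comp (zero_add 0) (η k) (l k) = LHom.zid E le_rfl ((𝒜.res le_top).zero (z k))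
  π : Fin n → DGMod.Hom (free (𝒜.obj ⊤) deg).toDGMod (free (𝒜.obj ⊤) deg).toDGMod 0
  π_l : ∀ k, LHom.comp (zero_add 0) (canon le_rfl le_rfl (π k)) (l k) = l k
  η_π : ∀ k k', k ≠ k' → LHom.comp (zero_add 0) (η k') (canon le_rfl le_rfl (π k)) = 0

attribute [instance] LocalDomination.fintype LocalDomination.decEq

section ofDualBases

variable {S : SoftCover 𝒜 U} {E : CohesiveFamily 𝒜 U} {n : ℕ} {idx : Fin n → ι} (b : ∀ k, DualBasis (E (idx k)))
  {t : ∀ k, (b k).κ → (b k).κ → (𝒜.obj ⊤).Z}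

lemma ρ_mul_sum (ht : ∀ k x y, (𝒜.res (le_top : U (idx k) ≤ ⊤)).zero (t k x y) =
      (𝒜.res le_rfl).zero ((b k).l x ((E (idx k)).D₀ ((b k).e y)))) (k : Fin n) (x y : (b k).κ) :
    S.ρ (idx k) * ∑ x', t k x x' * t k x' y = 0 := by
  refine S.ρ_mul _ ?_
  have h1 := congrArg (fun e => (𝒜.res (le_rfl : U (idx k) ≤ U (idx k))).zero ((b k).l x e))
    ((E (idx k)).D₀_D₀ ((b k).e y))
  simp only [map_zero] at h1
  rw [← h1]
  conv_rhs => rw [← (b k).sum_l_e ((E (idx k)).D₀ ((b k).e y))]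
  simp only [map_sum, map_smul, smul_eq_mul, map_mul, ht]
  exact Finset.sum_congr rfl fun x' _ => mul_comm _ _

abbrev blockIncl (k : Fin n) (x : (b k).κ) : Σ k, (b k).κ := ⟨k, x⟩

abbrev blockDeg (q : Σ k, (b k).κ) : ℤ := (b q.1).deg q.2

/-- The comparison over `U_k` of `E_k` with the free module on all dual bases. -/
def blockTo (r : ∀ k, (b k).κ → (𝒜.obj ⊤).Z) (k : Fin n) :
    LHom E (restrFamily U (free (𝒜.obj ⊤) (blockDeg b))) (U (idx k)) le_rfl le_rfl 0 :=
  toLocal (b k) (i := blockIncl b k) (deg := blockDeg b) (fun _ => rfl) (r k)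

/-- The comparison over `U_k` of the free module on all dual bases with `E_k`. -/
def blockOf (q : ∀ k, (b k).κ → (𝒜.obj ⊤).Z) (k : Fin n) :
    LHom (restrFamily U (free (𝒜.obj ⊤) (blockDeg b))) E (U (idx k)) le_rfl le_rfl 0 :=
  ofLocal (b k) (i := blockIncl b k) (deg := blockDeg b) (fun _ => rfl) (q k)

lemma blockProj_comp_blockTo (r : ∀ k, (b k).κ → (𝒜.obj ⊤).Z) (k : Fin n) :
    LHom.comp (zero_add 0) (canon le_rfl le_rfl
      (freeMap (blockProj _ (fun k => (b k).κ) k) (blockProj_deg k (blockDeg b)))) (blockTo b r k) =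
      blockTo b r k :=
  canon_comp_toLocal (b k) (i := blockIncl b k) (hi := fun _ => rfl) (blockProj_deg k (blockDeg b)) fun x => by
    funext q
    rw [blockProj_apply, Pi.single_apply]
    split_ifs with h1 h2 h2
    · rfl
    · rfl
    · exact absurd (congrArg Sigma.fst h2) h1
    · rfl

lemma blockOf_comp_blockProj (q : ∀ k, (b k).κ → (𝒜.obj ⊤).Z) {k k' : Fin n} (h : k ≠ k') :
    LHom.comp (zero_add 0) (blockOf b q k') (canon le_rfl le_rfl
      (freeMap (blockProj _ (fun k => (b k).κ) k) (blockProj_deg k (blockDeg b)))) = 0 :=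
  ofLocal_comp_canon (b k') (i := blockIncl b k') (hi := fun _ => rfl) (blockProj_deg k (blockDeg b)) fun v x => by
    rw [blockProj_apply, if_neg h.symm]

lemma blockOf_comp_blockTo {r q : ∀ k, (b k).κ → (𝒜.obj ⊤).Z} {k : Fin n} {s : (𝒜.obj ⊤).Z}
    (h : ∀ x, q k x * r k x = s) : LHom.comp (zero_add 0) (blockOf b q k) (blockTo b r k) =
      LHom.zid E le_rfl ((𝒜.res le_top).zero s) :=
  ofLocal_toLocal (b k) (i := blockIncl b k) (hi := fun _ => rfl) (fun _ _ h => eq_of_heq (Sigma.mk.inj h).2) h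

def LocalDomination.ofDualBases
    (ht : ∀ k x y, (𝒜.res (le_top : U (idx k) ≤ ⊤)).zero (t k x y) =
      (𝒜.res le_rfl).zero ((b k).l x ((E (idx k)).D₀ ((b k).e y))))
    (ht0 : ∀ k x y, (b k).deg x ≠ (b k).deg y + 1 → t k x y = 0) {r q : ∀ k, (b k).κ → (𝒜.obj ⊤).Z}
    {z : Fin n → (𝒜.obj ⊤).Z} (hz : ∀ k x, q k x * r k x = z k)
    (hr : ∀ k x y, r k y * (S.ρ (idx k) * t k x y) = r k x * t k x y)
    (hq : ∀ k x y, q k x * (S.ρ (idx k) * t k x y) = q k y * t k x y)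
    (ha : ∑ k, z k * S.ρ (idx k) ^ 2 = 1) : LocalDomination S E where
  n := n
  idx := idx
  κ := Σ k, (b k).κ
  deg := blockDeg b
  δ := blockDiff (fun k => S.ρ (idx k)) t
  δ_deg := blockDiff_deg (deg := fun k => (b k).deg) ht0
  l := blockTo b r
  η := blockOf b q
  z := z
  δ_δ := blockDiff_blockDiff (ρ_mul_sum b ht)
  sum_z := ha
  d_l k := d_toLocal (b k) (i := blockIncl b k) (hi := fun _ => rfl) _ (ht k) fun y =>
    smul_blockDiff_single (K := fun k => (b k).κ) (ρ := fun k => S.ρ (idx k)) (hr k) y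
  d_η k := d_ofLocal (b k) (i := blockIncl b k) (hi := fun _ => rfl) _ (ht k) fun x v =>
    mul_blockDiff (K := fun k => (b k).κ) (ρ := fun k => S.ρ (idx k)) (hq k) x v
  η_l k := blockOf_comp_blockTo b (hz k)
  π k := freeMap (blockProj _ (fun k => (b k).κ) k) (blockProj_deg k _)
  π_l k := blockProj_comp_blockTo b r k
  η_π k k' hk := blockOf_comp_blockProj b q hk

end ofDualBases

lemma exists_localDomination (S : SoftCover 𝒜 U) (E : CohesiveFamily 𝒜 U) :
    Nonempty (LocalDomination S E) := by
  let idx : Fin S.J.card → ι := fun k => S.J.equivFin.symm k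
  let b : ∀ k, DualBasis (E (idx k)) := fun k => (E (idx k)).exists_dualBasis.some
  obtain ⟨M, hM⟩ := (Set.finite_range (blockDeg b)).bddAbove
  obtain ⟨m, hm⟩ := (Set.finite_range (blockDeg b)).bddBelow
  have hM : ∀ k x, (b k).deg x ≤ M := fun k x => hM (Set.mem_range_self (⟨k, x⟩ : Σ k, (b k).κ))
  have hm : ∀ k x, m ≤ (b k).deg x := fun k x => hm (Set.mem_range_self (⟨k, x⟩ : Σ k, (b k).κ))
  have hρ : ∑ k, S.ρ (idx k) = 1 := by
    rw [← S.sum_ρ, ← Finset.sum_coe_sort S.J]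
    exact Equiv.sum_comp S.J.equivFin.symm fun c : S.J => S.ρ c
  obtain ⟨a, ha⟩ := exists_sum_mul_pow hρ ((M - m).toNat + 2)
  have hl : ∀ k x y, ∃ s, (𝒜.res (le_top : U (idx k) ≤ ⊤)).zero s =
      (𝒜.res le_rfl).zero ((b k).l x ((E (idx k)).D₀ ((b k).e y))) ∧
      ((b k).deg x ≠ (b k).deg y + 1 → s = 0) := fun k x y => by
    by_cases h : (b k).deg x = (b k).deg y + 1
    · obtain ⟨s, hs⟩ := S.exists_lift (idx k)
        ((𝒜.res le_rfl).zero ((b k).l x ((E (idx k)).D₀ ((b k).e y))))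
      exact ⟨s, hs, fun h' => absurd h h'⟩
    · refine ⟨0, ?_, fun _ => rfl⟩
      rw [(b k).l_eq_zero x ((E (idx k)).D₀_mem ((b k).e_mem y)) (Ne.symm h), map_zero, map_zero]
  choose t ht ht0 using hl
  refine ⟨.ofDualBases b ht ht0 (r := fun k x => S.ρ (idx k) ^ ((b k).deg x - m).toNat)
    (q := fun k x => a k * S.ρ (idx k) ^ (M - (b k).deg x).toNat)
    (z := fun k => a k * S.ρ (idx k) ^ (M - m).toNat) (fun k x => ?_) (fun k x y => ?_) (fun k x y => ?_) ?_⟩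
  · have h1 : (M - m).toNat = (M - (b k).deg x).toNat + ((b k).deg x - m).toNat := by
      have := hM k x
      have := hm k x
      omega
    rw [h1, pow_add, ← mul_assoc]
  · by_cases h : (b k).deg x = (b k).deg y + 1
    · have h1 : ((b k).deg x - m).toNat = ((b k).deg y - m).toNat + 1 := by
        have := hm k y
        omega
      simp only [h1, pow_succ, mul_assoc]
    · rw [ht0 k x y h, mul_zero, mul_zero, mul_zero]
  · by_cases h : (b k).deg x = (b k).deg y + 1
    · have h1 : (M - (b k).deg y).toNat = (M - (b k).deg x).toNat + 1 := by
        have := hM k x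
        omega
      simp only [h1, pow_succ, mul_assoc]
    · rw [ht0 k x y h, mul_zero, mul_zero, mul_zero]
  · rw [← ha]
    exact Finset.sum_congr rfl fun k _ => by rw [pow_add, mul_assoc]

end LocalDomination

/-! ### Cochains of Čech degree zero -/

section Low

open Finset

lemma TotCat.exists_right_inverse_up_to {C : TotCat.{u, v}} {X : C.Obj} {φ h : C.Hom X X}
    (hφ : φ ∈ C.gr 0) (hh : h ∈ C.gr (-1)) (hdφ : C.D φ = 0) (k : ℕ) :
    ∃ g ∈ C.gr 0, C.D g = 0 ∧ ∃ y ∈ C.gr (-1), ∃ w ∈ C.gr 0, C.D w = 0 ∧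
      φ ⊚ g = C.id X + C.D y - w ∧ w = (fun x => (C.id X - φ + C.D h) ⊚ x)^[k] (C.id X) := by
  have hn : C.id X - φ + C.D h ∈ C.gr 0 := add_mem (sub_mem (C.id_gr X) hφ) (C.D_gr (by omega) hh)
  have hD : C.D (C.id X - φ + C.D h) = 0 := by rw [map_add, map_sub, C.D_id, hdφ, C.D_D]; simp
  induction k with
  | zero => exact ⟨0, zero_mem _, map_zero _, 0, zero_mem _, C.id X, C.id_gr X, C.D_id X, by simp, rfl⟩
  | succ k ih =>
    obtain ⟨g, hg, hdg, y, hy, w, hw, hdw, e, e'⟩ := ih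
    refine ⟨g + w, add_mem hg hw, by rw [map_add, hdg, hdw, add_zero], y + h ⊚ w,
      add_mem hy (C.comp_gr (by omega) hh hw), (C.id X - φ + C.D h) ⊚ w, C.comp_gr (by omega) hn hw, ?_, ?_, ?_⟩
    · rw [C.D_comp, hD, hdw]
      simp
    · rw [map_add, e, map_add, C.D_comp, hdw, map_zero, add_zero]
      simp only [map_add, map_sub, AddMonoidHom.add_apply, AddMonoidHom.sub_apply, C.id_comp]
      abel
    · rw [Function.iterate_succ_apply', e']

lemma CohesiveModule.exists_bound {A : DGAlg.{u}} (E : CohesiveModule A) :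
    ∃ N : ℕ, ∀ q : ℤ, N < q.natAbs → ∀ e ∈ E.gr q, e = 0 := by
  obtain ⟨b⟩ := E.exists_dualBasis
  refine ⟨∑ x, (b.deg x).natAbs, fun q hq e he => ?_⟩
  rw [← b.sum_l_e e]
  refine sum_eq_zero fun x _ => ?_
  rw [b.l_eq_zero x he, zero_smul]
  rintro rfl
  exact absurd (single_le_sum (f := fun x => (b.deg x).natAbs) (fun _ _ => Nat.zero_le _) (mem_univ x))
    (not_le.2 hq)

variable {X : Type v} [TopologicalSpace X] {𝒜 : DGAlgPresheaf.{u} X} {ι : Type w}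
  {U : ι → Opens X}

lemma LHom.eq_zero_of_lt {E F : CohesiveFamily 𝒜 U} {V : Opens X} {i j : ι} {hi : V ≤ U i}
    {hj : V ≤ U j} {N : ℕ} (hE : ∀ q : ℤ, N < q.natAbs → ∀ e ∈ (E i).gr q, e = 0)
    (hF : ∀ q : ℤ, N < q.natAbs → ∀ e ∈ (F j).gr q, e = 0) {n : ℤ} (hn : n < -(2 * N))
    (x : LHom E F V hi hj n) : x = 0 := by
  refine Subtype.ext (LinearMap.ext fun y => ?_)
  refine ScalarExt.hom_induction _ (E i).internal y (map_zero _) (fun m q b e hb he => ?_)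
    (fun y z hy hz => (map_add _ _ _).trans ((congrArg₂ _ hy hz).trans (add_zero _)))
  have h0 : x.1 (ScalarExt.mk _ 1 e) = 0 := by
    by_cases hq : N < q.natAbs
    · rw [hE q hq e he]
      exact (congrArg x.1 (ScalarExt.mk_zero (𝒜.res hi) 1)).trans (map_zero _)
    · refine ScalarExt.filGr_induction (P := fun y => y = 0) (LHom.mem_fil_zero x q e he) rfl (fun j' n' b' e' _ he' h' _ => ?_)
        (fun y z hy hz => (congrArg₂ _ hy hz).trans (add_zero _))
      rw [hF n' (by omega) e' he']
      exact ScalarExt.mk_zero (𝒜.res hj) b'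
  rw [ScalarExt.mk_eq]
  exact (map_smul x.1 _ _).trans ((congrArg _ h0).trans (smul_zero _))

namespace CechHom

lemma mul_mem_low {E F G : CohesiveFamily 𝒜 U} {m n l : ℤ} (h : m + n = l) {k : ℕ} {u : CechHom F G m}
    {v : CechHom E F n} (hu : ∀ a b s, u 0 a b s ∈ LHom.fil 1)
    (hv : ∀ p < k, ∀ a b s, v p a b s ∈ LHom.fil 1) (p : ℕ) (hp : p < k + 1) (a b : ι) (s : Simplex ι p a b) :
    mul h u v p a b s ∈ LHom.fil 1 := by
  rw [mul_apply]
  refine sum_mem ?_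
  rintro ⟨⟨i, j⟩, hx⟩ -
  have e : i + j = p := by simpa using hx
  rw [Units.smul_def]
  refine zsmul_mem ?_ _
  by_cases hi : i = 0
  · subst hi
    exact LHom.comp_mem_fil (p := 1) (q := 0) (by push_cast; omega) (LHom.rs_mem_fil _ (hu _ _ _))
      (LHom.mem_fil_zero _)
  · exact LHom.comp_mem_fil (p := 0) (q := 1) (by push_cast; omega) (LHom.mem_fil_zero _)
      (LHom.rs_mem_fil _ (hv j (by omega) _ _ _))

lemma exists_mem_fil_of_low (S : SoftCover 𝒜 U) (E : CohesiveFamily 𝒜 U) :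
    ∃ k, ∀ u : CechHom E E 0, (∀ p < k, ∀ a b s, u p a b s ∈ LHom.fil 1) → u ∈ fil 1 := by
  choose N hN using fun c => (E c).exists_bound
  refine ⟨2 * ∑ c ∈ S.J, N c + 1, fun u hu p a b s => ?_⟩
  by_cases hp : p < 2 * ∑ c ∈ S.J, N c + 1
  · exact hu p hp a b s
  by_cases ha : a ∈ S.J
  · by_cases hb : b ∈ S.J
    · have h1 := single_le_sum (f := N) (fun _ _ => Nat.zero_le _) ha
      have h2 := single_le_sum (f := N) (fun _ _ => Nat.zero_le _) hb
      rw [LHom.eq_zero_of_lt (N := ∑ c ∈ S.J, N c) (fun q hq => hN b q (h2.trans_lt hq))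
        (fun q hq => hN a q (h1.trans_lt hq)) (by omega) (u p a b s)]
      exact zero_mem _
    · rw [LHom.eq_zero_of_notMem S hb (supp_le_last s) (u p a b s)]
      exact zero_mem _
  · rw [LHom.eq_zero_of_notMem S ha (supp_le_first s) (u p a b s)]
    exact zero_mem _

variable {E F G : CohesiveFamily 𝒜 U}

lemma mem_low_of_atPt {n : ℤ} {u : CechHom E F n} (h : ∀ c, atPt c u ∈ LHom.fil 1) (a b : ι)
    (s : Simplex ι 0 a b) : u 0 a b s ∈ LHom.fil 1 := by
  obtain ⟨s, rfl, rfl⟩ := s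
  have h0 : (⟨s, rfl, rfl⟩ : Simplex ι 0 (s 0) (s (Fin.last 0))) = Simplex.pt (s 0) :=
    Subtype.ext (funext fun i => congrArg s (Fin.fin_one_eq_zero i))
  have h1 := LHom.cast_mem_fil (n.sub_zero).symm (LHom.rs_mem_fil (supp_le_first (Simplex.pt (s 0))) (h (s 0)))
  rw [atPt_apply, LHom.rs_cast, LHom.cast_cast, LHom.rs_rs, LHom.rs_self] at h1
  exact h0 ▸ h1

lemma atPt_mul {m n k : ℤ} (h : m + n = k) (c : ι) (u : CechHom F G m) (v : CechHom E F n) :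
    atPt c (mul h u v) = LHom.comp h (atPt c u) (atPt c v) := by
  rw [atPt_apply, mul_apply, sum_eq_single ⟨(0, 0), by simp⟩ (by
    rintro ⟨⟨i, j⟩, hx⟩ - hne
    obtain ⟨rfl, rfl⟩ : i = 0 ∧ j = 0 := by simpa using hx
    exact (hne rfl).elim) (fun h => (h (mem_univ _)).elim)]
  simp only [Nat.cast_zero, mul_zero, Int.negOnePow_zero, one_smul]
  rw [cup_rs, cup_cast, atPt_apply, atPt_apply, LHom.comp_cast_left, LHom.comp_cast_right]
  rfl

lemma atPt_id (c : ι) : atPt c (id E) = LHom.eqId E le_rfl le_rfl rfl := by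
  rw [atPt_apply]
  change LHom.cast _ (LHom.rs _ (LHom.cast _ (LHom.eqId E _ _ _))) = _
  rw [LHom.rs_cast, LHom.cast_cast, LHom.rs_eqId]
  rfl

lemma exists_atPt_eq {n : ℤ} (x : ∀ c, LHom E F (U c) le_rfl le_rfl n) :
    ∃ u : CechHom E F n, ∀ c, atPt c u = x c := by
  let u : CechHom E F n := fun p a b s => match p, s with
    | 0, s => LHom.comp (by push_cast; omega) (LHom.rs (supp_le_first s) (x a))
        (LHom.eqId E (supp_le_last s) (supp_le_first s) (s.2.2.symm.trans s.2.1))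
    | _ + 1, _ => 0
  refine ⟨u, fun c => ?_⟩
  rw [atPt_apply]
  change LHom.cast _ (LHom.rs _ (LHom.comp _ _ _)) = _
  rw [LHom.rs_comp, LHom.rs_rs, LHom.rs_eqId, LHom.comp_eqId, LHom.cast_cast, LHom.rs_self]
  rfl

end CechHom

end Low

/-! ### The degree zero part of the Maurer–Cartan equation -/

section Edge

open Finset

variable {X : Type v} [TopologicalSpace X] {𝒜 : DGAlgPresheaf.{u} X} {ι : Type w}
  {U : ι → Opens X} {V V' : Opens X} {i j k : ι}
  {hi : V ≤ U i} {hj : V ≤ U j} {hk : V ≤ U k}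

namespace LHom

variable {E F G : CohesiveFamily 𝒜 U}

/-- The morphisms of degree zero that are exact modulo positive form degree. -/
def bd : AddSubgroup (LHom E F V hi hj 0) where
  carrier := {x | ∃ y : LHom E F V hi hj (-1), x - d (neg_add_cancel 1) y ∈ fil 1}
  add_mem' := by
    rintro x x' ⟨y, hy⟩ ⟨y', hy'⟩
    exact ⟨y + y', mem_of_eq (by rw [map_add]; abel) (add_mem hy hy')⟩
  zero_mem' := ⟨0, by rw [map_zero, sub_zero]; exact zero_mem _⟩
  neg_mem' := by
    rintro x ⟨y, hy⟩
    exact ⟨-y, mem_of_eq (by rw [map_neg]; abel) (neg_mem hy)⟩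

lemma d_mem_bd (y : LHom E F V hi hj (-1)) : d (neg_add_cancel 1) y ∈ bd :=
  ⟨y, by rw [sub_self]; exact zero_mem _⟩

lemma comp_left_mem_bd {x : LHom F G V hj hk 0} (hx : d (zero_add 1) x ∈ fil 1) {y : LHom E F V hi hj 0}
    (hy : y ∈ bd) : comp (zero_add 0) x y ∈ bd := by
  obtain ⟨z, hz⟩ := hy
  refine ⟨comp (zero_add _) x z, ?_⟩
  rw [d_comp (zero_add _) (zero_add 1) (neg_add_cancel 1) _ (add_neg_cancel 1) (zero_add 0),
    Int.negOnePow_zero, one_smul, sub_add_eq_sub_sub_swap, ← map_sub]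
  exact sub_mem (comp_mem_fil (p := 0) (q := 1) (zero_add 0) (mem_fil_zero x) hz)
    (comp_mem_fil (p := 1) (q := 0) (add_neg_cancel 1) hx (mem_fil_zero z))

lemma comp_right_mem_bd {x : LHom E F V hi hj 0} (hx : d (zero_add 1) x ∈ fil 1) {y : LHom F G V hj hk 0}
    (hy : y ∈ bd) : comp (zero_add 0) y x ∈ bd := by
  obtain ⟨z, hz⟩ := hy
  refine ⟨comp (add_zero _) z x, ?_⟩
  rw [d_comp (add_zero _) (neg_add_cancel 1) (zero_add 1) _ (zero_add 0) (neg_add_cancel 1),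
    sub_add_eq_sub_sub, ← LinearMap.sub_apply, ← map_sub, Units.smul_def]
  exact sub_mem (comp_mem_fil (p := 1) (q := 0) (zero_add 0) hz (mem_fil_zero x))
    (zsmul_mem (comp_mem_fil (p := 0) (q := 1) (neg_add_cancel 1) (mem_fil_zero z) hx) _)

lemma bump_mem_bd (S : SoftCover 𝒜 U) (c : ι)
    {x : LHom E F (V ⊓ U c) (inf_le_left.trans hi) (inf_le_left.trans hj) 0} (hx : x ∈ bd) :
    (bump S c x : LHom E F V hi hj 0) ∈ bd := by
  obtain ⟨z, hz⟩ := hx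
  refine ⟨bump S c z, ?_⟩
  have h1 := bump_mem_fil S c (hi := hi) (hj := hj) hz
  rw [map_sub] at h1
  exact mem_of_eq (sub_sub_sub_cancel_right _ _ _).symm
    (sub_mem h1 (d_bump S c (hi := hi) (hj := hj) (neg_add_cancel 1) (mem_fil_zero z)))

end LHom

open LHom

def Simplex.pair (i j : ι) : Simplex ι 1 i j := ⟨![i, j], rfl, rfl⟩

lemma le_pair (hi : V ≤ U i) (hj : V ≤ U j) : V ≤ supp U (Simplex.pair i j) :=
  le_iInf fun q => by fin_cases q; exacts [hi, hj]

section edge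

variable {E : CohesiveFamily 𝒜 U} (a : CechHom E E 1)

def edge (hi : V ≤ U i) (hj : V ≤ U j) : LHom E E V hj hi 0 :=
  LHom.cast (by norm_num) (rs (le_pair hi hj) (a 1 i j (Simplex.pair i j)))

lemma rs_edge (h : V' ≤ V) (hi : V ≤ U i) (hj : V ≤ U j) :
    rs h (edge a hi hj) = edge a (h.trans hi) (h.trans hj) := by
  rw [edge, rs_cast, rs_rs]
  rfl

lemma rs_apply_one (s : Simplex ι 1 i j) (hV : V ≤ supp U s) (hi : V ≤ U i) (hj : V ≤ U j) :
    rs hV (a 1 i j s) = LHom.cast (by norm_num) (edge a hi hj) := by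
  rw [edge, LHom.cast_cast, LHom.cast_rfl]
  exact CechHom.rs_congr a (funext fun q => by fin_cases q; exacts [s.2.1, s.2.2]) _ _

end edge

namespace TwistedComplex

variable (M : TwistedComplex 𝒜 U)

lemma d_edge (hi : V ≤ U i) (hj : V ≤ U j) : d (zero_add 1) (edge M.a hi hj) = 0 := by
  have h1 : CechHom.dInt one_add_one_eq_two M.a 1 i j (Simplex.pair i j) +
      CechHom.delta one_add_one_eq_two M.a 1 i j (Simplex.pair i j) +
      CechHom.mul one_add_one_eq_two M.a M.a 1 i j (Simplex.pair i j) = 0 :=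
    congrFun (congrFun (congrFun (congrFun M.mc 1) i) j) (Simplex.pair i j)
  have h2 : CechHom.mul one_add_one_eq_two M.a M.a 1 i j (Simplex.pair i j) = 0 := by
    rw [CechHom.mul_apply]
    refine sum_eq_zero ?_
    rintro ⟨⟨p, q⟩, hx⟩ -
    have e : p + q = 1 := by simpa using hx
    by_cases hp : p = 0
    · subst hp
      simp only [CechHom.cup, M.a_zero, map_zero, LinearMap.zero_apply, smul_zero]
    · obtain rfl : q = 0 := by omega
      simp only [CechHom.cup, M.a_zero, map_zero, smul_zero]
  rw [h2, CechHom.delta_succ, CechHom.dInt_apply, univ_eq_empty, sum_empty, add_zero, add_zero, Units.smul_def,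
    Int.negOnePow_def] at h1
  simp only [Nat.cast_one, zpow_one, Units.val_neg, Units.val_one, neg_smul, one_smul, neg_eq_zero] at h1
  rw [edge, d_cast, ← LHom.cast_d (m := 2 - (1 : ℕ)) (by norm_num) (by norm_num), ← rs_d, h1, map_zero, map_zero]

lemma edge_comp_edge (hi : V ≤ U i) (hj : V ≤ U j) (hk : V ≤ U k) :
    comp (zero_add 0) (edge M.a hi hj) (edge M.a hj hk) - edge M.a hi hk ∈ bd := by
  have hV : V ≤ supp U (⟨![i, j, k], rfl, rfl⟩ : Simplex ι 2 i k) :=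
    le_iInf fun q => by fin_cases q; exacts [hi, hj, hk]
  have h1 : CechHom.dInt one_add_one_eq_two M.a 2 i k ⟨![i, j, k], rfl, rfl⟩ +
      CechHom.delta one_add_one_eq_two M.a 2 i k ⟨![i, j, k], rfl, rfl⟩ +
      CechHom.mul one_add_one_eq_two M.a M.a 2 i k ⟨![i, j, k], rfl, rfl⟩ = 0 :=
    congrFun (congrFun (congrFun (congrFun M.mc 2) i) k) ⟨![i, j, k], rfl, rfl⟩
  have h2 : rs hV (CechHom.mul one_add_one_eq_two M.a M.a 2 i k ⟨![i, j, k], rfl, rfl⟩) =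
      LHom.cast (by norm_num) (comp (zero_add 0) (edge M.a hi hj) (edge M.a hj hk)) := by
    rw [CechHom.mul_apply, sum_eq_single ⟨(1, 1), by simp⟩ (by
      rintro ⟨⟨p, q⟩, hx⟩ - hne
      have e : p + q = 2 := by simpa using hx
      by_cases hp : p = 0
      · subst hp
        simp only [CechHom.cup, M.a_zero, map_zero, LinearMap.zero_apply, smul_zero]
      · obtain rfl : q = 0 := by
          by_contra hq
          obtain ⟨rfl, rfl⟩ : p = 1 ∧ q = 1 := by omega
          exact hne rfl
        simp only [CechHom.cup, M.a_zero, map_zero, smul_zero]) (fun h => (h (mem_univ _)).elim)]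
    simp only [Nat.cast_one, sub_self, zero_mul, Int.negOnePow_zero, one_smul]
    rw [CechHom.cup_rs]
    refine (congrArg₂ (fun x y => comp _ x y) (rs_apply_one M.a _ _ hi hj) (rs_apply_one M.a _ _ hj hk)).trans ?_
    rw [comp_cast_left, comp_cast_right, cast_comp]
  have h3 := congrArg (rs hV) h1
  rw [map_add, map_add, h2, CechHom.delta_succ, CechHom.dInt_apply, univ_unique, sum_singleton, map_zero] at h3
  simp only [Units.smul_def, map_zsmul, Fin.default_eq_zero, Fin.val_zero, Nat.cast_zero, zero_add, rs_cast,
    rs_rs] at h3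
  rw [rs_apply_one M.a _ _ hi hk] at h3
  have h4 := congrArg (LHom.cast (by norm_num : (2 : ℤ) - (2 : ℕ) = 0)) h3
  rw [map_add, map_add, map_zsmul, map_zsmul, LHom.cast_cast, LHom.cast_cast, LHom.cast_cast, LHom.cast_rfl,
    LHom.cast_rfl, LHom.cast_rfl, rs_d, map_zero] at h4
  have h5 := d_mem_bd (-(LHom.cast (by norm_num) (rs hV (M.a 2 i k ⟨![i, j, k], rfl, rfl⟩))))
  refine mem_of_eq ?_ h5
  rw [map_neg, LHom.d_cast, ← sub_eq_zero, ← h4, Int.negOnePow_even _ (by decide), Int.negOnePow_one,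
    Units.val_one, Units.val_neg, Units.val_one, one_smul, neg_smul, one_smul]
  abel

lemma edge_self_sub_id (c : ι) :
    edge M.a (le_refl (U c)) le_rfl - eqId M.E le_rfl le_rfl rfl ∈ bd := by
  obtain ⟨-, ψ, hψ, ⟨h, hh⟩, -⟩ := M.invertible c
  have hc : U c ≤ supp U (Simplex.diag c) := le_iInf fun _ => le_rfl
  have e1 : comp (zero_add 0) (rs hc (ψ : LHom M.E M.E _ (supp_le_last _) (supp_le_last _) 0))
      (edge M.a le_rfl le_rfl) - eqId M.E le_rfl le_rfl rfl = d (neg_add_cancel 1)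
        (rs hc (h : LHom M.E M.E _ (supp_le_last _) (supp_le_last _) (-1))) := by
    have h1 := congrArg (rs hc : LHom M.E M.E _ (supp_le_last _) (supp_le_last _) 0 →ₗ[ℂ] _) hh
    refine Eq.trans ?_ (h1.trans (rs_d hc _ _))
    refine Eq.trans ?_ (map_sub (rs hc : LHom M.E M.E _ (supp_le_last _) (supp_le_last _) 0 →ₗ[ℂ] _) _ _).symm
    refine congrArg₂ _ (Eq.trans ?_ (rs_comp hc (zero_add 0) _ _).symm) (rs_eqId hc rfl).symm
    refine congrArg _ (Eq.trans ?_ (rs_cast hc _ _).symm)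
    rw [rs_apply_one M.a _ _ le_rfl le_rfl, LHom.cast_cast, LHom.cast_rfl]
  have e2 : d (zero_add 1) (rs hc (ψ : LHom M.E M.E _ (supp_le_last _) (supp_le_last _) 0)) = 0 :=
    (rs_d hc _ _).symm.trans ((congrArg (rs hc) hψ).trans (map_zero _))
  have h0 := comp_left_mem_bd (mem_of_eq e2 (zero_mem _)) (M.edge_comp_edge (le_refl (U c)) le_rfl le_rfl)
  have h1 := d_mem_bd (rs hc (h : LHom M.E M.E _ (supp_le_last _) (supp_le_last _) (-1)))
  refine mem_of_eq ?_ (add_mem (sub_mem h0 (comp_right_mem_bd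
    (mem_of_eq (M.d_edge (le_refl (U c)) le_rfl) (zero_mem _)) h1)) h1)
  rw [map_sub, ← comp_assoc (zero_add 0) (zero_add 0) (zero_add 0) (zero_add 0), ← e1, map_sub,
    LinearMap.sub_apply, eqId_comp, LHom.cast_rfl]
  abel

end TwistedComplex

namespace CechHom

variable {E : CohesiveFamily 𝒜 U} {Q : CohesiveModule (𝒜.obj ⊤)} (S : SoftCover 𝒜 U) (c : ι)
  (a : CechHom E E 1)

lemma atPt_first (l : LHom E (restrFamily U Q) (U j) le_rfl le_rfl 0) :
    atPt c (first S j l (zero_add 1) a) = bump S j (LHom.comp (zero_add 0) (lam l inf_le_right inf_le_left)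
      (edge a inf_le_right inf_le_left)) := by
  rw [atPt_apply, first_apply, rs_bump, LHom.rs_comp, rs_lam, rs_rs, rs_apply_one a _ _ inf_le_right inf_le_left,
    LHom.comp_cast_right, ← bump_cast, LHom.cast_comp]

lemma atPt_last (l : LHom (restrFamily U Q) E (U j) le_rfl le_rfl 0) :
    atPt c (last S j l (zero_add 1) a) = bump S j (LHom.comp (zero_add 0) (edge a inf_le_left inf_le_right)
      (eta l inf_le_left inf_le_right)) := by
  rw [atPt_apply, last_apply, show ((0 : ℕ) : ℤ).negOnePow = 1 from rfl, one_smul, rs_bump, LHom.rs_comp, rs_eta, rs_rs,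
    rs_apply_one a _ _ inf_le_left inf_le_right, LHom.comp_cast_left, ← bump_cast, LHom.cast_comp]

lemma atPt_last_mul_first (l : LHom E (restrFamily U Q) (U j) le_rfl le_rfl 0)
    (l' : LHom (restrFamily U Q) E (U k) le_rfl le_rfl 0) :
    atPt c (mul (zero_add 0) (last S k l' (zero_add 1) a) (first S j l (zero_add 1) a)) =
      bump S k (bump S j (LHom.comp (zero_add 0) (edge a (inf_le_left.trans inf_le_left) (inf_le_left.trans inf_le_right))
        (LHom.comp (zero_add 0) (LHom.comp (zero_add 0) (eta l' (inf_le_left.trans inf_le_left) (inf_le_left.trans inf_le_right))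
          (lam l inf_le_right (inf_le_left.trans inf_le_left)))
            (edge a inf_le_right (inf_le_left.trans inf_le_left))))) := by
  rw [atPt_mul, atPt_first, atPt_last, ← bump_comp_rs, rs_bump, ← bump_rs_comp, LHom.rs_comp, LHom.rs_comp, rs_lam, rs_eta,
    rs_edge, rs_edge]
  rfl

end CechHom

end Edge

/-! ### Twisted complexes are dominated by free modules -/

section Domination

open Finset LHom

variable {X : Type v} [TopologicalSpace X] {𝒜 : DGAlgPresheaf.{u} X} {ι : Type w}
  {U : ι → Opens X} {S : SoftCover 𝒜 U}

lemma res_zero {V V' : Opens X} (h : V' ≤ V) (z : (𝒜.obj ⊤).Z) :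
    (𝒜.res h).zero ((𝒜.res le_top).zero z) = (𝒜.res le_top).zero z := by
  refine (𝒜.obj V').zero_injective ?_
  rw [(𝒜.res h).algebraMap_zero, (𝒜.res _).algebraMap_zero, (𝒜.res _).algebraMap_zero, 𝒜.res_res]

/-- The differential of the morphisms of degree zero to a cohesive module. -/
def toD (M : TwistedComplex 𝒜 U) (Q : CohesiveModule (𝒜.obj ⊤)) :
    CechHom M.E (restrFamily U Q) 0 →ₗ[ℂ] CechHom M.E (restrFamily U Q) 1 :=
  (twCat 𝒜 U).d (X := M) (Y := Q.toTwisted U) (zero_add 1)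

/-- The differential of the morphisms of degree zero from a cohesive module. -/
def fromD (M : TwistedComplex 𝒜 U) (Q : CohesiveModule (𝒜.obj ⊤)) :
    CechHom (restrFamily U Q) M.E 0 →ₗ[ℂ] CechHom (restrFamily U Q) M.E 1 :=
  (twCat 𝒜 U).d (X := Q.toTwisted U) (Y := M) (zero_add 1)

variable {M : TwistedComplex 𝒜 U} {Q : CohesiveModule (𝒜.obj ⊤)}

lemma toD_apply (x : CechHom M.E (restrFamily U Q) 0) :
    toD M Q x = CechHom.dInt (zero_add 1) x + CechHom.delta (zero_add 1) x +
      CechHom.mul (add_zero 1) (twistCochain U Q) x - CechHom.mul (zero_add 1) x M.a := by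
  refine (twCat_d (M := M) (N := Q.toTwisted U) (zero_add 1) (add_zero 1) x).trans ?_
  rw [Int.negOnePow_zero, Units.val_one, one_smul]
  rfl

lemma fromD_apply (x : CechHom (restrFamily U Q) M.E 0) :
    fromD M Q x = CechHom.dInt (zero_add 1) x + CechHom.delta (zero_add 1) x +
      CechHom.mul (add_zero 1) M.a x - CechHom.mul (zero_add 1) x (twistCochain U Q) := by
  refine (twCat_d (M := Q.toTwisted U) (N := M) (zero_add 1) (add_zero 1) x).trans ?_
  rw [Int.negOnePow_zero, Units.val_one, one_smul]
  rfl

lemma LHom.sum_rmul_rmul {E F : CohesiveFamily 𝒜 U} {V : Opens X} {i j : ι} {hi : V ≤ U i}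
    {hj : V ≤ U j} {n : ℕ} {idx : Fin n → ι} {z : Fin n → (𝒜.obj ⊤).Z}
    (hz : ∑ k, z k * S.ρ (idx k) ^ 2 = 1) (x : LHom E F V hi hj 0) :
    ∑ k, rmul S (idx k) (rmul S (idx k) (comp (zero_add 0) (zid F hj ((𝒜.res le_top).zero (z k))) x)) = x := by
  refine Subtype.ext (LinearMap.ext fun y => ?_)
  have h1 := map_sum ((LinearMap.applyₗ' ℤ y).toAddMonoidHom.comp
    (DGMod.Hom ((E i).extend (𝒜.res hi)) ((F j).extend (𝒜.res hj)) 0).subtype.toAddMonoidHom)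
    (fun k => rmul S (idx k) (rmul S (idx k) (comp (zero_add 0) (zid F hj ((𝒜.res le_top).zero (z k))) x))) univ
  have h2 := sum_zmul (f := 𝒜.res hj) (𝒜.res (le_top : V ≤ ⊤)).zero (fun k => z k * S.ρ (idx k) ^ 2) univ
    (x.1 y : ScalarExt (𝒜.res hj) (F j).E)
  rw [hz, map_one] at h2
  refine h1.trans (Eq.trans (sum_congr rfl fun k _ => ?_) (h2.trans (zmul_one _)))
  change (((x.1 y : ScalarExt (𝒜.res hj) (F j).E) <• algebraMap (𝒜.obj V).Z (𝒜.obj V).A _) <•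
      algebraMap (𝒜.obj V).Z (𝒜.obj V).A _) <•
    algebraMap (𝒜.obj V).Z (𝒜.obj V).A _ =
      (x.1 y : ScalarExt (𝒜.res hj) (F j).E) <• algebraMap (𝒜.obj V).Z (𝒜.obj V).A _
  rw [smul_smul, smul_smul, ← MulOpposite.op_mul, ← MulOpposite.op_mul, ← map_mul, ← map_mul, ← map_mul, ← map_mul]
  congr 4
  ring

namespace LocalDomination

variable (D : LocalDomination S M.E)

def s : CechHom M.E (restrFamily U (CohesiveModule.free (𝒜.obj ⊤) D.deg)) 0 :=
  ∑ k, CechHom.first S (D.idx k) (D.l k) (zero_add 1) M.a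

def r : CechHom (restrFamily U (CohesiveModule.free (𝒜.obj ⊤) D.deg)) M.E 0 :=
  ∑ k, CechHom.last S (D.idx k) (D.η k) (zero_add 1) M.a

lemma atPt_r_s (c : ι) : CechHom.atPt c (CechHom.mul (zero_add 0) D.r D.s) - eqId M.E le_rfl le_rfl rfl ∈ bd := by
  have h1 : CechHom.atPt c (CechHom.mul (zero_add 0) D.r D.s) = ∑ k, CechHom.atPt c (CechHom.mul (zero_add 0)
      (CechHom.last S (D.idx k) (D.η k) (zero_add 1) M.a) (CechHom.first S (D.idx k) (D.l k) (zero_add 1) M.a)) := by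
    rw [r, s, ← CechHom.comp_apply, map_sum, map_sum]
    refine sum_congr rfl fun k _ => ?_
    rw [map_sum, LinearMap.sum_apply, map_sum]
    refine sum_eq_single k (fun k' _ hk => ?_) (fun h => (h (mem_univ k)).elim)
    rw [CechHom.comp_apply, CechHom.atPt_last_mul_first, eta_comp_lam_ne (D.π k) (D.π_l k) (D.η_π k k' hk.symm),
      map_zero, LinearMap.zero_apply, map_zero, map_zero, map_zero]
  refine mem_of_eq (sub_add_sub_cancel _ (edge M.a (le_refl (U c)) le_rfl) _).symm
    (add_mem ?_ (M.edge_self_sub_id c))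
  refine mem_of_eq (congrArg₂ (· - ·) h1 (LHom.sum_rmul_rmul D.sum_z (edge M.a (le_refl (U c)) le_rfl)).symm) ?_
  rw [← sum_sub_distrib]
  refine sum_mem fun k _ => ?_
  rw [CechHom.atPt_last_mul_first, eta_comp_lam (D.η_l k), ← bump_rs, ← bump_rs, rs_bump, ← map_sub, ← map_sub]
  refine bump_mem_bd S _ (bump_mem_bd S _ ?_)
  rw [LHom.rs_comp, LHom.rs_comp, rs_zid, rs_zid, rs_edge, rs_edge, res_zero, res_zero,
    ← LHom.comp_assoc (zero_add 0) (zero_add 0) (zero_add 0) (zero_add 0), ← zid_comp_eq (zero_add 0) (zero_add 0),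
    LHom.comp_assoc (zero_add 0) (zero_add 0) (zero_add 0) (zero_add 0), ← map_sub]
  exact comp_left_mem_bd (d_zid_mem _ _) (M.edge_comp_edge _ _ _)

lemma d_s : toD M _ D.s +
    CechHom.mul (add_zero 1) (mapCochain U (CohesiveModule.freeMap D.δ D.δ_deg)) D.s ∈ CechHom.fil 1 := by
  refine mem_of_eq (congrArg₂ (· + ·) (map_sum (toD M _) _ _) (map_sum (CechHom.comp (add_zero 1)
    (mapCochain U (CohesiveModule.freeMap D.δ D.δ_deg))) _ _)) ?_
  rw [← sum_add_distrib]
  refine sum_mem fun k _ => ?_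
  have h0 : CechHom.first S (D.idx k) (D.l k) one_add_one_eq_two
      (CechHom.dInt one_add_one_eq_two M.a + CechHom.delta one_add_one_eq_two M.a +
      CechHom.mul one_add_one_eq_two M.a M.a) = 0 := by
    refine (congrArg (CechHom.first S (D.idx k) (D.l k) one_add_one_eq_two) M.mc).trans ?_
    exact map_zero (CechHom.firstHom S (D.idx k) (D.l k) one_add_one_eq_two)
  rw [CechHom.first_add, CechHom.first_add] at h0
  have h1 := CechHom.first_delta S (D.idx k) (D.l k) (zero_add 1) one_add_one_eq_two (add_zero 1) M.a
  have h2 := CechHom.first_dInt S (D.idx k) (D.l k) (D.d_l k) (zero_add 1) one_add_one_eq_two (add_zero 1)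
    (u := M.a) (k := 0) fun _ _ _ _ => mem_fil_zero _
  have h3 : CechHom.first S (D.idx k) (D.l k) one_add_one_eq_two (CechHom.mul one_add_one_eq_two M.a M.a) =
      CechHom.mul (zero_add 1) (CechHom.first S (D.idx k) (D.l k) (zero_add 1) M.a) M.a :=
    CechHom.ext fun p a b t => by
      rw [CechHom.first_mul S _ _ (zero_add 1) one_add_one_eq_two one_add_one_eq_two (zero_add 1), CechHom.cup,
        M.a_zero, map_zero, map_zero, LinearMap.zero_apply, map_zero, map_zero, smul_zero, add_zero]
  rw [h3] at h0
  refine mem_of_eq (congrArg (· + _) (toD_apply _)) (mem_of_eq ?_ h2)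
  rw [CechHom.comp_apply, ← sub_eq_zero]
  refine Eq.trans ?_ (congrArg₂ (· - ·) h1 h0 |>.trans (sub_zero _))
  abel

lemma d_r : fromD M _ D.r -
    CechHom.mul (zero_add 1) D.r (mapCochain U (CohesiveModule.freeMap D.δ D.δ_deg)) ∈ CechHom.fil 1 := by
  refine mem_of_eq (congrArg₂ (· - ·) (map_sum (fromD M _) _ _) (map_sum ((CechHom.comp (zero_add 1)).flip
    (mapCochain U (CohesiveModule.freeMap D.δ D.δ_deg))) _ _)) ?_
  rw [← sum_sub_distrib]
  refine sum_mem fun k _ => ?_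
  have h0 : CechHom.last S (D.idx k) (D.η k) one_add_one_eq_two
      (CechHom.dInt one_add_one_eq_two M.a + CechHom.delta one_add_one_eq_two M.a +
      CechHom.mul one_add_one_eq_two M.a M.a) = 0 := by
    refine (congrArg (CechHom.last S (D.idx k) (D.η k) one_add_one_eq_two) M.mc).trans ?_
    exact map_zero (AddMonoidHom.mk' _ (CechHom.last_add S (D.idx k) (D.η k) one_add_one_eq_two))
  rw [CechHom.last_add, CechHom.last_add] at h0
  have h1 := CechHom.last_delta S (D.idx k) (D.η k) (zero_add 1) one_add_one_eq_two M.a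
  have h2 := CechHom.last_dInt S (D.idx k) (D.η k) (D.d_η k) (zero_add 1) one_add_one_eq_two
    (u := M.a) (k := 0) fun _ _ _ _ => mem_fil_zero _
  have h3 : CechHom.last S (D.idx k) (D.η k) one_add_one_eq_two (CechHom.mul one_add_one_eq_two M.a M.a) =
      -CechHom.mul (add_zero 1) M.a (CechHom.last S (D.idx k) (D.η k) (zero_add 1) M.a) :=
    CechHom.ext fun p a b t => by
      rw [CechHom.last_mul S _ _ (zero_add 1) one_add_one_eq_two one_add_one_eq_two (add_zero 1), CechHom.cup,
        M.a_zero, map_zero, map_zero, map_zero, LinearMap.zero_apply, map_zero, smul_zero, add_zero,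
        Int.negOnePow_one, Units.neg_smul, one_smul]
      rfl
  rw [h3] at h0
  rw [Int.negOnePow_zero, one_smul] at h1 h2
  refine mem_of_eq (congrArg (· - _) (fromD_apply _)) (mem_of_eq ?_ h2)
  rw [LinearMap.flip_apply, CechHom.comp_apply, ← sub_eq_zero]
  refine Eq.trans ?_ (congrArg₂ (· - ·) (sub_eq_zero.2 h1) h0 |>.trans (sub_zero _))
  abel

end LocalDomination

end Domination

/-! ### Existence of the dominating free module -/

namespace DGCat

section

variable {C : DGCat.{u, v}} (𝓒 : C.Filt) {X Y Z : C.Obj}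

/-- The class of a homogeneous morphism modulo positive filtration. -/
def Filt.tcls {n : ℤ} : C.Hom X Y n →+ 𝓒.tot.quot.Hom X Y :=
  𝓒.tot.cls.comp (AddMonoidHom.mk' tof tof_add)

lemma Filt.tcls_eq_zero {n : ℤ} {f : C.Hom X Y n} (h : f ∈ 𝓒.fil 1) : 𝓒.tcls f = 0 :=
  𝓒.tot.cls_eq_zero.2 (Filt.tof_mem.2 h)

lemma Filt.tcls_comp {m n k : ℤ} (h : m + n = k) (g : C.Hom Y Z m) (f : C.Hom X Y n) :
    𝓒.tcls (C.comp h g f) = 𝓒.tcls g ⊚ 𝓒.tcls f := congrArg 𝓒.tot.cls (tcomp_tof h g f).symm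

lemma Filt.tcls_d {n m : ℤ} (h : n + 1 = m) (f : C.Hom X Y n) :
    𝓒.tcls (C.d h f) = 𝓒.tot.quot.D (𝓒.tcls f) := congrArg 𝓒.tot.cls (tD_tof h f).symm

lemma Filt.tcls_gr {n : ℤ} (f : C.Hom X Y n) : 𝓒.tcls f ∈ 𝓒.tot.quot.gr n :=
  𝓒.tot.cls_gr (tof_mem_gr f)

end

lemma FilTransfer.exists_dominatedObj {P : DGCat} {C : DGCat.{w, max u v}} {T : Functor P C} {𝓟 : P.Filt}
    {𝓒 : C.Filt} (τ : FilTransfer T 𝓟 𝓒) {R : Type u} [CommRing R] {𝕀 : P.tot.UnitObj R} {κ : Type} [Fintype κ]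
    [DecidableEq κ] {deg : κ → ℤ} {F : P.Obj} (φ : TotCat.FreeOn 𝕀 deg (F : P.tot.Obj))
    {δ : (κ → R) →ₗ[R] (κ → R)} (hδ : IsDeg (piGr R deg) (piGr R deg) 1 δ) (hδδ : ∀ x, δ (δ x) = 0)
    {Δ : P.Hom F F 1} (hΔ : φ.mat φ δ = tof Δ) {E : C.Obj} {r : C.Hom (T.obj F) E 0} {s : C.Hom E (T.obj F) 0}
    {h : C.Hom E E (-1)} (hr : C.d (zero_add 1) r - C.comp (zero_add 1) r (T.map Δ) ∈ 𝓒.fil 1)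
    (hs : C.d (zero_add 1) s + C.comp (add_zero 1) (T.map Δ) s ∈ 𝓒.fil 1) {k : ℕ}
    (hk : (fun x => C.comp (zero_add 0) (C.id E - C.comp (zero_add 0) r s + C.d (neg_add_cancel 1) h) x)^[k] (C.id E)
      ∈ 𝓒.fil 1) : Nonempty (TotCat.LevelZero.DominatedObj τ.tot.quotFunc (φ.quot 𝓟.tot) (E : C.tot.Obj) δ) := by
  have eΔ : τ.tot.quotFunc.map ((φ.quot 𝓟.tot).mat (φ.quot 𝓟.tot) δ) = 𝓒.tcls (T.map Δ) :=
    (congrArg _ ((TotCat.FreeOn.quot_mat 𝓟.tot φ δ).trans (congrArg 𝓟.tot.cls hΔ))).trans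
      (congrArg 𝓒.tot.cls (T.tot_map Δ))
  have er : 𝓒.tot.quot.D (𝓒.tcls r) = 𝓒.tcls r ⊚ 𝓒.tcls (T.map Δ) := by
    rw [← Filt.tcls_d 𝓒 (zero_add 1), ← Filt.tcls_comp 𝓒 (zero_add 1), ← sub_eq_zero, ← map_sub]
    exact 𝓒.tcls_eq_zero hr
  have es : 𝓒.tot.quot.D (𝓒.tcls s) = -(𝓒.tcls (T.map Δ) ⊚ 𝓒.tcls s) := by
    rw [← Filt.tcls_d 𝓒 (zero_add 1), ← Filt.tcls_comp 𝓒 (add_zero 1), ← add_eq_zero_iff_eq_neg, ← map_add]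
    exact 𝓒.tcls_eq_zero hs
  have σr := 𝓒.tot.quot.σ_even (𝓒.tcls_gr r) Even.zero
  have σs := 𝓒.tot.quot.σ_even (𝓒.tcls_gr s) Even.zero
  obtain ⟨g, hg, hdg, y, hy, w, -, -, e, e'⟩ := TotCat.exists_right_inverse_up_to
    (𝓒.tot.quot.comp_gr (by omega) (𝓒.tcls_gr r) (𝓒.tcls_gr s)) (𝓒.tcls_gr h)
    (by rw [𝓒.tot.quot.D_comp, er, σr, es, map_neg, 𝓒.tot.quot.assoc, add_neg_cancel]) k
  have hw : w = 0 := by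
    rw [e', ← 𝓒.tcls_eq_zero hk]
    have hb : 𝓒.tcls (C.id E - C.comp (zero_add 0) r s + C.d (neg_add_cancel 1) h) =
        𝓒.tot.quot.id E - 𝓒.tcls r ⊚ 𝓒.tcls s + 𝓒.tot.quot.D (𝓒.tcls h) := by
      rw [map_add, map_sub, Filt.tcls_comp, Filt.tcls_d]
      rfl
    have key : ∀ k, (fun x => (𝓒.tot.quot.id E - 𝓒.tcls r ⊚ 𝓒.tcls s + 𝓒.tot.quot.D (𝓒.tcls h)) ⊚ x)^[k]
        (𝓒.tot.quot.id E) = 𝓒.tcls ((fun x => C.comp (zero_add 0)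
          (C.id E - C.comp (zero_add 0) r s + C.d (neg_add_cancel 1) h) x)^[k] (C.id E)) := fun k => by
      induction k with
      | zero => rfl
      | succ k ih =>
        rw [Function.iterate_succ_apply', Function.iterate_succ_apply', Filt.tcls_comp, ih, hb]
    exact key k
  rw [hw, sub_zero] at e
  exact ⟨{
    r := 𝓒.tcls r
    s := 𝓒.tcls s ⊚ g
    h := y
    r_gr := 𝓒.tcls_gr r
    s_gr := 𝓒.tot.quot.comp_gr (by omega) (𝓒.tcls_gr s) hg
    h_gr := hy
    δ_deg := hδ
    δ_δ := hδδ
    D_r := by rw [eΔ]; exact er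
    D_s := by
      rw [𝓒.tot.quot.D_comp, es, hdg, map_zero, add_zero, eΔ, map_neg, AddMonoidHom.neg_apply,
        𝓒.tot.quot.assoc]
    r_s := (𝓒.tot.quot.assoc _ _ _).symm.trans e }⟩

end DGCat

section

variable {X : Type v} [TopologicalSpace X] {𝒜 : DGAlgPresheaf.{u} X} {ι : Type w}
  {U : ι → Opens X} {S : SoftCover 𝒜 U}

def selfD (M : TwistedComplex 𝒜 U) : CechHom M.E M.E (-1) →ₗ[ℂ] CechHom M.E M.E 0 :=
  (twCat 𝒜 U).d (X := M) (Y := M) (neg_add_cancel 1)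

lemma LocalDomination.exists_nilpotent {M : TwistedComplex 𝒜 U} (D : LocalDomination S M.E) :
    ∃ (h : CechHom M.E M.E (-1)) (k : ℕ), (fun x : CechHom M.E M.E 0 => CechHom.mul (zero_add 0)
      (CechHom.id M.E - CechHom.mul (zero_add 0) D.r D.s + selfD M h) x)^[k] (CechHom.id M.E) ∈
          CechHom.fil 1 := by
  choose y hy using D.atPt_r_s
  obtain ⟨h, hh⟩ := CechHom.exists_atPt_eq y
  obtain ⟨k, hk⟩ := CechHom.exists_mem_fil_of_low S M.E
  refine ⟨h, k, hk _ ?_⟩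
  generalize e : CechHom.id M.E - CechHom.mul (zero_add 0) D.r D.s + selfD M h = v
  have hv := CechHom.mem_low_of_atPt (u := v) fun c => by
    rw [← e, map_add, map_sub, CechHom.atPt_id]
    have h1 : CechHom.atPt c (selfD M h) = LHom.d (neg_add_cancel 1) (y c) :=
      (CechHom.atPt_twCat_d (M := M) (N := M) _ (add_neg_cancel 1) h c).trans (congrArg _ (hh c))
    rw [h1]
    exact mem_of_eq (by abel) (neg_mem (hy c))
  clear hk
  induction k with
  | zero => exact fun p hp => absurd hp p.not_lt_zero
  | succ k ih =>
    rw [Function.iterate_succ_apply']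
    exact CechHom.mul_mem_low (zero_add 0) hv ih

set_option maxHeartbeats 1000000 in
lemma SoftCover.isQuasiEquivalence (S : SoftCover 𝒜 U) : (twistingFunctor 𝒜 U).IsQuasiEquivalence := by
  refine (twistingTransfer 𝒜 U S).isQuasiEquivalence (cohesiveFilt_isFinite S) (twFilt_isFinite S) fun M => ?_
  obtain ⟨D⟩ := exists_localDomination S M.E
  obtain ⟨h, k, hk⟩ := D.exists_nilpotent
  obtain ⟨e⟩ := (twistingTransfer 𝒜 U S).exists_dominatedObj (CohesiveModule.freeOn (𝒜.obj ⊤) D.deg) D.δ_deg D.δ_δ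
    (CohesiveModule.freeOn_mat D.δ_deg) (E := M) (r := D.r) (s := D.s) (h := h) D.d_r D.d_s (k := k) hk
  exact TotCat.exists_isEquiv_of_dominated (twistingTransfer 𝒜 U S).tot (CohesiveModule.unitReduced (𝒜.obj ⊤))
    (cohesiveFilt_isFinite S).tot (twFilt_isFinite S).tot (fun κ _ _ deg => CohesiveModule.free (𝒜.obj ⊤) deg)
    (fun κ _ _ deg => CohesiveModule.freeOn (𝒜.obj ⊤) deg)
    (fun κ _ _ deg => CohesiveModule.exists_split deg) e

end

/-! ### Partitions of unity for the Dolbeault algebras -/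

section Dolbeault

variable {E : Type u} [NormedAddCommGroup E] [NormedSpace ℂ E] [FiniteDimensional ℂ E]
  {X : Type v} [TopologicalSpace X] [ChartedSpace E X] [IsManifold 𝓘(ℂ, E) ω X]

lemma smoothFormAt_ofReal {f : X → ℝ} (hf : ContMDiff 𝓘(ℝ, E) 𝓘(ℝ, ℝ) ∞ f) (x : X) :
    SmoothFormAt (fun y => (f y : ℂ) • (1 : FormFibre E)) x :=
  ⟨[(fun y => (f y : ℂ), [])], Set.univ, trivial, isOpen_univ, by
    intro t ht
    rw [List.mem_singleton] at ht
    subst ht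
    exact ⟨(Complex.ofRealCLM.contMDiff.comp hf).contMDiffOn, by simp⟩, fun y _ => by
    simp [exprVal, dbarProd_nil]⟩

lemma dolbeaultRes_grSurj [CompactSpace X] [T2Space X] {K K' : Set X} (hK : IsClosed K') (h : K' ⊆ K) :
    (dolbeaultRes (E := E) h).GrSurj := by
  have := isManifold_real (E := E) (X := X)
  intro i b hb
  obtain ⟨β, hβ, rfl⟩ := formGerm_surj (E := E) b
  obtain ⟨O, hO, hKO, hO'⟩ := eventually_nhdsSet_iff_exists.1
    ((SmoothFormAt.eventually hβ).and (mem_germGr.1 hb))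
  obtain ⟨u, hu, hKu, huO⟩ := normal_exists_closure_subset hK hO hKO
  obtain ⟨χ, h1, h0, -⟩ := exists_contMDiffMap_one_nhds_of_subset_interior (n := ⊤) 𝓘(ℝ, E) hK
    (hKu.trans (hu.subset_interior_iff.2 subset_closure))
  have hs : ∀ x, SmoothFormAt (fun y => (χ y : ℂ) • (1 : FormFibre E) * β y) x := fun x => by
    by_cases hx : x ∈ O
    · exact (smoothFormAt_ofReal χ.contMDiff x).mul (hO' x hx).1
    · refine (SmoothFormAt.algebraMap 0 x).congr ?_
      filter_upwards [isClosed_closure.isOpen_compl.mem_nhds fun hx' => hx (huO hx')] with y hy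
      rw [h0 y hy, Complex.ofReal_zero, zero_smul, zero_mul, map_zero]
  refine ⟨formGerm _ fun x _ => hs x, mem_germGr.2 (Filter.Eventually.of_forall fun x => ?_), ?_⟩
  · by_cases hx : x ∈ O
    · rw [smul_mul_assoc, one_mul]
      exact Submodule.smul_mem _ _ (hO' x hx).2
    · rw [h0 x fun hx' => hx (huO hx'), Complex.ofReal_zero, zero_smul, zero_mul]
      exact zero_mem _
  · refine formGerm_congr (h := fun x _ => hs x) ?_
    filter_upwards [h1] with x hx
    rw [hx, Complex.ofReal_one, one_smul, one_mul]

def ofRealGerm (K : Set X) {f : X → ℝ} (hf : ContMDiff 𝓘(ℝ, E) 𝓘(ℝ, ℝ) ∞ f) :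
    (dolbeaultAlg E K).Z :=
  ⟨formGerm _ fun x _ => smoothFormAt_ofReal hf x, mem_germGr.2 (Filter.Eventually.of_forall fun x =>
    Submodule.smul_mem _ _ SetLike.GradedOne.one_mem)⟩

lemma exists_softCover [CompactSpace X] [T2Space X] {ι : Type w} (U : ι → Opens X)
    (hU : LocallyFinite fun i => (U i : Set X)) (hcov : ⨆ i, U i = ⊤) :
    Nonempty (SoftCover (dolbeault E X) U) := by
  have := isManifold_real (E := E) (X := X)
  obtain ⟨f, hf⟩ := SmoothPartitionOfUnity.exists_isSubordinate 𝓘(ℝ, E) isClosed_univ (fun i => (U i : Set X))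
    (fun i => (U i).isOpen) (fun x _ => by
      have hx : x ∈ (⨆ i, U i) := hcov ▸ trivial
      simpa using hx)
  have hfin := hU.finite_nonempty_of_compact
  have h0 : ∀ i ∉ hfin.toFinset, (U i : Set X) = ∅ := fun i hi =>
    Set.not_nonempty_iff_eq_empty.1 fun h => hi (hfin.mem_toFinset.2 h)
  refine ⟨{
    surj := fun h => dolbeaultRes_grSurj isClosed_closure _
    J := hfin.toFinset
    ρ := fun i => ofRealGerm _ (f i).contMDiff
    sum_ρ := ?_
    mul_eq_zero := ?_
    eq_zero := ?_
    N := Module.finrank ℂ (E →ₗ⋆[ℂ] ℂ)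
    gr_eq_zero := ?_ }⟩
  · refine (dolbeaultAlg E _).zero_injective ((map_sum _ _ _).trans (Subtype.ext ?_))
    refine (AddSubmonoidClass.coe_finsetSum (S := smoothForms E (closure ((⊤ : Opens X) : Set X)))
      _ _).trans ?_
    refine (map_sum (Filter.Germ.coeAddHom (nhdsSet (closure ((⊤ : Opens X) : Set X))))
      (fun i y => (f i y : ℂ) • (1 : FormFibre E)) hfin.toFinset).symm.trans ?_
    refine congrArg Filter.Germ.ofFun (funext fun y => ?_)
    rw [Finset.sum_apply, ← Finset.sum_smul, ← Complex.ofReal_sum, ← finsum_eq_sum_of_support_subset,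
      f.sum_eq_one (Set.mem_univ y), Complex.ofReal_one, one_smul]
    intro i hi
    by_contra h
    exact hi (image_eq_zero_of_notMem_tsupport fun hy => (h0 i h).le (hf i hy))
  · intro j W V h hVW b hb
    obtain ⟨β, hβ, rfl⟩ := formGerm_surj (E := E) b
    have hb' : ∀ᶠ x in nhdsSet (closure (W : Set X)), β x = 0 := Filter.Germ.coe_eq.1 (congrArg Subtype.val hb)
    refine Subtype.ext (Filter.Germ.coe_eq.2 (eventually_nhdsSet_iff_forall.2 fun x hx => ?_))
    change ∀ᶠ y in nhds x, (f j y : ℂ) • (1 : FormFibre E) * β y = 0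
    by_cases hxj : x ∈ U j
    · have hxW : x ∈ closure (W : Set X) :=
        closure_mono (show ((V : Set X) ∩ U j) ⊆ W from hVW) ((U j).isOpen.closure_inter ⟨hx, hxj⟩)
      exact (eventually_nhdsSet_iff_forall.1 hb' x hxW).mono fun y hy => by rw [hy, mul_zero]
    · filter_upwards [(isClosed_tsupport (f j)).isOpen_compl.mem_nhds fun hx' => hxj (hf j hx')] with y hy
      rw [image_eq_zero_of_notMem_tsupport hy, Complex.ofReal_zero, zero_smul, zero_mul]
  · intro i hi a
    obtain ⟨α, hα, rfl⟩ := formGerm_surj (E := E) a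
    refine Subtype.ext (Filter.Germ.coe_eq.2 ?_)
    rw [h0 i hi, closure_empty, nhdsSet_empty]
    exact Filter.eventually_bot
  · intro V j hj b hb
    obtain ⟨β, hβ, rfl⟩ := formGerm_surj (E := E) b
    refine Subtype.ext (Filter.Germ.coe_eq.2 ((mem_germGr.1 hb).mono fun x hx => ?_))
    exact (formComp_same hx).symm.trans (formComp_eq_zero hj _)

end Dolbeault

end

theorem theorem5p3 {E : Type u} [NormedAddCommGroup E] [NormedSpace ℂ E] [FiniteDimensional ℂ E]
    {X : Type v} [TopologicalSpace X] [ChartedSpace E X] [IsManifold 𝓘(ℂ, E) ω X] [CompactSpace X]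
    [T2Space X] {ι : Type w} (U : ι → TopologicalSpace.Opens X)
    (hU : LocallyFinite fun i => (U i : Set X)) (hcov : ⨆ i, U i = ⊤) :
    (twistingFunctor (dolbeault E X) U).IsQuasiEquivalence :=
  (exists_softCover U hU hcov).some.isQuasiEquivalence
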